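/- Let $M$ be a smooth (finite dimensional, Hausdorff, second countable) manifold and let $\mathcal F$ be a singular foliation on $M$, i.e. a locally finitely generated $C^\infty(M)$-submodule of $C_c^\infty(M;TM)$ stable under Lie brackets. For $x\in M$ put $I_x=\{f\in C^\infty(M): f(x)=0\}$ and $\mathcal F_x=\mathcal F/I_x\mathcal F$. A bi-submersion of $(M,\mathcal F)$ is a smooth manifold $U$ with two smooth submersions $t,s:U\to M$ such that $s^{-1}(\mathcal F)=t^{-1}(\mathcal F)=C_c^\infty(U;\ker ds)+C_c^\infty(U;\ker dt)$, where $f^{-1}(\mathcal F)$ denotes the pull-back foliation; a morphism of bi-submersions is a smooth map commuting with $s$ and with $t$. An atlas is a family $\mathcal U=(U_i,t_i,s_i)_{i\in I}$ of bi-submersions such that $\bigcup_i s_i(U_i)=M$ and such that the inverses $(U_i,s_i,t_i)$ and the compositions $U_i\circ U_j=U_i\times_{s_i,t_j}U_j$ are adapted to $\mathcal U$, i.e. near each of their points they admit a morphism to some member of $\mathcal U$. Its groupoid $\mathcal G(\mathcal U)$ over $M$ is the quotient of $\coprod_i U_i$ by the relation $u\sim u'$ ($u\in U_i$, $u'\in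 U_j$) if there is a morphism from a neighbourhood of $u$ in $U_i$ to $U_j$ mapping $u$ to $u'$; source and target are induced by the $s_i$ and $t_i$, and the product of the classes of $u\in U_i$ and $v\in U_j$ with $s_i(u)=t_j(v)$ is the class of the image of $(u,v)\in U_i\circ U_j$ under a local morphism to a member of $\mathcal U$. The adiabatic foliation $\mathcal T\mathcal F$ on $M\times\mathbb R$ is the set of finite sums $\sum_k f_k\,(X_k\otimes 1)$ with $X_k\in\mathcal F$ and $f_k\in\lambda C_c^\infty(M\times\mathbb R)$, where $\lambda:M\times\mathbb R\to\mathbb R$ is the second projection and $X\otimes 1$ is the extension of $X$ to $M\times\mathbb R$ tangent along $M$. Let $\mathcal U=(U_i,t_i,s_i)_{i\in I}$ be an atlas for $(M,\mathcal F)$ and, for each $i$, let $V_i\subset U_i$ be an identity bisection (a possibly empty, locally closed submanifold on which $s_i$ and $t_i$ coincide and are étale), with $\bigcup_i s_i(V_i)=M$. Let $D(U_i,V_i)$ be the deformation to the normal cone of $V_i$ in $U_i$: the smooth manifold with underlying set $U_i\times\mathbb R^*\cup N_i\times\{0\}$, where $N_i$ is the normal bundle of $V_i$ in $U_i$; let $q_i:D(U_i,V_i)\to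 U_i\times\mathbb R$ be the canonical smooth map, equal to the identity on $U_i\times\mathbb R^*$ and to the bundle projection on $N_i\times\{0\}$. Put $\tilde{\mathcal U}=\big(D(U_i,V_i),\,(t_i\times\mathrm{id})\circ q_i,\,(s_i\times\mathrm{id})\circ q_i\big)_{i\in I}$. Then $\mathcal T\mathcal F$ is a foliation on $M\times\mathbb R$, $\tilde{\mathcal U}$ is an atlas for $(M\times\mathbb R,\mathcal T\mathcal F)$, the relation defining $\mathcal G(\tilde{\mathcal U})$ is an equivalence relation, $\mathcal G(\tilde{\mathcal U})$ is a groupoid over $M\times\mathbb R$, and there is an isomorphism of groupoids over $M\times\mathbb R$ (bijective, compatible with source, target and composition) $$\Theta:\ \mathcal G(\tilde{\mathcal U})\ \longrightarrow\ \bigcup_{x\in M}\mathcal F_x\times\{0\}\ \cup\ \mathcal G(\mathcal U)\times\mathbb R^*$$ onto the deformation (tangent) groupoid, in which $\mathcal F_x\times\{0\}$ is the additive group $\mathcal F_x$ over the object $(x,0)$ and $\mathcal G(\mathcal U)\times\{\beta\}$ is a copy of the groupoid $\mathcal G(\mathcal U)$ over $M\times\{\beta\}$ for $\beta\ne0$.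 It is given by the following formulas: - for $\beta\neq 0$ and $u\in U_i$, it maps the class of $(u,\beta)$ to $([u],\beta)$; - for $v\in V_i$, $x=s_i(v)$, and a smooth vector field $\xi$ on $U_i$, there is $Y\in\mathcal F$ with $Y(s_i(w))=dt_i(\xi_w)-ds_i(\xi_w)$ for all $w\in V_i$ near $v$, and the class of $(v,\xi_v \bmod T_vV_i,0)$ is mapped to the class of $Y$ in $\mathcal F_x=\mathcal F/I_x\mathcal F$, over $(x,0)$. -/

import Mathlib

open Set Filter Topology
open scoped Manifold ContDiff

namespace SingularFoliation
universe u
section Calculus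

theorem contDiff_nat_integral {X : Type u} [NormedAddCommGroup X] [NormedSpace ℝ X]
    [FiniteDimensional ℝ X] (n : ℕ) :
    ∀ {G : Type u} [NormedAddCommGroup G] [NormedSpace ℝ G] {K : X × ℝ → G},
      ContDiff ℝ n K → ContDiff ℝ n fun x => ∫ s in (0 : ℝ)..1, K (x, s) := by
  induction n with
  | zero =>
    intro G _ _ K hK
    have hc : Continuous K := hK.continuous
    refine contDiff_zero.2 ?_
    exact intervalIntegral.continuous_parametric_intervalIntegral_of_continuous'
      (f := fun x s => K (x, s)) (by simpa [Function.uncurry_def] using hc) 0 1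
  | succ n ih =>
    intro G _ _ K hK
    have hK1 : ContDiff ℝ 1 K := hK.of_le (by exact_mod_cast Nat.succ_le_succ (Nat.zero_le n))
    let K' : X × ℝ → (X →L[ℝ] G) := fun p => (fderiv ℝ K p).comp (ContinuousLinearMap.inl ℝ X ℝ)
    have hK' : ContDiff ℝ n K' := by
      have h1 : ContDiff ℝ n (fderiv ℝ K) := hK.fderiv_right (by norm_cast)
      exact h1.clm_comp contDiff_const
    have hK'c : Continuous K' := hK'.continuous
    have hder : ∀ x s, HasFDerivAt (fun y => K (y, s)) (K' (x, s)) x := by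
      intro x s
      have h1 : HasFDerivAt K (fderiv ℝ K (x, s)) (x, s) :=
        (hK1.differentiable one_ne_zero _).hasFDerivAt
      exact h1.comp x (hasFDerivAt_prodMk_left x s)
    have key : ∀ x, HasFDerivAt (fun x => ∫ s in (0 : ℝ)..1, K (x, s))
        (∫ s in (0 : ℝ)..1, K' (x, s)) x := by
      intro x
      obtain ⟨C, hC⟩ := ((isCompact_closedBall x 1).prod (isCompact_Icc (a := (0 : ℝ)) (b := 1))
        ).exists_bound_of_continuousOn hK'c.continuousOn
      refine intervalIntegral.hasFDerivAt_integral_of_dominated_of_fderiv_le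
        (F := fun x s => K (x, s)) (F' := fun x s => K' (x, s)) (bound := fun _ => C)
        (Metric.closedBall_mem_nhds x one_pos) ?_ ?_ ?_ ?_ ?_ ?_
      · refine Eventually.of_forall fun y => ?_
        exact (hK1.continuous.comp (by fun_prop : Continuous fun s : ℝ => (y, s))
          ).aestronglyMeasurable
      · exact (hK1.continuous.comp (by fun_prop : Continuous fun s : ℝ => (x, s))
          ).intervalIntegrable _ _
      · exact (hK'c.comp (by fun_prop : Continuous fun s : ℝ => (x, s))).aestronglyMeasurable
      · refine Eventually.of_forall fun s hs y hy => hC (y, s) ⟨hy, ?_⟩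
        rw [uIoc_of_le zero_le_one] at hs
        exact Ioc_subset_Icc_self hs
      · exact intervalIntegrable_const
      · exact Eventually.of_forall fun s _ y _ => hder y s
    have : ((n + 1 : ℕ) : ℕ∞ω) = (n : ℕ∞ω) + 1 := by norm_cast
    rw [this, contDiff_succ_iff_fderiv]
    refine ⟨fun x => (key x).differentiableAt, by simp, ?_⟩
    have : fderiv ℝ (fun x => ∫ s in (0 : ℝ)..1, K (x, s)) =
        fun x => ∫ s in (0 : ℝ)..1, K' (x, s) := funext fun x => (key x).fderiv
    rw [this]
    exact ih hK'

variable {E : Type u} [NormedAddCommGroup E] [NormedSpace ℝ E]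

/-- The dilation `e ↦ π e + β (e - π e)` in the direction complementary to the range of `π`. -/
def dil (π : E →L[ℝ] E) (β : ℝ) (e : E) : E := π e + β • (e - π e)

theorem contDiff_dil (π : E →L[ℝ] E) : ContDiff ℝ ∞ fun p : E × ℝ => dil π p.2 p.1 := by
  unfold dil; fun_prop

/-- The map `f` read through dilations, extended over `β = 0` by its derivative. -/
noncomputable def dilTrans (π π' : E →L[ℝ] E) (f : E → E) (p : E × ℝ) : E × ℝ :=
  open Classical in
  if p.2 = 0 then
    (f (π p.1) + (fderiv ℝ f (π p.1) (p.1 - π p.1) - π' (fderiv ℝ f (π p.1) (p.1 - π p.1))), 0)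
  else (dil π' p.2⁻¹ (f (dil π p.2 p.1)), p.2)

theorem contDiffAt_dilTrans [FiniteDimensional ℝ E] (π π' : E →L[ℝ] E) (hπ : ∀ e, π (π e) = π e)
    {A : Set E} (hA : IsOpen A) {f : E → E} (hf : ContDiffOn ℝ ∞ f A) (p : E × ℝ)
    (hp : dil π p.2 p.1 ∈ A)
    (hfπ : p.2 = 0 → ∀ y ∈ A, π y = y → π' (f y) = f y) :
    ContDiffAt ℝ ∞ (dilTrans π π' f) p := by
  by_cases h0 : p.2 = 0
  · have hs := hfπ h0
    set y₀ : E := π p.1 with hy₀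
    have hy₀A : y₀ ∈ A := by simpa [dil, h0] using hp
    obtain ⟨ε, hε, hball⟩ := Metric.isOpen_iff.1 hA y₀ hy₀A
    let χ : ContDiffBump y₀ := ⟨ε / 4, ε / 2, by positivity, by linarith⟩
    let g : E → E := fun y => χ y • (f y - π' (f y))
    have hg : ContDiff ℝ ∞ g := by
      rw [contDiff_iff_contDiffAt]
      intro y
      by_cases hy : y ∈ Metric.ball y₀ ε
      · have : ContDiffAt ℝ ∞ f y := hf.contDiffAt (hA.mem_nhds (hball hy))
        exact χ.contDiff.contDiffAt.smul (this.sub (π'.contDiff.contDiffAt.comp y this))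
      · have : g =ᶠ[𝓝 y] fun _ => 0 := by
          have hmem : (Metric.closedBall y₀ (ε / 2))ᶜ ∈ 𝓝 y :=
            Metric.isClosed_closedBall.isOpen_compl.mem_nhds (by
              simp only [mem_compl_iff, Metric.mem_closedBall, Metric.mem_ball] at hy ⊢
              linarith)
          filter_upwards [hmem] with z hz
          have : χ z = 0 := χ.zero_of_le_dist (by
            simp only [mem_compl_iff, Metric.mem_closedBall, not_le] at hz
            exact hz.le)
          simp [g, this]
        exact contDiffAt_const.congr_of_eventuallyEq this
    let G : E × ℝ → E := fun q => ∫ s in (0 : ℝ)..1,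
      fderiv ℝ g (π q.1 + (s * q.2) • (q.1 - π q.1)) (q.1 - π q.1)
    have hG : ContDiff ℝ ∞ G := by
      rw [contDiff_infty]
      intro n
      have hK : ContDiff ℝ n fun r : (E × ℝ) × ℝ =>
          fderiv ℝ g (π r.1.1 + (r.2 * r.1.2) • (r.1.1 - π r.1.1)) (r.1.1 - π r.1.1) := by
        have h1 : ContDiff ℝ n (fderiv ℝ g) :=
          (hg.of_le (by exact_mod_cast le_top : ((n + 1 : ℕ) : ℕ∞ω) ≤ ∞)).fderiv_right (by norm_cast)
        have h2 : ContDiff ℝ n fun r : (E × ℝ) × ℝ =>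
          (π r.1.1 + (r.2 * r.1.2) • (r.1.1 - π r.1.1)) := by fun_prop
        exact (h1.comp h2).clm_apply (by fun_prop)
      exact contDiff_nat_integral n hK
    have hGeq : ∀ q : E × ℝ, q.2 ≠ 0 → g (π q.1) = 0 →
        G q = q.2⁻¹ • g (dil π q.2 q.1) := by
      intro q hq hgq
      have hd : ∀ s : ℝ, HasDerivAt (fun s : ℝ => g (π q.1 + (s * q.2) • (q.1 - π q.1)))
          (q.2 • fderiv ℝ g (π q.1 + (s * q.2) • (q.1 - π q.1)) (q.1 - π q.1)) s := by
        intro s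
        have h1 : HasDerivAt (fun s : ℝ => π q.1 + (s * q.2) • (q.1 - π q.1))
            (q.2 • (q.1 - π q.1)) s := by
          have := (((hasDerivAt_id s).mul_const q.2).smul_const (q.1 - π q.1)).const_add (π q.1)
          simpa using this
        have h2 := (hg.differentiable (by simp) (π q.1 + (s * q.2) • (q.1 - π q.1))).hasFDerivAt
        have := h2.comp_hasDerivAt s h1
        rw [map_smul] at this
        exact this
      have hcont : Continuous fun s : ℝ =>
          (q.2 • fderiv ℝ g (π q.1 + (s * q.2) • (q.1 - π q.1)) (q.1 - π q.1)) := by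
        have h1 : Continuous (fderiv ℝ g) := hg.continuous_fderiv (by simp)
        have h2 : Continuous fun s : ℝ => π q.1 + (s * q.2) • (q.1 - π q.1) := by fun_prop
        exact ((h1.comp h2).clm_apply continuous_const).const_smul _
      have := intervalIntegral.integral_eq_sub_of_hasDerivAt (a := 0) (b := 1)
        (fun s _ => hd s) (hcont.intervalIntegrable _ _)
      rw [intervalIntegral.integral_smul] at this
      simp only [one_mul, zero_mul, zero_smul, add_zero, hgq, sub_zero] at this
      rw [dil, ← this, smul_smul, inv_mul_cancel₀ hq, one_smul]
    let N : Set (E × ℝ) := {q | π q.1 ∈ Metric.ball y₀ (ε / 4) ∧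
      dil π q.2 q.1 ∈ Metric.ball y₀ (ε / 4)}
    have hN : N ∈ 𝓝 p := by
      refine IsOpen.mem_nhds (IsOpen.inter ?_ ?_) ⟨?_, ?_⟩
      · exact Metric.isOpen_ball.preimage (by fun_prop : Continuous fun q : E × ℝ => π q.1)
      · exact Metric.isOpen_ball.preimage (contDiff_dil π).continuous
      · simpa [← hy₀] using hε
      · simpa [dil, h0, ← hy₀] using hε
    have hsmall : ∀ y ∈ Metric.ball y₀ (ε / 4), y ∈ A ∧ g y = f y - π' (f y) := by
      intro y hy
      refine ⟨hball (Metric.ball_subset_ball (by linarith) hy), ?_⟩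
      have : χ y = 1 := χ.one_of_mem_closedBall (Metric.ball_subset_closedBall hy)
      simp [g, this]
    have heq : dilTrans π π' f =ᶠ[𝓝 p] fun q => (π' (f (dil π q.2 q.1)) + G q, q.2) := by
      filter_upwards [hN] with q hq
      have hπq := hsmall _ hq.1
      have hgq : g (π q.1) = 0 := by
        rw [hπq.2, hs _ hπq.1 (hπ _), sub_self]
      by_cases hq0 : q.2 = 0
      · simp only [dilTrans, hq0, if_true]
        have hfd : HasFDerivAt g (fderiv ℝ f (π q.1) - π'.comp (fderiv ℝ f (π q.1))) (π q.1) := by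
          have h1 : HasFDerivAt f (fderiv ℝ f (π q.1)) (π q.1) :=
            ((hf.contDiffAt (hA.mem_nhds hπq.1)).differentiableAt (by simp)).hasFDerivAt
          refine (h1.sub (π'.hasFDerivAt.comp _ h1)).congr_of_eventuallyEq ?_
          filter_upwards [Metric.isOpen_ball.mem_nhds hq.1] with z hz
          exact (hsmall z hz).2
        simp only [G, hq0, mul_zero, zero_smul, add_zero, dil, hs _ hπq.1 (hπ _)]
        rw [hfd.fderiv]
        simp
      · simp only [dilTrans, hq0, if_false]
        rw [hGeq q hq0 hgq, (hsmall _ hq.2).2]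
        simp [dil]
    refine ContDiffAt.congr_of_eventuallyEq ?_ heq
    have h1 : ContDiffAt ℝ ∞ (fun q : E × ℝ => f (dil π q.2 q.1)) p :=
      (hf.contDiffAt (hA.mem_nhds hp)).comp p (contDiff_dil π).contDiffAt
    exact ((π'.contDiff.contDiffAt.comp p h1).add hG.contDiffAt).prodMk contDiffAt_snd
  · have heq : dilTrans π π' f =ᶠ[𝓝 p] fun q => (dil π' q.2⁻¹ (f (dil π q.2 q.1)), q.2) := by
      have : {q : E × ℝ | q.2 ≠ 0} ∈ 𝓝 p :=
        (isOpen_ne.preimage continuous_snd).mem_nhds h0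
      filter_upwards [this] with q hq
      have hq' : q.2 ≠ 0 := hq
      simp [dilTrans, hq']
    refine ContDiffAt.congr_of_eventuallyEq ?_ heq
    have h1 : ContDiffAt ℝ ∞ (fun q : E × ℝ => f (dil π q.2 q.1)) p :=
      (hf.contDiffAt (hA.mem_nhds hp)).comp p (contDiff_dil π).contDiffAt
    have h2 : ContDiffAt ℝ ∞ (fun q : E × ℝ => q.2⁻¹) p := contDiffAt_snd.inv h0
    refine ContDiffAt.prodMk ?_ contDiffAt_snd
    exact ((contDiff_dil π').contDiffAt (x := (f (dil π p.2 p.1), p.2⁻¹))).comp p (h1.prodMk h2)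

end Calculus

section NormalCone

set_option linter.unusedSectionVars false

variable {E : Type u} [NormedAddCommGroup E] [NormedSpace ℝ E] [FiniteDimensional ℝ E]
  {U : Type u} [TopologicalSpace U] [ChartedSpace E U] [IsManifold 𝓘(ℝ, E) ∞ U]

/-- A (locally closed, embedded) smooth submanifold of `U`: a subset which around each of its
points is, in some smooth chart of `U`, a linear subspace of the model space. -/
structure Submfd (E : Type u) [NormedAddCommGroup E] [NormedSpace ℝ E]
    (U : Type u) [TopologicalSpace U] [ChartedSpace E U] where
  carrier : Set U
  slice : ∀ v ∈ carrier, ∃ φ ∈ IsManifold.maximalAtlas 𝓘(ℝ, E) ∞ U, v ∈ φ.source ∧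
    ∃ P : Submodule ℝ E, ∀ u ∈ φ.source, u ∈ carrier ↔ φ u ∈ P

/-- The tangent space `T_v V ⊆ T_v U`: the vectors killed by the differentials of all smooth
functions defined near `v` and vanishing on `V`. (In Mathlib, the tangent space `T_v U` is by
definition a copy of the model space `E`.) -/
noncomputable def Submfd.tangent (V : Submfd E U) (v : U) : Submodule ℝ E :=
  ⨅ (f : U → ℝ) (_ : ContMDiffAt 𝓘(ℝ, E) 𝓘(ℝ) ∞ f v)
    (_ : ∀ᶠ u in 𝓝 v, u ∈ V.carrier → f u = 0),
    LinearMap.ker (mfderiv 𝓘(ℝ, E) 𝓘(ℝ) f v : E →L[ℝ] ℝ).toLinearMap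

theorem Submfd.mem_tangent_iff (V : Submfd E U) (v : U) (ξ : E) :
    ξ ∈ V.tangent v ↔ ∀ f : U → ℝ, ContMDiffAt 𝓘(ℝ, E) 𝓘(ℝ) ∞ f v →
      (∀ᶠ u in 𝓝 v, u ∈ V.carrier → f u = 0) →
      (mfderiv 𝓘(ℝ, E) 𝓘(ℝ) f v : E →L[ℝ] ℝ) ξ = 0 := by
  simp only [Submfd.tangent, Submodule.mem_iInf]
  rfl

/-- The fibre `N_v = T_v U / T_v V` of the normal bundle. -/
abbrev Submfd.Normal (V : Submfd E U) (v : U) : Type u := E ⧸ V.tangent v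

/-- The deformation to the normal cone `D(U, V)`: as a set, `U × ℝ^* ∪ N × {0}`. -/
inductive DNC (V : Submfd E U) : Type u
  | off (u : U) (β : ℝ) (hβ : β ≠ 0) : DNC V
  | on (v : V.carrier) (n : V.Normal (v : U)) : DNC V

namespace DNC

variable {V : Submfd E U}

/-- The map `q : D(U, V) → U × ℝ`, the identity over `ℝ^*`, the bundle projection over `0`. -/
def q : DNC V → U × ℝ
  | off u β _ => (u, β)
  | on v _ => (v, 0)

variable (V) in
/-- Data of a chart of `D(U, V)`: a smooth chart `φ` of `U`, a projection `π` of the model space,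
and an open set `B` of allowed values of the deformation parameter. If `0 ∈ B`, then `V` has to
correspond under `φ` to the range of `π`. -/
structure ChartData where
  φ : OpenPartialHomeomorph U E
  mem : φ ∈ IsManifold.maximalAtlas 𝓘(ℝ, E) ∞ U
  π : E →L[ℝ] E
  idem : ∀ e, π (π e) = π e
  B : Set ℝ
  isOpen_B : IsOpen B
  slice : (0 : ℝ) ∈ B → ∀ u ∈ φ.source, u ∈ V.carrier ↔ π (φ u) = φ u

/-- The differential of the chart map at `u`, as a map of the model space. -/
noncomputable def ChartData.d (c : ChartData V) (u : U) : E →L[ℝ] E :=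
  mfderiv 𝓘(ℝ, E) 𝓘(ℝ, E) c.φ u

/-- The differential of the inverse of the chart map at `e`, as a map of the model space. -/
noncomputable def ChartData.dsymm (c : ChartData V) (e : E) : E →L[ℝ] E :=
  mfderiv 𝓘(ℝ, E) 𝓘(ℝ, E) c.φ.symm e

theorem ChartData.mdiff (c : ChartData V) : c.φ.MDifferentiable 𝓘(ℝ, E) 𝓘(ℝ, E) := by
  have h : c.φ ∈ IsManifold.maximalAtlas 𝓘(ℝ, E) 1 U :=
    IsManifold.maximalAtlas_subset_of_le (by simp) c.mem
  exact ⟨fun x hx => (mdifferentiableAt_of_mem_maximalAtlas h hx).mdifferentiableWithinAt,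
    fun x hx => (mdifferentiableAt_symm_of_mem_maximalAtlas h hx).mdifferentiableWithinAt⟩

theorem ChartData.d_dsymm (c : ChartData V) {e : E} (he : e ∈ c.φ.target) (x : E) :
    c.d (c.φ.symm e) (c.dsymm e x) = x :=
  DFunLike.congr_fun (c.mdiff.comp_symm_deriv he) x

theorem ChartData.dsymm_d (c : ChartData V) {u : U} (hu : u ∈ c.φ.source) (x : E) :
    c.dsymm (c.φ u) (c.d u x) = x :=
  DFunLike.congr_fun (c.mdiff.symm_comp_deriv hu) x

theorem ChartData.contMDiffAt (c : ChartData V) {u : U} (hu : u ∈ c.φ.source) :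
    ContMDiffAt 𝓘(ℝ, E) 𝓘(ℝ, E) ∞ c.φ u := contMDiffAt_of_mem_maximalAtlas c.mem hu

theorem ChartData.contMDiffAt_symm (c : ChartData V) {e : E} (he : e ∈ c.φ.target) :
    ContMDiffAt 𝓘(ℝ, E) 𝓘(ℝ, E) ∞ c.φ.symm e := contMDiffAt_symm_of_mem_maximalAtlas c.mem he

theorem ChartData.mem_tangent (c : ChartData V) (h0 : (0 : ℝ) ∈ c.B) {v : U}
    (hv : v ∈ c.φ.source) (hV : v ∈ V.carrier) (ξ : E) :
    ξ ∈ V.tangent v ↔ c.π (c.d v ξ) = c.d v ξ := by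
  constructor
  · intro h
    by_contra hne
    have hne' : c.d v ξ - c.π (c.d v ξ) ≠ 0 := sub_ne_zero.2 (Ne.symm hne)
    rw [V.mem_tangent_iff] at h
    obtain ⟨l, -, hl⟩ := exists_dual_vector ℝ _ (norm_ne_zero_iff.2 hne')
    let L : E →L[ℝ] ℝ := l.comp (ContinuousLinearMap.id ℝ E - c.π)
    have hLs : HasMFDerivAt 𝓘(ℝ, E) 𝓘(ℝ) L (c.φ v) L := L.hasFDerivAt.hasMFDerivAt
    have hcomp := hLs.comp v (c.mdiff.mdifferentiableAt hv).hasMFDerivAt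
    have h1 := h (fun u => L (c.φ u)) ((L.contMDiff.contMDiffAt).comp v (c.contMDiffAt hv)) (by
      filter_upwards [c.φ.open_source.mem_nhds hv] with u hu huV
      have := (c.slice h0 u hu).1 huV
      simp [L, this])
    have h2 : mfderiv 𝓘(ℝ, E) 𝓘(ℝ) (fun u => L (c.φ u)) v = L.comp (c.d v) := hcomp.mfderiv
    rw [h2] at h1
    have h3 : l (c.d v ξ - c.π (c.d v ξ)) = 0 := h1
    rw [h3] at hl
    exact hne' (by simpa using hl.symm)
  · intro h
    rw [V.mem_tangent_iff]
    intro f hf hf0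
    have hφv : c.φ v ∈ c.φ.target := c.φ.map_source hv
    have hs : c.φ.symm (c.φ v) = v := c.φ.left_inv hv
    have hπv : c.π (c.φ v) = c.φ v := (c.slice h0 v hv).1 hV
    have hfd : HasMFDerivAt 𝓘(ℝ, E) 𝓘(ℝ) f v (mfderiv 𝓘(ℝ, E) 𝓘(ℝ) f v) :=
      (hf.mdifferentiableAt (by simp)).hasMFDerivAt
    let D : E →L[ℝ] ℝ := mfderiv 𝓘(ℝ, E) 𝓘(ℝ) f v
    have hg : HasFDerivAt (fun e => f (c.φ.symm e)) (D.comp (c.dsymm (c.φ v))) (c.φ v) := by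
      have h1 : HasMFDerivAt 𝓘(ℝ, E) 𝓘(ℝ, E) c.φ.symm (c.φ v) (c.dsymm (c.φ v)) :=
        (c.mdiff.mdifferentiableAt_symm hφv).hasMFDerivAt
      have h2 : HasMFDerivAt 𝓘(ℝ, E) 𝓘(ℝ) f (c.φ.symm (c.φ v)) D := by
        have : ∀ w, w = v → HasMFDerivAt 𝓘(ℝ, E) 𝓘(ℝ) f w D := by
          rintro w rfl; exact hfd
        exact this _ hs
      exact (h2.comp (c.φ v) h1).hasFDerivAt
    have hg' : HasFDerivAt (fun e => f (c.φ.symm e)) (D.comp (c.dsymm (c.φ v))) (c.π (c.φ v)) := by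
      rw [hπv]; exact hg
    have hcomp : HasFDerivAt (fun e => f (c.φ.symm (c.π e)))
        ((D.comp (c.dsymm (c.φ v))).comp c.π) (c.φ v) :=
      hg'.comp (c.φ v) c.π.hasFDerivAt
    have hz : (fun e => f (c.φ.symm (c.π e))) =ᶠ[𝓝 (c.φ v)] fun _ => 0 := by
      have ht : Tendsto (fun e => c.φ.symm (c.π e)) (𝓝 (c.φ v)) (𝓝 v) := by
        have h1 : ContinuousAt c.φ.symm (c.π (c.φ v)) := by
          rw [hπv]; exact c.φ.continuousAt_symm hφv
        have h2 : ContinuousAt (fun e => c.φ.symm (c.π e)) (c.φ v) :=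
          ContinuousAt.comp (f := c.π) (g := c.φ.symm) h1 c.π.continuous.continuousAt
        have h3 := h2.tendsto
        simpa [hπv, hs] using h3
      have htar : ∀ᶠ e in 𝓝 (c.φ v), c.π e ∈ c.φ.target := by
        refine c.π.continuous.continuousAt.eventually_mem (c.φ.open_target.mem_nhds ?_)
        rw [hπv]; exact hφv
      filter_upwards [ht.eventually hf0, htar] with e he het
      refine he ((c.slice h0 _ (c.φ.map_target het)).2 ?_)
      rw [c.φ.right_inv het, c.idem]
    have huniq : (D.comp (c.dsymm (c.φ v))).comp c.π = 0 :=
      hcomp.unique ((hasFDerivAt_const (0 : ℝ) (c.φ v)).congr_of_eventuallyEq hz)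
    have := DFunLike.congr_fun huniq (c.d v ξ)
    simp only [ContinuousLinearMap.comp_apply, h, c.dsymm_d hv] at this
    exact this

theorem on_congr {v v' : U} (hv : v ∈ V.carrier) (hv' : v' ∈ V.carrier) (h : v' = v) (ξ ξ' : E)
    (hξ : ξ' - ξ ∈ V.tangent v) :
    (on ⟨v', hv'⟩ (Submodule.Quotient.mk ξ') : DNC V) = on ⟨v, hv⟩ (Submodule.Quotient.mk ξ) := by
  subst h
  congr 1
  exact (Submodule.Quotient.eq _).2 hξ

/-- A vector representing the normal vector `n`. -/
noncomputable def rep {v : U} (n : V.Normal v) : E :=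
  Function.surjInv (Submodule.mkQ_surjective (V.tangent v)) n

theorem mk_rep {v : U} (n : V.Normal v) :
    (Submodule.Quotient.mk (p := V.tangent v) (rep n) : V.Normal v) = n :=
  Function.surjInv_eq (Submodule.mkQ_surjective (V.tangent v)) n

theorem rep_mk_sub {v : U} (ξ : E) :
    (rep (Submodule.Quotient.mk (p := V.tangent v) ξ) - ξ : E) ∈ V.tangent v :=
  (Submodule.Quotient.eq _).1 (mk_rep _)

/-- The chart of `D(U, V)`: `(u, β) ↦ (π φ(u) + β⁻¹ (1 - π) φ(u), β)` for `β ≠ 0`, and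
`(v, n, 0) ↦ (φ(v) + (1 - π) dφ(n), 0)`. -/
noncomputable def ChartData.fwd (c : ChartData V) : DNC V → E × ℝ
  | off u β _ => (dil c.π β⁻¹ (c.φ u), β)
  | on v n => (c.φ v + (c.d v (rep n) - c.π (c.d v (rep n))), 0)

open Classical in
/-- The inverse of the chart `ChartData.fwd`: `(e, β) ↦ (φ⁻¹(π e + β (1 - π) e), β)` for `β ≠ 0`,
and `(e, 0) ↦ (φ⁻¹(π e), [dφ⁻¹((1 - π) e)], 0)`. -/
noncomputable def ChartData.bwd (c : ChartData V) (p : E × ℝ) : DNC V :=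
  if hβ : p.2 = 0 then
    if hv : c.φ.symm (c.π p.1) ∈ V.carrier then
      on ⟨c.φ.symm (c.π p.1), hv⟩ (Submodule.Quotient.mk (c.dsymm (c.π p.1) (p.1 - c.π p.1)))
    else off (c.φ.symm (c.π p.1)) 1 one_ne_zero
  else off (c.φ.symm (dil c.π p.2 p.1)) p.2 hβ

theorem ChartData.proj_dil (c : ChartData V) (β : ℝ) (e : E) : c.π (dil c.π β e) = c.π e := by
  simp [dil, c.idem]

theorem ChartData.dil_dil (c : ChartData V) {β : ℝ} (hβ : β ≠ 0) (e : E) :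
    dil c.π β (dil c.π β⁻¹ e) = e := by
  rw [dil, c.proj_dil, dil, add_sub_cancel_left, smul_smul, mul_inv_cancel₀ hβ, one_smul,
    add_sub_cancel]

theorem ChartData.dil_dil' (c : ChartData V) {β : ℝ} (hβ : β ≠ 0) (e : E) :
    dil c.π β⁻¹ (dil c.π β e) = e := by
  simpa using c.dil_dil (inv_ne_zero hβ) e

theorem ChartData.symm_mem (c : ChartData V) (h0 : (0 : ℝ) ∈ c.B) {e : E}
    (he : c.π e ∈ c.φ.target) : c.φ.symm (c.π e) ∈ V.carrier :=
  (c.slice h0 _ (c.φ.map_target he)).2 (by rw [c.φ.right_inv he, c.idem])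

theorem dil_zero (π : E →L[ℝ] E) (e : E) : dil π 0 e = π e := by simp [dil]

theorem ChartData.bwd_zero (c : ChartData V) (h0 : (0 : ℝ) ∈ c.B) {e : E}
    (he : c.π e ∈ c.φ.target) :
    c.bwd (e, 0) = on ⟨c.φ.symm (c.π e), c.symm_mem h0 he⟩
      (Submodule.Quotient.mk (c.dsymm (c.π e) (e - c.π e))) := by
  simp [bwd, c.symm_mem h0 he]

theorem ChartData.bwd_ne (c : ChartData V) (e : E) {β : ℝ} (hβ : β ≠ 0) :
    c.bwd (e, β) = off (c.φ.symm (dil c.π β e)) β hβ := by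
  simp [bwd, hβ]

/-- The chart of `D(U, V)` given by chart data. -/
noncomputable def ChartData.equiv (c : ChartData V) : PartialEquiv (DNC V) (E × ℝ) where
  toFun := c.fwd
  invFun := c.bwd
  source := {x | (q x).1 ∈ c.φ.source ∧ (q x).2 ∈ c.B}
  target := {p | dil c.π p.2 p.1 ∈ c.φ.target ∧ p.2 ∈ c.B}
  map_source' := by
    rintro (⟨u, β, hβ⟩ | ⟨v, n⟩) ⟨h1, h2⟩
    · refine ⟨?_, h2⟩
      simp only [fwd, c.dil_dil hβ]
      exact c.φ.map_source h1
    · have hv := (c.slice h2 v h1).1 v.2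
      refine ⟨?_, h2⟩
      simp only [fwd, dil_zero, map_add, map_sub, c.idem, hv, sub_self, add_zero]
      exact c.φ.map_source h1
  map_target' := by
    rintro ⟨e, β⟩ ⟨h1, h2⟩
    by_cases hβ : β = 0
    · subst hβ
      simp only [dil_zero] at h1
      rw [c.bwd_zero h2 h1]
      exact ⟨c.φ.map_target h1, h2⟩
    · rw [c.bwd_ne e hβ]
      exact ⟨c.φ.map_target h1, h2⟩
  left_inv' := by
    rintro (⟨u, β, hβ⟩ | ⟨v, n⟩) ⟨h1, h2⟩
    · simp only [fwd]
      rw [c.bwd_ne _ hβ]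
      simp only [c.dil_dil hβ]
      congr 1
      exact c.φ.left_inv h1
    · have hv := (c.slice h2 v h1).1 v.2
      have hπ : c.π (c.φ v + (c.d v (rep n) - c.π (c.d v (rep n)))) = c.φ v := by
        simp only [map_add, map_sub, c.idem, hv, sub_self, add_zero]
      have ht : c.φ v ∈ c.φ.target := c.φ.map_source h1
      have hvs : c.φ.symm (c.φ v) = v := c.φ.left_inv h1
      simp only [fwd]
      rw [c.bwd_zero h2 (by rw [hπ]; exact ht)]
      conv_rhs => rw [← mk_rep n]
      obtain ⟨v, hvV⟩ := v
      refine on_congr hvV _ (by rw [hπ]; exact hvs) _ _ ?_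
      refine (c.mem_tangent h2 (v := v) h1 hvV _).2 ?_
      simp only [hπ, add_sub_cancel_left]
      have h3 : c.d v (c.dsymm (c.φ v) (c.d v (rep n) - c.π (c.d v (rep n)))) =
          c.d v (rep n) - c.π (c.d v (rep n)) := by
        have := c.d_dsymm ht (c.d v (rep n) - c.π (c.d v (rep n)))
        rwa [hvs] at this
      rw [map_sub, h3]
      simp [c.idem]
  right_inv' := by
    rintro ⟨e, β⟩ ⟨h1, h2⟩
    by_cases hβ : β = 0
    · subst hβ
      simp only [dil_zero] at h1
      rw [c.bwd_zero h2 h1]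
      have h3 : ∀ r : E, r - c.dsymm (c.π e) (e - c.π e) ∈ V.tangent (c.φ.symm (c.π e)) →
          c.d (c.φ.symm (c.π e)) r - c.π (c.d (c.φ.symm (c.π e)) r) = e - c.π e := by
        intro r hr
        have h4 := (c.mem_tangent h2 (c.φ.map_target h1) (c.symm_mem h2 h1) _).1 hr
        rw [map_sub (c.d _) r, c.d_dsymm h1, map_sub, map_sub, c.idem, sub_self, sub_zero] at h4
        rw [h4]; abel
      simp only [fwd, c.φ.right_inv h1]
      rw [h3 _ (rep_mk_sub _)]
      ext
      · simp
      · rfl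
    · rw [c.bwd_ne e hβ]
      simp only [fwd]
      rw [c.φ.right_inv h1, c.dil_dil' hβ]

theorem ChartData.trans_source (c c' : ChartData V) :
    (c.equiv.symm.trans c'.equiv).source =
      {p | p.2 ∈ c.B ∧ p.2 ∈ c'.B ∧ dil c.π p.2 p.1 ∈ c.φ.target ∩ c.φ.symm ⁻¹' c'.φ.source} := by
  ext ⟨e, β⟩
  simp only [PartialEquiv.trans_source, PartialEquiv.symm_source, mem_inter_iff, mem_preimage,
    mem_ofPred_eq]
  constructor
  · rintro ⟨⟨h1, h2⟩, h3, h4⟩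
    change (q (c.bwd (e, β))).1 ∈ _ at h3
    change (q (c.bwd (e, β))).2 ∈ _ at h4
    by_cases hβ : β = 0
    · subst hβ
      simp only [dil_zero] at h1 ⊢
      rw [c.bwd_zero h2 h1] at h3 h4
      exact ⟨h2, h4, h1, h3⟩
    · rw [c.bwd_ne e hβ] at h3 h4
      exact ⟨h2, h4, h1, h3⟩
  · rintro ⟨h1, h2, h3, h4⟩
    refine ⟨⟨h3, h1⟩, ?_⟩
    change (q (c.bwd (e, β))).1 ∈ _ ∧ (q (c.bwd (e, β))).2 ∈ _
    by_cases hβ : β = 0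
    · subst hβ
      simp only [dil_zero] at h3 h4
      rw [c.bwd_zero h1 h3]
      exact ⟨h4, h2⟩
    · rw [c.bwd_ne e hβ]
      exact ⟨h4, h2⟩

theorem ChartData.isOpen_overlap (c c' : ChartData V) :
    IsOpen (c.φ.target ∩ c.φ.symm ⁻¹' c'.φ.source) :=
  c.φ.symm.isOpen_inter_preimage c'.φ.open_source

theorem ChartData.isOpen_trans_source (c c' : ChartData V) :
    IsOpen (c.equiv.symm.trans c'.equiv).source := by
  rw [c.trans_source c']
  exact (c.isOpen_B.preimage continuous_snd).inter ((c'.isOpen_B.preimage continuous_snd).inter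
    ((c.isOpen_overlap c').preimage (contDiff_dil c.π).continuous))

theorem ChartData.contDiffOn_overlap (c c' : ChartData V) :
    ContDiffOn ℝ ∞ (fun e => c'.φ (c.φ.symm e)) (c.φ.target ∩ c.φ.symm ⁻¹' c'.φ.source) := by
  intro e he
  refine ContDiffAt.contDiffWithinAt ?_
  rw [← contMDiffAt_iff_contDiffAt]
  exact (c'.contMDiffAt he.2).comp e (c.contMDiffAt_symm he.1)

theorem ChartData.fderiv_overlap (c c' : ChartData V) {e : E}
    (he : e ∈ c.φ.target ∩ c.φ.symm ⁻¹' c'.φ.source) (x : E) :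
    fderiv ℝ (fun e => c'.φ (c.φ.symm e)) e x = c'.d (c.φ.symm e) (c.dsymm e x) := by
  have h1 := (c'.mdiff.mdifferentiableAt he.2).hasMFDerivAt.comp e
    (c.mdiff.mdifferentiableAt_symm he.1).hasMFDerivAt
  have h2 : HasFDerivAt (fun e => c'.φ (c.φ.symm e)) ((c'.d (c.φ.symm e)).comp (c.dsymm e)) e :=
    h1.hasFDerivAt
  rw [h2.fderiv]; rfl

theorem ChartData.trans_eq (c c' : ChartData V) {p : E × ℝ}
    (hp : p ∈ (c.equiv.symm.trans c'.equiv).source) :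
    (c.equiv.symm.trans c'.equiv) p = dilTrans c.π c'.π (fun e => c'.φ (c.φ.symm e)) p := by
  rw [c.trans_source c'] at hp
  obtain ⟨e, β⟩ := p
  obtain ⟨h1, h2, h3⟩ := hp
  change c'.fwd (c.bwd (e, β)) = _
  by_cases hβ : β = 0
  · subst hβ
    simp only [dil_zero] at h1 h2 h3
    have h4 := (c'.mem_tangent h2 h3.2 (c.symm_mem h1 h3.1) _).1
      (rep_mk_sub (V := V) (v := c.φ.symm (c.π e)) (c.dsymm (c.π e) (e - c.π e)))
    rw [c.bwd_zero h1 h3.1]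
    simp only [fwd, dilTrans, if_true, c.fderiv_overlap c' h3]
    refine Prod.ext ?_ rfl
    simp only [map_sub] at h4 ⊢
    rw [add_right_inj]
    have h5 := sub_eq_sub_iff_sub_eq_sub.1 h4
    grind
  · rw [c.bwd_ne e hβ]
    simp [fwd, dilTrans, hβ]

theorem ChartData.contDiffOn_trans (c c' : ChartData V) :
    ContDiffOn ℝ ∞ (c.equiv.symm.trans c'.equiv) (c.equiv.symm.trans c'.equiv).source := by
  refine ContDiffOn.congr (f := dilTrans c.π c'.π (fun e => c'.φ (c.φ.symm e))) ?_
    fun p hp => c.trans_eq c' hp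
  intro p hp
  rw [c.trans_source c'] at hp
  refine (contDiffAt_dilTrans c.π c'.π c.idem (c.isOpen_overlap c') (c.contDiffOn_overlap c') p
    hp.2.2 ?_).contDiffWithinAt
  intro h0 y hy hyπ
  have h1 : (0 : ℝ) ∈ c.B := h0 ▸ hp.1
  have h2 : (0 : ℝ) ∈ c'.B := h0 ▸ hp.2.1
  refine (c'.slice h2 _ hy.2).1 ((c.slice h1 _ (c.φ.map_target hy.1)).2 ?_)
  rw [c.φ.right_inv hy.1, hyπ]

/-- Chart data near a point `(u, β)` with `β ≠ 0`. -/
noncomputable def offData (V : Submfd E U) (u : U) : ChartData V where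
  φ := chartAt E u
  mem := IsManifold.chart_mem_maximalAtlas u
  π := ContinuousLinearMap.id ℝ E
  idem := fun _ => rfl
  B := {0}ᶜ
  isOpen_B := isOpen_compl_singleton
  slice := fun h => absurd rfl h

theorem exists_onData (V : Submfd E U) (v : V.carrier) :
    ∃ c : ChartData V, (v : U) ∈ c.φ.source ∧ c.B = univ := by
  obtain ⟨φ, hφ, hv, P, hP⟩ := V.slice v v.2
  obtain ⟨Q, hQ⟩ := P.exists_isCompl
  let π : E →L[ℝ] E := LinearMap.toContinuousLinearMap (P.projection Q hQ)
  have hπ : ∀ e, π e = e ↔ e ∈ P := fun e => by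
    constructor
    · intro h
      rw [← h]
      exact Submodule.projection_apply_mem hQ e
    · intro h
      exact Submodule.projection_apply_left hQ ⟨e, h⟩
  exact ⟨⟨φ, hφ, π, fun e => (hπ _).2 (Submodule.projection_apply_mem hQ e), univ, isOpen_univ,
    fun _ u hu => (hP u hu).trans (hπ _).symm⟩, hv, rfl⟩

/-- Chart data near the points of `N_v × {0}`. -/
noncomputable def onData (V : Submfd E U) (v : V.carrier) : ChartData V :=
  (exists_onData V v).choose

variable (V) in
/-- The smooth atlas of `D(U, V)`. -/
noncomputable def core : ChartedSpaceCore (E × ℝ) (DNC V) where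
  atlas := range ChartData.equiv
  chartAt
    | off u _ _ => (offData V u).equiv
    | on v _ => (onData V v).equiv
  mem_chart_source
    | off u _ hβ => ⟨mem_chart_source E u, hβ⟩
    | on v _ => ⟨(exists_onData V v).choose_spec.1, by
        change (0 : ℝ) ∈ (onData V v).B
        rw [onData, (exists_onData V v).choose_spec.2]; trivial⟩
  chart_mem_atlas
    | off u _ _ => ⟨_, rfl⟩
    | on v _ => ⟨_, rfl⟩
  open_source := by
    rintro _ _ ⟨c, rfl⟩ ⟨c', rfl⟩
    exact c.isOpen_trans_source c'
  continuousOn_toFun := by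
    rintro _ _ ⟨c, rfl⟩ ⟨c', rfl⟩
    exact (c.contDiffOn_trans c').continuousOn

noncomputable instance : TopologicalSpace (DNC V) := (core V).toTopologicalSpace

noncomputable instance : ChartedSpace (E × ℝ) (DNC V) := (core V).toChartedSpace

instance : IsManifold 𝓘(ℝ, E × ℝ) ∞ (DNC V) := by
  refine isManifold_of_contDiffOn _ _ _ fun e e' he he' => ?_
  obtain ⟨_, ⟨_, rfl⟩, _, ⟨⟨c, rfl⟩, rfl⟩, rfl⟩ := he
  obtain ⟨_, ⟨_, rfl⟩, _, ⟨⟨c', rfl⟩, rfl⟩, rfl⟩ := he'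
  have h := c.contDiffOn_trans c'
  simp only [modelWithCornersSelf_coe, modelWithCornersSelf_coe_symm, range_id, inter_univ,
    Function.comp_id, Function.id_comp, preimage_id]
  exact h

/-- The chart of `D(U, V)` given by chart data, as a local homeomorphism. -/
noncomputable def ChartData.chart (c : ChartData V) : OpenPartialHomeomorph (DNC V) (E × ℝ) :=
  (core V).openPartialHomeomorph c.equiv ⟨c, rfl⟩

theorem ChartData.chart_mem_atlas (c : ChartData V) : c.chart ∈ atlas (E × ℝ) (DNC V) :=
  mem_iUnion.2 ⟨c.equiv, mem_iUnion.2 ⟨⟨c, rfl⟩, rfl⟩⟩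

theorem chartAt_off (u : U) (β : ℝ) (hβ : β ≠ 0) :
    chartAt (E × ℝ) (off u β hβ : DNC V) = (offData V u).chart := rfl

theorem chartAt_on (v : V.carrier) (n : V.Normal (v : U)) :
    chartAt (E × ℝ) (on v n : DNC V) = (onData V v).chart := rfl

theorem exists_chartAt (x : DNC V) : ∃ c : ChartData V, chartAt (E × ℝ) x = c.chart := by
  rcases x with ⟨u, β, hβ⟩ | ⟨v, n⟩
  exacts [⟨_, rfl⟩, ⟨_, rfl⟩]

theorem ChartData.q_eq (c : ChartData V) {x : DNC V} (hx : x ∈ c.chart.source) :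
    q x = (c.φ.symm (dil c.π (c.chart x).2 (c.chart x).1), (c.chart x).2) := by
  have hp := c.chart.map_source hx
  have hs : c.bwd (c.chart x) = x := c.chart.left_inv hx
  conv_lhs => rw [← hs]
  obtain ⟨h1, h2⟩ := hp
  generalize c.chart x = p at *
  obtain ⟨e, β⟩ := p
  by_cases hβ : β = 0
  · subst hβ
    simp only [dil_zero] at h1 ⊢
    rw [c.bwd_zero h2 h1]
    rfl
  · rw [c.bwd_ne e hβ]
    rfl

theorem contMDiff_q : ContMDiff 𝓘(ℝ, E × ℝ) (𝓘(ℝ, E).prod 𝓘(ℝ)) ∞ (q : DNC V → U × ℝ) := by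
  intro x
  obtain ⟨c, hc⟩ := exists_chartAt x
  have hx : x ∈ c.chart.source := hc ▸ mem_chart_source (E × ℝ) x
  have h1 : ContMDiffAt 𝓘(ℝ, E × ℝ) 𝓘(ℝ, E × ℝ) ∞ c.chart x :=
    contMDiffAt_of_mem_maximalAtlas (IsManifold.subset_maximalAtlas c.chart_mem_atlas) hx
  have h2 : ContMDiffAt 𝓘(ℝ, E × ℝ) 𝓘(ℝ, E) ∞ (fun y => dil c.π (c.chart y).2 (c.chart y).1) x :=
    ((contDiff_dil c.π).contMDiff.contMDiffAt).comp x h1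
  have h3 : ContMDiffAt 𝓘(ℝ, E × ℝ) 𝓘(ℝ, E) ∞
      (fun y => c.φ.symm (dil c.π (c.chart y).2 (c.chart y).1)) x :=
    (c.contMDiffAt_symm (c.chart.map_source hx).1).comp x h2
  have h4 : ContMDiffAt 𝓘(ℝ, E × ℝ) 𝓘(ℝ) ∞ (fun y => (c.chart y).2) x :=
    (contDiff_snd.contMDiff.contMDiffAt).comp x h1
  refine (h3.prodMk h4).congr_of_eventuallyEq ?_
  filter_upwards [c.chart.open_source.mem_nhds hx] with y hy
  exact c.q_eq hy

instance [T2Space U] : T2Space (DNC V) := by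
  refine ⟨fun x y hxy => ?_⟩
  by_cases hq : q x = q y
  · have key : ∃ c : ChartData V, x ∈ c.chart.source ∧ y ∈ c.chart.source := by
      rcases x with ⟨u, β, hβ⟩ | ⟨v, n⟩ <;> rcases y with ⟨u', β', hβ'⟩ | ⟨v', n'⟩
      · simp only [q, Prod.mk.injEq] at hq
        obtain ⟨rfl, rfl⟩ := hq
        exact absurd rfl hxy
      · exact absurd (congrArg Prod.snd hq) hβ
      · exact absurd (congrArg Prod.snd hq).symm hβ'
      · have : v = v' := Subtype.ext (congrArg Prod.fst hq)
        subst this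
        exact ⟨onData V v, mem_chart_source (E × ℝ) (on v n : DNC V),
          mem_chart_source (E × ℝ) (on v n' : DNC V)⟩
    obtain ⟨c, hx, hy⟩ := key
    have hne : c.chart x ≠ c.chart y := fun h => hxy (c.chart.injOn hx hy h)
    obtain ⟨A, B, hA, hB, hxA, hyB, hAB⟩ := t2_separation hne
    refine ⟨c.chart.source ∩ c.chart ⁻¹' A, c.chart.source ∩ c.chart ⁻¹' B,
      c.chart.isOpen_inter_preimage hA, c.chart.isOpen_inter_preimage hB, ⟨hx, hxA⟩, ⟨hy, hyB⟩, ?_⟩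
    exact (hAB.preimage c.chart).mono inter_subset_right inter_subset_right
  · obtain ⟨A, B, hA, hB, hxA, hyB, hAB⟩ := t2_separation hq
    have hqc : Continuous (q : DNC V → U × ℝ) := contMDiff_q.continuous
    exact ⟨q ⁻¹' A, q ⁻¹' B, hA.preimage hqc, hB.preimage hqc, hxA, hyB, hAB.preimage q⟩

instance [SecondCountableTopology U] : SecondCountableTopology (DNC V) := by
  obtain ⟨S, hS, hSU⟩ := TopologicalSpace.countable_cover_nhds
    (f := fun u : U => (chartAt E u).source) fun u => chart_source_mem_nhds E u
  obtain ⟨T, hT, hTV⟩ := TopologicalSpace.isOpen_iUnion_countable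
    (fun v : V.carrier => (onData V v).φ.source) fun v => (onData V v).φ.open_source
  refine ChartedSpace.secondCountable_of_countable_cover (E × ℝ)
    (s := (fun u => (off u 1 one_ne_zero : DNC V)) '' S ∪ (fun v => (on v 0 : DNC V)) '' T) ?_
    ((hS.image _).union (hT.image _))
  refine eq_univ_of_forall ?_
  rintro (⟨u, β, hβ⟩ | ⟨v, n⟩)
  · have hu : u ∈ ⋃ x ∈ S, (chartAt E x).source := hSU ▸ mem_univ u
    simp only [mem_iUnion] at hu
    obtain ⟨u', hu', hu⟩ := hu
    refine mem_iUnion₂.2 ⟨_, Or.inl ⟨u', hu', rfl⟩, ?_⟩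
    rw [chartAt_off]
    exact ⟨hu, hβ⟩
  · have hv : (v : U) ∈ ⋃ v ∈ T, (onData V v).φ.source := by
      rw [hTV]
      exact mem_iUnion.2 ⟨v, (exists_onData V v).choose_spec.1⟩
    simp only [mem_iUnion] at hv
    obtain ⟨v', hv', hv⟩ := hv
    refine mem_iUnion₂.2 ⟨_, Or.inr ⟨v', hv', rfl⟩, ?_⟩
    rw [chartAt_on]
    refine ⟨hv, ?_⟩
    change (0 : ℝ) ∈ (onData V v').B
    rw [onData, (exists_onData V v').choose_spec.2]; trivial

end DNC

end NormalCone

section Foliations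

/-- A family of vectors `X x ∈ B x`, for instance a (not necessarily smooth) vector field. -/
def Sections {N : Type*} (B : N → Type*) : Type _ := ∀ x, B x

variable {E : Type*} [NormedAddCommGroup E] [NormedSpace ℝ E] {H : Type*} [TopologicalSpace H]
  {I : ModelWithCorners ℝ E H} {M : Type*} [TopologicalSpace M] [ChartedSpace H M]
  {E' : Type*} [NormedAddCommGroup E'] [NormedSpace ℝ E'] {H' : Type*} [TopologicalSpace H']
  {J : ModelWithCorners ℝ E' H'} {N : Type*} [TopologicalSpace N] [ChartedSpace H' N]

namespace Sections

variable {B : N → Type*} [∀ x, AddCommGroup (B x)] [∀ x, Module ℝ (B x)]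

instance : AddCommGroup (Sections B) := inferInstanceAs (AddCommGroup (∀ x, B x))

/-- Smooth functions act on sections by pointwise multiplication. -/
noncomputable instance : Module C^∞⟮J, N; ℝ⟯ (Sections B) where
  smul f X := fun x => f x • X x
  one_smul X := funext fun x => one_smul ℝ (X x)
  mul_smul f g X := funext fun x => mul_smul (f x) (g x) (X x)
  smul_zero f := funext fun x => smul_zero (f x)
  smul_add f X Y := funext fun x => smul_add (f x) (X x) (Y x)
  add_smul f g X := funext fun x => add_smul (f x) (g x) (X x)
  zero_smul X := funext fun x => zero_smul ℝ (X x)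

end Sections

variable (I M) in
/-- Vector fields on `M`, without regularity. -/
abbrev VF : Type _ := Sections fun x : M => TangentSpace I x

/-- Smoothness of a vector field. -/
def IsSmooth [IsManifold I ∞ M] (X : VF I M) : Prop :=
  ContMDiff I I.tangent ∞ fun x => (⟨x, X x⟩ : TangentBundle I M)

/-- The closed support of a vector field. -/
def supp (X : VF I M) : Set M := closure {x | X x ≠ 0}

variable (I M) in
/-- The `C^∞(M)`-module `C_c^∞(M; TM)` of smooth vector fields with compact support. -/
noncomputable def compactFields [IsManifold I ∞ M] : Submodule C^∞⟮I, M; ℝ⟯ (VF I M) where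
  carrier := {X | IsSmooth X ∧ IsCompact (supp X)}
  add_mem' := by
    rintro X Y ⟨hX, hX'⟩ ⟨hY, hY'⟩
    refine ⟨ContMDiff.add_section hX hY, ?_⟩
    refine (hX'.union hY').of_isClosed_subset isClosed_closure ?_
    rw [supp, supp, supp, ← closure_union]
    refine closure_mono fun x hx => ?_
    by_contra h
    simp only [mem_union, mem_ofPred_eq, not_or, not_not] at h
    exact hx (by change X x + Y x = 0; rw [h.1, h.2, add_zero])
  zero_mem' := by
    refine ⟨Bundle.contMDiff_zeroSection ℝ (TangentSpace I : M → Type _), ?_⟩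
    have : supp (0 : VF I M) = ∅ := by
      rw [supp, closure_empty_iff, eq_empty_iff_forall_notMem]
      exact fun x hx => hx rfl
    rw [this]
    exact isCompact_empty
  smul_mem' := by
    rintro f X ⟨hX, hX'⟩
    refine ⟨ContMDiff.smul_section f.contMDiff hX, ?_⟩
    refine hX'.of_isClosed_subset isClosed_closure (closure_mono fun x hx h => hx ?_)
    change f x • X x = 0
    rw [h, smul_zero]

/-- A (singular) foliation of `M`: a submodule of `C_c^∞(M; TM)` which is locally finitely
generated and stable under Lie brackets. -/
structure IsFoliation [IsManifold I ∞ M] (F : Submodule C^∞⟮I, M; ℝ⟯ (VF I M)) : Prop where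
  le : F ≤ compactFields I M
  locally_fg : ∀ x : M, ∃ O : Set M, IsOpen O ∧ x ∈ O ∧ ∃ S : Set (VF I M), S.Finite ∧
    S ⊆ F ∧ ∀ X ∈ F, supp X ⊆ O → X ∈ Submodule.span C^∞⟮I, M; ℝ⟯ S
  bracket : ∀ X ∈ F, ∀ Y ∈ F, (VectorField.mlieBracket I X Y : VF I M) ∈ F

/-- The ideal `I_x` of smooth functions vanishing at `x`. -/
noncomputable def vanishingIdeal (I : ModelWithCorners ℝ E H) {M : Type*} [TopologicalSpace M]
    [ChartedSpace H M] (x : M) : Ideal C^∞⟮I, M; ℝ⟯ :=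
  RingHom.ker (ContMDiffMap.evalRingHom x : C^∞⟮I, M; ℝ⟯ →+* ℝ)

/-- The fibre `F_x = F / I_x F` of the foliation `F` at `x`. -/
abbrev Fiber (F : Submodule C^∞⟮I, M; ℝ⟯ (VF I M)) (x : M) : Type _ :=
  F ⧸ (vanishingIdeal I x • ⊤ : Submodule C^∞⟮I, M; ℝ⟯ F)

/-- The differential of `f : N → M`, from vector fields on `N` to vector fields along `f`. -/
noncomputable def push (J : ModelWithCorners ℝ E' H') (I : ModelWithCorners ℝ E H) (f : N → M) :
    VF J N →ₗ[C^∞⟮J, N; ℝ⟯] Sections fun u : N => TangentSpace I (f u) where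
  toFun X := fun u => mfderiv J I f u (X u)
  map_add' X Y := funext fun u => map_add (mfderiv J I f u) (X u) (Y u)
  map_smul' g X := funext fun u => map_smul (mfderiv J I f u) (g u) (X u)

/-- The module `C_c^∞(N; ker df)` of vertical vector fields. -/
noncomputable def verticalFields (J : ModelWithCorners ℝ E' H') (I : ModelWithCorners ℝ E H)
    {N : Type*} [TopologicalSpace N] [ChartedSpace H' N] [IsManifold J ∞ N]
    (f : N → M) : Submodule C^∞⟮J, N; ℝ⟯ (VF J N) :=
  compactFields J N ⊓ LinearMap.ker (push J I f)

/-- The pull-back foliation `f⁻¹(F)`: the smooth compactly supported vector fields `X` on `N` such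
that `df(X)` is a finite sum `∑ gᵢ (Yᵢ ∘ f)` with `gᵢ` smooth and `Yᵢ ∈ F`. -/
noncomputable def pullback (J : ModelWithCorners ℝ E' H') {N : Type*} [TopologicalSpace N]
    [ChartedSpace H' N] [IsManifold J ∞ N] (F : Submodule C^∞⟮I, M; ℝ⟯ (VF I M)) (f : N → M) :
    Submodule C^∞⟮J, N; ℝ⟯ (VF J N) :=
  compactFields J N ⊓ (Submodule.span C^∞⟮J, N; ℝ⟯
    {Z : Sections fun u : N => TangentSpace I (f u) | ∃ Y ∈ F, Z = fun u => Y (f u)}).comap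
      (push J I f)

/-- The vector field `X ⊗ 1` on `M × ℝ`, tangent along `M`. -/
def extend (X : VF I M) : VF (I.prod 𝓘(ℝ)) (M × ℝ) := fun p => ((X p.1, 0) : E × ℝ)

/-- The adiabatic foliation `TF` on `M × ℝ`: the finite sums `∑ fᵢ (Xᵢ ⊗ 1)` with `Xᵢ ∈ F` and
`fᵢ ∈ λ C_c^∞(M × ℝ)`, where `λ : M × ℝ → ℝ` is the second projection. -/
noncomputable def adiabatic (F : Submodule C^∞⟮I, M; ℝ⟯ (VF I M)) :
    Submodule C^∞⟮I.prod 𝓘(ℝ), M × ℝ; ℝ⟯ (VF (I.prod 𝓘(ℝ)) (M × ℝ)) :=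
  Submodule.span C^∞⟮I.prod 𝓘(ℝ), M × ℝ; ℝ⟯
    {Z | ∃ g : C^∞⟮I.prod 𝓘(ℝ), M × ℝ; ℝ⟯, HasCompactSupport g ∧ ∃ X ∈ F,
      Z = fun p => (p.2 * g p) • extend X p}

end Foliations

section BiSubmersions

variable {E : Type*} [NormedAddCommGroup E] [NormedSpace ℝ E] {H : Type*} [TopologicalSpace H]
  {I : ModelWithCorners ℝ E H} {M : Type*} [TopologicalSpace M] [ChartedSpace H M]

/-- A smooth (Hausdorff, second countable) manifold `U` with two smooth maps `t, s : U → M`. -/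
structure Span {E : Type*} [NormedAddCommGroup E] [NormedSpace ℝ E] {H : Type*}
    [TopologicalSpace H] (I : ModelWithCorners ℝ E H) (M : Type*) [TopologicalSpace M]
    [ChartedSpace H M] where
  Model : Type u
  [normed : NormedAddCommGroup Model]
  [normedSpace : NormedSpace ℝ Model]
  [finiteDim : FiniteDimensional ℝ Model]
  U : Type u
  [top : TopologicalSpace U]
  [charted : ChartedSpace Model U]
  [manifold : IsManifold 𝓘(ℝ, Model) ∞ U]
  [t2 : T2Space U]
  [secondCountable : SecondCountableTopology U]
  t : U → M
  s : U → M
  smooth_t : ContMDiff 𝓘(ℝ, Model) I ∞ t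
  smooth_s : ContMDiff 𝓘(ℝ, Model) I ∞ s

namespace Span

attribute [instance] normed normedSpace finiteDim top charted manifold t2 secondCountable

/-- The differential of `t` at `u`. -/
noncomputable def dt (S : Span.{u} I M) (u : S.U) : S.Model →L[ℝ] E :=
  mfderiv 𝓘(ℝ, S.Model) I S.t u

/-- The differential of `s` at `u`. -/
noncomputable def ds (S : Span.{u} I M) (u : S.U) : S.Model →L[ℝ] E :=
  mfderiv 𝓘(ℝ, S.Model) I S.s u

/-- `(U, t, s)` is a bi-submersion for `F`: the maps `s, t` are submersions and
`s⁻¹(F) = t⁻¹(F) = C_c^∞(U; ker ds) + C_c^∞(U; ker dt)`. -/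
structure IsBiSubmersion (F : Submodule C^∞⟮I, M; ℝ⟯ (VF I M)) (S : Span.{u} I M) : Prop where
  submersion_s : ∀ u, Function.Surjective (S.ds u)
  submersion_t : ∀ u, Function.Surjective (S.dt u)
  pullback_eq : pullback 𝓘(ℝ, S.Model) F S.s = pullback 𝓘(ℝ, S.Model) F S.t
  pullback_s : pullback 𝓘(ℝ, S.Model) F S.s =
    verticalFields 𝓘(ℝ, S.Model) I S.s ⊔ verticalFields 𝓘(ℝ, S.Model) I S.t

/-- The inverse `(U, s, t)` of `(U, t, s)`. -/
def inv (S : Span.{u} I M) : Span.{u} I M where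
  Model := S.Model
  U := S.U
  t := S.s
  s := S.t
  smooth_t := S.smooth_s
  smooth_s := S.smooth_t

/-- There is a morphism from a neighbourhood of `u` in `S` to `T` which maps `u` to `w`. -/
def HasMorphism (S T : Span.{u} I M) (u : S.U) (w : T.U) : Prop :=
  ∃ O : Set S.U, IsOpen O ∧ u ∈ O ∧ ∃ f : S.U → T.U,
    ContMDiffOn 𝓘(ℝ, S.Model) 𝓘(ℝ, T.Model) ∞ f O ∧
    (∀ y ∈ O, T.t (f y) = S.t y ∧ T.s (f y) = S.s y) ∧ f u = w

/-- There is a morphism from a neighbourhood of `(u, v)` in the composition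
`S ∘ S' = S ×_{s, t} S'`, with target `t(u)` and source `s(v)`, to `T` which maps `(u, v)` to `w`.
The fibre product is an embedded submanifold of the product, so that smooth maps on it are locally
the restrictions of smooth maps on the product. -/
def HasCompMorphism (S S' T : Span.{u} I M) (u : S.U) (v : S'.U) (w : T.U) : Prop :=
  S.s u = S'.t v ∧
  ∃ O : Set (S.U × S'.U), IsOpen O ∧ (u, v) ∈ O ∧ ∃ f : S.U × S'.U → T.U,
    ContMDiffOn (𝓘(ℝ, S.Model).prod 𝓘(ℝ, S'.Model)) 𝓘(ℝ, T.Model) ∞ f O ∧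
    (∀ p ∈ O, S.s p.1 = S'.t p.2 → T.t (f p) = S.t p.1 ∧ T.s (f p) = S'.s p.2) ∧ f (u, v) = w

/-- `V` is an identity bisection of `(U, t, s)`: a (locally closed) submanifold on which `s` and
`t` coincide and are étale. -/
structure IsIdentityBisection (S : Span.{u} I M) (V : Submfd S.Model S.U) : Prop where
  eq : ∀ v ∈ V.carrier, S.s v = S.t v
  etale : ∀ v ∈ V.carrier, Function.Bijective fun ξ : V.tangent v => S.ds v ξ

/-- The deformation to the normal cone `(D(U, V), t ∘ q, s ∘ q)`, over `M × ℝ`. -/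
noncomputable def deform (S : Span.{u} I M) (V : Submfd S.Model S.U) :
    Span.{u} (I.prod 𝓘(ℝ)) (M × ℝ) where
  Model := S.Model × ℝ
  U := DNC V
  t := fun x => (S.t (DNC.q x).1, (DNC.q x).2)
  s := fun x => (S.s (DNC.q x).1, (DNC.q x).2)
  smooth_t := (S.smooth_t.comp (contMDiff_fst.comp DNC.contMDiff_q)).prodMk
    (contMDiff_snd.comp DNC.contMDiff_q)
  smooth_s := (S.smooth_s.comp (contMDiff_fst.comp DNC.contMDiff_q)).prodMk
    (contMDiff_snd.comp DNC.contMDiff_q)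

end Span

variable {ι : Type*}

/-- The family `𝒰` of bi-submersions of `F` is an atlas. -/
structure IsAtlas (F : Submodule C^∞⟮I, M; ℝ⟯ (VF I M)) (𝒰 : ι → Span.{u} I M) : Prop where
  biSubmersion : ∀ i, (𝒰 i).IsBiSubmersion F
  cover : ∀ x : M, ∃ i, ∃ u : (𝒰 i).U, (𝒰 i).s u = x
  inv_adapted : ∀ i, ∀ u : (𝒰 i).U, ∃ j, ∃ w : (𝒰 j).U, (𝒰 i).inv.HasMorphism (𝒰 j) u w
  comp_adapted : ∀ i j, ∀ (u : (𝒰 i).U) (v : (𝒰 j).U), (𝒰 i).s u = (𝒰 j).t v →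
    ∃ k, ∃ w : (𝒰 k).U, (𝒰 i).HasCompMorphism (𝒰 j) (𝒰 k) u v w

/-- The relation on `∐ Uᵢ` which defines the groupoid of the atlas `𝒰`. -/
def Rel (𝒰 : ι → Span.{u} I M) (a b : Σ i, (𝒰 i).U) : Prop :=
  (𝒰 a.1).HasMorphism (𝒰 b.1) a.2 b.2

/-- The groupoid `G(𝒰)` of the atlas `𝒰` (its set of arrows). -/
def Arrow (𝒰 : ι → Span.{u} I M) : Type _ := Quot (Rel 𝒰)

namespace Arrow

variable {𝒰 : ι → Span.{u} I M}

/-- The class of `u ∈ Uᵢ`. -/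
def mk (i : ι) (u : (𝒰 i).U) : Arrow 𝒰 := Quot.mk _ ⟨i, u⟩

/-- The source map of `G(𝒰)`. -/
def src : Arrow 𝒰 → M :=
  Quot.lift (fun a => (𝒰 a.1).s a.2) (by
    rintro a b ⟨O, -, hu, f, -, hf, hfu⟩
    rw [← (hf _ hu).2, hfu])

/-- The target map of `G(𝒰)`. -/
def tgt : Arrow 𝒰 → M :=
  Quot.lift (fun a => (𝒰 a.1).t a.2) (by
    rintro a b ⟨O, -, hu, f, -, hf, hfu⟩
    rw [← (hf _ hu).1, hfu])

/-- `k = g h` in `G(𝒰)`: the product of the classes of `u ∈ Uᵢ` and `v ∈ Uⱼ` is the class of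
`(u, v) ∈ Uᵢ ∘ Uⱼ`, that is, of the image of `(u, v)` under a local morphism to some `Uₖ`. -/
def IsComp (g h k : Arrow 𝒰) : Prop :=
  ∃ (i j l : ι) (u : (𝒰 i).U) (v : (𝒰 j).U) (w : (𝒰 l).U),
    g = mk i u ∧ h = mk j v ∧ k = mk l w ∧ (𝒰 i).HasCompMorphism (𝒰 j) (𝒰 l) u v w

end Arrow

/-- `G`, with the given source and target maps to `X` and the given composition relation
(`comp g h k` meaning `k = g h`), is a groupoid with set of objects `X`. -/
structure IsGroupoid {X G : Type*} (src tgt : G → X) (comp : G → G → G → Prop) : Prop where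
  composable : ∀ {g h k}, comp g h k → src g = tgt h ∧ src k = src h ∧ tgt k = tgt g
  existsUnique_comp : ∀ {g h}, src g = tgt h → ∃! k, comp g h k
  assoc : ∀ {g h k a b c}, comp g h a → comp h k b → comp a k c → comp g b c
  unit_inv : ∃ unit : X → G, (∀ x, src (unit x) = x ∧ tgt (unit x) = x) ∧
    (∀ g, comp g (unit (src g)) g ∧ comp (unit (tgt g)) g g) ∧
    ∀ g, ∃ h, comp h g (unit (src g)) ∧ comp g h (unit (tgt g))

/-- The tangent groupoid `⋃ F_x × {0} ∪ G(𝒰) × ℝ^*` (its set of arrows). -/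
inductive TangentGroupoid (F : Submodule C^∞⟮I, M; ℝ⟯ (VF I M)) (𝒰 : ι → Span.{u} I M) : Type _
  | zero (x : M) (ξ : Fiber F x) : TangentGroupoid F 𝒰
  | ne (g : Arrow 𝒰) (β : ℝ) (hβ : β ≠ 0) : TangentGroupoid F 𝒰

namespace TangentGroupoid

variable {F : Submodule C^∞⟮I, M; ℝ⟯ (VF I M)} {𝒰 : ι → Span.{u} I M}

/-- The source map of the tangent groupoid. -/
def src : TangentGroupoid F 𝒰 → M × ℝ
  | zero x _ => (x, 0)
  | ne g β _ => (g.src, β)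

/-- The target map of the tangent groupoid. -/
def tgt : TangentGroupoid F 𝒰 → M × ℝ
  | zero x _ => (x, 0)
  | ne g β _ => (g.tgt, β)

/-- The composition of the tangent groupoid: addition in the fibres `F_x` over `(x, 0)`, and the
composition of `G(𝒰)` over each `β ≠ 0`. -/
inductive IsComp : TangentGroupoid F 𝒰 → TangentGroupoid F 𝒰 → TangentGroupoid F 𝒰 → Prop
  | zero (x : M) (ξ η : Fiber F x) : IsComp (.zero x ξ) (.zero x η) (.zero x (ξ + η))
  | ne (g h k : Arrow 𝒰) (β : ℝ) (hβ : β ≠ 0) (hk : Arrow.IsComp g h k) :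
      IsComp (.ne g β hβ) (.ne h β hβ) (.ne k β hβ)

end TangentGroupoid

/-- The family `(D(Uᵢ, Vᵢ), tᵢ ∘ qᵢ, sᵢ ∘ qᵢ)` over `M × ℝ`. -/
noncomputable def adiabaticAtlas (𝒰 : ι → Span.{u} I M)
    (V : ∀ i, Submfd (𝒰 i).Model (𝒰 i).U) : ι → Span.{u} (I.prod 𝓘(ℝ)) (M × ℝ) :=
  fun i => (𝒰 i).deform (V i)

end BiSubmersions

end SingularFoliation

open SingularFoliation

namespace SingularFoliation

universe u

section Nemytskii

set_option linter.unusedSectionVars false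

abbrev II : Type := Icc (0 : ℝ) 1

/-- The pointwise pairing of two paths. -/
noncomputable def pathApply (R Q G : Type*) [NormedAddCommGroup R] [NormedSpace ℝ R]
    [NormedAddCommGroup Q] [NormedSpace ℝ Q]
    [NormedAddCommGroup G] [NormedSpace ℝ G] (B : R →L[ℝ] Q →L[ℝ] G) :=
  LinearMap.mkContinuous₂
    (LinearMap.mk₂ ℝ (fun (A : C(II, R)) (h : C(II, Q)) =>
        (⟨fun r => B (A r) (h r), by fun_prop⟩ : C(II, G)))
      (fun A A' h => by ext r; simp) (fun c A h => by ext r; simp)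
      (fun A h h' => by ext r; simp) (fun c A h => by ext r; simp)) ‖B‖
    (fun A h => by
      rw [ContinuousMap.norm_le _ (by positivity)]
      intro r
      refine (B.le_opNorm₂ _ _).trans ?_
      gcongr
      · exact A.norm_coe_le_norm r
      · exact h.norm_coe_le_norm r)

theorem contDiff_pathApply {n : ℕ∞ω} (R Q G : Type*) [NormedAddCommGroup R] [NormedSpace ℝ R]
    [NormedAddCommGroup Q] [NormedSpace ℝ Q]
    [NormedAddCommGroup G] [NormedSpace ℝ G] (B : R →L[ℝ] Q →L[ℝ] G) :
    ContDiff ℝ n fun A : C(II, R) => pathApply R Q G B A := by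
  have h : IsBoundedLinearMap ℝ (fun A : C(II, R) => pathApply R Q G B A) :=
   ⟨⟨map_add _, map_smul _⟩, by
      refine ⟨‖B‖+1, by positivity, fun A => ?_⟩
      refine ContinuousLinearMap.opNorm_le_bound _ (by positivity) fun h => ?_
      rw [ContinuousMap.norm_le _ (by positivity)]
      intro r
      refine (B.le_opNorm₂ _ _).trans ?_
      gcongr
      · linarith
      · exact A.norm_coe_le_norm r
      · exact h.norm_coe_le_norm r⟩
  exact h.contDiff

theorem hasFDerivAt_comp_path {Q G : Type*} [NormedAddCommGroup Q] [NormedSpace ℝ Q]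
    [FiniteDimensional ℝ Q] [NormedAddCommGroup G] [NormedSpace ℝ G] (g : C(Q, G))
    (g' : C(Q, Q →L[ℝ] G)) (hg : ∀ x, HasFDerivAt g (g' x) x) (hs : HasCompactSupport g')
    (u : C(II, Q)) :
    HasFDerivAt (fun u : C(II, Q) => g.comp u) (pathApply (Q →L[ℝ] G) Q G (ContinuousLinearMap.id ℝ (Q →L[ℝ] G)) (g'.comp u)) u := by
  have huc : UniformContinuous g' := hs.uniformContinuous_of_continuous g'.continuous
  rw [hasFDerivAt_iff_isLittleO_nhds_zero, Asymptotics.isLittleO_iff]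
  intro ε hε
  obtain ⟨δ, hδ, h⟩ := Metric.uniformContinuous_iff.1 huc ε hε
  filter_upwards [Metric.ball_mem_nhds (0 : C(II, Q)) hδ] with k hk
  rw [ContinuousMap.norm_le _ (by positivity)]
  intro r
  have hkr : ‖k r‖ ≤ ‖k‖ := k.norm_coe_le_norm r
  have hk' : ‖k‖ < δ := by simpa using hk
  have key := (convex_ball (u r) δ).norm_image_sub_le_of_norm_hasFDerivWithin_le' (f := g)
    (f' := g') (φ := g' (u r)) (C := ε) (x := u r) (y := u r + k r)
    (fun x _ => (hg x).hasFDerivWithinAt) (fun x hx => by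
      have := h (a := x) (b := u r) hx
      rw [dist_eq_norm] at this
      exact this.le) (Metric.mem_ball_self hδ) (by simpa using hkr.trans_lt hk')
  simp only [add_sub_cancel_left] at key
  calc _ = ‖g (u r + k r) - g (u r) - g' (u r) (k r)‖ := rfl
    _ ≤ ε * ‖k r‖ := key
    _ ≤ ε * ‖k‖ := by gcongr

theorem contDiff_comp_path {Q : Type u} [NormedAddCommGroup Q] [NormedSpace ℝ Q]
    [FiniteDimensional ℝ Q] (n : ℕ) :
    ∀ {G : Type u} [NormedAddCommGroup G] [NormedSpace ℝ G] (g : C(Q, G)), ContDiff ℝ ∞ g →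
      HasCompactSupport (fderiv ℝ g) → ContDiff ℝ n fun u : C(II, Q) => g.comp u := by
  induction n with
  | zero =>
    intro G _ _ g _ _
    exact contDiff_zero.2 (ContinuousMap.continuous_postcomp g)
  | succ n ih =>
    intro G _ _ g hg hs
    have hg' : ContDiff ℝ ∞ (fderiv ℝ g) := hg.fderiv_right (by simp)
    let g' : C(Q, Q →L[ℝ] G) := ⟨fderiv ℝ g, hg'.continuous⟩
    have key : ∀ u, HasFDerivAt (fun u : C(II, Q) => g.comp u) (pathApply (Q →L[ℝ] G) Q G (ContinuousLinearMap.id ℝ (Q →L[ℝ] G)) (g'.comp u)) u :=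
      hasFDerivAt_comp_path g g'
        (fun x => (hg.differentiable (by simp) x).hasFDerivAt) hs
    have : ((n + 1 : ℕ) : ℕ∞ω) = (n : ℕ∞ω) + 1 := by norm_cast
    rw [this, contDiff_succ_iff_fderiv]
    refine ⟨fun u => (key u).differentiableAt, by simp, ?_⟩
    have h2 : fderiv ℝ (fun u : C(II, Q) => g.comp u) = fun u => pathApply (Q →L[ℝ] G) Q G (ContinuousLinearMap.id ℝ (Q →L[ℝ] G)) (g'.comp u) :=
      funext fun u => (key u).fderiv
    rw [h2]
    have h3 := contDiff_pathApply (n := n) (Q →L[ℝ] G) Q G (ContinuousLinearMap.id ℝ (Q →L[ℝ] G))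
    exact h3.comp (ih g' hg' (hs.fderiv ℝ))

end Nemytskii

section Flow

set_option linter.unusedSectionVars false

variable {Q : Type u} [NormedAddCommGroup Q] [NormedSpace ℝ Q] [FiniteDimensional ℝ Q]

/-- Multiplication of a path by a scalar function. -/
noncomputable def pathSMul (Q : Type*) [NormedAddCommGroup Q] [NormedSpace ℝ Q] (a : C(II, ℝ)) :
    C(II, Q) →L[ℝ] C(II, Q) :=
  LinearMap.mkContinuous
    { toFun := fun y => ⟨fun r => a r • y r, by fun_prop⟩
      map_add' := fun y z => by ext r; simp
      map_smul' := fun c y => by ext r; exact smul_comm (a r) c (y r) } ‖a‖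
    (fun y => by
      rw [ContinuousMap.norm_le _ (by positivity)]
      intro r
      change ‖a r • y r‖ ≤ _
      rw [norm_smul]
      exact mul_le_mul (a.norm_coe_le_norm r) (y.norm_coe_le_norm r) (by positivity)
        (by positivity))

theorem pathSMul_apply {Q : Type*} [NormedAddCommGroup Q] [NormedSpace ℝ Q] (a : C(II, ℝ))
    (y : C(II, Q)) (r : II) : pathSMul Q a y r = a r • y r := rfl

/-- The extension of a path to the real line, constant outside of the unit interval. -/
noncomputable def pathExt (y : C(II, Q)) (r : ℝ) : Q := y (projIcc 0 1 zero_le_one r)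

theorem continuous_pathExt (y : C(II, Q)) : Continuous (pathExt y) :=
  y.continuous.comp continuous_projIcc

theorem pathExt_coe (y : C(II, Q)) (r : II) : pathExt y r = y r := by
  simp [pathExt]

/-- The primitive of a path. -/
noncomputable def pathInt (Q : Type*) [NormedAddCommGroup Q] [NormedSpace ℝ Q]
    [FiniteDimensional ℝ Q] : C(II, Q) →L[ℝ] C(II, Q) :=
  LinearMap.mkContinuous
    { toFun := fun y => ⟨fun r => ∫ s in (0 : ℝ)..r, pathExt y s,
        (intervalIntegral.continuous_primitive
          (fun _ _ => (continuous_pathExt y).intervalIntegrable _ _) 0).comp continuous_subtype_val⟩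
      map_add' := fun y z => by
        ext r
        exact intervalIntegral.integral_add ((continuous_pathExt y).intervalIntegrable _ _)
          ((continuous_pathExt z).intervalIntegrable _ _)
      map_smul' := fun c y => by
        ext r
        exact intervalIntegral.integral_smul c _ } 1
    (fun y => by
      rw [ContinuousMap.norm_le _ (by positivity)]
      intro r
      have := intervalIntegral.norm_integral_le_of_norm_le_const (a := 0) (b := r) (C := ‖y‖)
        (f := pathExt y) (fun s _ => y.norm_coe_le_norm _)
      refine this.trans ?_
      rw [mul_comm, sub_zero, abs_of_nonneg r.2.1]
      exact mul_le_mul_of_nonneg_right r.2.2 (norm_nonneg _))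

theorem pathInt_apply (y : C(II, Q)) (r : II) : pathInt Q y r = ∫ s in (0 : ℝ)..r, pathExt y s :=
  rfl

/-- The path `r ↦ exp (c r)`. -/
noncomputable def expPath (c : ℝ) : C(II, ℝ) := ⟨fun r => Real.exp (c * r), by fun_prop⟩

theorem lipschitz_pathInt_comp {V : C(Q, Q)} {K : ℝ} (hK : 0 ≤ K)
    (hV : ∀ x y, ‖V x - V y‖ ≤ K * ‖x - y‖) {L : ℝ} (hL : 2 * K ≤ L) (hL0 : 0 < L) (y z : C(II, Q)) :
    ‖pathSMul Q (expPath (-L)) (pathInt Q (V.comp (pathSMul Q (expPath L) y))) -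
      pathSMul Q (expPath (-L)) (pathInt Q (V.comp (pathSMul Q (expPath L) z)))‖ ≤
        (1 / 2) * ‖y - z‖ := by
  rw [← map_sub, ← map_sub, ContinuousMap.norm_le _ (by positivity)]
  intro r
  rw [pathSMul_apply, pathInt_apply, norm_smul]
  have h1 : ‖∫ s in (0 : ℝ)..r, pathExt (V.comp (pathSMul Q (expPath L) y) -
      V.comp (pathSMul Q (expPath L) z)) s‖ ≤
        ∫ s in (0 : ℝ)..r, K * Real.exp (L * s) * ‖y - z‖ := by
    refine intervalIntegral.norm_integral_le_of_norm_le r.2.1 (Eventually.of_forall ?_)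
      ((by fun_prop : Continuous fun s : ℝ => K * Real.exp (L * s) * ‖y - z‖).intervalIntegrable
        _ _)
    intro s hs
    have hsI : s ∈ Icc (0 : ℝ) 1 := ⟨hs.1.le, hs.2.trans r.2.2⟩
    have h2 : pathExt (V.comp (pathSMul Q (expPath L) y) - V.comp (pathSMul Q (expPath L) z)) s =
        V (Real.exp (L * s) • y ⟨s, hsI⟩) - V (Real.exp (L * s) • z ⟨s, hsI⟩) :=
      pathExt_coe _ (⟨s, hsI⟩ : II)
    rw [h2]
    refine (hV _ _).trans ?_
    rw [← smul_sub, norm_smul, Real.norm_eq_abs, abs_of_pos (Real.exp_pos _), mul_assoc]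
    gcongr
    exact (y - z).norm_coe_le_norm ⟨s, hsI⟩
  have h3 : ∫ s in (0 : ℝ)..r, K * Real.exp (L * s) * ‖y - z‖ =
      K * ‖y - z‖ * ((Real.exp (L * r) - 1) / L) := by
    have : ∀ s : ℝ, K * Real.exp (L * s) * ‖y - z‖ = (K * ‖y - z‖) * Real.exp (L * s) :=
      fun s => by ring
    simp only [this, intervalIntegral.integral_const_mul]
    congr 1
    rw [intervalIntegral.integral_comp_mul_left (fun x => Real.exp x) hL0.ne', integral_exp]
    simp [div_eq_inv_mul]
  rw [h3] at h1
  have h4 : ‖expPath (-L) r‖ = (Real.exp (L * r))⁻¹ := by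
    change ‖Real.exp (-L * r)‖ = _
    rw [Real.norm_eq_abs, abs_of_pos (Real.exp_pos _), neg_mul, Real.exp_neg]
  rw [h4]
  have h5 : 0 < Real.exp (L * r) := Real.exp_pos _
  calc (Real.exp (L * r))⁻¹ * _ ≤ (Real.exp (L * r))⁻¹ * (K * ‖y - z‖ * ((Real.exp (L * r) - 1) / L))
        := by gcongr
    _ ≤ (Real.exp (L * r))⁻¹ * (K * ‖y - z‖ * (Real.exp (L * r) / L)) := by gcongr; linarith
    _ = (K / L) * ‖y - z‖ := by field_simp
    _ ≤ (1 / 2) * ‖y - z‖ := by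
      refine mul_le_mul_of_nonneg_right ?_ (norm_nonneg _)
      rw [div_le_iff₀ hL0]; linarith

theorem exists_smooth_flow (V : Q → Q) (hV : ContDiff ℝ ∞ V) (hs : HasCompactSupport (fderiv ℝ V)) :
    ∃ Φ : Q → ℝ → Q, (∀ r ∈ Icc (0 : ℝ) 1, ContDiff ℝ ∞ fun q => Φ q r) ∧
      Continuous (Function.uncurry Φ) ∧ (∀ q, Φ q 0 = q) ∧
      ∀ q, ∀ r ∈ Icc (0 : ℝ) 1, HasDerivAt (Φ q) (V (Φ q r)) r := by
  let Vc : C(Q, Q) := ⟨V, hV.continuous⟩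
  have hdV : Continuous (fderiv ℝ V) := hV.continuous_fderiv (by simp)
  obtain ⟨K', hK'⟩ := hs.exists_bound_of_continuous hdV
  set K : ℝ := max K' 0 with hKdef
  have hK : 0 ≤ K := le_max_right _ _
  have hlip : ∀ x y, ‖Vc x - Vc y‖ ≤ K * ‖x - y‖ := fun x y =>
    convex_univ.norm_image_sub_le_of_norm_fderiv_le (𝕜 := ℝ) (f := V)
      (fun x _ => hV.differentiable (by simp) x) (fun x _ => (hK' x).trans (le_max_left _ _))
      (mem_univ y) (mem_univ x)
  set L : ℝ := 2 * K + 1 with hLdef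
  have hL0 : 0 < L := by positivity
  let T : C(II, Q) → C(II, Q) := fun y =>
    pathSMul Q (expPath (-L)) (pathInt Q (Vc.comp (pathSMul Q (expPath L) y)))
  have hT : ∀ y z, ‖T y - T z‖ ≤ (1 / 2) * ‖y - z‖ :=
    lipschitz_pathInt_comp hK hlip (by linarith) hL0
  have hTs : ContDiff ℝ ∞ T := by
    rw [contDiff_infty]
    intro n
    exact (pathSMul Q (expPath (-L))).contDiff.comp ((pathInt Q).contDiff.comp
      ((contDiff_comp_path n Vc hV hs).comp (pathSMul Q (expPath L)).contDiff))
  let f : C(II, Q) → C(II, Q) := fun y => y - T y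
  have hf : ApproximatesLinearOn f
      ((ContinuousLinearEquiv.refl ℝ C(II, Q) : C(II, Q) ≃L[ℝ] C(II, Q)) :
        C(II, Q) →L[ℝ] C(II, Q)) univ (1 / 2) := by
    intro y _ z _
    have : f y - f z - ((ContinuousLinearEquiv.refl ℝ C(II, Q) : C(II, Q) ≃L[ℝ] C(II, Q)) :
        C(II, Q) →L[ℝ] C(II, Q)) (y - z) = -(T y - T z) := by
      simp [f]; abel
    rw [this, norm_neg]
    simpa using hT y z
  have hc : Subsingleton C(II, Q) ∨ (1 / 2 : NNReal) <
      ‖((ContinuousLinearEquiv.refl ℝ C(II, Q) : C(II, Q) ≃L[ℝ] C(II, Q)).symm :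
        C(II, Q) →L[ℝ] C(II, Q))‖₊⁻¹ := by
    rcases subsingleton_or_nontrivial C(II, Q) with h | h
    · exact Or.inl h
    · right
      have : ‖((ContinuousLinearEquiv.refl ℝ C(II, Q) : C(II, Q) ≃L[ℝ] C(II, Q)).symm :
        C(II, Q) →L[ℝ] C(II, Q))‖₊ = 1 := by
        ext
        exact ContinuousLinearMap.norm_id
      rw [this, inv_one]
      exact NNReal.half_lt_self one_ne_zero
  let h : C(II, Q) ≃ₜ C(II, Q) := hf.toHomeomorph f hc
  have hh : ∀ y, h y = f y := fun y => rfl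
  have hfs : ContDiff ℝ ∞ f := contDiff_id.sub hTs
  have hd : ∀ y, ∃ A : C(II, Q) ≃L[ℝ] C(II, Q), HasFDerivAt h (A : C(II, Q) →L[ℝ] C(II, Q)) y := by
    intro y
    have h1 : HasFDerivAt T (fderiv ℝ T y) y := (hTs.differentiable (by simp) y).hasFDerivAt
    have h2 : ‖fderiv ℝ T y‖ ≤ 1 / 2 := by
      have := norm_fderiv_le_of_lipschitz ℝ (f := T) (x₀ := y) (C := 1 / 2)
        (LipschitzWith.of_dist_le_mul fun y z => by
          rw [dist_eq_norm, dist_eq_norm]; simpa using hT y z)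
      simpa using this
    refine ⟨ContinuousLinearEquiv.unitsEquiv ℝ _ (Units.oneSub (fderiv ℝ T y) (by linarith)), ?_⟩
    exact (hasFDerivAt_id y).sub h1
  choose A hA using hd
  have hhs : ContDiff ℝ ∞ h.symm := h.contDiff_symm hA hfs
  let cst : Q →L[ℝ] C(II, Q) := ContinuousLinearMap.const ℝ II
  let γ : Q → C(II, Q) := fun q =>
    pathSMul Q (expPath L) (h.symm (pathSMul Q (expPath (-L)) (cst q)))
  have hγ : ContDiff ℝ ∞ γ := (pathSMul Q (expPath L)).contDiff.comp (hhs.comp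
    ((pathSMul Q (expPath (-L))).contDiff.comp cst.contDiff))
  have hexp : ∀ r : II, expPath L r * expPath (-L) r = 1 := fun r => by
    change Real.exp (L * r) * Real.exp (-L * r) = 1
    rw [← Real.exp_add]; simp
  have heq : ∀ q (r : II), γ q r = q + ∫ s in (0 : ℝ)..r, V (pathExt (γ q) s) := by
    intro q r
    have h1 : f (h.symm (pathSMul Q (expPath (-L)) (cst q))) = pathSMul Q (expPath (-L)) (cst q) :=
      h.apply_symm_apply _
    have h2 : h.symm (pathSMul Q (expPath (-L)) (cst q)) = pathSMul Q (expPath (-L)) (cst q) +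
        pathSMul Q (expPath (-L)) (pathInt Q (Vc.comp (γ q))) := sub_eq_iff_eq_add.1 h1
    have h3 : γ q r = expPath L r • h.symm (pathSMul Q (expPath (-L)) (cst q)) r := rfl
    rw [h3, h2, ContinuousMap.add_apply, pathSMul_apply, pathSMul_apply, smul_add, smul_smul,
      smul_smul, hexp, one_smul, one_smul]
    rfl
  have hcont : ∀ q, Continuous fun s => V (pathExt (γ q) s) := fun q =>
    hV.continuous.comp (continuous_pathExt _)
  have hΦ : ∀ q, ∀ r : II, q + ∫ s in (0 : ℝ)..r, V (pathExt (γ q) s) = γ q r :=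
    fun q r => (heq q r).symm
  refine ⟨fun q r => q + ∫ s in (0 : ℝ)..r, V (pathExt (γ q) s), ?_, ?_, ?_, ?_⟩
  · intro r hr
    have : (fun q => q + ∫ s in (0 : ℝ)..r, V (pathExt (γ q) s)) = fun q => γ q ⟨r, hr⟩ :=
      funext fun q => hΦ q ⟨r, hr⟩
    rw [this]
    exact (ContinuousMap.evalCLM ℝ (⟨r, hr⟩ : II)).contDiff.comp hγ
  · have h1 : Continuous (Function.uncurry fun q s => V (pathExt (γ q) s)) := by
      have : Continuous fun p : Q × ℝ => (γ p.1) (projIcc 0 1 zero_le_one p.2) :=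
        (hγ.continuous.comp continuous_fst).eval (continuous_projIcc.comp continuous_snd)
      exact hV.continuous.comp this
    have h2 : Continuous fun p : Q × ℝ => ∫ s in (0 : ℝ)..p.2, V (pathExt (γ p.1) s) :=
      intervalIntegral.continuous_parametric_intervalIntegral_of_continuous
        (f := fun (p : Q × ℝ) s => V (pathExt (γ p.1) s))
        (h1.comp (by fun_prop : Continuous fun x : (Q × ℝ) × ℝ => (x.1.1, x.2))) continuous_snd
    exact continuous_fst.add h2
  · intro q; simp
  · intro q r hr
    have h1 := (intervalIntegral.integral_hasDerivAt_right ((hcont q).intervalIntegrable 0 r)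
      ((hcont q).stronglyMeasurableAtFilter _ _) (hcont q).continuousAt).const_add q
    have h2 : q + ∫ s in (0 : ℝ)..r, V (pathExt (γ q) s) = pathExt (γ q) r :=
      (hΦ q ⟨r, hr⟩).trans (pathExt_coe _ ⟨r, hr⟩).symm
    simp only [h2]
    exact h1

end Flow

section LocalFlow

theorem exists_cutoff {Q : Type*} [NormedAddCommGroup Q] [NormedSpace ℝ Q] [FiniteDimensional ℝ Q]
    {F : Type*} [NormedAddCommGroup F] [NormedSpace ℝ F]
    {K : Set Q} (hK : IsCompact K) (G : Q → F) (hG : ∀ q ∈ K, ∀ᶠ z in 𝓝 q, ContDiffAt ℝ ∞ G z) :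
    ∃ G' : Q → F, ContDiff ℝ ∞ G' ∧ HasCompactSupport G' ∧ ∀ q ∈ K, G' =ᶠ[𝓝 q] G := by
  let Ω : Set Q := interior {z | ContDiffAt ℝ ∞ G z}
  have hKΩ : K ⊆ Ω := fun q hq => mem_interior_iff_mem_nhds.2 (hG q hq)
  obtain ⟨K', hK', hKK', hK'Ω⟩ := exists_compact_between hK isOpen_interior hKΩ
  obtain ⟨χ, h1, h0, -⟩ := exists_contMDiffMap_one_nhds_of_subset_interior 𝓘(ℝ, Q) (n := ⊤)
    hK.isClosed hKK'
  have hχ : ContDiff ℝ ∞ χ := χ.contMDiff.contDiff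
  have hout : ∀ z ∉ K', χ z • G z = 0 := fun z hz => by rw [h0 z hz, zero_smul]
  refine ⟨fun z => χ z • G z, ?_, HasCompactSupport.intro hK' hout, ?_⟩
  · rw [contDiff_iff_contDiffAt]
    intro z
    by_cases hz : z ∈ K'
    · exact hχ.contDiffAt.smul (interior_subset (hK'Ω hz))
    · refine (contDiffAt_const (c := (0 : F))).congr_of_eventuallyEq ?_
      filter_upwards [hK'.isClosed.isOpen_compl.mem_nhds hz] with y hy using hout y hy
  · intro q hq
    filter_upwards [eventually_nhdsSet_iff_forall.1 h1 q hq] with z hz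
    rw [hz, one_smul]

theorem exists_local_flow {P : Type*} [NormedAddCommGroup P] [NormedSpace ℝ P]
    [FiniteDimensional ℝ P] {X : Type*} [NormedAddCommGroup X] [NormedSpace ℝ X]
    [FiniteDimensional ℝ X] (G : P × ℝ × X → X) (p₀ : P) (γ₀ : ℝ → X)
    (hG : ∀ r ∈ Icc (0 : ℝ) 1, ∀ᶠ q in 𝓝 (p₀, r, γ₀ r), ContDiffAt ℝ ∞ G q)
    (hγ : ∀ r ∈ Icc (0 : ℝ) 1, HasDerivAt γ₀ (G (p₀, r, γ₀ r)) r)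
    (g₀ : P → X) (hg₀ : ∀ᶠ p in 𝓝 p₀, ContDiffAt ℝ ∞ g₀ p) (hg₀γ : g₀ p₀ = γ₀ 0) :
    ∃ Γ : P → ℝ → X, (∀ᶠ p in 𝓝 p₀, ContDiffAt ℝ ∞ (fun p => Γ p 1) p) ∧
      (∀ r ∈ Icc (0 : ℝ) 1, Γ p₀ r = γ₀ r) ∧ (∀ p, Γ p 0 = g₀ p) ∧
      (∀ᶠ p in 𝓝 p₀, ∀ r ∈ Icc (0 : ℝ) 1, HasDerivAt (Γ p) (G (p, r, Γ p r)) r) ∧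
      ∀ r ∈ Icc (0 : ℝ) 1, ContinuousAt (Function.uncurry Γ) (p₀, r) := by
  let c : ℝ → P × ℝ × X := fun r => (p₀, r, γ₀ r)
  have hγc : ContinuousOn γ₀ (Icc 0 1) := fun r hr => (hγ r hr).continuousAt.continuousWithinAt
  have hc : ContinuousOn c (Icc 0 1) :=
    continuousOn_const.prodMk (continuousOn_id.prodMk hγc)
  have hK : IsCompact (c '' Icc 0 1) := isCompact_Icc.image_of_continuousOn hc
  obtain ⟨G', hG', hG's, hGG'⟩ := exists_cutoff hK G (by
    rintro _ ⟨r, hr, rfl⟩; exact hG r hr)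
  let V : P × ℝ × X → P × ℝ × X := fun q => (0, 1, G' q)
  have hV : ContDiff ℝ ∞ V := contDiff_const.prodMk (contDiff_const.prodMk hG')
  have hVs : HasCompactSupport (fderiv ℝ V) := by
    have h1 : fderiv ℝ V = fun q => (ContinuousLinearMap.inr ℝ P (ℝ × X)).comp
        ((ContinuousLinearMap.inr ℝ ℝ X).comp (fderiv ℝ G' q)) := by
      funext q
      have h2 : HasFDerivAt V ((0 : P × ℝ × X →L[ℝ] P).prod
          ((0 : P × ℝ × X →L[ℝ] ℝ).prod (fderiv ℝ G' q))) q :=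
        (hasFDerivAt_const _ _).prodMk ((hasFDerivAt_const _ _).prodMk
          (hG'.differentiable (by simp) q).hasFDerivAt)
      rw [h2.fderiv]
      ext <;> simp
    rw [h1]
    exact (hG's.fderiv ℝ).comp_left (g := fun A : P × ℝ × X →L[ℝ] X =>
      (ContinuousLinearMap.inr ℝ P (ℝ × X)).comp ((ContinuousLinearMap.inr ℝ ℝ X).comp A))
      (by simp)
  obtain ⟨Φ, hΦs, hΦc, hΦ0, hΦd⟩ := exists_smooth_flow V hV hVs
  obtain ⟨K, hKl⟩ : ∃ K, LipschitzWith K V := by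
    have hdV : Continuous (fderiv ℝ V) := hV.continuous_fderiv (by simp)
    obtain ⟨K, hK⟩ := hVs.exists_bound_of_continuous hdV
    refine ⟨K.toNNReal, lipschitzWith_of_nnnorm_fderiv_le (𝕜 := ℝ)
      (hV.differentiable (by simp)) fun x => ?_⟩
    rw [← NNReal.coe_le_coe]
    exact (hK x).trans (Real.le_coe_toNNReal K)
  have hfst : ∀ q, ∀ r ∈ Icc (0 : ℝ) 1, (Φ q r).1 = q.1 ∧ (Φ q r).2.1 = q.2.1 + r := by
    intro q
    have hcont : Continuous (Φ q) := hΦc.comp (by fun_prop : Continuous fun r : ℝ => (q, r))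
    have h1 : ∀ r ∈ Icc (0 : ℝ) 1, HasDerivAt (fun r => ((Φ q r).1, (Φ q r).2.1 - r)) (0, 0) r := by
      intro r hr
      have hd := hΦd q r hr
      have ha : HasDerivAt (fun r => (Φ q r).1) (0 : P) r :=
        (ContinuousLinearMap.fst ℝ P (ℝ × X)).hasFDerivAt.comp_hasDerivAt r hd
      have hb : HasDerivAt (fun r => (Φ q r).2.1) (1 : ℝ) r :=
        ((ContinuousLinearMap.fst ℝ ℝ X).comp
          (ContinuousLinearMap.snd ℝ P (ℝ × X))).hasFDerivAt.comp_hasDerivAt r hd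
      have hb' := hb.sub (hasDerivAt_id r)
      rw [sub_self] at hb'
      exact ha.prodMk hb'
    intro r hr
    have h2 := constant_of_has_deriv_right_zero (a := 0) (b := 1)
      (f := fun r => ((Φ q r).1, (Φ q r).2.1 - r))
      (fun r hr => (h1 r hr).continuousAt.continuousWithinAt)
      (fun r hr => (h1 r (Ico_subset_Icc_self hr)).hasDerivWithinAt) r hr
    simp only [hΦ0, sub_zero, Prod.mk.injEq] at h2
    exact ⟨h2.1, by linarith [h2.2]⟩
  have hbase : EqOn (Φ (p₀, 0, γ₀ 0)) c (Icc 0 1) := by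
    refine ODE_solution_unique (v := fun _ => V) (K := K) (fun _ => hKl)
      (fun r hr => (hΦd _ r hr).continuousAt.continuousWithinAt)
      (fun r hr => (hΦd _ r (Ico_subset_Icc_self hr)).hasDerivWithinAt) hc ?_ (hΦ0 _)
    intro r hr
    have hr' := Ico_subset_Icc_self hr
    have h1 : V (c r) = (0, 1, G (p₀, r, γ₀ r)) := by
      simp only [V, (hGG' _ ⟨r, hr', rfl⟩).eq_of_nhds, c]
    rw [h1]
    exact ((hasDerivAt_const r p₀).prodMk ((hasDerivAt_id r).prodMk (hγ r hr'))).hasDerivWithinAt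
  have hinit : ContinuousAt (fun p => ((p, 0, g₀ p) : P × ℝ × X)) p₀ :=
    continuousAt_id.prodMk (continuousAt_const.prodMk hg₀.self_of_nhds.continuousAt)
  have hcu : ∀ r, ContinuousAt (fun z : P × ℝ => Φ (z.1, 0, g₀ z.1) z.2) (p₀, r) := by
    intro r
    have h1 : ContinuousAt (fun z : P × ℝ => (((z.1, 0, g₀ z.1) : P × ℝ × X), z.2)) (p₀, r) :=
      (ContinuousAt.comp (f := Prod.fst) (x := (p₀, r)) hinit continuousAt_fst).prodMk
        continuousAt_snd
    exact hΦc.continuousAt.comp h1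
  refine ⟨fun p r => (Φ (p, 0, g₀ p) r).2.2, ?_, ?_, ?_, ?_, ?_⟩
  · filter_upwards [hg₀] with p hp
    have h1 : ContDiffAt ℝ ∞ (fun p => ((p, 0, g₀ p) : P × ℝ × X)) p :=
      contDiffAt_id.prodMk (contDiffAt_const.prodMk hp)
    have h2 := ((hΦs 1 ⟨zero_le_one, le_rfl⟩).contDiffAt (x := (p, 0, g₀ p))).comp p h1
    exact contDiffAt_snd.comp p (contDiffAt_snd.comp p h2)
  · intro r hr
    change (Φ (p₀, 0, g₀ p₀) r).2.2 = _
    rw [hg₀γ, hbase hr]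
  · intro p
    change (Φ (p, 0, g₀ p) 0).2.2 = _
    rw [hΦ0]
  · have hA : ∀ᶠ p in 𝓝 p₀, ∀ r ∈ Icc (0 : ℝ) 1,
        G' (Φ (p, 0, g₀ p) r) = G (Φ (p, 0, g₀ p) r) := by
      refine isCompact_Icc.eventually_forall_of_forall_eventually fun r hr => ?_
      have h1 := hcu r
      have h2 : Φ (p₀, 0, g₀ p₀) r = c r := by rw [hg₀γ, hbase hr]
      have h3 : ∀ᶠ q in 𝓝 (Φ (p₀, 0, g₀ p₀) r), G' q = G q := by
        rw [h2]; exact hGG' _ ⟨r, hr, rfl⟩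
      exact h1.eventually h3
    filter_upwards [hA] with p hp r hr
    have hd := (((ContinuousLinearMap.snd ℝ ℝ X).comp
          (ContinuousLinearMap.snd ℝ P (ℝ × X))).hasFDerivAt.comp_hasDerivAt r
            (hΦd (p, 0, g₀ p) r hr))
    have h1 : (p, r, (Φ (p, 0, g₀ p) r).2.2) = Φ (p, 0, g₀ p) r := by
      obtain ⟨ha, hb⟩ := hfst (p, 0, g₀ p) r hr
      refine Prod.ext ha.symm (Prod.ext ?_ rfl)
      rw [hb]; simp
    rw [h1, ← hp r hr]
    exact hd
  · intro r hr
    exact continuousAt_snd.comp (f := fun z : P × ℝ => (Φ (z.1, 0, g₀ z.1) z.2).2)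
      (continuousAt_snd.comp (hcu r))

end LocalFlow

section PathLifting

/-- A smooth family of paths which are integral curves of `∑ C k • Y k` lifts along `τ` to a
smooth family of integral curves of `∑ C k • b k`, if `b k` is a lift of `Y k`. -/
theorem exists_path_lift {P : Type*} [NormedAddCommGroup P] [NormedSpace ℝ P]
    [FiniteDimensional ℝ P] {X : Type*} [NormedAddCommGroup X] [NormedSpace ℝ X]
    [FiniteDimensional ℝ X] {E : Type*} [NormedAddCommGroup E] [NormedSpace ℝ E]
    {Z : Type*} [NormedAddCommGroup Z] [NormedSpace ℝ Z]
    {κ : Type*} [Fintype κ] {p₀ : P} {e₀ : E} {γ₀ : ℝ → X} {Y : κ → E → E} {C : κ → P × ℝ → ℝ}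
    {b : κ → P × X → X} {τ : P × X → E} {μ : P → ℝ} {β : P → ℝ → E} {g₀ : P → X} (ρ : X →L[ℝ] Z)
    (hY : ∀ k, ContDiffAt ℝ 1 (Y k) e₀)
    (hC : ∀ k, ∀ r ∈ Icc (0 : ℝ) 1, ∀ᶠ q in 𝓝 (p₀, r), ContDiffAt ℝ ∞ (C k) q)
    (hb : ∀ k, ∀ r ∈ Icc (0 : ℝ) 1, ∀ᶠ q in 𝓝 (p₀, γ₀ r), ContDiffAt ℝ ∞ (b k) q)
    (hτ : ∀ r ∈ Icc (0 : ℝ) 1, ∀ᶠ q in 𝓝 (p₀, γ₀ r),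
      DifferentiableAt ℝ (fun x => τ (q.1, x)) q.2 ∧
      ∀ k, fderiv ℝ (fun x => τ (q.1, x)) q.2 (b k q) = μ q.1 • Y k (τ q))
    (hτc : ∀ r ∈ Icc (0 : ℝ) 1, ContinuousAt τ (p₀, γ₀ r))
    (hτ₀ : ∀ r ∈ Icc (0 : ℝ) 1, τ (p₀, γ₀ r) = e₀)
    (hρ : ∀ k, ∀ r ∈ Icc (0 : ℝ) 1, ∀ᶠ q in 𝓝 (p₀, γ₀ r), ρ (b k q) = 0)
    (hβc : ∀ r ∈ Icc (0 : ℝ) 1, ContinuousAt (Function.uncurry β) (p₀, r))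
    (hβ₀ : ∀ r ∈ Icc (0 : ℝ) 1, β p₀ r = e₀)
    (hβ : ∀ᶠ p in 𝓝 p₀, ∀ r ∈ Icc (0 : ℝ) 1,
      HasDerivAt (β p) (μ p • ∑ k, C k (p, r) • Y k (β p r)) r)
    (hγ : ∀ r ∈ Icc (0 : ℝ) 1, HasDerivAt γ₀ (∑ k, C k (p₀, r) • b k (p₀, γ₀ r)) r)
    (hg₀ : ∀ᶠ p in 𝓝 p₀, ContDiffAt ℝ ∞ g₀ p) (hg₀γ : g₀ p₀ = γ₀ 0)
    (hg₀τ : ∀ᶠ p in 𝓝 p₀, τ (p, g₀ p) = β p 0) :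
    ∃ g : P → X, (∀ᶠ p in 𝓝 p₀, ContDiffAt ℝ ∞ g p) ∧ g p₀ = γ₀ 1 ∧
      ∀ᶠ p in 𝓝 p₀, τ (p, g p) = β p 1 ∧ ρ (g p) = ρ (g₀ p) := by
  let G : P × ℝ × X → X := fun q => ∑ k, C k (q.1, q.2.1) • b k (q.1, q.2.2)
  have hG : ∀ r ∈ Icc (0 : ℝ) 1, ∀ᶠ q in 𝓝 (p₀, r, γ₀ r), ContDiffAt ℝ ∞ G q := by
    intro r hr
    have c1 : Tendsto (fun q : P × ℝ × X => (q.1, q.2.1)) (𝓝 (p₀, r, γ₀ r)) (𝓝 (p₀, r)) :=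
      (by fun_prop : Continuous fun q : P × ℝ × X => (q.1, q.2.1)).continuousAt
    have c2 : Tendsto (fun q : P × ℝ × X => (q.1, q.2.2)) (𝓝 (p₀, r, γ₀ r)) (𝓝 (p₀, γ₀ r)) :=
      (by fun_prop : Continuous fun q : P × ℝ × X => (q.1, q.2.2)).continuousAt
    filter_upwards [c1.eventually (eventually_all.2 fun k => hC k r hr),
      c2.eventually (eventually_all.2 fun k => hb k r hr)] with q h1 h2
    refine ContDiffAt.sum fun k _ => ContDiffAt.smul ?_ ?_
    · exact (h1 k).comp q (f := fun q : P × ℝ × X => (q.1, q.2.1)) (by fun_prop)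
    · exact (h2 k).comp q (f := fun q : P × ℝ × X => (q.1, q.2.2)) (by fun_prop)
  obtain ⟨Γ, hΓs, hΓ₀, hΓ0, hΓd, hΓc⟩ := exists_local_flow G p₀ γ₀ hG hγ g₀ hg₀ hg₀γ
  have near : ∀ {A : P × X → Prop}, (∀ r ∈ Icc (0 : ℝ) 1, ∀ᶠ q in 𝓝 (p₀, γ₀ r), A q) →
      ∀ᶠ p in 𝓝 p₀, ∀ r ∈ Icc (0 : ℝ) 1, A (p, Γ p r) := by
    intro A hA
    refine isCompact_Icc.eventually_forall_of_forall_eventually fun r hr => ?_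
    have h1 : ContinuousAt (fun z : P × ℝ => (z.1, Γ z.1 z.2)) (p₀, r) :=
      continuousAt_fst.prodMk (hΓc r hr)
    have h2 : ∀ᶠ q in 𝓝 (p₀, Γ p₀ r), A q := by rw [hΓ₀ r hr]; exact hA r hr
    exact h1.eventually h2
  have hlip : ∃ K : NNReal, ∃ B ∈ 𝓝 e₀, ∀ k, LipschitzOnWith K (Y k) B := by
    choose K B hB hL using fun k => (hY k).exists_lipschitzOnWith
    refine ⟨∑ k, K k, ⋂ k, B k, iInter_mem.2 hB, fun k => ?_⟩
    exact ((hL k).mono (iInter_subset _ k)).weaken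
      (Finset.single_le_sum (f := K) (fun _ _ => zero_le) (Finset.mem_univ k))
  obtain ⟨K, B, hB, hL⟩ := hlip
  have hτB := near (A := fun q => τ q ∈ B) fun r hr => (hτc r hr).eventually (by
    rw [hτ₀ r hr]; exact hB)
  have hβB : ∀ᶠ p in 𝓝 p₀, ∀ r ∈ Icc (0 : ℝ) 1, β p r ∈ B := by
    refine isCompact_Icc.eventually_forall_of_forall_eventually fun r hr => ?_
    refine (hβc r hr).eventually ?_
    change ∀ᶠ y in 𝓝 (β p₀ r), y ∈ B
    rw [hβ₀ r hr]; exact hB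
  have hCc : ∀ᶠ p in 𝓝 p₀, ∀ r ∈ Icc (0 : ℝ) 1, ∀ k, ContDiffAt ℝ ∞ (C k) (p, r) :=
    isCompact_Icc.eventually_forall_of_forall_eventually fun r hr =>
      eventually_all.2 fun k => hC k r hr
  refine ⟨fun p => Γ p 1, hΓs, hΓ₀ 1 ⟨zero_le_one, le_rfl⟩, ?_⟩
  filter_upwards [hΓd, hτB, hβB, hCc, hβ, hg₀τ, near hτ,
    near (A := fun q => ∀ k, ρ (b k q) = 0) fun r hr => eventually_all.2 fun k => hρ k r hr]
    with p hd hτB hβB hCc hβ hg₀τ hτp hρp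
  constructor
  · have hbd : ∃ R : NNReal, ∀ r ∈ Icc (0 : ℝ) 1, ∀ k, ‖C k (p, r)‖₊ ≤ R := by
      have h1 : ∀ k, ∃ R : ℝ, ∀ r ∈ Icc (0 : ℝ) 1, ‖C k (p, r)‖ ≤ R := fun k =>
        isCompact_Icc.exists_bound_of_continuousOn fun r hr =>
          ((hCc r hr k).continuousAt.comp (f := fun r : ℝ => (p, r))
            (by fun_prop)).continuousWithinAt
      choose R hR using h1
      refine ⟨∑ k, (R k).toNNReal, fun r hr k => ?_⟩
      have h2 : ‖C k (p, r)‖₊ ≤ (R k).toNNReal := by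
        rw [← NNReal.coe_le_coe]
        exact (hR k r hr).trans (Real.le_coe_toNNReal _)
      exact h2.trans (Finset.single_le_sum (f := fun k => (R k).toNNReal)
        (fun _ _ => zero_le) (Finset.mem_univ k))
    obtain ⟨R, hR⟩ := hbd
    have huniq := ODE_solution_unique_of_mem_Icc_right (a := 0) (b := 1)
      (v := fun r e => μ p • ∑ k, C k (p, r) • Y k e) (s := fun _ => B)
      (K := ‖μ p‖₊ * ∑ _k : κ, R * K) (f := fun r => τ (p, Γ p r)) (g := β p) ?_ ?_ ?_ ?_ ?_ ?_ ?_ ?_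
    · exact huniq ⟨zero_le_one, le_rfl⟩
    · intro r hr
      have hr' := Ico_subset_Icc_self hr
      refine LipschitzOnWith.of_dist_le_mul fun x hx y hy => ?_
      rw [dist_eq_norm, dist_eq_norm, ← smul_sub, norm_smul, ← Finset.sum_sub_distrib]
      push_cast
      rw [mul_assoc]
      refine mul_le_mul_of_nonneg_left ?_ (norm_nonneg _)
      rw [Finset.sum_mul]
      refine (norm_sum_le _ _).trans (Finset.sum_le_sum fun k _ => ?_)
      rw [← smul_sub, norm_smul, mul_assoc]
      refine mul_le_mul (by exact_mod_cast hR r hr' k) ?_ (norm_nonneg _) R.2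
      have := (hL k).dist_le_mul x hx y hy
      rwa [dist_eq_norm, dist_eq_norm] at this
    · intro r hr
      exact (((hτp r hr).1.hasFDerivAt.comp_hasDerivAt r (hd r hr)).continuousAt
        ).continuousWithinAt
    · intro r hr
      have hr' := Ico_subset_Icc_self hr
      have h1 := (hτp r hr').1.hasFDerivAt.comp_hasDerivAt r (hd r hr')
      have h2 : fderiv ℝ (fun x => τ (p, x)) (Γ p r) (G (p, r, Γ p r)) =
          μ p • ∑ k, C k (p, r) • Y k (τ (p, Γ p r)) := by
        simp only [G, map_sum, map_smul, (hτp r hr').2, Finset.smul_sum]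
        refine Finset.sum_congr rfl fun k _ => smul_comm _ _ _
      rw [← h2]
      exact h1.hasDerivWithinAt
    · exact fun r hr => hτB r (Ico_subset_Icc_self hr)
    · exact fun r hr => (hβ r hr).continuousAt.continuousWithinAt
    · exact fun r hr => (hβ r (Ico_subset_Icc_self hr)).hasDerivWithinAt
    · exact fun r hr => hβB r (Ico_subset_Icc_self hr)
    · rw [hΓ0, hg₀τ]
  · have h1 : ∀ r ∈ Icc (0 : ℝ) 1, HasDerivAt (fun r => ρ (Γ p r)) 0 r := by
      intro r hr
      have := ρ.hasFDerivAt.comp_hasDerivAt r (hd r hr)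
      have h2 : ρ (G (p, r, Γ p r)) = 0 := by
        simp only [G, map_sum, map_smul, hρp r hr, smul_zero, Finset.sum_const_zero]
      rwa [h2] at this
    have h2 := constant_of_has_deriv_right_zero (a := 0) (b := 1) (f := fun r => ρ (Γ p r))
      (fun r hr => (h1 r hr).continuousAt.continuousWithinAt)
      (fun r hr => (h1 r (Ico_subset_Icc_self hr)).hasDerivWithinAt) 1 ⟨zero_le_one, le_rfl⟩
    rw [h2, hΓ0]

end PathLifting

section Bump

variable {E : Type*} [NormedAddCommGroup E] [NormedSpace ℝ E] [FiniteDimensional ℝ E]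
  {H : Type*} [TopologicalSpace H]
  {I : ModelWithCorners ℝ E H} {M : Type*} [TopologicalSpace M] [ChartedSpace H M]
  [IsManifold I ∞ M] [T2Space M]

variable (I) in
theorem exists_bump {x : M} {O : Set M} (hO : O ∈ 𝓝 x) :
    ∃ χ : C^∞⟮I, M; ℝ⟯, HasCompactSupport χ ∧ tsupport χ ⊆ O ∧ ∀ᶠ y in 𝓝 x, χ y = 1 := by
  obtain ⟨f, -, hf⟩ := (SmoothBumpFunction.nhds_basis_tsupport (I := I) x).mem_iff.1 hO
  exact ⟨⟨f, f.contMDiff⟩, f.hasCompactSupport, hf, f.eventuallyEq_one⟩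

theorem exists_smooth_extension {x : M} {f : M → ℝ} (hf : ∀ᶠ y in 𝓝 x, ContMDiffAt I 𝓘(ℝ) ∞ f y) :
    ∃ g : C^∞⟮I, M; ℝ⟯, HasCompactSupport g ∧ ∀ᶠ y in 𝓝 x, g y = f y := by
  obtain ⟨χ, h1, h2, h3⟩ := exists_bump I hf
  have hsm : ContMDiff I 𝓘(ℝ) ∞ fun y => χ y * f y := by
    intro y
    by_cases hy : y ∈ tsupport χ
    · exact (χ.contMDiff y).mul (h2 hy)
    · refine (contMDiffAt_const (c := (0 : ℝ))).congr_of_eventuallyEq ?_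
      filter_upwards [(isClosed_tsupport χ).isOpen_compl.mem_nhds hy] with z hz
      rw [image_eq_zero_of_notMem_tsupport hz, zero_mul]
  refine ⟨⟨_, hsm⟩, ?_, ?_⟩
  · exact h1.mul_right
  · filter_upwards [h3] with y hy
    change χ y * f y = f y
    rw [hy, one_mul]

variable [SecondCountableTopology M]

/-- A section which belongs locally to a module of sections belongs to this module. -/
theorem mem_of_locally {B : M → Type*} [∀ x, AddCommGroup (B x)] [∀ x, Module ℝ (B x)]
    (A : Submodule C^∞⟮I, M; ℝ⟯ (Sections B)) (X : Sections B) {K : Set M} (hK : IsCompact K)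
    (hX : ∀ x ∉ K, X x = 0)
    (h : ∀ x ∈ K, ∃ O, IsOpen O ∧ x ∈ O ∧ ∀ ρ : C^∞⟮I, M; ℝ⟯, tsupport ρ ⊆ O →
      HasCompactSupport ρ → (ρ • X : Sections B) ∈ A) : X ∈ A := by
  have : LocallyCompactSpace H := I.locallyCompactSpace
  have : LocallyCompactSpace M := ChartedSpace.locallyCompactSpace H M
  obtain ⟨L, hL, hKL⟩ := exists_compact_superset hK
  choose! O hO hxO hmem using h
  let O' : K → Set M := fun x => O x ∩ interior L
  obtain ⟨f, hf⟩ := SmoothPartitionOfUnity.exists_isSubordinate I hK.isClosed O'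
    (fun x => (hO x x.2).inter isOpen_interior)
    (fun x hx => mem_iUnion.2 ⟨⟨x, hx⟩, hxO x hx, hKL hx⟩)
  have hfin : {i | (Function.support (f i) ∩ K).Nonempty}.Finite :=
    f.locallyFinite.finite_nonempty_inter_compact hK
  have hsum : X = ∑ i ∈ hfin.toFinset, (f i • X : Sections B) := by
    funext x
    have happ : ∀ s : Finset K, (∑ i ∈ s, (f i • X : Sections B)) x = (∑ i ∈ s, f i x) • X x := by
      intro s
      induction s using Finset.cons_induction with
      | empty => rw [Finset.sum_empty, Finset.sum_empty, zero_smul]; rfl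
      | cons a s ha ih =>
        rw [Finset.sum_cons, Finset.sum_cons, add_smul, ← ih]
        rfl
    rw [happ]
    by_cases hx : x ∈ K
    · have h1 := f.sum_eq_one hx
      rw [finsum_eq_sum_of_support_subset (s := hfin.toFinset)] at h1
      · rw [h1, one_smul]
      · intro i hi
        simp only [Finite.coe_toFinset, mem_ofPred_eq]
        exact ⟨x, hi, hx⟩
    · rw [hX x hx, smul_zero]
  rw [hsum]
  refine Submodule.sum_mem _ fun i _ => hmem i i.2 (f i) ((hf i).trans inter_subset_left) ?_
  exact hL.of_isClosed_subset (isClosed_tsupport _)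
    ((hf i).trans (inter_subset_right.trans interior_subset))

end Bump

section ChartField

variable {W : Type*} [NormedAddCommGroup W] [NormedSpace ℝ W]
  {N : Type*} [TopologicalSpace N] [ChartedSpace W N]
  {E : Type*} [NormedAddCommGroup E] [NormedSpace ℝ E]
  {M : Type*} [TopologicalSpace M] [ChartedSpace E M]

/-- The differential of a chart, as a map of the model space. -/
noncomputable def chartD (φ : OpenPartialHomeomorph N W) (u : N) : W →L[ℝ] W :=
  mfderiv 𝓘(ℝ, W) 𝓘(ℝ, W) φ u

/-- The differential of the inverse of a chart, as a map of the model space. -/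
noncomputable def chartDsymm (φ : OpenPartialHomeomorph N W) (e : W) : W →L[ℝ] W :=
  mfderiv 𝓘(ℝ, W) 𝓘(ℝ, W) φ.symm e

variable {φ : OpenPartialHomeomorph N W} {ψ : OpenPartialHomeomorph M E}

theorem mdifferentiable_of_mem_maximalAtlas [IsManifold 𝓘(ℝ, W) ∞ N]
    (hφ : φ ∈ IsManifold.maximalAtlas 𝓘(ℝ, W) ∞ N) :
    φ.MDifferentiable 𝓘(ℝ, W) 𝓘(ℝ, W) := by
  have h : φ ∈ IsManifold.maximalAtlas 𝓘(ℝ, W) 1 N :=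
    IsManifold.maximalAtlas_subset_of_le (by simp) hφ
  exact ⟨fun x hx => (mdifferentiableAt_of_mem_maximalAtlas h hx).mdifferentiableWithinAt,
    fun x hx => (mdifferentiableAt_symm_of_mem_maximalAtlas h hx).mdifferentiableWithinAt⟩

variable [IsManifold 𝓘(ℝ, W) ∞ N] [IsManifold 𝓘(ℝ, E) ∞ M]
  (hφ : φ ∈ IsManifold.maximalAtlas 𝓘(ℝ, W) ∞ N) (hψ : ψ ∈ IsManifold.maximalAtlas 𝓘(ℝ, E) ∞ M)

include hφ

theorem chartD_chartDsymm {e : W} (he : e ∈ φ.target) (x : W) :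
    chartD φ (φ.symm e) (chartDsymm φ e x) = x :=
  DFunLike.congr_fun ((mdifferentiable_of_mem_maximalAtlas hφ).comp_symm_deriv he) x

theorem chartDsymm_chartD {u : N} (hu : u ∈ φ.source) (x : W) :
    chartDsymm φ (φ u) (chartD φ u x) = x :=
  DFunLike.congr_fun ((mdifferentiable_of_mem_maximalAtlas hφ).symm_comp_deriv hu) x

theorem chartD_injective {u : N} (hu : u ∈ φ.source) : Function.Injective (chartD φ u) :=
  Function.LeftInverse.injective (chartDsymm_chartD hφ hu)

theorem chartD_surjective {u : N} (hu : u ∈ φ.source) : Function.Surjective (chartD φ u) := by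
  intro x
  refine ⟨chartDsymm φ (φ u) x, ?_⟩
  have := chartD_chartDsymm hφ (φ.map_source hu) x
  rwa [φ.left_inv hu] at this

include hψ in
/-- The differential of a map, in charts. -/
theorem chartD_mfderiv {f : N → M} {u : N} (hf : MDifferentiableAt 𝓘(ℝ, W) 𝓘(ℝ, E) f u)
    (hu : u ∈ φ.source) (hfu : f u ∈ ψ.source) (x : W) :
    chartD ψ (f u) ((mfderiv 𝓘(ℝ, W) 𝓘(ℝ, E) f u : W →L[ℝ] E) x) =
      fderiv ℝ (fun e => ψ (f (φ.symm e))) (φ u) (chartD φ u x) := by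
  have h1 : HasMFDerivAt 𝓘(ℝ, W) 𝓘(ℝ, W) φ.symm (φ u)
      (chartDsymm φ (φ u) : W →L[ℝ] W) :=
    ((mdifferentiable_of_mem_maximalAtlas hφ).mdifferentiableAt_symm
      (φ.map_source hu)).hasMFDerivAt
  have h2 : HasMFDerivAt 𝓘(ℝ, W) 𝓘(ℝ, E) f (φ.symm (φ u)) (mfderiv 𝓘(ℝ, W) 𝓘(ℝ, E) f u) := by
    have : ∀ w, w = u → HasMFDerivAt 𝓘(ℝ, W) 𝓘(ℝ, E) f w
        ((mfderiv 𝓘(ℝ, W) 𝓘(ℝ, E) f u : W →L[ℝ] E) : W →L[ℝ] E) := by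
      rintro w rfl; exact hf.hasMFDerivAt
    exact this _ (φ.left_inv hu)
  have h3 : HasMFDerivAt 𝓘(ℝ, E) 𝓘(ℝ, E) ψ (f (φ.symm (φ u)))
      (chartD ψ (f u) : E →L[ℝ] E) := by
    have : ∀ w, w = u → HasMFDerivAt 𝓘(ℝ, E) 𝓘(ℝ, E) ψ (f w)
        (chartD ψ (f u) : E →L[ℝ] E) := by
      rintro w rfl
      exact ((mdifferentiable_of_mem_maximalAtlas hψ).mdifferentiableAt hfu).hasMFDerivAt
    exact this _ (φ.left_inv hu)
  have h4 : HasMFDerivAt 𝓘(ℝ, W) 𝓘(ℝ, E) (fun e => ψ (f (φ.symm e))) (φ u)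
      ((chartD ψ (f u)).comp ((mfderiv 𝓘(ℝ, W) 𝓘(ℝ, E) f u : W →L[ℝ] E).comp
        (chartDsymm φ (φ u))) : W →L[ℝ] E) := h3.comp (φ u) (h2.comp (φ u) h1)
  have h5 : HasFDerivAt (fun e => ψ (f (φ.symm e)))
      ((chartD ψ (f u)).comp ((mfderiv 𝓘(ℝ, W) 𝓘(ℝ, E) f u : W →L[ℝ] E).comp
        (chartDsymm φ (φ u)))) (φ u) := h4.hasFDerivAt
  rw [h5.fderiv]
  exact (congrArg (fun y => chartD ψ (f u) ((mfderiv 𝓘(ℝ, W) 𝓘(ℝ, E) f u : W →L[ℝ] E) y))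
    (chartDsymm_chartD hφ hu x)).symm

omit hφ in
/-- A vector field, in a chart. -/
noncomputable def fieldIn (φ : OpenPartialHomeomorph N W) (X : VF 𝓘(ℝ, W) N) (e : W) : W :=
  chartD φ (φ.symm e) (X (φ.symm e))

omit [IsManifold 𝓘(ℝ, W) ∞ N] hφ in
theorem fieldIn_apply (X : VF 𝓘(ℝ, W) N) {u : N} (hu : u ∈ φ.source) :
    fieldIn φ X (φ u) = chartD φ u (X u) := by
  have : ∀ w, w = u → chartD φ w (X w) = chartD φ u (X u) := by rintro w rfl; rfl
  exact this _ (φ.left_inv hu)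

theorem chartD_isInvertible {u : N} (hu : u ∈ φ.source) :
    (mfderiv 𝓘(ℝ, W) 𝓘(ℝ, W) φ u).IsInvertible :=
  ⟨(mdifferentiable_of_mem_maximalAtlas hφ).mfderiv hu, rfl⟩

theorem chartDsymm_isInvertible {e : W} (he : e ∈ φ.target) :
    (mfderiv 𝓘(ℝ, W) 𝓘(ℝ, W) φ.symm e).IsInvertible :=
  ⟨(mdifferentiable_of_mem_maximalAtlas hφ).symm.mfderiv he, rfl⟩

theorem inverse_chartD {u : N} (hu : u ∈ φ.source) (x : W) :
    (chartD φ u).inverse x = chartDsymm φ (φ u) x := by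
  obtain ⟨y, rfl⟩ := chartD_surjective hφ hu x
  rw [chartDsymm_chartD hφ hu]
  have := ContinuousLinearMap.IsInvertible.inverse_apply_eq (f := chartD φ u) (y := chartD φ u y)
    (x := y) (chartD_isInvertible hφ hu)
  exact this.2 rfl

theorem inverse_chartDsymm {e : W} (he : e ∈ φ.target) (x : W) :
    (chartDsymm φ e).inverse x = chartD φ (φ.symm e) x := by
  have := ContinuousLinearMap.IsInvertible.inverse_apply_eq (f := chartDsymm φ e) (y := x)
    (x := chartD φ (φ.symm e) x) (chartDsymm_isInvertible hφ he)
  refine this.2 ?_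
  have h2 := chartDsymm_chartD hφ (φ.map_target he) x
  rwa [φ.right_inv he, eq_comm] at h2

theorem contDiffAt_fieldIn [CompleteSpace W] {X : VF 𝓘(ℝ, W) N} (hX : IsSmooth X) {e : W}
    (he : e ∈ φ.target) :
    ContDiffAt ℝ ∞ (fieldIn φ X) e := by
  have h1 : ContMDiffAt 𝓘(ℝ, W) 𝓘(ℝ, W).tangent ∞
      (fun e => (⟨e, VectorField.mpullback 𝓘(ℝ, W) 𝓘(ℝ, W) φ.symm X e⟩ :
        TangentBundle 𝓘(ℝ, W) W)) e :=
    ContMDiffAt.mpullback_vectorField_preimage (n := ∞) (hX (φ.symm e))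
      (contMDiffAt_symm_of_mem_maximalAtlas hφ he) (chartDsymm_isInvertible hφ he) (by simp)
  have h2 := contMDiffAt_vectorSpace_iff_contDiffAt.1 h1
  refine h2.congr_of_eventuallyEq ?_
  filter_upwards [φ.open_target.mem_nhds he] with z hz
  exact (inverse_chartDsymm hφ hz _).symm

theorem exists_compactField [FiniteDimensional ℝ W] [T2Space N] {a : W → W} {u₀ : N}
    (hu₀ : u₀ ∈ φ.source) (ha : ∀ᶠ e in 𝓝 (φ u₀), ContDiffAt ℝ ∞ a e) :
    ∃ X ∈ compactFields 𝓘(ℝ, W) N, ∀ᶠ u in 𝓝 u₀, chartD φ u (X u) = a (φ u) := by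
  let Y : VF 𝓘(ℝ, W) N := VectorField.mpullback 𝓘(ℝ, W) 𝓘(ℝ, W) φ (V := fun e => a e)
  have hO : {u | u ∈ φ.source ∧ ContDiffAt ℝ ∞ a (φ u)} ∈ 𝓝 u₀ :=
    inter_mem (φ.open_source.mem_nhds hu₀) ((φ.continuousAt hu₀).eventually ha)
  obtain ⟨χ, h1, h2, h3⟩ := exists_bump 𝓘(ℝ, W) hO
  have hY : ∀ u, u ∈ φ.source → ContDiffAt ℝ ∞ a (φ u) →
      ContMDiffAt 𝓘(ℝ, W) 𝓘(ℝ, W).tangent ∞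
        (fun u => (⟨u, Y u⟩ : TangentBundle 𝓘(ℝ, W) N)) u := by
    intro u hu hau
    exact ContMDiffAt.mpullback_vectorField_preimage (n := ∞)
      (contMDiffAt_vectorSpace_iff_contDiffAt.2 hau)
      (contMDiffAt_of_mem_maximalAtlas hφ hu) (chartD_isInvertible hφ hu) (by simp)
  have hz : ∀ u ∉ tsupport χ, χ u • Y u = 0 := fun u hu => by
    rw [image_eq_zero_of_notMem_tsupport hu, zero_smul]
  refine ⟨fun u => χ u • Y u, ⟨?_, ?_⟩, ?_⟩
  · intro u
    by_cases hu : u ∈ tsupport χ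
    · exact ContMDiffAt.smul_section (χ.contMDiff u) (hY u (h2 hu).1 (h2 hu).2)
    · refine (Bundle.contMDiff_zeroSection ℝ (TangentSpace 𝓘(ℝ, W) : N → Type _)
        u).congr_of_eventuallyEq ?_
      filter_upwards [(isClosed_tsupport χ).isOpen_compl.mem_nhds hu] with z hz'
      rw [hz z hz']
      rfl
  · refine h1.of_isClosed_subset isClosed_closure (closure_minimal ?_ (isClosed_tsupport χ))
    intro u hu
    by_contra hne
    exact hu (hz u hne)
  · filter_upwards [hO, h3] with u hu hχ
    rw [hχ, one_smul]
    change chartD φ u ((chartD φ u).inverse (a (φ u))) = _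
    rw [inverse_chartD hφ hu.1]
    have := chartD_chartDsymm hφ (φ.map_source hu.1) (a (φ u))
    rwa [φ.left_inv hu.1] at this

end ChartField

theorem Sections.sum_apply {N : Type*} {B : N → Type*} [∀ x, AddCommGroup (B x)] {κ : Type*}
    (s : Finset κ) (X : κ → Sections B) (x : N) : (∑ k ∈ s, X k : Sections B) x = ∑ k ∈ s, X k x := by
  induction s using Finset.cons_induction with
  | empty => rw [Finset.sum_empty, Finset.sum_empty]; rfl
  | cons a s ha ih =>
    rw [Finset.sum_cons, Finset.sum_cons, ← ih]
    rfl

section LocalInverse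

/-- The inverse function theorem, with smoothness on the whole domain. -/
theorem exists_local_inverse {W W' : Type*} [NormedAddCommGroup W] [NormedSpace ℝ W]
    [CompleteSpace W] [NormedAddCommGroup W'] [NormedSpace ℝ W'] {h : W → W'} {a : W}
    (hh : ∀ᶠ x in 𝓝 a, ContDiffAt ℝ ∞ h x) (A : W ≃L[ℝ] W')
    (hA : HasFDerivAt h (A : W →L[ℝ] W') a) {O : Set W} (hO : O ∈ 𝓝 a) :
    ∃ g : OpenPartialHomeomorph W W', a ∈ g.source ∧ g.source ⊆ O ∧ (∀ x, g x = h x) ∧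
      (∀ x ∈ g.source, ContDiffAt ℝ ∞ g x) ∧ ∀ y ∈ g.target, ContDiffAt ℝ ∞ g.symm y := by
  have ha := hh.self_of_nhds
  let g₀ := ha.toOpenPartialHomeomorph h hA (by simp)
  have hcont : ContinuousAt (fderiv ℝ h) a := by
    have := ha.fderiv_right (m := 0) (by simp)
    exact this.continuousAt
  have hinv : ∀ᶠ x in 𝓝 a, ∃ B : W ≃L[ℝ] W', (B : W →L[ℝ] W') = fderiv ℝ h x :=
    hcont.eventually (by rw [hA.fderiv]; exact A.nhds)
  have hall : {x | ContDiffAt ℝ ∞ h x ∧ (∃ B : W ≃L[ℝ] W', (B : W →L[ℝ] W') = fderiv ℝ h x) ∧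
      x ∈ O} ∈ 𝓝 a := hh.and (hinv.and hO)
  let g := g₀.restrOpen _ (isOpen_interior (s := {x | ContDiffAt ℝ ∞ h x ∧
    (∃ B : W ≃L[ℝ] W', (B : W →L[ℝ] W') = fderiv ℝ h x) ∧ x ∈ O}))
  have hsub : ∀ x ∈ g.source, ContDiffAt ℝ ∞ h x ∧
      (∃ B : W ≃L[ℝ] W', (B : W →L[ℝ] W') = fderiv ℝ h x) ∧ x ∈ O := fun x hx => by
    have hx' : x ∈ interior {x | ContDiffAt ℝ ∞ h x ∧
      (∃ B : W ≃L[ℝ] W', (B : W →L[ℝ] W') = fderiv ℝ h x) ∧ x ∈ O} := hx.2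
    have hx2 := interior_subset hx'
    exact hx2
  refine ⟨g, ⟨ha.mem_toOpenPartialHomeomorph_source hA (by simp), mem_interior_iff_mem_nhds.2 hall⟩,
    fun x hx => (hsub x hx).2.2, fun _ => rfl, fun x hx => (hsub x hx).1, fun y hy => ?_⟩
  obtain ⟨h1, ⟨B, hB⟩, -⟩ := hsub _ (g.map_target hy)
  exact g.contDiffAt_symm hy (f₀' := B) (by
    rw [hB]; exact (h1.differentiableAt (by simp)).hasFDerivAt) h1

end LocalInverse

section Adapted

set_option linter.unusedSectionVars false

variable {E : Type*} [NormedAddCommGroup E] [NormedSpace ℝ E]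
  {M : Type*} [TopologicalSpace M] [ChartedSpace E M] [IsManifold 𝓘(ℝ, E) ∞ M]

/-- A chart of `U` in which `s` is a linear projection. -/
structure AdaptedChart (S : Span.{u} 𝓘(ℝ, E) M) (ψs ψt : OpenPartialHomeomorph M E) where
  φ : OpenPartialHomeomorph S.U S.Model
  mem : φ ∈ IsManifold.maximalAtlas 𝓘(ℝ, S.Model) ∞ S.U
  ρ : S.Model →L[ℝ] E
  sec : E →L[ℝ] S.Model
  ρ_sec : ∀ e, ρ (sec e) = e
  s_mem : ∀ u ∈ φ.source, S.s u ∈ ψs.source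
  s_eq : ∀ u ∈ φ.source, ψs (S.s u) = ρ (φ u)
  t_mem : ∀ u ∈ φ.source, S.t u ∈ ψt.source
  memₛ : ψs ∈ IsManifold.maximalAtlas 𝓘(ℝ, E) ∞ M
  memₜ : ψt ∈ IsManifold.maximalAtlas 𝓘(ℝ, E) ∞ M

theorem contDiffAt_chart {S : Span.{u} 𝓘(ℝ, E) M} {f : S.U → M}
    (hf : ContMDiff 𝓘(ℝ, S.Model) 𝓘(ℝ, E) ∞ f) {ψ : OpenPartialHomeomorph M E}
    (hψ : ψ ∈ IsManifold.maximalAtlas 𝓘(ℝ, E) ∞ M) {φ : OpenPartialHomeomorph S.U S.Model}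
    (hφ : φ ∈ IsManifold.maximalAtlas 𝓘(ℝ, S.Model) ∞ S.U) {e : S.Model} (he : e ∈ φ.target)
    (hfe : f (φ.symm e) ∈ ψ.source) : ContDiffAt ℝ ∞ (fun e => ψ (f (φ.symm e))) e := by
  rw [← contMDiffAt_iff_contDiffAt]
  exact (contMDiffAt_of_mem_maximalAtlas hψ hfe).comp e
    ((hf _).comp e (contMDiffAt_symm_of_mem_maximalAtlas hφ he))

theorem exists_adaptedChart (S : Span.{u} 𝓘(ℝ, E) M) {ψs ψt : OpenPartialHomeomorph M E}
    (hψs : ψs ∈ IsManifold.maximalAtlas 𝓘(ℝ, E) ∞ M)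
    (hψt : ψt ∈ IsManifold.maximalAtlas 𝓘(ℝ, E) ∞ M)
    {φ₀ : OpenPartialHomeomorph S.U S.Model}
    (hφ₀ : φ₀ ∈ IsManifold.maximalAtlas 𝓘(ℝ, S.Model) ∞ S.U) {u₀ : S.U} (hu₀ : u₀ ∈ φ₀.source)
    (hs : S.s u₀ ∈ ψs.source) (ht : S.t u₀ ∈ ψt.source) (L : S.Model →L[ℝ] E)
    (hL : L = fderiv ℝ (fun e => ψs (S.s (φ₀.symm e))) (φ₀ u₀)) (A : E →L[ℝ] S.Model)
    (ϖ : S.Model →L[ℝ] S.Model) (hLA : ∀ e, L (A e) = e) (hϖA : ∀ e, ϖ (A e) = A e)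
    (hALϖ : ∀ x, A (L (ϖ x)) = ϖ x) :
    ∃ c : AdaptedChart S ψs ψt, u₀ ∈ c.φ.source ∧ c.φ.source ⊆ φ₀.source ∧ c.sec = A ∧
      ∀ u ∈ c.φ.source, c.φ u = A (ψs (S.s u)) + (φ₀ u - ϖ (φ₀ u)) := by
  let f : S.Model → E := fun e => ψs (S.s (φ₀.symm e))
  let h : S.Model → S.Model := fun e => A (f e) + (e - ϖ e)
  have hD : {e | e ∈ φ₀.target ∧ S.s (φ₀.symm e) ∈ ψs.source ∧ S.t (φ₀.symm e) ∈ ψt.source} ∈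
      𝓝 (φ₀ u₀) := by
    have hc := φ₀.continuousAt_symm (φ₀.map_source hu₀)
    refine inter_mem (φ₀.open_target.mem_nhds (φ₀.map_source hu₀)) (Filter.Eventually.and ?_ ?_)
    · refine (S.smooth_s.continuous.continuousAt.comp hc).eventually_mem (ψs.open_source.mem_nhds ?_)
      rw [Function.comp_apply, φ₀.left_inv hu₀]; exact hs
    · refine (S.smooth_t.continuous.continuousAt.comp hc).eventually_mem (ψt.open_source.mem_nhds ?_)
      rw [Function.comp_apply, φ₀.left_inv hu₀]; exact ht
  have hf : ∀ e, e ∈ φ₀.target → S.s (φ₀.symm e) ∈ ψs.source → ContDiffAt ℝ ∞ f e :=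
    fun e he hse => contDiffAt_chart S.smooth_s hψs hφ₀ he hse
  have hh : ∀ᶠ e in 𝓝 (φ₀ u₀), ContDiffAt ℝ ∞ h e := by
    filter_upwards [hD] with e he
    exact (A.contDiff.contDiffAt.comp e (hf e he.1 he.2.1)).add
      (contDiffAt_id.sub ϖ.contDiff.contDiffAt)
  have hϖϖ : ∀ x, ϖ (ϖ x) = ϖ x := fun x => by
    rw [← hALϖ x, hϖA]
  let B : S.Model ≃L[ℝ] S.Model := ContinuousLinearEquiv.equivOfInverse
    (A.comp L + (ContinuousLinearMap.id ℝ S.Model - ϖ))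
    (ContinuousLinearMap.id ℝ S.Model + (ϖ - A.comp L))
    (fun x => by simp [hϖA, hALϖ, hLA, hϖϖ]; abel)
    (fun x => by simp [hϖA, hALϖ, hLA, hϖϖ])
  have hB : HasFDerivAt h (B : S.Model →L[ℝ] S.Model) (φ₀ u₀) := by
    have h1 : HasFDerivAt f L (φ₀ u₀) := by
      rw [hL]
      exact ((hf _ (mem_of_mem_nhds hD).1 (mem_of_mem_nhds hD).2.1).differentiableAt
        (by simp)).hasFDerivAt
    exact (A.hasFDerivAt.comp _ h1).add ((hasFDerivAt_id _).sub ϖ.hasFDerivAt)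
  obtain ⟨g, hg1, hg2, hg3, hg4, hg5⟩ := exists_local_inverse hh B hB hD
  have hsrc : ∀ u ∈ (φ₀.trans g).source, u ∈ φ₀.source ∧ φ₀ u ∈ g.source := fun u hu => by
    simpa using hu
  have key : ∀ u ∈ (φ₀.trans g).source,
      (φ₀.trans g) u = A (ψs (S.s u)) + (φ₀ u - ϖ (φ₀ u)) := by
    intro u hu
    change g (φ₀ u) = _
    rw [hg3]
    simp only [h, f, φ₀.left_inv (hsrc u hu).1]
  refine ⟨⟨φ₀.trans g, ?_, L.comp ϖ, A, ?_, ?_, ?_, ?_, hψs, hψt⟩, ?_, ?_, rfl, key⟩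
  · refine (φ₀.trans g).mem_maximalAtlas_of_contMDiffOn ?_ ?_
    · intro u hu
      have hu' := hsrc u hu
      exact (((hg4 _ hu'.2).contMDiffAt).comp u
        (contMDiffAt_of_mem_maximalAtlas hφ₀ hu'.1)).contMDiffWithinAt
    · intro e he
      have he' : e ∈ g.target ∧ g.symm e ∈ φ₀.target := by simpa using he
      exact ((contMDiffAt_symm_of_mem_maximalAtlas hφ₀ he'.2).comp e
        (hg5 e he'.1).contMDiffAt).contMDiffWithinAt
  · intro e
    simp [hϖA, hLA]
  · intro u hu
    have := (hg2 (hsrc u hu).2).2.1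
    rwa [φ₀.left_inv (hsrc u hu).1] at this
  · intro u hu
    rw [key u hu]
    simp [hϖA, hLA, hϖϖ]
  · intro u hu
    have := (hg2 (hsrc u hu).2).2.2
    rwa [φ₀.left_inv (hsrc u hu).1] at this
  · simp [hu₀, hg1]
  · exact fun u hu => (hsrc u hu).1

theorem Span.contMDiff_mdiff {S : Span.{u} 𝓘(ℝ, E) M} {f : S.U → M}
    (hf : ContMDiff 𝓘(ℝ, S.Model) 𝓘(ℝ, E) ∞ f) (u : S.U) :
    MDifferentiableAt 𝓘(ℝ, S.Model) 𝓘(ℝ, E) f u := (hf u).mdifferentiableAt (by simp)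

variable [FiniteDimensional ℝ E]

theorem exists_adaptedChart_of_surjective (S : Span.{u} 𝓘(ℝ, E) M)
    {ψs ψt : OpenPartialHomeomorph M E}
    (hψs : ψs ∈ IsManifold.maximalAtlas 𝓘(ℝ, E) ∞ M)
    (hψt : ψt ∈ IsManifold.maximalAtlas 𝓘(ℝ, E) ∞ M) (u₀ : S.U)
    (hs : S.s u₀ ∈ ψs.source) (ht : S.t u₀ ∈ ψt.source)
    (hsurj : Function.Surjective (S.ds u₀)) :
    ∃ c : AdaptedChart S ψs ψt, u₀ ∈ c.φ.source := by
  let φ₀ := chartAt S.Model u₀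
  have hφ₀ : φ₀ ∈ IsManifold.maximalAtlas 𝓘(ℝ, S.Model) ∞ S.U :=
    IsManifold.chart_mem_maximalAtlas u₀
  have hu₀ : u₀ ∈ φ₀.source := mem_chart_source _ u₀
  let L := fderiv ℝ (fun e => ψs (S.s (φ₀.symm e))) (φ₀ u₀)
  have hLs : Function.Surjective L := by
    intro y
    obtain ⟨z, rfl⟩ := chartD_surjective hψs hs y
    obtain ⟨x, rfl⟩ := hsurj z
    exact ⟨chartD φ₀ u₀ x,
      (chartD_mfderiv hφ₀ hψs (Span.contMDiff_mdiff S.smooth_s u₀) hu₀ hs x).symm⟩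
  obtain ⟨A, hA⟩ := L.toLinearMap.exists_rightInverse_of_surjective (LinearMap.range_eq_top.2 hLs)
  have hA' : ∀ e, L (A e) = e := fun e => DFunLike.congr_fun hA e
  let A' : E →L[ℝ] S.Model := LinearMap.toContinuousLinearMap A
  obtain ⟨c, hc, -⟩ := exists_adaptedChart S hψs hψt hφ₀ hu₀ hs ht L rfl A' (A'.comp L) hA'
    (fun e => by change A (L (A e)) = A e; rw [hA'])
    (fun x => by change A (L (A (L x))) = A (L x); rw [hA'])
  exact ⟨c, hc⟩

namespace AdaptedChart

variable {S : Span.{u} 𝓘(ℝ, E) M} {ψs ψt : OpenPartialHomeomorph M E} (c : AdaptedChart S ψs ψt)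

/-- The map `t`, in charts. -/
noncomputable def τ (e : S.Model) : E := ψt (S.t (c.φ.symm e))

theorem t_symm_mem {e : S.Model} (he : e ∈ c.φ.target) : S.t (c.φ.symm e) ∈ ψt.source :=
  c.t_mem _ (c.φ.map_target he)

theorem contDiffAt_τ {e : S.Model} (he : e ∈ c.φ.target) : ContDiffAt ℝ ∞ c.τ e :=
  contDiffAt_chart S.smooth_t c.memₜ c.mem he (c.t_symm_mem he)

theorem τ_apply {u : S.U} (hu : u ∈ c.φ.source) : c.τ (c.φ u) = ψt (S.t u) := by
  rw [τ, c.φ.left_inv hu]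

theorem symm_τ {e : S.Model} (he : e ∈ c.φ.target) : ψt.symm (c.τ e) = S.t (c.φ.symm e) :=
  ψt.left_inv (c.t_symm_mem he)

theorem chartD_dt {u : S.U} (hu : u ∈ c.φ.source) (x : S.Model) :
    chartD ψt (S.t u) (S.dt u x) = fderiv ℝ c.τ (c.φ u) (chartD c.φ u x) :=
  chartD_mfderiv c.mem c.memₜ (Span.contMDiff_mdiff S.smooth_t u) hu (c.t_mem u hu) x

theorem chartD_ds {u : S.U} (hu : u ∈ c.φ.source) (x : S.Model) :
    chartD ψs (S.s u) (S.ds u x) = c.ρ (chartD c.φ u x) := by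
  refine (chartD_mfderiv c.mem c.memₛ (Span.contMDiff_mdiff S.smooth_s u) hu
    (c.s_mem u hu) x).trans ?_
  have h : (fun e => ψs (S.s (c.φ.symm e))) =ᶠ[𝓝 (c.φ u)] c.ρ := by
    filter_upwards [c.φ.open_target.mem_nhds (c.φ.map_source hu)] with e he
    rw [c.s_eq _ (c.φ.map_target he), c.φ.right_inv he]
  rw [h.fderiv_eq, c.ρ.fderiv]

theorem ds_eq_zero_iff {u : S.U} (hu : u ∈ c.φ.source) (x : S.Model) :
    S.ds u x = 0 ↔ c.ρ (chartD c.φ u x) = 0 := by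
  rw [← c.chartD_ds hu]
  exact ⟨fun h => by rw [h, map_zero],
    fun h => chartD_injective c.memₛ (c.s_mem u hu) (by rw [h, map_zero])⟩

variable [T2Space M] [SecondCountableTopology M]
  {F : Submodule C^∞⟮𝓘(ℝ, E), M; ℝ⟯ (VF 𝓘(ℝ, E) M)}

/-- Near a point where `dt` is surjective, a smooth vector field lifts along `t`. -/
theorem exists_lift_field {u₀ : S.U} (hu₀ : u₀ ∈ c.φ.source)
    (hsurj : Function.Surjective (S.dt u₀)) {a : E → E}
    (ha : ∀ᶠ e in 𝓝 (c.τ (c.φ u₀)), ContDiffAt ℝ ∞ a e) :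
    ∃ b : S.Model → S.Model, ∀ᶠ e in 𝓝 (c.φ u₀), ContDiffAt ℝ ∞ b e ∧
      fderiv ℝ c.τ e (b e) = a (c.τ e) := by
  set e₀ := c.φ u₀ with he₀
  have he₀t : e₀ ∈ c.φ.target := c.φ.map_source hu₀
  have hLs : Function.Surjective (fderiv ℝ c.τ e₀) := by
    intro y
    obtain ⟨z, rfl⟩ := chartD_surjective c.memₜ (c.t_mem u₀ hu₀) y
    obtain ⟨x, rfl⟩ := hsurj z
    exact ⟨chartD c.φ u₀ x, (c.chartD_dt hu₀ x).symm⟩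
  obtain ⟨R₀, hR₀⟩ := (fderiv ℝ c.τ e₀).toLinearMap.exists_rightInverse_of_surjective
    (LinearMap.range_eq_top.2 hLs)
  let R : E →L[ℝ] S.Model := LinearMap.toContinuousLinearMap R₀
  have hR : (fderiv ℝ c.τ e₀).comp R = ContinuousLinearMap.id ℝ E := by
    ext e; exact DFunLike.congr_fun hR₀ e
  have hcont : ContDiffAt ℝ ∞ (fun e => (fderiv ℝ c.τ e).comp R) e₀ :=
    ((c.contDiffAt_τ he₀t).fderiv_right (m := ∞) (by simp)).clm_comp contDiffAt_const
  have hinv : ∀ᶠ e in 𝓝 e₀, ∃ B : E ≃L[ℝ] E, (B : E →L[ℝ] E) = (fderiv ℝ c.τ e).comp R :=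
    hcont.continuousAt.eventually
      (p := fun T : E →L[ℝ] E => ∃ B : E ≃L[ℝ] E, (B : E →L[ℝ] E) = T) (by
        change ∀ᶠ T in 𝓝 ((fderiv ℝ c.τ e₀).comp R), _
        rw [hR]; exact (ContinuousLinearEquiv.refl ℝ E).nhds)
  refine ⟨fun e => R (((fderiv ℝ c.τ e).comp R).inverse (a (c.τ e))), ?_⟩
  filter_upwards [hinv, c.φ.open_target.mem_nhds he₀t,
    (c.contDiffAt_τ he₀t).continuousAt.eventually ha] with e ⟨B, hB⟩ het hae
  constructor
  · have h1 : ContDiffAt ℝ ∞ (fun e => (fderiv ℝ c.τ e).comp R) e :=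
      ((c.contDiffAt_τ het).fderiv_right (m := ∞) (by simp)).clm_comp contDiffAt_const
    have h2 : ContDiffAt ℝ ∞ ContinuousLinearMap.inverse ((fderiv ℝ c.τ e).comp R) := by
      rw [← hB]; exact contDiffAt_map_inverse B
    have h3 : ContDiffAt ℝ ∞ (fun e => a (c.τ e)) e := hae.comp e (c.contDiffAt_τ het)
    have h4 : ContDiffAt ℝ ∞ (fun e => ((fderiv ℝ c.τ e).comp R).inverse) e :=
      ContDiffAt.comp e (g := ContinuousLinearMap.inverse) h2 h1
    exact R.contDiff.contDiffAt.comp e (h4.clm_apply h3)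
  · have : ((fderiv ℝ c.τ e).comp R) (((fderiv ℝ c.τ e).comp R).inverse (a (c.τ e))) =
        a (c.τ e) := by
      rw [← hB, ContinuousLinearMap.inverse_equiv]
      exact B.apply_symm_apply _
    exact this

theorem eventually_source {u₀ : S.U} (hu₀ : u₀ ∈ c.φ.source) {p : S.Model → Prop}
    (h : ∀ᶠ e in 𝓝 (c.φ u₀), p e) : ∀ᶠ u in 𝓝 u₀, p (c.φ u) :=
  (c.φ.continuousAt hu₀).eventually h

theorem eventually_target {u₀ : S.U} (hu₀ : u₀ ∈ c.φ.source) {p : S.U → Prop}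
    (h : ∀ᶠ u in 𝓝 u₀, p u) : ∀ᶠ e in 𝓝 (c.φ u₀), p (c.φ.symm e) := by
  refine (c.φ.continuousAt_symm (c.φ.map_source hu₀)).eventually ?_
  rwa [c.φ.left_inv hu₀]

/-- The elements of `F` lift along `t` to vector fields in the kernel of `ds`. -/
theorem exists_lift (hF : F ≤ compactFields 𝓘(ℝ, E) M) (hS : S.IsBiSubmersion F)
    {u₀ : S.U} (hu₀ : u₀ ∈ c.φ.source)
    {Y : VF 𝓘(ℝ, E) M} (hY : Y ∈ F) :
    ∃ b : S.Model → S.Model, ∀ᶠ e in 𝓝 (c.φ u₀), ContDiffAt ℝ ∞ b e ∧ c.ρ (b e) = 0 ∧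
      fderiv ℝ c.τ e (b e) = fieldIn ψt Y (c.τ e) := by
  have hYs : IsSmooth Y := (hF hY).1
  have hτ₀ : c.τ (c.φ u₀) ∈ ψt.target := by
    rw [c.τ_apply hu₀]; exact ψt.map_source (c.t_mem u₀ hu₀)
  obtain ⟨a, ha⟩ := c.exists_lift_field hu₀ (hS.submersion_t u₀) (a := fieldIn ψt Y) (by
    filter_upwards [ψt.open_target.mem_nhds hτ₀] with e he
    exact contDiffAt_fieldIn c.memₜ hYs he)
  obtain ⟨X₀, hX₀, hX₀a⟩ := exists_compactField c.mem hu₀ (ha.mono fun e he => he.1)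
  have hO : {u | u ∈ c.φ.source ∧ S.dt u (X₀ u) = Y (S.t u)} ∈ 𝓝 u₀ := by
    filter_upwards [c.φ.open_source.mem_nhds hu₀, hX₀a, c.eventually_source hu₀ ha] with u hu h1 h2
    refine ⟨hu, chartD_injective c.memₜ (c.t_mem u hu) ?_⟩
    refine (c.chartD_dt hu _).trans ((congrArg _ h1).trans (h2.2.trans ?_))
    rw [c.τ_apply hu, fieldIn_apply _ (c.t_mem u hu)]
  obtain ⟨χ, -, h2, h3⟩ := exists_bump 𝓘(ℝ, S.Model) hO
  have hX : (χ • X₀ : VF 𝓘(ℝ, S.Model) S.U) ∈ pullback 𝓘(ℝ, S.Model) F S.t := by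
    refine ⟨Submodule.smul_mem _ χ hX₀, ?_⟩
    change push 𝓘(ℝ, S.Model) 𝓘(ℝ, E) S.t (χ • X₀) ∈ Submodule.span _ _
    let Z : Sections fun u : S.U => TangentSpace 𝓘(ℝ, E) (S.t u) := fun u => Y (S.t u)
    have : push 𝓘(ℝ, S.Model) 𝓘(ℝ, E) S.t (χ • X₀) = χ • Z := by
      rw [map_smul]
      funext u
      change χ u • S.dt u (X₀ u) = χ u • Y (S.t u)
      by_cases hu : u ∈ tsupport χ
      · exact congrArg (χ u • ·) (h2 hu).2
      · rw [image_eq_zero_of_notMem_tsupport hu]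
        exact (zero_smul ℝ _).trans (zero_smul ℝ _).symm
    rw [this]
    exact Submodule.smul_mem _ χ (Submodule.subset_span ⟨Y, hY, rfl⟩)
  rw [← hS.pullback_eq, hS.pullback_s] at hX
  obtain ⟨A, hA, B, hB, hAB⟩ := Submodule.mem_sup.1 hX
  refine ⟨fieldIn c.φ A, ?_⟩
  filter_upwards [c.φ.open_target.mem_nhds (c.φ.map_source hu₀), c.eventually_target hu₀ hO,
    c.eventually_target hu₀ h3] with e he h4 h5
  refine ⟨contDiffAt_fieldIn c.mem hA.1.1 he, ?_, ?_⟩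
  · have hAs : S.ds (c.φ.symm e) (A (c.φ.symm e)) = 0 := congrFun hA.2 (c.φ.symm e)
    exact (c.ds_eq_zero_iff (c.φ.map_target he) _).1 hAs
  · have hBt : S.dt (c.φ.symm e) (B (c.φ.symm e)) = 0 := congrFun hB.2 (c.φ.symm e)
    have hsum : A (c.φ.symm e) + B (c.φ.symm e) = X₀ (c.φ.symm e) := by
      have := congrFun hAB (c.φ.symm e)
      change A (c.φ.symm e) + B (c.φ.symm e) = χ (c.φ.symm e) • X₀ (c.φ.symm e) at this
      rwa [h5, one_smul] at this
    have h6 : S.dt (c.φ.symm e) (A (c.φ.symm e)) = Y (S.t (c.φ.symm e)) := by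
      rw [← h4.2, ← hsum]
      exact ((S.dt (c.φ.symm e)).map_add _ _).symm ▸ by rw [hBt, add_zero]
    have h7 := c.chartD_dt (c.φ.map_target he) (A (c.φ.symm e))
    rw [h6, c.φ.right_inv he] at h7
    rw [fieldIn, ← h7, fieldIn, c.symm_τ he]

/-- The differential of `t` maps the vector fields which project along `s` to an element of `F` to
the span of `F`. -/
theorem exists_span_dt (hS : S.IsBiSubmersion F) {u₀ : S.U}
    (hu₀ : u₀ ∈ c.φ.source) {Y : VF 𝓘(ℝ, E) M} (hY : Y ∈ F) {a : S.Model → S.Model}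
    (ha : ∀ᶠ e in 𝓝 (c.φ u₀), ContDiffAt ℝ ∞ a e)
    (haY : ∀ᶠ e in 𝓝 (c.φ u₀), c.ρ (a e) = fieldIn ψs Y (c.ρ e)) :
    ∃ (n : ℕ) (Y : Fin n → VF 𝓘(ℝ, E) M) (C : Fin n → S.Model → ℝ), (∀ k, Y k ∈ F) ∧
      ∀ᶠ e in 𝓝 (c.φ u₀), (∀ k, ContDiffAt ℝ ∞ (C k) e) ∧
        fderiv ℝ c.τ e (a e) = ∑ k, C k e • fieldIn ψt (Y k) (c.τ e) := by
  obtain ⟨X₀, hX₀, hX₀a⟩ := exists_compactField c.mem hu₀ ha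
  have hO : {u | u ∈ c.φ.source ∧ chartD c.φ u (X₀ u) = a (c.φ u) ∧
      S.ds u (X₀ u) = Y (S.s u)} ∈ 𝓝 u₀ := by
    filter_upwards [c.φ.open_source.mem_nhds hu₀, hX₀a, c.eventually_source hu₀ haY] with u hu h1 h2
    refine ⟨hu, h1, chartD_injective c.memₛ (c.s_mem u hu) ?_⟩
    refine (c.chartD_ds hu _).trans ((congrArg c.ρ h1).trans (h2.trans ?_))
    rw [← c.s_eq u hu, fieldIn_apply _ (c.s_mem u hu)]
  obtain ⟨χ, -, h2, h3⟩ := exists_bump 𝓘(ℝ, S.Model) hO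
  have hX' : (χ • X₀ : VF 𝓘(ℝ, S.Model) S.U) ∈ pullback 𝓘(ℝ, S.Model) F S.t := by
    rw [← hS.pullback_eq]
    refine ⟨Submodule.smul_mem _ χ hX₀, ?_⟩
    change push 𝓘(ℝ, S.Model) 𝓘(ℝ, E) S.s (χ • X₀) ∈ Submodule.span _ _
    let Z : Sections fun u : S.U => TangentSpace 𝓘(ℝ, E) (S.s u) := fun u => Y (S.s u)
    have : push 𝓘(ℝ, S.Model) 𝓘(ℝ, E) S.s (χ • X₀) = χ • Z := by
      rw [map_smul]
      funext u
      change χ u • S.ds u (X₀ u) = χ u • Y (S.s u)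
      by_cases hu : u ∈ tsupport χ
      · exact congrArg (χ u • ·) (h2 hu).2.2
      · rw [image_eq_zero_of_notMem_tsupport hu]
        exact (zero_smul ℝ _).trans (zero_smul ℝ _).symm
    rw [this]
    exact Submodule.smul_mem _ χ (Submodule.subset_span ⟨Y, hY, rfl⟩)
  obtain ⟨n, f, g, hfg⟩ := Submodule.mem_span_set'.1 hX'.2
  choose Y hY hgY using fun k => (g k).2
  refine ⟨n, Y, fun k e => f k (c.φ.symm e), hY, ?_⟩
  filter_upwards [c.φ.open_target.mem_nhds (c.φ.map_source hu₀), c.eventually_target hu₀ hO,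
    c.eventually_target hu₀ h3] with e he h4 h5
  constructor
  · intro k
    rw [← contMDiffAt_iff_contDiffAt]
    exact ((f k).contMDiff _).comp e (contMDiffAt_symm_of_mem_maximalAtlas c.mem he)
  · have h6 := congrFun hfg (c.φ.symm e)
    rw [Sections.sum_apply] at h6
    have h7 : ∑ k, f k (c.φ.symm e) • Y k (S.t (c.φ.symm e)) =
        S.dt (c.φ.symm e) (χ (c.φ.symm e) • X₀ (c.φ.symm e)) := by
      rw [← show _ = S.dt (c.φ.symm e) (χ (c.φ.symm e) • X₀ (c.φ.symm e)) from h6]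
      refine Finset.sum_congr rfl fun k _ => ?_
      have := congrFun (hgY k) (c.φ.symm e)
      exact (congrArg (f k (c.φ.symm e) • ·) this).symm
    rw [h5, one_smul] at h7
    have h8 := c.chartD_dt (c.φ.map_target he) (X₀ (c.φ.symm e))
    rw [← h7, c.φ.right_inv he] at h8
    have h9 := h4.2.1
    rw [c.φ.right_inv he] at h9
    rw [← h9, ← h8]
    refine (map_sum (chartD ψt (S.t (c.φ.symm e))) _ _).trans (Finset.sum_congr rfl fun k _ => ?_)
    rw [fieldIn, c.symm_τ he]
    exact (chartD ψt (S.t (c.φ.symm e))).map_smul _ _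

/-- `dt` maps the kernel of `ds` to the span of `F`. -/
theorem exists_span (hS : S.IsBiSubmersion F) {u₀ : S.U}
    (hu₀ : u₀ ∈ c.φ.source) :
    ∃ (κ : Type) (_ : Fintype κ) (Y : κ → VF 𝓘(ℝ, E) M) (C : κ → S.Model → S.Model →L[ℝ] ℝ),
      (∀ k, Y k ∈ F) ∧ ∀ᶠ e in 𝓝 (c.φ u₀), (∀ k, ContDiffAt ℝ ∞ (C k) e) ∧
        ∀ y, c.ρ y = 0 → fderiv ℝ c.τ e y = ∑ k, C k e y • fieldIn ψt (Y k) (c.τ e) := by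
  let b := Module.finBasis ℝ S.Model
  have hb : ∀ j, c.ρ (b j - c.sec (c.ρ (b j))) = 0 := fun j => by
    rw [map_sub, c.ρ_sec, sub_self]
  choose n Y C hY hC using fun j => c.exists_span_dt hS hu₀ F.zero_mem
    (Eventually.of_forall fun _ => contDiffAt_const) (Eventually.of_forall fun e => (hb j).trans
      (map_zero (chartD ψs (ψs.symm (c.ρ e)))).symm)
  refine ⟨Σ j, Fin (n j), inferInstance, fun k => Y k.1 k.2,
    fun k e => C k.1 k.2 e • LinearMap.toContinuousLinearMap (b.coord k.1), fun k => hY k.1 k.2, ?_⟩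
  filter_upwards [eventually_all.2 hC] with e he
  refine ⟨fun k => ((he k.1).1 k.2).smul contDiffAt_const, fun y hy => ?_⟩
  have h1 : y = ∑ j, b.coord j y • (b j - c.sec (c.ρ (b j))) := by
    have h2 : y = ∑ j, b.coord j y • b j := (b.sum_repr y).symm
    have h3 : c.sec (c.ρ y) = ∑ j, b.coord j y • c.sec (c.ρ (b j)) := by
      conv_lhs => rw [h2]
      simp only [map_sum, map_smul]
    simp only [smul_sub, Finset.sum_sub_distrib]
    rw [← h2, ← h3, hy, map_zero, sub_zero]
  conv_lhs => rw [h1]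
  rw [map_sum, Fintype.sum_sigma]
  refine Finset.sum_congr rfl fun j _ => ?_
  rw [map_smul, (he j).2, Finset.smul_sum]
  refine Finset.sum_congr rfl fun k _ => ?_
  rw [smul_smul]
  congr 1
  simp [mul_comm]

end AdaptedChart

end Adapted

section Germs

variable {E : Type*} [NormedAddCommGroup E] [NormedSpace ℝ E] {H : Type*} [TopologicalSpace H]
  {I : ModelWithCorners ℝ E H} {M : Type*} [TopologicalSpace M] [ChartedSpace H M]

namespace Span

/-- The germ at `s u` of `h` is the composition of `t` with a local section of `s` through `u`. -/
def Carries (S : Span.{u} I M) (u : S.U) (h : M → M) : Prop :=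
  ∃ σ : M → S.U, σ (S.s u) = u ∧ ∀ᶠ x in 𝓝 (S.s u),
    ContMDiffAt I 𝓘(ℝ, S.Model) ∞ σ x ∧ S.s (σ x) = x ∧ S.t (σ x) = h x

theorem hasMorphism_iff {S T : Span.{u} I M} {u : S.U} {w : T.U} :
    S.HasMorphism T u w ↔ ∃ f : S.U → T.U, f u = w ∧ ∀ᶠ y in 𝓝 u,
      ContMDiffAt 𝓘(ℝ, S.Model) 𝓘(ℝ, T.Model) ∞ f y ∧ T.t (f y) = S.t y ∧ T.s (f y) = S.s y := by
  constructor
  · rintro ⟨O, hO, hu, f, hf, hts, hfu⟩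
    refine ⟨f, hfu, ?_⟩
    filter_upwards [hO.mem_nhds hu] with y hy
    exact ⟨(hf y hy).contMDiffAt (hO.mem_nhds hy), hts y hy⟩
  · rintro ⟨f, hfu, hf⟩
    refine ⟨_, isOpen_interior, mem_interior_iff_mem_nhds.2 hf, f, fun y hy => ?_, fun y hy => ?_,
      hfu⟩
    · exact (interior_subset hy).1.contMDiffWithinAt
    · exact (interior_subset hy).2

theorem hasCompMorphism_iff {S S' T : Span.{u} I M} {u : S.U} {v : S'.U} {w : T.U} :
    S.HasCompMorphism S' T u v w ↔ S.s u = S'.t v ∧ ∃ f : S.U × S'.U → T.U, f (u, v) = w ∧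
      ∀ᶠ p in 𝓝 (u, v),
        ContMDiffAt (𝓘(ℝ, S.Model).prod 𝓘(ℝ, S'.Model)) 𝓘(ℝ, T.Model) ∞ f p ∧
        (S.s p.1 = S'.t p.2 → T.t (f p) = S.t p.1 ∧ T.s (f p) = S'.s p.2) := by
  constructor
  · rintro ⟨h, O, hO, hu, f, hf, hts, hfu⟩
    refine ⟨h, f, hfu, ?_⟩
    filter_upwards [hO.mem_nhds hu] with y hy
    exact ⟨(hf y hy).contMDiffAt (hO.mem_nhds hy), hts y hy⟩
  · rintro ⟨h, f, hfu, hf⟩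
    refine ⟨h, _, isOpen_interior, mem_interior_iff_mem_nhds.2 hf, f, fun y hy => ?_,
      fun y hy => ?_, hfu⟩
    · exact (interior_subset hy).1.contMDiffWithinAt
    · exact (interior_subset hy).2

end Span

end Germs

section Factor

set_option linter.unusedSectionVars false

variable {E : Type*} [NormedAddCommGroup E] [NormedSpace ℝ E] [FiniteDimensional ℝ E]
  {M : Type*} [TopologicalSpace M] [ChartedSpace E M] [IsManifold 𝓘(ℝ, E) ∞ M]
  [T2Space M] [SecondCountableTopology M]
  {F : Submodule C^∞⟮𝓘(ℝ, E), M; ℝ⟯ (VF 𝓘(ℝ, E) M)}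

/-- A pair `(ρ₁, τ₁)` such that `τ₁` varies along the leaves of `F` on the fibres of `ρ₁` factors
through a bi-submersion of `F`, as soon as it does so on a section of `ρ₁`. -/
theorem AdaptedChart.exists_factor (hF : F ≤ compactFields 𝓘(ℝ, E) M) {T : Span.{u} 𝓘(ℝ, E) M}
    {ψs ψt : OpenPartialHomeomorph M E} (c : AdaptedChart T ψs ψt) (hT : T.IsBiSubmersion F)
    {w : T.U} (hw : w ∈ c.φ.source) {P : Type*} [NormedAddCommGroup P] [NormedSpace ℝ P]
    [FiniteDimensional ℝ P] (ρ₁ : P →L[ℝ] E) {τ₁ : P → E} {p₀ : P}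
    (hτ₁ : ∀ᶠ p in 𝓝 p₀, ContDiffAt ℝ ∞ τ₁ p)
    {σ₁ : E → P} (hσ₁ : ∀ᶠ e in 𝓝 (ρ₁ p₀), ContDiffAt ℝ ∞ σ₁ e) (hσp : σ₁ (ρ₁ p₀) = p₀)
    (hρσ : ∀ᶠ e in 𝓝 (ρ₁ p₀), ρ₁ (σ₁ e) = e) {κ : Type*} [Fintype κ]
    {Y : κ → VF 𝓘(ℝ, E) M} {C : κ → P → P →L[ℝ] ℝ} (hY : ∀ k, Y k ∈ F)
    (hC : ∀ᶠ p in 𝓝 p₀, (∀ k, ContDiffAt ℝ ∞ (C k) p) ∧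
      ∀ y, ρ₁ y = 0 → fderiv ℝ τ₁ p y = ∑ k, C k p y • fieldIn ψt (Y k) (τ₁ p))
    {σ₂ : E → T.Model} (hσ₂ : ∀ᶠ e in 𝓝 (ρ₁ p₀), ContDiffAt ℝ ∞ σ₂ e)
    (hσw : σ₂ (ρ₁ p₀) = c.φ w)
    (hστ : ∀ᶠ e in 𝓝 (ρ₁ p₀), c.ρ (σ₂ e) = e ∧ c.τ (σ₂ e) = τ₁ (σ₁ e)) :
    ∃ g : P → T.Model, (∀ᶠ p in 𝓝 p₀, ContDiffAt ℝ ∞ g p) ∧ g p₀ = c.φ w ∧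
      ∀ᶠ p in 𝓝 p₀, c.ρ (g p) = ρ₁ p ∧ c.τ (g p) = τ₁ p := by
  have hρc : Tendsto ρ₁ (𝓝 p₀) (𝓝 (ρ₁ p₀)) := ρ₁.continuous.continuousAt
  choose b hb using fun k => c.exists_lift hF hT hw (hY k)
  let δ : P → P := fun p => p - σ₁ (ρ₁ p)
  let y : P × ℝ → P := fun q => σ₁ (ρ₁ q.1) + q.2 • δ q.1
  have hδ : ∀ᶠ p in 𝓝 p₀, ContDiffAt ℝ ∞ δ p ∧ ContDiffAt ℝ ∞ (fun p => σ₁ (ρ₁ p)) p ∧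
      ρ₁ (δ p) = 0 := by
    filter_upwards [hρc.eventually hσ₁, hρc.eventually hρσ] with p h1 h2
    have h3 : ContDiffAt ℝ ∞ (fun p => σ₁ (ρ₁ p)) p := h1.comp p ρ₁.contDiff.contDiffAt
    exact ⟨contDiffAt_id.sub h3, h3, by simp [δ, h2]⟩
  have hδ₀ : δ p₀ = 0 := by simp [δ, hσp]
  have hy₀ : ∀ r, y (p₀, r) = p₀ := fun r => by simp [y, hδ₀, hσp]
  have hy : ∀ r, ∀ᶠ q in 𝓝 (p₀, r), ContDiffAt ℝ ∞ y q ∧ ContDiffAt ℝ ∞ (fun q : P × ℝ => δ q.1) q := by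
    intro r
    filter_upwards [hδ.prod_inl_nhds r] with q hq
    have h1 : ContDiffAt ℝ ∞ (fun q : P × ℝ => δ q.1) q := hq.1.comp q contDiffAt_fst
    exact ⟨(ContDiffAt.comp q (g := fun p => σ₁ (ρ₁ p)) hq.2.1 contDiffAt_fst).add
      (contDiffAt_snd.smul h1), h1⟩
  have hyt : ∀ r, Tendsto y (𝓝 (p₀, r)) (𝓝 p₀) := fun r => by
    have := (hy r).self_of_nhds.1.continuousAt
    rwa [ContinuousAt, hy₀] at this
  have hτw : c.τ (c.φ w) = τ₁ p₀ := by
    have := hστ.self_of_nhds.2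
    rwa [hσw, hσp] at this
  have htw : τ₁ p₀ ∈ ψt.target := by
    rw [← hτw, c.τ_apply hw]; exact ψt.map_source (c.t_mem w hw)
  have hwt := c.φ.map_source hw
  have main : ∃ g : P → T.Model, (∀ᶠ p in 𝓝 p₀, ContDiffAt ℝ ∞ g p) ∧ g p₀ = c.φ w ∧
      ∀ᶠ p in 𝓝 p₀, c.τ (g p) = τ₁ (y (p, 1)) ∧ c.ρ (g p) = c.ρ (σ₂ (ρ₁ p)) := by
    refine exists_path_lift (p₀ := p₀) (e₀ := τ₁ p₀) (γ₀ := fun _ => c.φ w)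
      (Y := fun k => fieldIn ψt (Y k)) (C := fun k q => C k (y q) (δ q.1)) (b := fun k q => b k q.2)
      (τ := fun q => c.τ q.2) (μ := fun _ => 1) (β := fun p r => τ₁ (y (p, r)))
      (g₀ := fun p => σ₂ (ρ₁ p)) c.ρ ?_ ?_ ?_ ?_ ?_ ?_ ?_ ?_ ?_ ?_ ?_ ?_ ?_ ?_
    · exact fun k => (contDiffAt_fieldIn c.memₜ (hF (hY k)).1 htw).of_le (by simp)
    · intro k r _
      filter_upwards [hy r, (hyt r).eventually hC] with q h1 h2
      exact ((h2.1 k).comp q h1.1).clm_apply h1.2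
    · intro k r _
      filter_upwards [(hb k).prod_inr_nhds p₀] with q h1
      exact h1.1.comp q contDiffAt_snd
    · intro r _
      filter_upwards [(eventually_all.2 hb).prod_inr_nhds p₀,
        Eventually.prod_inr_nhds (c.φ.open_target.mem_nhds hwt) p₀] with q h1 h2
      exact ⟨(c.contDiffAt_τ h2).differentiableAt (by simp), fun k => by
        rw [one_smul]; exact (h1 k).2.2⟩
    · intro r _
      exact ContinuousAt.comp (g := c.τ) (x := (p₀, c.φ w)) (c.contDiffAt_τ hwt).continuousAt
        continuousAt_snd
    · exact fun r _ => hτw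
    · intro k r _
      filter_upwards [(hb k).prod_inr_nhds p₀] with q h1
      exact h1.2.1
    · intro r _
      refine ContinuousAt.comp (g := τ₁) (f := y) (x := (p₀, r)) ?_ (hy r).self_of_nhds.1.continuousAt
      rw [hy₀]
      exact hτ₁.self_of_nhds.continuousAt
    · exact fun r _ => by rw [hy₀]
    · have h1 : ∀ᶠ p in 𝓝 p₀, ∀ r ∈ Icc (0 : ℝ) 1, (∀ y', ρ₁ y' = 0 → fderiv ℝ τ₁ (y (p, r)) y' =
          ∑ k, C k (y (p, r)) y' • fieldIn ψt (Y k) (τ₁ (y (p, r)))) ∧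
          ContDiffAt ℝ ∞ τ₁ (y (p, r)) := by
        refine isCompact_Icc.eventually_forall_of_forall_eventually fun r _ => ?_
        filter_upwards [(hyt r).eventually hC, (hyt r).eventually hτ₁] with q h1 h2
        exact ⟨h1.2, h2⟩
      filter_upwards [h1, hδ] with p h1 h2 r hr
      rw [one_smul, ← (h1 r hr).1 _ h2.2.2]
      have h3 : HasDerivAt (fun r => y (p, r)) (δ p) r := by
        have h4 := ((hasDerivAt_id r).smul_const (δ p)).const_add (σ₁ (ρ₁ p))
        rw [one_smul] at h4
        exact h4
      exact ((h1 r hr).2.differentiableAt (by simp)).hasFDerivAt.comp_hasDerivAt r h3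
    · intro r _
      simp only [hδ₀, map_zero, zero_smul, Finset.sum_const_zero]
      exact hasDerivAt_const _ _
    · filter_upwards [hρc.eventually hσ₂] with p h1
      exact h1.comp p ρ₁.contDiff.contDiffAt
    · exact hσw
    · filter_upwards [hρc.eventually hστ] with p h1
      simp only [h1.2, y, zero_smul, add_zero]
  obtain ⟨g, hg, hgp, hgτ⟩ := main
  refine ⟨g, hg, hgp, ?_⟩
  filter_upwards [hgτ, hρc.eventually hστ] with p h1 h2
  refine ⟨h1.2.trans h2.1, h1.1.trans ?_⟩
  simp [y, δ]

namespace AdaptedChart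

variable {S : Span.{u} 𝓘(ℝ, E) M} {ψs ψt : OpenPartialHomeomorph M E} (c : AdaptedChart S ψs ψt)

theorem s_eq_of {u : S.U} (hu : u ∈ c.φ.source) {x : M} (hx : x ∈ ψs.source)
    (h : c.ρ (c.φ u) = ψs x) : S.s u = x :=
  ψs.injOn (c.s_mem u hu) hx ((c.s_eq u hu).trans h)

theorem t_eq_of {u : S.U} (hu : u ∈ c.φ.source) {x : M} (hx : x ∈ ψt.source)
    (h : c.τ (c.φ u) = ψt x) : S.t u = x :=
  ψt.injOn (c.t_mem u hu) hx ((c.τ_apply hu).symm.trans h)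

theorem ρ_mem {u : S.U} (hu : u ∈ c.φ.source) : c.ρ (c.φ u) ∈ ψs.target := by
  rw [← c.s_eq u hu]; exact ψs.map_source (c.s_mem u hu)

theorem symm_ρ {u : S.U} (hu : u ∈ c.φ.source) : ψs.symm (c.ρ (c.φ u)) = S.s u := by
  rw [← c.s_eq u hu, ψs.left_inv (c.s_mem u hu)]

theorem exists_section {u : S.U} (hu : u ∈ c.φ.source) {h : M → M} (hh : S.Carries u h) :
    ∃ σ : E → S.Model, σ (c.ρ (c.φ u)) = c.φ u ∧ ∀ᶠ e in 𝓝 (c.ρ (c.φ u)), ContDiffAt ℝ ∞ σ e ∧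
      c.ρ (σ e) = e ∧ c.τ (σ e) = ψt (h (ψs.symm e)) ∧ h (ψs.symm e) ∈ ψt.source := by
  obtain ⟨σ, hσu, hσ⟩ := hh
  refine ⟨fun e => c.φ (σ (ψs.symm e)), by
    change c.φ (σ (ψs.symm (c.ρ (c.φ u)))) = _
    rw [c.symm_ρ hu, hσu], ?_⟩
  have hc : Tendsto ψs.symm (𝓝 (c.ρ (c.φ u))) (𝓝 (S.s u)) := by
    have := ψs.continuousAt_symm (c.ρ_mem hu)
    rwa [ContinuousAt, c.symm_ρ hu] at this
  have hσc : Tendsto σ (𝓝 (S.s u)) (𝓝 u) := by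
    have := hσ.self_of_nhds.1.continuousAt
    rwa [ContinuousAt, hσu] at this
  filter_upwards [hc.eventually hσ, (hσc.comp hc).eventually (c.φ.open_source.mem_nhds hu),
    ψs.open_target.mem_nhds (c.ρ_mem hu)] with e ⟨h1, h2, h3⟩ h4 h5
  have h4' : σ (ψs.symm e) ∈ c.φ.source := h4
  refine ⟨?_, ?_, ?_, ?_⟩
  · rw [← contMDiffAt_iff_contDiffAt]
    exact (contMDiffAt_of_mem_maximalAtlas c.mem h4').comp e
      (h1.comp e (contMDiffAt_symm_of_mem_maximalAtlas c.memₛ h5))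
  · rw [← c.s_eq _ h4', h2, ψs.right_inv h5]
  · rw [c.τ_apply h4', h3]
  · rw [← h3]; exact c.t_mem _ h4'

end AdaptedChart

/-- Two points of bi-submersions which carry a common germ are related by a morphism. -/
theorem Span.hasMorphism_of_carries (hF : F ≤ compactFields 𝓘(ℝ, E) M) {S T : Span.{u} 𝓘(ℝ, E) M}
    (hS : S.IsBiSubmersion F) (hT : T.IsBiSubmersion F) {u : S.U} {w : T.U} {h : M → M}
    (hu : S.Carries u h) (hw : T.Carries w h) (hs : S.s u = T.s w) : S.HasMorphism T u w := by
  have ht : S.t u = T.t w := by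
    obtain ⟨σ, h1, h2⟩ := hu
    obtain ⟨σ', h1', h2'⟩ := hw
    have h3 := h2.self_of_nhds.2.2
    have h4 := h2'.self_of_nhds.2.2
    rw [h1] at h3
    rw [h1', ← hs] at h4
    exact h3.trans h4.symm
  obtain ⟨c, hc⟩ := exists_adaptedChart_of_surjective S
    (IsManifold.chart_mem_maximalAtlas (I := 𝓘(ℝ, E)) (S.s u))
    (IsManifold.chart_mem_maximalAtlas (I := 𝓘(ℝ, E)) (S.t u)) u (mem_chart_source _ _)
    (mem_chart_source _ _) (hS.submersion_s u)
  obtain ⟨d, hd⟩ := exists_adaptedChart_of_surjective T c.memₛ c.memₜ w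
    (hs ▸ mem_chart_source _ _) (ht ▸ mem_chart_source _ _) (hT.submersion_s w)
  obtain ⟨σ₁, hσ₁, hσ₁'⟩ := c.exists_section hc hu
  obtain ⟨σ₂, hσ₂, hσ₂'⟩ := d.exists_section hd hw
  have hcd : d.ρ (d.φ w) = c.ρ (c.φ u) := by rw [← c.s_eq u hc, ← d.s_eq w hd, hs]
  rw [hcd] at hσ₂ hσ₂'
  obtain ⟨κ, _, Y, C, hY, hC⟩ := c.exists_span hS hc
  have hct := c.φ.open_target.mem_nhds (c.φ.map_source hc)
  obtain ⟨g, hg, hgu, hg'⟩ := d.exists_factor hF hT hd c.ρ (τ₁ := c.τ) (p₀ := c.φ u)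
    (by filter_upwards [hct] with e he using c.contDiffAt_τ he)
    (hσ₁'.mono fun e he => he.1) hσ₁ (hσ₁'.mono fun e he => he.2.1) hY hC
    (hσ₂'.mono fun e he => he.1) hσ₂ (by
      filter_upwards [hσ₁', hσ₂'] with e h1 h2
      exact ⟨h2.2.1, h2.2.2.1.trans h1.2.2.1.symm⟩)
  refine hasMorphism_iff.2 ⟨fun y => d.φ.symm (g (c.φ y)), by
    change d.φ.symm (g (c.φ u)) = w
    rw [hgu, d.φ.left_inv hd], ?_⟩
  have hgt : ∀ᶠ e in 𝓝 (c.φ u), g e ∈ d.φ.target :=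
    hg.self_of_nhds.continuousAt.eventually_mem
      (d.φ.open_target.mem_nhds (hgu ▸ d.φ.map_source hd))
  filter_upwards [c.φ.open_source.mem_nhds hc, c.eventually_source hc hg,
    c.eventually_source hc hg', c.eventually_source hc hgt] with y h1 h2 h3 h4
  refine ⟨?_, ?_, ?_⟩
  · exact (contMDiffAt_symm_of_mem_maximalAtlas d.mem h4).comp y
      (h2.contMDiffAt.comp y (contMDiffAt_of_mem_maximalAtlas c.mem h1))
  · refine d.t_eq_of (d.φ.map_target h4) (c.t_mem y h1) ?_
    rw [d.φ.right_inv h4, h3.2, c.τ_apply h1]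
  · refine d.s_eq_of (d.φ.map_target h4) (c.s_mem y h1) ?_
    rw [d.φ.right_inv h4, h3.1, c.s_eq y h1]

/-- A composition of bi-submersions is mapped by a local morphism to any point of a bi-submersion
which carries the composed germ. -/
theorem Span.hasCompMorphism_of_carries (hF : F ≤ compactFields 𝓘(ℝ, E) M)
    {S S' T : Span.{u} 𝓘(ℝ, E) M}
    (hS : S.IsBiSubmersion F) (hS' : S'.IsBiSubmersion F) (hT : T.IsBiSubmersion F)
    {u : S.U} {v : S'.U} {w : T.U} {h h' : M → M} (hu : S.Carries u h) (hv : S'.Carries v h')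
    (hw : T.Carries w (h ∘ h')) (huv : S.s u = S'.t v) (hs : T.s w = S'.s v) :
    S.HasCompMorphism S' T u v w := by
  have ht : S.t u = T.t w := by
    obtain ⟨σ, h1, h2⟩ := hu
    obtain ⟨σ', h1', h2'⟩ := hv
    obtain ⟨σ'', h1'', h2''⟩ := hw
    have h3 := h2.self_of_nhds.2.2
    have h4 := h2'.self_of_nhds.2.2
    have h5 := h2''.self_of_nhds.2.2
    rw [h1] at h3
    rw [h1'] at h4
    rw [h1'', hs, Function.comp_apply, ← h4, ← huv] at h5
    exact h3.trans h5.symm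
  have hchart : ∀ x : M, ∃ ψ ∈ IsManifold.maximalAtlas 𝓘(ℝ, E) ∞ M, x ∈ ψ.source := fun x =>
    ⟨_, IsManifold.chart_mem_maximalAtlas (I := 𝓘(ℝ, E)) x, mem_chart_source _ _⟩
  obtain ⟨ψs, hψs, hvs⟩ := hchart (S'.s v)
  obtain ⟨ψm, hψm, hus⟩ := hchart (S.s u)
  obtain ⟨ψt, hψt, hut⟩ := hchart (S.t u)
  obtain ⟨c, hc⟩ := exists_adaptedChart_of_surjective S hψm hψt u hus hut (hS.submersion_s u)
  obtain ⟨c', hc'⟩ := exists_adaptedChart_of_surjective S' hψs hψm v hvs (huv ▸ hus)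
    (hS'.submersion_s v)
  obtain ⟨d, hd⟩ := exists_adaptedChart_of_surjective T hψs hψt w (hs ▸ hvs) (ht ▸ hut)
    (hT.submersion_s w)
  obtain ⟨σ, hσ, hσ'⟩ := c.exists_section hc hu
  obtain ⟨σv, hσv, hσv'⟩ := c'.exists_section hc' hv
  obtain ⟨σ₂, hσ₂, hσ₂'⟩ := d.exists_section hd hw
  have hcd : d.ρ (d.φ w) = c'.ρ (c'.φ v) := by rw [← c'.s_eq v hc', ← d.s_eq w hd, hs]
  rw [hcd] at hσ₂ hσ₂'
  have hτv : c'.τ (c'.φ v) = c.ρ (c.φ u) := by rw [c'.τ_apply hc', ← huv, c.s_eq u hc]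
  obtain ⟨κ, _, Y, C, hY, hC⟩ := c.exists_span hS hc
  obtain ⟨κ', _, Y', C', hY', hC'⟩ := c'.exists_span hS' hc'
  have hct := c.φ.open_target.mem_nhds (c.φ.map_source hc)
  have hct' := c'.φ.open_target.mem_nhds (c'.φ.map_source hc')
  have hX : ∀ k, ∀ᶠ e in 𝓝 (c.φ u), ContDiffAt ℝ ∞ (fun e => c.sec (fieldIn ψm (Y' k) (c.ρ e))) e := by
    intro k
    filter_upwards [c.ρ.continuous.continuousAt.eventually
      (ψm.open_target.mem_nhds (c.ρ_mem hc))] with e he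
    exact c.sec.contDiff.contDiffAt.comp e
      ((contDiffAt_fieldIn c.memₛ (hF (hY' k)).1 he).comp e c.ρ.contDiff.contDiffAt)
  choose n X D hXF hD using fun k => c.exists_span_dt hS hc (hY' k) (hX k)
    (Eventually.of_forall fun e => c.ρ_sec _)
  let ρ₁ : S'.Model × S.Model →L[ℝ] E := c'.ρ.comp (ContinuousLinearMap.fst ℝ _ _)
  let Ξ : S'.Model × S.Model → S.Model := fun p => c.sec (c'.τ p.1) + (p.2 - c.sec (c.ρ p.2))
  let τ₁ : S'.Model × S.Model → E := fun p => c.τ (Ξ p)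
  let p₀ : S'.Model × S.Model := (c'.φ v, c.φ u)
  have hΞ₀ : Ξ p₀ = c.φ u := by simp [Ξ, p₀, hτv]
  have hρΞ : ∀ p, c.ρ (Ξ p) = c'.τ p.1 := fun p => by simp [Ξ, c.ρ_sec]
  have hΞ : ∀ᶠ p in 𝓝 p₀, ContDiffAt ℝ ∞ Ξ p := by
    filter_upwards [Eventually.prod_inl_nhds hct' (c.φ u)] with p hp
    exact (c.sec.contDiff.contDiffAt.comp p ((c'.contDiffAt_τ hp).comp p contDiffAt_fst)).add
      (contDiffAt_snd.sub ((c.sec.comp c.ρ).contDiff.contDiffAt.comp p contDiffAt_snd))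
  have hΞc : Tendsto Ξ (𝓝 p₀) (𝓝 (c.φ u)) := by
    have := hΞ.self_of_nhds.continuousAt
    rwa [ContinuousAt, hΞ₀] at this
  let Q : S.Model →L[ℝ] S.Model := ContinuousLinearMap.id ℝ _ - c.sec.comp c.ρ
  have hQ : ∀ y, c.ρ (Q y) = 0 := fun y => by simp [Q, c.ρ_sec]
  let Y₁ : κ ⊕ (Σ k, Fin (n k)) → VF 𝓘(ℝ, E) M := Sum.elim Y fun k => X k.1 k.2
  let C₁ : κ ⊕ (Σ k, Fin (n k)) → S'.Model × S.Model → S'.Model × S.Model →L[ℝ] ℝ :=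
    Sum.elim (fun k p => (C k (Ξ p)).comp (Q.comp (ContinuousLinearMap.snd ℝ _ _)))
      fun k p => D k.1 k.2 (Ξ p) • (C' k.1 p.1).comp (ContinuousLinearMap.fst ℝ _ _)
  have hσv_t : Tendsto (fun e => c'.τ (σv e)) (𝓝 (c'.ρ (c'.φ v))) (𝓝 (c.ρ (c.φ u))) := by
    have h1 : ContinuousAt c'.τ (σv (c'.ρ (c'.φ v))) := by
      rw [hσv]; exact (c'.contDiffAt_τ (c'.φ.map_source hc')).continuousAt
    have := h1.comp (f := σv) hσv'.self_of_nhds.1.continuousAt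
    rwa [ContinuousAt, Function.comp_apply, hσv, hτv] at this
  have hσv_s : ∀ᶠ e in 𝓝 (c'.ρ (c'.φ v)), σv e ∈ c'.φ.target :=
    hσv'.self_of_nhds.1.continuousAt.eventually_mem (hσv.symm ▸ hct')
  obtain ⟨g, hg, hgu, hg'⟩ := d.exists_factor hF hT hd ρ₁ (τ₁ := τ₁) (p₀ := p₀)
    (σ₁ := fun e => (σv e, σ (c'.τ (σv e)))) (Y := Y₁) (C := C₁) (σ₂ := σ₂)
    (by
      filter_upwards [hΞ, hΞc.eventually hct] with p h1 h2
      exact (c.contDiffAt_τ h2).comp p h1)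
    (by
      filter_upwards [hσv', hσv_s, hσv_t.eventually hσ'] with e h1 h2 h3
      exact h1.1.prodMk (h3.1.comp e ((c'.contDiffAt_τ h2).comp e h1.1)))
    (by
      change (σv (c'.ρ (c'.φ v)), σ (c'.τ (σv (c'.ρ (c'.φ v))))) = p₀
      rw [hσv, hτv, hσ])
    (by
      filter_upwards [hσv'] with e h1
      exact h1.2.1)
    (by
      rintro (k | k)
      · exact hY k
      · exact hXF k.1 k.2)
    (by
      filter_upwards [hΞ, hΞc.eventually hct, hΞc.eventually hC, hC'.prod_inl_nhds (c.φ u),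
        hΞc.eventually (eventually_all.2 hD), Eventually.prod_inl_nhds hct' (c.φ u)] with
        p h1 h2 h3 h4 h5 h6
      refine ⟨?_, fun y hy => ?_⟩
      · rintro (k | k)
        · exact ((h3.1 k).comp p h1).clm_comp contDiffAt_const
        · exact (((h5 k.1).1 k.2).comp p h1).smul
            (((h4.1 k.1).comp p contDiffAt_fst).clm_comp contDiffAt_const)
      · have hd1 : HasFDerivAt Ξ (c.sec.comp ((fderiv ℝ c'.τ p.1).comp
            (ContinuousLinearMap.fst ℝ _ _)) + Q.comp (ContinuousLinearMap.snd ℝ _ _)) p := by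
          have e1 : HasFDerivAt (fun p : S'.Model × S.Model => c'.τ p.1)
              ((fderiv ℝ c'.τ p.1).comp (ContinuousLinearMap.fst ℝ _ _)) p :=
            (((c'.contDiffAt_τ h6).differentiableAt (by simp)).hasFDerivAt).comp p hasFDerivAt_fst
          exact (c.sec.hasFDerivAt.comp p e1).add (Q.hasFDerivAt.comp p hasFDerivAt_snd)
        have hd2 := (((c.contDiffAt_τ h2).differentiableAt (by simp)).hasFDerivAt).comp p hd1
        have hd3 : fderiv ℝ τ₁ p y = fderiv ℝ c.τ (Ξ p) (c.sec (fderiv ℝ c'.τ p.1 y.1)) +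
            fderiv ℝ c.τ (Ξ p) (Q y.2) := by
          rw [show fderiv ℝ τ₁ p = _ from hd2.fderiv, ← map_add]
          rfl
        rw [hd3, h4.2 y.1 hy, h3.2 _ (hQ _), Fintype.sum_sum_type, add_comm]
        refine congrArg₂ _ rfl ?_
        rw [Fintype.sum_sigma, map_sum, map_sum]
        refine Finset.sum_congr rfl fun k _ => ?_
        have h7 := (h5 k).2
        rw [hρΞ] at h7
        rw [map_smul, map_smul, h7, Finset.smul_sum]
        refine Finset.sum_congr rfl fun j _ => ?_
        rw [smul_smul, mul_comm]
        rfl)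
    (hσ₂'.mono fun e he => he.1) hσ₂ (by
      filter_upwards [hσv', hσv_t.eventually hσ', hσ₂'] with e h1 h2 h3
      have h4 : Ξ (σv e, σ (c'.τ (σv e))) = σ (c'.τ (σv e)) := by
        simp [Ξ, h2.2.1]
      refine ⟨h3.2.1, ?_⟩
      change d.τ (σ₂ e) = c.τ (Ξ (σv e, σ (c'.τ (σv e))))
      rw [h4, h2.2.2.1, h3.2.2.1, h1.2.2.1, ψm.left_inv h1.2.2.2]
      rfl)
  refine hasCompMorphism_iff.2 ⟨huv, fun y => d.φ.symm (g (c'.φ y.2, c.φ y.1)), by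
    change d.φ.symm (g p₀) = w
    rw [hgu, d.φ.left_inv hd], ?_⟩
  have hgt : ∀ᶠ e in 𝓝 p₀, g e ∈ d.φ.target :=
    hg.self_of_nhds.continuousAt.eventually_mem
      (d.φ.open_target.mem_nhds (hgu ▸ d.φ.map_source hd))
  have hpc : Tendsto (fun y : S.U × S'.U => (c'.φ y.2, c.φ y.1)) (𝓝 (u, v)) (𝓝 p₀) :=
    ((c'.φ.continuousAt hc').comp' continuousAt_snd).prodMk
      ((c.φ.continuousAt hc).comp' continuousAt_fst)
  filter_upwards [Eventually.prod_inl_nhds (c.φ.open_source.mem_nhds hc) v,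
    Eventually.prod_inr_nhds (c'.φ.open_source.mem_nhds hc') u, hpc.eventually hg,
    hpc.eventually hg', hpc.eventually hgt] with y h0 h1 h2 h3 h4
  refine ⟨?_, fun hy => ⟨?_, ?_⟩⟩
  · refine (contMDiffAt_symm_of_mem_maximalAtlas d.mem h4).comp y
      (ContMDiffAt.comp y (g := g) h2.contMDiffAt ?_)
    exact ((contMDiffAt_of_mem_maximalAtlas c'.mem h1).comp y contMDiffAt_snd).prodMk_space
      ((contMDiffAt_of_mem_maximalAtlas c.mem h0).comp y contMDiffAt_fst)
  · refine d.t_eq_of (d.φ.map_target h4) (c.t_mem _ h0) ?_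
    have h5 : Ξ (c'.φ y.2, c.φ y.1) = c.φ y.1 := by
      simp only [Ξ]
      rw [c'.τ_apply h1, ← hy, c.s_eq _ h0, add_sub_cancel]
    rw [d.φ.right_inv h4, h3.2, ← c.τ_apply h0]
    exact congrArg c.τ h5
  · refine d.s_eq_of (d.φ.map_target h4) (c'.s_mem _ h1) ?_
    rw [d.φ.right_inv h4, h3.1, c'.s_eq _ h1]
    rfl

end Factor

section Carries

variable {E : Type*} [NormedAddCommGroup E] [NormedSpace ℝ E] {H : Type*} [TopologicalSpace H]
  {I : ModelWithCorners ℝ E H} {M : Type*} [TopologicalSpace M] [ChartedSpace H M]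

namespace Span

theorem IsBiSubmersion.inv {F : Submodule C^∞⟮I, M; ℝ⟯ (VF I M)} {S : Span.{u} I M}
    (hS : S.IsBiSubmersion F) : S.inv.IsBiSubmersion F where
  submersion_s := hS.submersion_t
  submersion_t := hS.submersion_s
  pullback_eq := hS.pullback_eq.symm
  pullback_s := by
    have := hS.pullback_eq.symm.trans hS.pullback_s
    rw [sup_comm] at this
    exact this

theorem HasMorphism.refl (S : Span.{u} I M) (u : S.U) : S.HasMorphism S u u :=
  hasMorphism_iff.2 ⟨id, rfl, Eventually.of_forall fun _ => ⟨contMDiffAt_id, rfl, rfl⟩⟩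

theorem HasMorphism.trans {S T R : Span.{u} I M} {u : S.U} {w : T.U} {z : R.U}
    (h : S.HasMorphism T u w) (h' : T.HasMorphism R w z) : S.HasMorphism R u z := by
  obtain ⟨f, rfl, hf⟩ := hasMorphism_iff.1 h
  obtain ⟨g, rfl, hg⟩ := hasMorphism_iff.1 h'
  refine hasMorphism_iff.2 ⟨g ∘ f, rfl, ?_⟩
  filter_upwards [hf, hf.self_of_nhds.1.continuousAt.eventually hg] with y h1 h2
  exact ⟨h2.1.comp y h1.1, h2.2.1.trans h1.2.1, h2.2.2.trans h1.2.2⟩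

theorem HasMorphism.s_eq {S T : Span.{u} I M} {u : S.U} {w : T.U} (h : S.HasMorphism T u w) :
    T.s w = S.s u := by
  obtain ⟨f, rfl, hf⟩ := hasMorphism_iff.1 h
  exact hf.self_of_nhds.2.2

theorem HasMorphism.t_eq {S T : Span.{u} I M} {u : S.U} {w : T.U} (h : S.HasMorphism T u w) :
    T.t w = S.t u := by
  obtain ⟨f, rfl, hf⟩ := hasMorphism_iff.1 h
  exact hf.self_of_nhds.2.1

theorem HasMorphism.carries {S T : Span.{u} I M} {u : S.U} {w : T.U} (h : S.HasMorphism T u w)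
    {φ : M → M} (hu : S.Carries u φ) : T.Carries w φ := by
  have hs := h.s_eq
  obtain ⟨f, rfl, hf⟩ := hasMorphism_iff.1 h
  obtain ⟨σ, hσu, hσ⟩ := hu
  have hσc : Tendsto σ (𝓝 (S.s u)) (𝓝 u) := by
    have := hσ.self_of_nhds.1.continuousAt
    rwa [ContinuousAt, hσu] at this
  refine ⟨f ∘ σ, by rw [hs, Function.comp_apply, hσu], ?_⟩
  rw [hs]
  filter_upwards [hσ, hσc.eventually hf] with x h1 h2
  exact ⟨h2.1.comp x h1.1, h2.2.2.trans h1.2.1, h2.2.1.trans h1.2.2⟩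

theorem Carries.t_eq {S : Span.{u} I M} {u : S.U} {φ : M → M} (hu : S.Carries u φ) :
    S.t u = φ (S.s u) := by
  obtain ⟨σ, hσu, hσ⟩ := hu
  have := hσ.self_of_nhds.2.2
  rwa [hσu] at this

theorem HasCompMorphism.eq {S S' T : Span.{u} I M} {u : S.U} {v : S'.U} {w : T.U}
    (h : S.HasCompMorphism S' T u v w) : S.s u = S'.t v ∧ T.s w = S'.s v ∧ T.t w = S.t u := by
  obtain ⟨huv, f, rfl, hf⟩ := hasCompMorphism_iff.1 h
  obtain ⟨h1, h2⟩ := hf.self_of_nhds.2 huv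
  exact ⟨huv, h2, h1⟩

theorem HasCompMorphism.carries_of_sections {S S' T : Span.{u} I M} {u : S.U} {v : S'.U} {w : T.U}
    (h : S.HasCompMorphism S' T u v w) {a : M → S.U} {b : M → S'.U} {φ : M → M}
    (ha : a (S'.s v) = u) (hb : b (S'.s v) = v)
    (hab : ∀ᶠ x in 𝓝 (S'.s v), ContMDiffAt I 𝓘(ℝ, S.Model) ∞ a x ∧
      ContMDiffAt I 𝓘(ℝ, S'.Model) ∞ b x ∧ S.s (a x) = S'.t (b x) ∧ S'.s (b x) = x ∧
      S.t (a x) = φ x) : T.Carries w φ := by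
  have hs := h.eq.2.1
  obtain ⟨huv, f, rfl, hf⟩ := hasCompMorphism_iff.1 h
  have hc : Tendsto (fun x => (a x, b x)) (𝓝 (S'.s v)) (𝓝 (u, v)) := by
    have h1 := hab.self_of_nhds.1.continuousAt
    have h2 := hab.self_of_nhds.2.1.continuousAt
    rw [ContinuousAt, ha] at h1
    rw [ContinuousAt, hb] at h2
    exact h1.prodMk_nhds h2
  refine ⟨fun x => f (a x, b x), by
    rw [hs]
    change f (a (S'.s v), b (S'.s v)) = _
    rw [ha, hb], ?_⟩
  rw [hs]
  filter_upwards [hab, hc.eventually hf] with x h1 h2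
  obtain ⟨h3, h4⟩ := h2.2 h1.2.2.1
  refine ⟨ContMDiffAt.comp x (g := f) h2.1 (h1.1.prodMk h1.2.1), h4.trans h1.2.2.2.1,
    h3.trans h1.2.2.2.2⟩

theorem HasCompMorphism.carries {S S' T : Span.{u} I M} {u : S.U} {v : S'.U} {w : T.U}
    (h : S.HasCompMorphism S' T u v w) {φ φ' : M → M} (hu : S.Carries u φ) (hv : S'.Carries v φ') :
    T.Carries w (φ ∘ φ') := by
  have huv := h.eq.1
  have htv := hv.t_eq
  obtain ⟨σ, hσu, hσ⟩ := hu
  obtain ⟨σ', hσv, hσ'⟩ := hv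
  have hc : ContMDiffAt I I ∞ (fun x => S'.t (σ' x)) (S'.s v) :=
    (S'.smooth_t _).comp _ hσ'.self_of_nhds.1
  have hc' : Tendsto (fun x => S'.t (σ' x)) (𝓝 (S'.s v)) (𝓝 (S.s u)) := by
    have := hc.continuousAt
    rwa [ContinuousAt, hσv, ← huv] at this
  refine h.carries_of_sections (a := fun x => σ (S'.t (σ' x))) (b := σ')
    (by rw [hσv, ← huv, hσu]) hσv ?_
  filter_upwards [hσ', hc'.eventually hσ] with x h1 h2
  refine ⟨ContMDiffAt.comp x (g := σ) h2.1 ((S'.smooth_t _).comp _ h1.1), h1.1, h2.2.1, h1.2.1, ?_⟩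
  rw [h2.2.2, h1.2.2]
  rfl

end Span

end Carries

section Groupoid

set_option linter.unusedSectionVars false

variable {E : Type*} [NormedAddCommGroup E] [NormedSpace ℝ E] [FiniteDimensional ℝ E]
  {M : Type*} [TopologicalSpace M] [ChartedSpace E M] [IsManifold 𝓘(ℝ, E) ∞ M]
  [T2Space M] [SecondCountableTopology M]
  {F : Submodule C^∞⟮𝓘(ℝ, E), M; ℝ⟯ (VF 𝓘(ℝ, E) M)}

theorem Span.IsBiSubmersion.exists_carries {S : Span.{u} 𝓘(ℝ, E) M} (hS : S.IsBiSubmersion F)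
    (u : S.U) : ∃ φ, S.Carries u φ := by
  obtain ⟨c, hc⟩ := exists_adaptedChart_of_surjective S
    (IsManifold.chart_mem_maximalAtlas (I := 𝓘(ℝ, E)) (S.s u))
    (IsManifold.chart_mem_maximalAtlas (I := 𝓘(ℝ, E)) (S.t u)) u (mem_chart_source _ _)
    (mem_chart_source _ _) (hS.submersion_s u)
  let ψ := chartAt E (S.s u)
  let a : E → S.Model := fun e => c.φ u + c.sec (e - c.ρ (c.φ u))
  have ha : ContDiff ℝ ∞ a := by fun_prop
  have ha₀ : a (ψ (S.s u)) = c.φ u := by simp [a, ψ, c.s_eq u hc]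
  let σ : M → S.U := fun x => c.φ.symm (a (ψ x))
  have hac : Tendsto (fun x => a (ψ x)) (𝓝 (S.s u)) (𝓝 (c.φ u)) := by
    rw [← ha₀]
    exact ha.continuous.continuousAt.tendsto.comp (ψ.continuousAt (mem_chart_source _ _))
  refine ⟨fun x => S.t (σ x), σ, ?_, ?_⟩
  · change c.φ.symm (a (ψ (S.s u))) = u
    rw [ha₀, c.φ.left_inv hc]
  · filter_upwards [hac.eventually (c.φ.open_target.mem_nhds (c.φ.map_source hc)),
      ψ.open_source.mem_nhds (mem_chart_source _ _)] with x h1 h2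
    refine ⟨(contMDiffAt_symm_of_mem_maximalAtlas c.mem h1).comp x
      (ha.contDiffAt.contMDiffAt.comp x (contMDiffAt_of_mem_maximalAtlas c.memₛ h2)), ?_, rfl⟩
    refine c.s_eq_of (c.φ.map_target h1) h2 ?_
    rw [c.φ.right_inv h1]
    simp [a, c.ρ_sec, ψ]

variable {ι : Type*} {𝒰 : ι → Span.{u} 𝓘(ℝ, E) M}

namespace IsAtlas

variable (hF : F ≤ compactFields 𝓘(ℝ, E) M) (h𝒰 : IsAtlas F 𝒰)
include hF h𝒰

theorem equivalence : Equivalence (Rel 𝒰) where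
  refl a := Span.HasMorphism.refl _ _
  symm {a b} h := by
    obtain ⟨φ, hφ⟩ := (h𝒰.biSubmersion a.1).exists_carries a.2
    exact Span.hasMorphism_of_carries hF (h𝒰.biSubmersion _) (h𝒰.biSubmersion _)
      (Span.HasMorphism.carries h hφ) hφ (Span.HasMorphism.s_eq h)
  trans h h' := Span.HasMorphism.trans h h'

theorem mk_eq_iff {i j : ι} {u : (𝒰 i).U} {w : (𝒰 j).U} :
    Arrow.mk i u = Arrow.mk j w ↔ (𝒰 i).HasMorphism (𝒰 j) u w := by
  refine ⟨fun h => ?_, fun h => Quot.sound h⟩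
  have := Quot.eqvGen_exact h
  rwa [(h𝒰.equivalence hF).eqvGen_iff] at this

theorem mk_eq_of_carries {i j : ι} {u : (𝒰 i).U} {w : (𝒰 j).U} {φ : M → M}
    (hu : (𝒰 i).Carries u φ) (hw : (𝒰 j).Carries w φ) (hs : (𝒰 i).s u = (𝒰 j).s w) :
    Arrow.mk i u = Arrow.mk j w :=
  (h𝒰.mk_eq_iff hF).2 (Span.hasMorphism_of_carries hF (h𝒰.biSubmersion _) (h𝒰.biSubmersion _)
    hu hw hs)

theorem isComp_mk_iff {i j l : ι} {u : (𝒰 i).U} {v : (𝒰 j).U} {w : (𝒰 l).U} :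
    Arrow.IsComp (Arrow.mk i u) (Arrow.mk j v) (Arrow.mk l w) ↔
      (𝒰 i).HasCompMorphism (𝒰 j) (𝒰 l) u v w := by
  refine ⟨?_, fun h => ⟨i, j, l, u, v, w, rfl, rfl, rfl, h⟩⟩
  rintro ⟨i', j', l', u', v', w', hu, hv, hw, h⟩
  rw [h𝒰.mk_eq_iff hF] at hu hv hw
  obtain ⟨φ, hφ⟩ := (h𝒰.biSubmersion i).exists_carries u
  obtain ⟨φ', hφ'⟩ := (h𝒰.biSubmersion j).exists_carries v
  have hw' := h.carries (hu.carries hφ) (hv.carries hφ')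
  have hs := (h𝒰.equivalence hF).symm (x := ⟨l, w⟩) (y := ⟨l', w'⟩) hw
  refine Span.hasCompMorphism_of_carries hF (h𝒰.biSubmersion _) (h𝒰.biSubmersion _)
    (h𝒰.biSubmersion _) hφ hφ' (Span.HasMorphism.carries hs hw') ?_ ?_
  · rw [← hu.s_eq, ← hv.t_eq, h.eq.1]
  · rw [← hw.s_eq, ← hv.s_eq, h.eq.2.1]

theorem exists_inverse (i : ι) (u : (𝒰 i).U) : ∃ (j : ι) (w : (𝒰 j).U),
    (∃ (l : ι) (z : (𝒰 l).U), (𝒰 j).HasCompMorphism (𝒰 i) (𝒰 l) w u z ∧ (𝒰 l).Carries z id) ∧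
    ∃ (l : ι) (z : (𝒰 l).U), (𝒰 i).HasCompMorphism (𝒰 j) (𝒰 l) u w z ∧ (𝒰 l).Carries z id := by
  obtain ⟨j, w, hw⟩ := h𝒰.inv_adapted i u
  refine ⟨j, w, ?_, ?_⟩
  · obtain ⟨l, z, hz⟩ := h𝒰.comp_adapted j i w u hw.s_eq
    refine ⟨l, z, hz, ?_⟩
    obtain ⟨φ, σ, hσu, hσ⟩ := (h𝒰.biSubmersion i).exists_carries u
    obtain ⟨f, rfl, hf⟩ := Span.hasMorphism_iff.1 hw
    have hσc : Tendsto σ (𝓝 ((𝒰 i).s u)) (𝓝 u) := by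
      have := hσ.self_of_nhds.1.continuousAt
      rwa [ContinuousAt, hσu] at this
    refine hz.carries_of_sections (a := fun x => f (σ x)) (b := σ) (congrArg f hσu) hσu ?_
    filter_upwards [hσ, hσc.eventually hf] with x h1 h2
    exact ⟨h2.1.comp x h1.1, h1.1, h2.2.2, h1.2.1, h2.2.1.trans h1.2.1⟩
  · obtain ⟨l, z, hz⟩ := h𝒰.comp_adapted i j u w hw.t_eq.symm
    refine ⟨l, z, hz, ?_⟩
    have hs := hw.s_eq
    obtain ⟨φ, σ, hσu, hσ⟩ := (h𝒰.biSubmersion i).inv.exists_carries u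
    obtain ⟨f, rfl, hf⟩ := Span.hasMorphism_iff.1 hw
    have hσc : Tendsto σ (𝓝 ((𝒰 i).inv.s u)) (𝓝 u) := by
      have := hσ.self_of_nhds.1.continuousAt
      rwa [ContinuousAt, hσu] at this
    refine hz.carries_of_sections (a := σ) (b := fun x => f (σ x)) ?_ ?_ ?_
    · rw [hs, hσu]
    · rw [hs, hσu]
    · rw [hs]
      filter_upwards [hσ, hσc.eventually hf] with x h1 h2
      exact ⟨h1.1, h2.1.comp x h1.1, h2.2.1.symm, h2.2.2.trans h1.2.1, h1.2.1⟩

theorem exists_unit (x : M) : ∃ (l : ι) (z : (𝒰 l).U), (𝒰 l).s z = x ∧ (𝒰 l).Carries z id := by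
  obtain ⟨i, u, rfl⟩ := h𝒰.cover x
  obtain ⟨j, w, ⟨l, z, hz, hz'⟩, -⟩ := h𝒰.exists_inverse hF i u
  exact ⟨l, z, hz.eq.2.1, hz'⟩

theorem isGroupoid : IsGroupoid (Arrow.src (𝒰 := 𝒰)) Arrow.tgt Arrow.IsComp where
  composable := by
    rintro _ _ _ ⟨i, j, l, u, v, w, rfl, rfl, rfl, h⟩
    exact h.eq
  existsUnique_comp := by
    rintro ⟨i, u⟩ ⟨j, v⟩ huv
    obtain ⟨l, w, hw⟩ := h𝒰.comp_adapted i j u v huv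
    refine ⟨Arrow.mk l w, ⟨i, j, l, u, v, w, rfl, rfl, rfl, hw⟩, ?_⟩
    rintro ⟨l', w'⟩ hw'
    have hw' := (h𝒰.isComp_mk_iff hF).1 hw'
    obtain ⟨φ, hφ⟩ := (h𝒰.biSubmersion i).exists_carries u
    obtain ⟨φ', hφ'⟩ := (h𝒰.biSubmersion j).exists_carries v
    exact h𝒰.mk_eq_of_carries hF (hw'.carries hφ hφ') (hw.carries hφ hφ')
      (hw'.eq.2.1.trans hw.eq.2.1.symm)
  assoc := by
    rintro ⟨i, g⟩ ⟨j, h⟩ ⟨l, k⟩ ⟨m, a⟩ ⟨n, b⟩ ⟨p, c⟩ h1 h2 h3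
    replace h1 := (h𝒰.isComp_mk_iff hF).1 h1
    replace h2 := (h𝒰.isComp_mk_iff hF).1 h2
    replace h3 := (h𝒰.isComp_mk_iff hF).1 h3
    obtain ⟨φ, hφ⟩ := (h𝒰.biSubmersion i).exists_carries g
    obtain ⟨φ', hφ'⟩ := (h𝒰.biSubmersion j).exists_carries h
    obtain ⟨φ'', hφ''⟩ := (h𝒰.biSubmersion l).exists_carries k
    have ha : (𝒰 m).Carries a (φ ∘ φ') := h1.carries hφ hφ'
    have hc : (𝒰 p).Carries c ((φ ∘ φ') ∘ φ'') := h3.carries ha hφ''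
    refine (h𝒰.isComp_mk_iff hF).2 (Span.hasCompMorphism_of_carries hF (h𝒰.biSubmersion _)
      (h𝒰.biSubmersion _) (h𝒰.biSubmersion _) hφ (h2.carries hφ' hφ'') hc ?_ ?_)
    · rw [h2.eq.2.2, h1.eq.1]
    · rw [h2.eq.2.1, h3.eq.2.1]
  unit_inv := by
    choose l z hz hz' using h𝒰.exists_unit hF
    have ht : ∀ x, (𝒰 (l x)).t (z x) = x := fun x => by rw [(hz' x).t_eq, hz]; rfl
    refine ⟨fun x => Arrow.mk (l x) (z x), fun x => ⟨hz x, ht x⟩, ?_, ?_⟩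
    · rintro ⟨i, g⟩
      obtain ⟨φ, hφ⟩ := (h𝒰.biSubmersion i).exists_carries g
      constructor
      · refine (h𝒰.isComp_mk_iff hF).2 (Span.hasCompMorphism_of_carries hF (h𝒰.biSubmersion _)
          (h𝒰.biSubmersion _) (h𝒰.biSubmersion _) hφ (hz' _) hφ ?_ ?_)
        · exact (ht _).symm
        · exact (hz _).symm
      · refine (h𝒰.isComp_mk_iff hF).2 (Span.hasCompMorphism_of_carries hF (h𝒰.biSubmersion _)
          (h𝒰.biSubmersion _) (h𝒰.biSubmersion _) (hz' _) hφ hφ ?_ rfl)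
        exact hz _
    · rintro ⟨i, g⟩
      obtain ⟨j, w, ⟨m, y, hy, hy'⟩, n, y', hyn, hyn'⟩ := h𝒰.exists_inverse hF i g
      refine ⟨Arrow.mk j w, ?_, ?_⟩
      · have : Arrow.mk m y = Arrow.mk (l ((𝒰 i).s g)) (z ((𝒰 i).s g)) :=
          h𝒰.mk_eq_of_carries hF hy' (hz' _) (hy.eq.2.1.trans (hz _).symm)
        refine Eq.mp ?_ ((h𝒰.isComp_mk_iff hF).2 hy)
        rw [this]
        rfl
      · have : Arrow.mk n y' = Arrow.mk (l ((𝒰 i).t g)) (z ((𝒰 i).t g)) := by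
          refine h𝒰.mk_eq_of_carries hF hyn' (hz' _) ?_
          rw [hz, ← hyn.eq.2.2, hyn'.t_eq]
          rfl
        refine Eq.mp ?_ ((h𝒰.isComp_mk_iff hF).2 hyn)
        rw [this]
        rfl

end IsAtlas

end Groupoid

section Transfer

variable {E : Type*} [NormedAddCommGroup E] [NormedSpace ℝ E] [FiniteDimensional ℝ E]
  {I : ModelWithCorners ℝ E E}
  {M : Type*} [TopologicalSpace M] [ChartedSpace E M] [IsManifold I ∞ M]
  [T2Space M] [SecondCountableTopology M]
  {F : Submodule C^∞⟮I, M; ℝ⟯ (VF I M)}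

theorem Span.hasMorphism_of_carries_of_eq (hI : I = 𝓘(ℝ, E)) (hF : F ≤ compactFields I M)
    {S T : Span.{u} I M}
    (hS : S.IsBiSubmersion F) (hT : T.IsBiSubmersion F) {u : S.U} {w : T.U} {h : M → M}
    (hu : S.Carries u h) (hw : T.Carries w h) (hs : S.s u = T.s w) : S.HasMorphism T u w := by
  subst hI
  exact hasMorphism_of_carries hF hS hT hu hw hs

theorem Span.hasCompMorphism_of_carries_of_eq (hI : I = 𝓘(ℝ, E)) (hF : F ≤ compactFields I M)
    {S S' T : Span.{u} I M}
    (hS : S.IsBiSubmersion F) (hS' : S'.IsBiSubmersion F) (hT : T.IsBiSubmersion F)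
    {u : S.U} {v : S'.U} {w : T.U} {h h' : M → M} (hu : S.Carries u h) (hv : S'.Carries v h')
    (hw : T.Carries w (h ∘ h')) (huv : S.s u = S'.t v) (hs : T.s w = S'.s v) :
    S.HasCompMorphism S' T u v w := by
  subst hI
  exact hasCompMorphism_of_carries hF hS hS' hT hu hv hw huv hs

variable {ι : Type*} {𝒰 : ι → Span.{u} I M}

theorem IsAtlas.equivalence_of_eq (hI : I = 𝓘(ℝ, E)) (hF : F ≤ compactFields I M)
    (h𝒰 : IsAtlas F 𝒰) : Equivalence (Rel 𝒰) := by
  subst hI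
  exact h𝒰.equivalence hF

theorem IsAtlas.isGroupoid_of_eq (hI : I = 𝓘(ℝ, E)) (hF : F ≤ compactFields I M)
    (h𝒰 : IsAtlas F 𝒰) : IsGroupoid (Arrow.src (𝒰 := 𝒰)) Arrow.tgt Arrow.IsComp := by
  subst hI
  exact h𝒰.isGroupoid hF

theorem IsAtlas.isComp_mk_iff_of_eq (hI : I = 𝓘(ℝ, E)) (hF : F ≤ compactFields I M)
    (h𝒰 : IsAtlas F 𝒰) {i j l : ι} {u : (𝒰 i).U} {v : (𝒰 j).U} {w : (𝒰 l).U} :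
    Arrow.IsComp (Arrow.mk i u) (Arrow.mk j v) (Arrow.mk l w) ↔
      (𝒰 i).HasCompMorphism (𝒰 j) (𝒰 l) u v w := by
  subst hI
  exact h𝒰.isComp_mk_iff hF

end Transfer

section DeformChart

set_option linter.unusedSectionVars false

variable {E : Type*} [NormedAddCommGroup E] [NormedSpace ℝ E]
  {M : Type*} [TopologicalSpace M] [ChartedSpace E M] [IsManifold 𝓘(ℝ, E) ∞ M]

/-- A chart of `D(U, V)` above a chart of `U` in which `s` is a linear projection. The functions
`m` and `n` are inverse of each other on the allowed values of `β`, and the dilations of factor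
`β` act on the kernel of the projection by `β * m β`. -/
structure DeformChart (S : Span.{u} 𝓘(ℝ, E) M) (V : Submfd S.Model S.U)
    (ψs ψt : OpenPartialHomeomorph M E) extends AdaptedChart S ψs ψt where
  d : DNC.ChartData V
  d_φ : d.φ = φ
  ρ_π : ∀ x, ρ (d.π x) = ρ x
  m : ℝ → ℝ
  n : ℝ → ℝ
  m_smooth : ∀ β ∈ d.B, ContDiffAt ℝ ∞ m β
  n_smooth : ContDiff ℝ ∞ n
  n_mul_m : ∀ β ∈ d.B, n β * m β = 1
  dil_ker : ∀ β ∈ d.B, ∀ x, ρ x = 0 → dil d.π β x = (β * m β) • x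

/-- A chart of `D(U, V)` near the zero section, in which moreover `V` is a linear section of the
projection given by `s`. -/
structure NormalChart (S : Span.{u} 𝓘(ℝ, E) M) (V : Submfd S.Model S.U)
    (ψs ψt : OpenPartialHomeomorph M E) extends AdaptedChart S ψs ψt where
  slice : ∀ u ∈ φ.source, u ∈ V.carrier ↔ sec (ρ (φ u)) = φ u

/-- The chart data given by a chart in which `V` is a linear section. -/
def NormalChart.data {S : Span.{u} 𝓘(ℝ, E) M} {V : Submfd S.Model S.U}
    {ψs ψt : OpenPartialHomeomorph M E} (c : NormalChart S V ψs ψt) : DNC.ChartData V where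
  φ := c.φ
  mem := c.mem
  π := c.sec.comp c.ρ
  idem := fun e => by simp [c.ρ_sec]
  B := univ
  isOpen_B := isOpen_univ
  slice := fun _ => c.slice

/-- The chart of `D(U, V)` given by a chart in which `V` is a linear section. -/
def NormalChart.deform {S : Span.{u} 𝓘(ℝ, E) M} {V : Submfd S.Model S.U}
    {ψs ψt : OpenPartialHomeomorph M E} (c : NormalChart S V ψs ψt) : DeformChart S V ψs ψt where
  toAdaptedChart := c.toAdaptedChart
  d := c.data
  d_φ := rfl
  ρ_π := fun x => by simp [NormalChart.data, c.ρ_sec]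
  m := fun _ => 1
  n := fun _ => 1
  m_smooth := fun _ _ => contDiffAt_const
  n_smooth := contDiff_const
  n_mul_m := fun _ _ => one_mul 1
  dil_ker := fun β _ x hx => by simp [dil, NormalChart.data, hx]

/-- The chart of `U × ℝ^*` given by a chart of `U`. -/
noncomputable def AdaptedChart.deformOff {S : Span.{u} 𝓘(ℝ, E) M} (V : Submfd S.Model S.U)
    {ψs ψt : OpenPartialHomeomorph M E} (c : AdaptedChart S ψs ψt) : DeformChart S V ψs ψt where
  toAdaptedChart := c
  d := ⟨c.φ, c.mem, ContinuousLinearMap.id ℝ _, fun _ => rfl, {0}ᶜ, isOpen_compl_singleton,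
    fun h => absurd rfl h⟩
  d_φ := rfl
  ρ_π := fun _ => rfl
  m := fun β => β⁻¹
  n := fun β => β
  m_smooth := fun _ hβ => contDiffAt_inv ℝ hβ
  n_smooth := contDiff_id
  n_mul_m := fun _ hβ => mul_inv_cancel₀ hβ
  dil_ker := fun β hβ x _ => by
    rw [mul_inv_cancel₀ hβ, one_smul]
    simp [dil]

theorem exists_normalChart [FiniteDimensional ℝ E] {S : Span.{u} 𝓘(ℝ, E) M}
    {V : Submfd S.Model S.U} (hV : S.IsIdentityBisection V)
    {ψs ψt : OpenPartialHomeomorph M E}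
    (hψs : ψs ∈ IsManifold.maximalAtlas 𝓘(ℝ, E) ∞ M)
    (hψt : ψt ∈ IsManifold.maximalAtlas 𝓘(ℝ, E) ∞ M) {v : S.U} (hv : v ∈ V.carrier)
    (hs : S.s v ∈ ψs.source) (ht : S.t v ∈ ψt.source) :
    ∃ c : NormalChart S V ψs ψt, v ∈ c.φ.source := by
  obtain ⟨d, hd, hB⟩ := DNC.exists_onData V ⟨v, hv⟩
  have h0 : (0 : ℝ) ∈ d.B := hB ▸ mem_univ _
  let L := fderiv ℝ (fun e => ψs (S.s (d.φ.symm e))) (d.φ v)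
  have hLd : ∀ ξ, chartD ψs (S.s v) (S.ds v ξ) = L (d.d v ξ) := fun ξ =>
    chartD_mfderiv d.mem hψs (Span.contMDiff_mdiff S.smooth_s v) hd hs ξ
  have htan : ∀ ξ, ξ ∈ V.tangent v ↔ d.π (d.d v ξ) = d.d v ξ := fun ξ => d.mem_tangent h0 hd hv ξ
  let R : Submodule ℝ S.Model := LinearMap.range d.π.toLinearMap
  have hR : ∀ x ∈ R, d.π x = x := by
    rintro _ ⟨y, rfl⟩
    exact d.idem y
  have hbij : Function.Bijective (L.toLinearMap.comp R.subtype) := by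
    constructor
    · rw [injective_iff_map_eq_zero]
      rintro ⟨x, hx⟩ hLx
      obtain ⟨ξ, rfl⟩ : ∃ ξ, d.d v ξ = x := chartD_surjective d.mem hd x
      have h1 : L (d.d v ξ) = 0 := hLx
      rw [← hLd] at h1
      have h2 : S.ds v ξ = 0 := chartD_injective hψs hs (h1.trans (map_zero _).symm)
      have hξ : ξ ∈ V.tangent v := (htan ξ).2 (hR _ hx)
      have h3 : (⟨ξ, hξ⟩ : V.tangent v) = 0 :=
        (hV.etale v hv).1 (h2.trans (map_zero (S.ds v)).symm)
      have h4 : ξ = 0 := congrArg Subtype.val h3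
      exact Subtype.ext ((congrArg (d.d v) h4).trans (map_zero (d.d v)))
    · intro e
      obtain ⟨y, rfl⟩ := chartD_surjective hψs hs e
      obtain ⟨⟨ξ, hξ⟩, rfl⟩ := (hV.etale v hv).2 y
      exact ⟨⟨d.d v ξ, ⟨d.d v ξ, (htan ξ).1 hξ⟩⟩, (hLd ξ).symm⟩
  let Λ : R ≃ₗ[ℝ] E := LinearEquiv.ofBijective _ hbij
  let A : E →L[ℝ] S.Model := LinearMap.toContinuousLinearMap (R.subtype.comp Λ.symm.toLinearMap)
  have hLA : ∀ e, L (A e) = e := fun e => Λ.apply_symm_apply e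
  have hπA : ∀ e, d.π (A e) = A e := fun e => hR _ (Λ.symm e).2
  obtain ⟨c, hvc, hsub, hsec, hc⟩ := exists_adaptedChart S hψs hψt d.mem hd hs ht L rfl A d.π hLA
    hπA (fun x => by
      have : Λ.symm (Λ ⟨d.π x, ⟨x, rfl⟩⟩) = ⟨d.π x, ⟨x, rfl⟩⟩ := Λ.symm_apply_apply _
      exact congrArg Subtype.val this)
  refine ⟨⟨c, fun u hu => ?_⟩, hvc⟩
  rw [d.slice h0 u (hsub hu), hsec, ← c.s_eq u hu, hc u hu, left_eq_add, sub_eq_zero, eq_comm]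

/-- The map `f ∘ q`, from `D(U, V)` to `M × ℝ`. -/
def deformMap {S : Span.{u} 𝓘(ℝ, E) M} (V : Submfd S.Model S.U) (f : S.U → M) (y : DNC V) : M × ℝ :=
  (f (DNC.q y).1, (DNC.q y).2)

/-- The differential of `f ∘ q`. -/
noncomputable def deformD {S : Span.{u} 𝓘(ℝ, E) M} (V : Submfd S.Model S.U) (f : S.U → M)
    (y : DNC V) : S.Model × ℝ →L[ℝ] E × ℝ :=
  mfderiv 𝓘(ℝ, S.Model × ℝ) (𝓘(ℝ, E).prod 𝓘(ℝ)) (deformMap V f) y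

theorem contMDiff_deformMap {S : Span.{u} 𝓘(ℝ, E) M} {V : Submfd S.Model S.U} {f : S.U → M}
    (hf : ContMDiff 𝓘(ℝ, S.Model) 𝓘(ℝ, E) ∞ f) :
    ContMDiff 𝓘(ℝ, S.Model × ℝ) (𝓘(ℝ, E).prod 𝓘(ℝ)) ∞ (deformMap V f) :=
  (hf.comp (contMDiff_fst.comp DNC.contMDiff_q)).prodMk (contMDiff_snd.comp DNC.contMDiff_q)

namespace DeformChart

variable {S : Span.{u} 𝓘(ℝ, E) M} {V : Submfd S.Model S.U}
  {ψs ψt : OpenPartialHomeomorph M E} (D : DeformChart S V ψs ψt)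

/-- The point of the chart of `U` below a point of the chart of `D(U, V)`. -/
def pt (p : S.Model × ℝ) : S.Model := dil D.d.π p.2 p.1

theorem contDiff_pt : ContDiff ℝ ∞ D.pt := contDiff_dil _

theorem ρ_dil (β : ℝ) (x : S.Model) : D.ρ (dil D.d.π β x) = D.ρ x := by
  simp [dil, D.ρ_π]

theorem chart_mem : D.d.chart ∈ IsManifold.maximalAtlas 𝓘(ℝ, S.Model × ℝ) ∞ (DNC V) :=
  IsManifold.subset_maximalAtlas D.d.chart_mem_atlas

theorem mem_source_iff {y : DNC V} :
    y ∈ D.d.chart.source ↔ (DNC.q y).1 ∈ D.φ.source ∧ (DNC.q y).2 ∈ D.d.B := by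
  rw [← D.d_φ]; rfl

theorem mem_target_iff {p : S.Model × ℝ} :
    p ∈ D.d.chart.target ↔ D.pt p ∈ D.φ.target ∧ p.2 ∈ D.d.B := by
  rw [← D.d_φ]; rfl

theorem q_symm {p : S.Model × ℝ} (hp : p ∈ D.d.chart.target) :
    DNC.q (D.d.chart.symm p) = (D.φ.symm (D.pt p), p.2) := by
  have := D.d.q_eq (D.d.chart.map_target hp)
  rw [D.d.chart.right_inv hp, D.d_φ] at this
  exact this

theorem q_eq {y : DNC V} (hy : y ∈ D.d.chart.source) :
    DNC.q y = (D.φ.symm (D.pt (D.d.chart y)), (D.d.chart y).2) := by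
  have := D.d.q_eq hy
  rw [D.d_φ] at this
  exact this

theorem φ_q {y : DNC V} (hy : y ∈ D.d.chart.source) :
    D.φ (DNC.q y).1 = D.pt (D.d.chart y) := by
  rw [D.q_eq hy, D.φ.right_inv (D.mem_target_iff.1 (D.d.chart.map_source hy)).1]

theorem contMDiff_q_fst : ContMDiff 𝓘(ℝ, S.Model × ℝ) 𝓘(ℝ, S.Model) ∞
    fun y : DNC V => (DNC.q y).1 := contMDiff_fst.comp DNC.contMDiff_q

/-- The differential of the target map of `D(U, V)`, in charts. -/
theorem hasMFDerivAt_of {f : S.U → M} (hf : ContMDiff 𝓘(ℝ, S.Model) 𝓘(ℝ, E) ∞ f)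
    {ψ : OpenPartialHomeomorph M E} (hψ : ψ ∈ IsManifold.maximalAtlas 𝓘(ℝ, E) ∞ M)
    {y : DNC V} (hy : y ∈ D.d.chart.source)
    (hfy : f (DNC.q y).1 ∈ ψ.source) (x : S.Model × ℝ) :
    chartD ψ (f (DNC.q y).1) (deformD V f y x).1 =
      fderiv ℝ (fun e => ψ (f (D.φ.symm e))) (D.pt (D.d.chart y))
        (dil D.d.π (D.d.chart y).2 (chartD D.d.chart y x).1 +
          (chartD D.d.chart y x).2 • ((D.d.chart y).1 - D.d.π (D.d.chart y).1)) ∧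
      (deformD V f y x).2 = (chartD D.d.chart y x).2 := by
  have hf' : ContMDiff 𝓘(ℝ, S.Model × ℝ) 𝓘(ℝ, E) ∞ fun y : DNC V => f (DNC.q y).1 :=
    hf.comp contMDiff_q_fst
  have h1 := (hf' y).mdifferentiableAt (by simp)
  have hq : ContMDiff 𝓘(ℝ, S.Model × ℝ) 𝓘(ℝ) ∞ fun y : DNC V => (DNC.q y).2 :=
    contMDiff_snd.comp DNC.contMDiff_q
  have h2 := (hq y).mdifferentiableAt (by simp)
  have hT : deformD V f y = ContinuousLinearMap.prod
      (mfderiv 𝓘(ℝ, S.Model × ℝ) 𝓘(ℝ, E) (fun y : DNC V => f (DNC.q y).1) y :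
        S.Model × ℝ →L[ℝ] E)
      (mfderiv 𝓘(ℝ, S.Model × ℝ) 𝓘(ℝ) (fun y : DNC V => (DNC.q y).2) y : S.Model × ℝ →L[ℝ] ℝ) :=
    mfderiv_prodMk h1 h2
  have hyt := D.d.chart.map_source hy
  have hpt := (D.mem_target_iff.1 hyt).1
  constructor
  · rw [hT]
    refine (chartD_mfderiv D.chart_mem hψ h1 hy hfy x).trans ?_
    have heq : (fun p => ψ (f (DNC.q (D.d.chart.symm p)).1)) =ᶠ[𝓝 (D.d.chart y)]
        fun p => ψ (f (D.φ.symm (D.pt p))) := by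
      filter_upwards [D.d.chart.open_target.mem_nhds hyt] with p hp
      rw [D.q_symm hp]
    rw [heq.fderiv_eq]
    have h3 : HasFDerivAt D.pt (((D.d.π + (D.d.chart y).2 •
        (ContinuousLinearMap.id ℝ S.Model - D.d.π)).comp (ContinuousLinearMap.fst ℝ _ _)) +
        (ContinuousLinearMap.snd ℝ S.Model ℝ).smulRight
          ((D.d.chart y).1 - D.d.π (D.d.chart y).1)) (D.d.chart y) := by
      have e1 : HasFDerivAt (fun p : S.Model × ℝ => D.d.π p.1)
        (D.d.π.comp (ContinuousLinearMap.fst ℝ _ _)) (D.d.chart y) :=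
          D.d.π.hasFDerivAt.comp _ hasFDerivAt_fst
      have e2 := (hasFDerivAt_snd (𝕜 := ℝ) (p := D.d.chart y)).smul
        ((hasFDerivAt_fst (𝕜 := ℝ) (p := D.d.chart y)).sub e1)
      refine (e1.add e2).congr_fderiv ?_
      ext <;> simp
    have h4 : DifferentiableAt ℝ (fun e => ψ (f (D.φ.symm e))) (D.pt (D.d.chart y)) := by
      refine (contDiffAt_chart hf hψ D.mem hpt ?_).differentiableAt (by simp)
      rw [← D.φ_q hy, D.φ.left_inv (D.mem_source_iff.1 hy).1]
      exact hfy
    have h5 : HasFDerivAt (fun p => ψ (f (D.φ.symm (D.pt p)))) _ (D.d.chart y) :=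
      h4.hasFDerivAt.comp (D.d.chart y) h3
    rw [h5.fderiv]
    refine congrArg (fderiv ℝ (fun e => ψ (f (D.φ.symm e))) (D.pt (D.d.chart y))) ?_
    simp [dil]
  · rw [hT]
    have h6 : HasMFDerivAt 𝓘(ℝ, S.Model × ℝ) 𝓘(ℝ, S.Model × ℝ) D.d.chart y
        (chartD D.d.chart y : S.Model × ℝ →L[ℝ] S.Model × ℝ) :=
      ((mdifferentiable_of_mem_maximalAtlas D.chart_mem).mdifferentiableAt hy).hasMFDerivAt
    have h7 : HasMFDerivAt 𝓘(ℝ, S.Model × ℝ) 𝓘(ℝ) (fun y : DNC V => (DNC.q y).2) y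
        ((ContinuousLinearMap.snd ℝ S.Model ℝ).comp (chartD D.d.chart y) :
          S.Model × ℝ →L[ℝ] ℝ) := by
      have h8 := (ContinuousLinearMap.snd ℝ S.Model ℝ).hasFDerivAt (x := D.d.chart y)
      refine (h8.hasMFDerivAt.comp y h6).congr_of_eventuallyEq ?_
      filter_upwards [D.d.chart.open_source.mem_nhds hy] with z hz
      rw [D.q_eq hz]
      rfl
    have h9 : (mfderiv 𝓘(ℝ, S.Model × ℝ) 𝓘(ℝ) (fun y : DNC V => (DNC.q y).2) y :
        S.Model × ℝ →L[ℝ] ℝ) = (ContinuousLinearMap.snd ℝ S.Model ℝ).comp (chartD D.d.chart y) :=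
      h7.mfderiv
    rw [h9]
    rfl

theorem chartD_dt {y : DNC V} (hy : y ∈ D.d.chart.source) (x : S.Model × ℝ) :
    chartD ψt (S.t (DNC.q y).1) (deformD V S.t y x).1 =
      fderiv ℝ D.τ (D.pt (D.d.chart y))
        (dil D.d.π (D.d.chart y).2 (chartD D.d.chart y x).1 +
          (chartD D.d.chart y x).2 • ((D.d.chart y).1 - D.d.π (D.d.chart y).1)) ∧
      (deformD V S.t y x).2 = (chartD D.d.chart y x).2 :=
  D.hasMFDerivAt_of S.smooth_t D.memₜ hy (D.t_mem _ (D.mem_source_iff.1 hy).1) x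

theorem chartD_ds {y : DNC V} (hy : y ∈ D.d.chart.source) (x : S.Model × ℝ) :
    chartD ψs (S.s (DNC.q y).1) (deformD V S.s y x).1 = D.ρ (chartD D.d.chart y x).1 ∧
      (deformD V S.s y x).2 = (chartD D.d.chart y x).2 := by
  obtain ⟨h1, h2⟩ :=
    D.hasMFDerivAt_of S.smooth_s D.memₛ hy (D.s_mem _ (D.mem_source_iff.1 hy).1) x
  refine ⟨h1.trans ?_, h2⟩
  have heq : (fun e => ψs (S.s (D.φ.symm e))) =ᶠ[𝓝 (D.pt (D.d.chart y))] D.ρ := by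
    filter_upwards [D.φ.open_target.mem_nhds
      (D.mem_target_iff.1 (D.d.chart.map_source hy)).1] with e he
    rw [D.s_eq _ (D.φ.map_target he), D.φ.right_inv he]
  rw [heq.fderiv_eq, D.ρ.fderiv, map_add, D.ρ_dil, map_smul, map_sub, D.ρ_π, sub_self, smul_zero,
    add_zero]

theorem ds_eq_zero_iff {y : DNC V} (hy : y ∈ D.d.chart.source) (x : S.Model × ℝ) :
    deformD V S.s y x = 0 ↔ D.ρ (chartD D.d.chart y x).1 = 0 ∧ (chartD D.d.chart y x).2 = 0 := by
  obtain ⟨h1, h2⟩ := D.chartD_ds hy x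
  rw [← h1, ← h2]
  constructor
  · intro h
    have h3 : (deformD V S.s y x).1 = 0 := congrArg Prod.fst h
    have h4 : (deformD V S.s y x).2 = 0 := congrArg Prod.snd h
    exact ⟨by rw [h3, map_zero], h4⟩
  · rintro ⟨h3, h4⟩
    refine Prod.ext (chartD_injective D.memₛ (D.s_mem _ (D.mem_source_iff.1 hy).1) ?_) h4
    exact h3.trans (map_zero _).symm

end DeformChart

theorem exists_deformChart [FiniteDimensional ℝ E] {S : Span.{u} 𝓘(ℝ, E) M}
    {V : Submfd S.Model S.U} (hV : S.IsIdentityBisection V)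
    (hS : ∀ u, Function.Surjective (S.ds u)) (y : DNC V)
    {ψs ψt : OpenPartialHomeomorph M E}
    (hψs : ψs ∈ IsManifold.maximalAtlas 𝓘(ℝ, E) ∞ M)
    (hψt : ψt ∈ IsManifold.maximalAtlas 𝓘(ℝ, E) ∞ M)
    (hs : S.s (DNC.q y).1 ∈ ψs.source) (ht : S.t (DNC.q y).1 ∈ ψt.source) :
    ∃ D : DeformChart S V ψs ψt, y ∈ D.d.chart.source := by
  rcases y with ⟨u, β, hβ⟩ | ⟨⟨v, hv⟩, n⟩
  · obtain ⟨c, hc⟩ := exists_adaptedChart_of_surjective S hψs hψt u hs ht (hS u)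
    exact ⟨c.deformOff V, hc, hβ⟩
  · obtain ⟨c, hc⟩ := exists_normalChart hV hψs hψt hv hs ht
    exact ⟨c.deform, hc, mem_univ _⟩

end DeformChart

section Criterion

variable {E : Type*} [NormedAddCommGroup E] [NormedSpace ℝ E] {H : Type*} [TopologicalSpace H]
  {I : ModelWithCorners ℝ E H} {M : Type*} [TopologicalSpace M] [ChartedSpace H M]
  {F : Submodule C^∞⟮I, M; ℝ⟯ (VF I M)} {W : Type*} [NormedAddCommGroup W] [NormedSpace ℝ W]
  [FiniteDimensional ℝ W] {N : Type*} [TopologicalSpace N] [ChartedSpace W N]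
  [IsManifold 𝓘(ℝ, W) ∞ N] [T2Space N] {s t : N → M}

theorem exists_mem_verticalFields {φ : OpenPartialHomeomorph N W}
    (hφ : φ ∈ IsManifold.maximalAtlas 𝓘(ℝ, W) ∞ N) {u₀ : N} (hu₀ : u₀ ∈ φ.source)
    {a : W → W} (ha : ∀ᶠ e in 𝓝 (φ u₀), ContDiffAt ℝ ∞ a e)
    (hs : ∀ᶠ y in 𝓝 u₀, ∀ x, chartD φ y x = a (φ y) → mfderiv 𝓘(ℝ, W) I s y x = 0) :
    ∃ Z ∈ verticalFields 𝓘(ℝ, W) I s, ∀ᶠ y in 𝓝 u₀, chartD φ y (Z y) = a (φ y) := by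
  obtain ⟨X₀, hX₀, hX₀a⟩ := exists_compactField hφ hu₀ ha
  obtain ⟨χ, -, h2, h3⟩ := exists_bump 𝓘(ℝ, W) (inter_mem hX₀a hs)
  refine ⟨χ • X₀, ⟨Submodule.smul_mem _ χ hX₀, ?_⟩, ?_⟩
  · rw [SetLike.mem_coe, LinearMap.mem_ker, map_smul]
    funext u
    change χ u • mfderiv 𝓘(ℝ, W) I s u (X₀ u) = 0
    by_cases hu : u ∈ tsupport χ
    · exact (congrArg (χ u • ·) ((h2 hu).2 _ (h2 hu).1)).trans (smul_zero _)
    · rw [image_eq_zero_of_notMem_tsupport hu]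
      exact zero_smul ℝ _
  · filter_upwards [hX₀a, h3] with y h4 h5
    have : (χ • X₀ : VF 𝓘(ℝ, W) N) y = X₀ y := by
      change χ y • X₀ y = X₀ y
      rw [h5, one_smul]
    rw [this, h4]

variable [SecondCountableTopology N]

theorem pullback_eq_sup
    (h1 : ∀ Y ∈ F, ∀ u, ∃ Z ∈ verticalFields 𝓘(ℝ, W) I s,
      ∀ᶠ y in 𝓝 u, mfderiv 𝓘(ℝ, W) I t y (Z y) = Y (t y))
    (h2 : ∀ X ∈ verticalFields 𝓘(ℝ, W) I s, ∀ u,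
      ∃ B ∈ Submodule.span C^∞⟮𝓘(ℝ, W), N; ℝ⟯
        {Z : Sections fun u : N => TangentSpace I (t u) | ∃ Y ∈ F, Z = fun u => Y (t u)},
      ∀ᶠ y in 𝓝 u, mfderiv 𝓘(ℝ, W) I t y (X y) = B y) :
    pullback 𝓘(ℝ, W) F t =
      verticalFields 𝓘(ℝ, W) I s ⊔ verticalFields 𝓘(ℝ, W) I t := by
  have hsupp : ∀ X : VF 𝓘(ℝ, W) N, ∀ x ∉ supp X, X x = 0 := fun X x hx => by
    by_contra h
    exact hx (subset_closure h)
  apply le_antisymm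
  · intro X hX
    refine mem_of_locally _ X hX.1.2 (hsupp X) fun x _ => ?_
    obtain ⟨n, f, g, hfg⟩ := Submodule.mem_span_set'.1 hX.2
    choose Y hY hgY using fun k => (g k).2
    choose Z hZ hZY using fun k => h1 (Y k) (hY k) x
    refine ⟨interior {y | ∀ k, mfderiv 𝓘(ℝ, W) I t y (Z k y) = Y k (t y)}, isOpen_interior,
      mem_interior_iff_mem_nhds.2 (eventually_all.2 hZY), fun ρ hρ _ => ?_⟩
    have hA : ∑ k, (ρ * f k) • Z k ∈ verticalFields 𝓘(ℝ, W) I s :=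
      Submodule.sum_mem _ fun k _ => Submodule.smul_mem _ _ (hZ k)
    have hB : ρ • X - ∑ k, (ρ * f k) • Z k ∈ verticalFields 𝓘(ℝ, W) I t := by
      refine ⟨Submodule.sub_mem _ (Submodule.smul_mem _ _ hX.1) hA.1, ?_⟩
      rw [SetLike.mem_coe, LinearMap.mem_ker, map_sub, map_smul, map_sum, ← hfg, Finset.smul_sum,
        ← Finset.sum_sub_distrib]
      refine Finset.sum_eq_zero fun k _ => ?_
      rw [map_smul, ← smul_smul, ← smul_sub, hgY k]
      funext y
      change ρ y • (f k y • Y k (t y) - f k y • mfderiv 𝓘(ℝ, W) I t y (Z k y)) = 0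
      by_cases hy : y ∈ tsupport ρ
      · have h3 : mfderiv 𝓘(ℝ, W) I t y (Z k y) = Y k (t y) := interior_subset (hρ hy) k
        have h4 : f k y • Y k (t y) - f k y • mfderiv 𝓘(ℝ, W) I t y (Z k y) = 0 :=
          sub_eq_zero.2 (congrArg (f k y • ·) h3.symm)
        exact (congrArg (ρ y • ·) h4).trans (smul_zero _)
      · rw [image_eq_zero_of_notMem_tsupport hy]
        exact zero_smul ℝ _
    have := Submodule.add_mem_sup hA hB
    rwa [add_sub_cancel] at this
  · refine sup_le (fun X hX => ⟨hX.1, ?_⟩) fun X hX => ⟨hX.1, ?_⟩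
    · change push 𝓘(ℝ, W) I t X ∈ Submodule.span _ _
      refine mem_of_locally (I := 𝓘(ℝ, W))
        (B := fun u : N => TangentSpace I (t u)) _ _ hX.1.2 ?_ fun x _ => ?_
      · intro x hx
        exact (congrArg (mfderiv 𝓘(ℝ, W) I t x) (hsupp X x hx)).trans (map_zero _)
      · obtain ⟨B, hB, hXB⟩ := h2 X hX x
        refine ⟨interior {y | mfderiv 𝓘(ℝ, W) I t y (X y) = B y}, isOpen_interior,
          mem_interior_iff_mem_nhds.2 hXB, fun ρ hρ _ => ?_⟩
        have : ρ • push 𝓘(ℝ, W) I t X = ρ • B := by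
          funext y
          change ρ y • mfderiv 𝓘(ℝ, W) I t y (X y) = ρ y • B y
          by_cases hy : y ∈ tsupport ρ
          · have h5 := interior_subset (hρ hy)
            exact congrArg (ρ y • ·) h5
          · rw [image_eq_zero_of_notMem_tsupport hy]
            exact (zero_smul ℝ _).trans (zero_smul ℝ _).symm
        rw [this]
        exact Submodule.smul_mem _ ρ hB
    · have h3 : push 𝓘(ℝ, W) I t X = 0 := hX.2
      change push 𝓘(ℝ, W) I t X ∈ Submodule.span _ _
      rw [h3]
      exact Submodule.zero_mem _

end Criterion

section Deform

set_option linter.unusedSectionVars false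

variable {E : Type*} [NormedAddCommGroup E] [NormedSpace ℝ E] [FiniteDimensional ℝ E]
  {M : Type*} [TopologicalSpace M] [ChartedSpace E M] [IsManifold 𝓘(ℝ, E) ∞ M]
  [T2Space M] [SecondCountableTopology M]
  {F : Submodule C^∞⟮𝓘(ℝ, E), M; ℝ⟯ (VF 𝓘(ℝ, E) M)}
  {S : Span.{u} 𝓘(ℝ, E) M} {V : Submfd S.Model S.U}
  {ψs ψt : OpenPartialHomeomorph M E} (D : DeformChart S V ψs ψt)

namespace DeformChart

theorem tendsto_pt {y : DNC V} (hy : y ∈ D.d.chart.source) :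
    Tendsto D.pt (𝓝 (D.d.chart y)) (𝓝 (D.φ (DNC.q y).1)) := by
  rw [D.φ_q hy]
  exact D.contDiff_pt.continuous.continuousAt

theorem snd_chart_mem {y : DNC V} (hy : y ∈ D.d.chart.source) :
    (D.d.chart y).2 ∈ D.d.B := (D.mem_target_iff.1 (D.d.chart.map_source hy)).2

theorem exists_lift_deform (hF : F ≤ compactFields 𝓘(ℝ, E) M) (hS : S.IsBiSubmersion F)
    {y₀ : DNC V} (hy₀ : y₀ ∈ D.d.chart.source) {X : VF 𝓘(ℝ, E) M} (hX : X ∈ F) :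
    ∃ Z ∈ verticalFields 𝓘(ℝ, S.Model × ℝ) (𝓘(ℝ, E).prod 𝓘(ℝ)) (deformMap V S.s),
      ∀ᶠ y in 𝓝 y₀, deformD V S.t y (Z y) = (DNC.q y).2 • extend X (deformMap V S.t y) := by
  obtain ⟨b, hb⟩ := D.exists_lift hF hS (D.mem_source_iff.1 hy₀).1 hX
  have hb' := (D.tendsto_pt hy₀).eventually hb
  let a : S.Model × ℝ → S.Model × ℝ := fun p => (D.n p.2 • b (D.pt p), 0)
  have hsource : ∀ᶠ y in 𝓝 y₀, y ∈ D.d.chart.source := D.d.chart.open_source.mem_nhds hy₀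
  have hby := (D.d.chart.continuousAt hy₀).eventually hb'
  obtain ⟨Z, hZ, hZa⟩ := exists_mem_verticalFields (I := 𝓘(ℝ, E).prod 𝓘(ℝ)) (s := deformMap V S.s) D.chart_mem hy₀ (a := a) (by
    filter_upwards [hb'] with p hp
    exact ((D.n_smooth.contDiffAt.comp p contDiffAt_snd).smul
      (hp.1.comp p D.contDiff_pt.contDiffAt)).prodMk contDiffAt_const) (by
    filter_upwards [hsource, hby] with y h1 h2 x hx
    refine (D.ds_eq_zero_iff h1 x).2 ?_
    rw [hx]
    exact ⟨by simp only [a, map_smul, h2.2.1, smul_zero], rfl⟩)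
  refine ⟨Z, hZ, ?_⟩
  filter_upwards [hsource, hby, hZa] with y h1 h2 h3
  obtain ⟨h4, h5⟩ := D.chartD_dt h1 (Z y)
  have h3' : chartD D.d.chart y (Z y) = a (D.d.chart y) := h3
  rw [h3'] at h4 h5
  have hu := (D.mem_source_iff.1 h1).1
  refine Prod.ext (chartD_injective D.memₜ (D.t_mem _ hu) (h4.trans ?_)) (h5.trans ?_)
  · have h6 : D.n (D.d.chart y).2 * ((D.d.chart y).2 * D.m (D.d.chart y).2) = (DNC.q y).2 := by
      have := D.n_mul_m _ (D.snd_chart_mem h1)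
      rw [D.q_eq h1, mul_left_comm, this, mul_one]
    have h7 : chartD ψt (S.t (DNC.q y).1) ((DNC.q y).2 • X (S.t (DNC.q y).1)) =
        (DNC.q y).2 • chartD ψt (S.t (DNC.q y).1) (X (S.t (DNC.q y).1)) := map_smul _ _ _
    refine Eq.trans ?_ h7.symm
    simp only [a, zero_smul, add_zero]
    rw [D.dil_ker _ (D.snd_chart_mem h1) _ (by rw [map_smul, h2.2.1, smul_zero]), smul_smul,
      map_smul, h2.2.2, mul_comm, h6, ← D.φ_q h1, D.τ_apply hu, fieldIn_apply _ (D.t_mem _ hu)]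
  · change (0 : ℝ) = (DNC.q y).2 • 0
    rw [smul_zero]

theorem exists_span_deform (hS : S.IsBiSubmersion F)
    {y₀ : DNC V} (hy₀ : y₀ ∈ D.d.chart.source) {X : VF 𝓘(ℝ, S.Model × ℝ) (DNC V)}
    (hX : X ∈ verticalFields 𝓘(ℝ, S.Model × ℝ) (𝓘(ℝ, E).prod 𝓘(ℝ)) (deformMap V S.s)) :
    ∃ W ∈ Submodule.span C^∞⟮𝓘(ℝ, S.Model × ℝ), DNC V; ℝ⟯
        {Z : Sections fun y : DNC V => TangentSpace (𝓘(ℝ, E).prod 𝓘(ℝ)) (deformMap V S.t y) |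
          ∃ Y ∈ adiabatic F, Z = fun y => Y (deformMap V S.t y)},
      ∀ᶠ y in 𝓝 y₀, deformD V S.t y (X y) = W y := by
  obtain ⟨κ, _, Y, C, hY, hC⟩ := D.exists_span hS (D.mem_source_iff.1 hy₀).1
  have hC' := (D.tendsto_pt hy₀).eventually hC
  have hsource : ∀ᶠ y in 𝓝 y₀, y ∈ D.d.chart.source := D.d.chart.open_source.mem_nhds hy₀
  have htarget : ∀ᶠ p in 𝓝 (D.d.chart y₀), p ∈ D.d.chart.target :=
    D.d.chart.open_target.mem_nhds (D.d.chart.map_source hy₀)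
  let a : S.Model × ℝ → S.Model := fun p => (fieldIn D.d.chart X p).1
  let f : κ → DNC V → ℝ := fun k y =>
    D.m (D.d.chart y).2 * C k (D.pt (D.d.chart y)) (a (D.d.chart y))
  have hf : ∀ k, ∀ᶠ y in 𝓝 y₀, ContMDiffAt 𝓘(ℝ, S.Model × ℝ) 𝓘(ℝ) ∞ (f k) y := by
    intro k
    filter_upwards [hsource, (D.d.chart.continuousAt hy₀).eventually (hC'.and htarget)]
      with y h1 h2
    have h3 : ContDiffAt ℝ ∞ (fun p : S.Model × ℝ => D.m p.2 * C k (D.pt p) (a p))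
        (D.d.chart y) := by
      refine ((D.m_smooth _ (D.snd_chart_mem h1)).comp _ contDiffAt_snd).mul ?_
      exact ((h2.1.1 k).comp _ D.contDiff_pt.contDiffAt).clm_apply
        (contDiffAt_fst.comp _ (contDiffAt_fieldIn D.chart_mem hX.1.1 h2.2))
    exact h3.contMDiffAt.comp y (contMDiffAt_of_mem_maximalAtlas D.chart_mem h1)
  choose g hg hgf using fun k => exists_smooth_extension (hf k)
  obtain ⟨χ, hχ, -, hχ1⟩ := exists_bump (𝓘(ℝ, E).prod 𝓘(ℝ)) (x := deformMap V S.t y₀) univ_mem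
  let Z : κ → VF (𝓘(ℝ, E).prod 𝓘(ℝ)) (M × ℝ) := fun k p => (p.2 * χ p) • extend (Y k) p
  have hZ : ∀ k, Z k ∈ adiabatic F := fun k =>
    Submodule.subset_span ⟨χ, hχ, Y k, hY k, rfl⟩
  let Z' : κ → Sections fun y : DNC V => TangentSpace (𝓘(ℝ, E).prod 𝓘(ℝ)) (deformMap V S.t y) :=
    fun k y => Z k (deformMap V S.t y)
  refine ⟨∑ k, g k • Z' k, Submodule.sum_mem _ fun k _ => Submodule.smul_mem _ _
    (Submodule.subset_span ⟨Z k, hZ k, rfl⟩), ?_⟩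
  filter_upwards [hsource, (D.d.chart.continuousAt hy₀).eventually hC', eventually_all.2 hgf,
    (contMDiff_deformMap S.smooth_t).continuous.continuousAt.eventually hχ1] with y h1 h2 h3 h4
  have hu := (D.mem_source_iff.1 h1).1
  have hXs : deformD V S.s y (X y) = 0 := congrFun hX.2 y
  obtain ⟨hρ, h2'⟩ := (D.ds_eq_zero_iff h1 _).1 hXs
  obtain ⟨h5, h6⟩ := D.chartD_dt h1 (X y)
  have ha : a (D.d.chart y) = (chartD D.d.chart y (X y)).1 :=
    congrArg Prod.fst (fieldIn_apply X h1)
  have hβ : (DNC.q y).2 = (D.d.chart y).2 := by rw [D.q_eq h1]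
  have hsum : (∑ k, g k • Z' k : Sections fun y : DNC V =>
      TangentSpace (𝓘(ℝ, E).prod 𝓘(ℝ)) (deformMap V S.t y)) y =
      (((DNC.q y).2 • ∑ k, f k y • Y k (S.t (DNC.q y).1), 0) : E × ℝ) := by
    rw [Sections.sum_apply]
    have h7 : ∀ k, (g k • Z' k : Sections fun y : DNC V =>
        TangentSpace (𝓘(ℝ, E).prod 𝓘(ℝ)) (deformMap V S.t y)) y =
        (((DNC.q y).2 • f k y • Y k (S.t (DNC.q y).1), 0) : E × ℝ) := by
      intro k
      change g k y • (((DNC.q y).2 * χ (deformMap V S.t y)) •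
        ((Y k (S.t (DNC.q y).1), 0) : E × ℝ)) = _
      rw [h3 k, h4, mul_one, smul_comm]
      refine Prod.ext rfl ?_
      change (DNC.q y).2 • (f k y • (0 : ℝ)) = 0
      rw [smul_zero, smul_zero]
    have h8 : ∀ s : Finset κ, (∑ k ∈ s, (g k • Z' k : Sections fun y : DNC V =>
        TangentSpace (𝓘(ℝ, E).prod 𝓘(ℝ)) (deformMap V S.t y)) y) =
        (((DNC.q y).2 • ∑ k ∈ s, f k y • Y k (S.t (DNC.q y).1), 0) : E × ℝ) := by
      intro s
      induction s using Finset.cons_induction with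
      | empty => simp only [Finset.sum_empty]; rw [smul_zero]; rfl
      | cons k s hk ih =>
        rw [Finset.sum_cons, Finset.sum_cons, ih, h7 k, smul_add]
        exact Prod.ext rfl (add_zero (0 : ℝ))
    exact h8 _
  refine Eq.trans (Prod.ext (chartD_injective D.memₜ (D.t_mem _ hu) (h5.trans ?_))
    (h6.trans h2')) hsum.symm
  rw [h2', zero_smul, add_zero, D.dil_ker _ (D.snd_chart_mem h1) _ hρ, map_smul, h2.2 _ hρ]
  have h9 : ∀ s : Finset κ, chartD ψt (S.t (DNC.q y).1)
      ((DNC.q y).2 • ∑ k ∈ s, f k y • Y k (S.t (DNC.q y).1)) =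
      (DNC.q y).2 • ∑ k ∈ s, f k y • chartD ψt (S.t (DNC.q y).1) (Y k (S.t (DNC.q y).1)) := by
    intro s
    refine (map_smul (chartD ψt (S.t (DNC.q y).1)) _ _).trans (congrArg _ ?_)
    refine (map_sum (chartD ψt (S.t (DNC.q y).1)) _ _).trans (Finset.sum_congr rfl fun k _ => ?_)
    exact map_smul (chartD ψt (S.t (DNC.q y).1)) _ _
  refine Eq.trans ?_ (h9 _).symm
  rw [mul_smul, hβ, Finset.smul_sum]
  refine congrArg _ (Finset.sum_congr rfl fun k _ => ?_)
  rw [smul_smul, ← D.φ_q h1, D.τ_apply hu, fieldIn_apply _ (D.t_mem _ hu), D.φ_q h1, ← ha]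

end DeformChart

end Deform

section Extend

set_option linter.unusedSectionVars false

variable {E : Type*} [NormedAddCommGroup E] [NormedSpace ℝ E] [FiniteDimensional ℝ E]
  {M : Type*} [TopologicalSpace M] [ChartedSpace E M] [IsManifold 𝓘(ℝ, E) ∞ M]
  {X Y : VF 𝓘(ℝ, E) M}

theorem isSmooth_extend (hX : IsSmooth X) : IsSmooth (extend X) := by
  have h0 : ContMDiff (𝓘(ℝ, E).prod 𝓘(ℝ)) 𝓘(ℝ).tangent ∞
      fun p : M × ℝ => (⟨p.2, 0⟩ : TangentBundle 𝓘(ℝ) ℝ) :=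
    (Bundle.contMDiff_zeroSection ℝ (TangentSpace 𝓘(ℝ) : ℝ → Type _)).comp contMDiff_snd
  have h1 : ContMDiff (𝓘(ℝ, E).prod 𝓘(ℝ)) 𝓘(ℝ, E).tangent ∞
      fun p : M × ℝ => (⟨p.1, X p.1⟩ : TangentBundle 𝓘(ℝ, E) M) :=
    hX.comp contMDiff_fst
  exact contMDiff_equivTangentBundleProd_symm.comp (h1.prodMk h0)

theorem lieBracket_prod_zero {a b : E → E} {p : E × ℝ} {a' b' : E × ℝ → E × ℝ}
    (ha : DifferentiableAt ℝ a p.1) (hb : DifferentiableAt ℝ b p.1)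
    (ha' : a' =ᶠ[𝓝 p] fun q => (a q.1, 0)) (hb' : b' =ᶠ[𝓝 p] fun q => (b q.1, 0)) :
    VectorField.lieBracket ℝ a' b' p = (VectorField.lieBracket ℝ a b p.1, 0) := by
  have key : ∀ {c : E → E} {c' : E × ℝ → E × ℝ}, DifferentiableAt ℝ c p.1 →
      (c' =ᶠ[𝓝 p] fun q => (c q.1, 0)) → ∀ z, fderiv ℝ c' p z = (fderiv ℝ c p.1 z.1, 0) := by
    intro c c' hc hc' z
    have h1 : HasFDerivAt (fun q : E × ℝ => (c q.1, (0 : ℝ)))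
        (((fderiv ℝ c p.1).comp (ContinuousLinearMap.fst ℝ E ℝ)).prod 0) p :=
      (hc.hasFDerivAt.comp p hasFDerivAt_fst).prodMk (hasFDerivAt_const _ _)
    rw [hc'.fderiv_eq, h1.fderiv]
    rfl
  rw [VectorField.lieBracket, VectorField.lieBracket, key hb hb', key ha ha', ha'.eq_of_nhds,
    hb'.eq_of_nhds]
  simp

theorem mlieBracket_model_eq_lieBracket {W : Type*} [NormedAddCommGroup W] [NormedSpace ℝ W]
    (a b : W → W) (p : W) :
    (VectorField.mlieBracket 𝓘(ℝ, W) a b p : W) = VectorField.lieBracket ℝ a b p := by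
  have h1 : VectorField.mlieBracketWithin 𝓘(ℝ, W) a b univ p =
      VectorField.lieBracketWithin ℝ a b univ p :=
    congrFun VectorField.mlieBracketWithin_eq_lieBracketWithin p
  rw [VectorField.lieBracketWithin_univ] at h1
  exact (congrFun VectorField.mlieBracketWithin_univ p).symm.trans h1

theorem mlieBracket_extend (hX : IsSmooth X) (hY : IsSmooth Y) :
    (VectorField.mlieBracket (𝓘(ℝ, E).prod 𝓘(ℝ)) (extend X) (extend Y) :
      VF (𝓘(ℝ, E).prod 𝓘(ℝ)) (M × ℝ)) =
      extend (VectorField.mlieBracket 𝓘(ℝ, E) X Y : VF 𝓘(ℝ, E) M) := by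
  funext ⟨x, r⟩
  let ψ := chartAt E x
  have hψ : ψ ∈ IsManifold.maximalAtlas 𝓘(ℝ, E) ∞ M := IsManifold.chart_mem_maximalAtlas x
  have hx : x ∈ ψ.source := mem_chart_source _ _
  have he := ψ.map_source hx
  have h3 : minSmoothness ℝ 3 ≤ (∞ : ℕ∞ω) := by
    rw [minSmoothness_of_isRCLikeNormedField]
    exact WithTop.coe_le_coe.2 (le_top : ((3 : ℕ) : ℕ∞) ≤ ⊤)
  have h2 : minSmoothness ℝ 2 ≤ (∞ : ℕ∞ω) := by
    rw [minSmoothness_of_isRCLikeNormedField]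
    exact WithTop.coe_le_coe.2 (le_top : ((2 : ℕ) : ℕ∞) ≤ ⊤)
  have : IsManifold 𝓘(ℝ, E) (minSmoothness ℝ 3) M := IsManifold.of_le (n := ∞) h3
  have : IsManifold (𝓘(ℝ, E).prod 𝓘(ℝ)) (minSmoothness ℝ 3) (M × ℝ) :=
    IsManifold.of_le (n := ∞) h3
  let f : E × ℝ → M × ℝ := fun p => (ψ.symm p.1, p.2)
  let a : VF 𝓘(ℝ, E) M → E → E := fun Z => VectorField.mpullback 𝓘(ℝ, E) 𝓘(ℝ, E) ψ.symm Z
  let a' : VF 𝓘(ℝ, E) M → E × ℝ → E × ℝ := fun Z =>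
    VectorField.mpullback 𝓘(ℝ, E × ℝ) (𝓘(ℝ, E).prod 𝓘(ℝ)) f (extend Z)
  have hfd : ∀ p : E × ℝ, p.1 ∈ ψ.target → (mfderiv 𝓘(ℝ, E × ℝ) (𝓘(ℝ, E).prod 𝓘(ℝ)) f p :
      E × ℝ →L[ℝ] E × ℝ) = ((chartDsymm ψ p.1).comp (ContinuousLinearMap.fst ℝ E ℝ)).prod
        (ContinuousLinearMap.snd ℝ E ℝ) := by
    intro p hp
    have h1 : HasMFDerivAt 𝓘(ℝ, E × ℝ) 𝓘(ℝ, E) (Prod.fst : E × ℝ → E) p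
        (ContinuousLinearMap.fst ℝ E ℝ : E × ℝ →L[ℝ] E) := hasFDerivAt_fst.hasMFDerivAt
    have h2 : HasMFDerivAt 𝓘(ℝ, E × ℝ) 𝓘(ℝ) (Prod.snd : E × ℝ → ℝ) p
        (ContinuousLinearMap.snd ℝ E ℝ : E × ℝ →L[ℝ] ℝ) := hasFDerivAt_snd.hasMFDerivAt
    have h3 : HasMFDerivAt 𝓘(ℝ, E) 𝓘(ℝ, E) ψ.symm p.1 (chartDsymm ψ p.1 : E →L[ℝ] E) :=
      ((mdifferentiable_of_mem_maximalAtlas hψ).mdifferentiableAt_symm hp).hasMFDerivAt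
    exact ((h3.comp p h1).prodMk h2).mfderiv
  have hinj : ∀ p : E × ℝ, p.1 ∈ ψ.target → ∀ v w : E × ℝ,
      (mfderiv 𝓘(ℝ, E × ℝ) (𝓘(ℝ, E).prod 𝓘(ℝ)) f p : E × ℝ →L[ℝ] E × ℝ).inverse v = w ↔
        v = (chartDsymm ψ p.1 w.1, w.2) := by
    intro p hp v w
    let B : (E × ℝ) ≃L[ℝ] (E × ℝ) := ContinuousLinearEquiv.equivOfInverse
      (((chartDsymm ψ p.1).comp (ContinuousLinearMap.fst ℝ E ℝ)).prod
        (ContinuousLinearMap.snd ℝ E ℝ))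
      (((chartD ψ (ψ.symm p.1)).comp (ContinuousLinearMap.fst ℝ E ℝ)).prod
        (ContinuousLinearMap.snd ℝ E ℝ))
      (fun z => Prod.ext (chartD_chartDsymm hψ hp z.1) rfl)
      (fun z => Prod.ext (by
        have := chartDsymm_chartD hψ (ψ.map_target hp) z.1
        rwa [ψ.right_inv hp] at this) rfl)
    rw [hfd p hp]
    change (B : E × ℝ →L[ℝ] E × ℝ).inverse v = w ↔ v = B w
    rw [ContinuousLinearMap.inverse_equiv]
    exact B.symm_apply_eq
  have ha : ∀ Z, ∀ e ∈ ψ.target, Z (ψ.symm e) = chartDsymm ψ e (a Z e) := by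
    intro Z e he
    have h1 : a Z e = chartD ψ (ψ.symm e) (Z (ψ.symm e)) := inverse_chartDsymm hψ he _
    have h2 := chartDsymm_chartD hψ (ψ.map_target he) (Z (ψ.symm e))
    rw [ψ.right_inv he] at h2
    rw [h1]
    exact h2.symm
  have ha' : ∀ Z, ∀ p : E × ℝ, p.1 ∈ ψ.target → a' Z p = (a Z p.1, 0) := by
    intro Z p hp
    exact (hinj p hp _ _).2 (Prod.ext (ha Z _ hp) rfl)
  let p₀ : E × ℝ := (ψ x, r)
  have hev : ∀ Z, a' Z =ᶠ[𝓝 p₀] fun q => (a Z q.1, 0) := fun Z => by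
    filter_upwards [Eventually.prod_inl_nhds (ψ.open_target.mem_nhds he) r] with q hq
    exact ha' Z q hq
  have hda : ∀ Z, IsSmooth Z → DifferentiableAt ℝ (a Z) (ψ x) := by
    intro Z hZ
    have h1 : a Z =ᶠ[𝓝 (ψ x)] fieldIn ψ Z := by
      filter_upwards [ψ.open_target.mem_nhds he] with e he
      exact inverse_chartDsymm hψ he _
    exact ((contDiffAt_fieldIn hψ hZ he).differentiableAt (by simp)).congr_of_eventuallyEq h1
  have hfs : ContMDiffAt 𝓘(ℝ, E × ℝ) (𝓘(ℝ, E).prod 𝓘(ℝ)) ∞ f p₀ := by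
    refine ContMDiffAt.prodMk ?_ contDiffAt_snd.contMDiffAt
    exact (contMDiffAt_symm_of_mem_maximalAtlas hψ he).comp p₀ contDiffAt_fst.contMDiffAt
  have hfx : f p₀ = (x, r) := Prod.ext (ψ.left_inv hx) rfl
  have hsm : ∀ Z, IsSmooth Z → ∀ q, MDifferentiableAt (𝓘(ℝ, E).prod 𝓘(ℝ))
      (𝓘(ℝ, E).prod 𝓘(ℝ)).tangent
      (fun q : M × ℝ => (⟨q, extend Z q⟩ : TangentBundle (𝓘(ℝ, E).prod 𝓘(ℝ)) (M × ℝ))) q :=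
    fun Z hZ q => (isSmooth_extend hZ q).mdifferentiableAt (by simp)
  have h1 := VectorField.mpullback_mlieBracket (n := ∞) (f := f) (x₀ := p₀) (hsm X hX _)
    (hsm Y hY _) hfs h2
  have h2' := VectorField.mpullback_mlieBracket (n := ∞) (f := ψ.symm) (x₀ := ψ x)
    ((hX (ψ.symm (ψ x))).mdifferentiableAt (by simp))
    ((hY (ψ.symm (ψ x))).mdifferentiableAt (by simp))
    (contMDiffAt_symm_of_mem_maximalAtlas hψ he) h2
  have h3 : VectorField.lieBracket ℝ (a' X) (a' Y) p₀ =
      (VectorField.lieBracket ℝ (a X) (a Y) (ψ x), 0) :=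
    lieBracket_prod_zero (hda X hX) (hda Y hY) (hev X) (hev Y)
  have h4 := (hinj p₀ he _ _).1 (h1.trans ((mlieBracket_model_eq_lieBracket _ _ _).trans h3))
  have h5 := ha (VectorField.mlieBracket 𝓘(ℝ, E) X Y) (ψ x) he
  have h6 : a (VectorField.mlieBracket 𝓘(ℝ, E) X Y) (ψ x) =
      VectorField.lieBracket ℝ (a X) (a Y) (ψ x) := h2'.trans (mlieBracket_model_eq_lieBracket _ _ _)
  have h7 : ∀ q, q = (x, r) → VectorField.mlieBracket (𝓘(ℝ, E).prod 𝓘(ℝ)) (extend X) (extend Y) q =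
      (((VectorField.mlieBracket 𝓘(ℝ, E) X Y) q.1, 0) : E × ℝ) →
      VectorField.mlieBracket (𝓘(ℝ, E).prod 𝓘(ℝ)) (extend X) (extend Y) (x, r) =
      (((VectorField.mlieBracket 𝓘(ℝ, E) X Y) x, 0) : E × ℝ) := by
    rintro q rfl h; exact h
  refine h7 (f p₀) hfx (h4.trans (Prod.ext ?_ rfl))
  rw [← h6]
  exact h5.symm

end Extend

section Bracket

set_option linter.unusedSectionVars false

variable {E : Type*} [NormedAddCommGroup E] [NormedSpace ℝ E] {H : Type*} [TopologicalSpace H]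
  {I : ModelWithCorners ℝ E H} {M : Type*} [TopologicalSpace M] [ChartedSpace H M]
  [IsManifold I ∞ M]

/-- The derivative of a function along a smooth vector field. -/
noncomputable def IsSmooth.derivation {X : VF I M} (hX : IsSmooth X) (f : C^∞⟮I, M; ℝ⟯) :
    C^∞⟮I, M; ℝ⟯ where
  val := fun x => mvfderiv I f x (X x)
  property := by
    have h1 : ContMDiff I 𝓘(ℝ).tangent ∞ fun x => tangentMap I 𝓘(ℝ) f ⟨x, X x⟩ :=
      (f.contMDiff.contMDiff_tangentMap (by simp)).comp hX
    exact (contMDiff_snd_tangentBundle_modelSpace ℝ 𝓘(ℝ)).comp h1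

theorem IsSmooth.mdifferentiableAt {X : VF I M} (hX : IsSmooth X) (x : M) :
    MDifferentiableAt I I.tangent (fun x => (⟨x, X x⟩ : TangentBundle I M)) x :=
  (hX x).mdifferentiableAt (by simp)

theorem IsSmooth.smul {X : VF I M} (hX : IsSmooth X) (f : C^∞⟮I, M; ℝ⟯) :
    IsSmooth (f • X : VF I M) := ContMDiff.smul_section f.contMDiff hX

theorem IsSmooth.derivation_smul {X : VF I M} (hX : IsSmooth X) (f g : C^∞⟮I, M; ℝ⟯) :
    (hX.smul f).derivation g = f * hX.derivation g :=
  ContMDiffMap.ext fun x => (mvfderiv I g x).map_smul (f x) (X x)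

theorem IsSmooth.add {X Y : VF I M} (hX : IsSmooth X) (hY : IsSmooth Y) :
    IsSmooth (X + Y : VF I M) := ContMDiff.add_section hX hY

theorem isSmooth_zero : IsSmooth (0 : VF I M) :=
  Bundle.contMDiff_zeroSection ℝ (TangentSpace I : M → Type _)

variable [CompleteSpace E]

/-- The Lie bracket of vector fields. -/
noncomputable abbrev VF.lie (X Y : VF I M) : VF I M := VectorField.mlieBracket I X Y

theorem VF.smul_lie {X Y : VF I M} (hX : IsSmooth X) (hY : IsSmooth Y)
    (f : C^∞⟮I, M; ℝ⟯) : VF.lie (f • X) Y = f • VF.lie X Y - hY.derivation f • X := by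
  funext x
  refine (VectorField.mlieBracket_smul_left (f := f) ((f.contMDiff x).mdifferentiableAt (by simp))
    (hX.mdifferentiableAt x)).trans ?_
  change -(mvfderiv I f x (Y x)) • X x + f x • VectorField.mlieBracket I X Y x =
    f x • VectorField.mlieBracket I X Y x - mvfderiv I f x (Y x) • X x
  rw [neg_smul, neg_add_eq_sub]

theorem VF.lie_smul {X Y : VF I M} (hX : IsSmooth X) (hY : IsSmooth Y)
    (f : C^∞⟮I, M; ℝ⟯) : VF.lie X (f • Y) = f • VF.lie X Y + hX.derivation f • Y := by
  funext x
  refine (VectorField.mlieBracket_smul_right (f := f) ((f.contMDiff x).mdifferentiableAt (by simp))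
    (hY.mdifferentiableAt x)).trans ?_
  exact add_comm _ _

theorem mlieBracket_mem_span {G : Set (VF I M)} (hG : ∀ X ∈ G, IsSmooth X)
    (h : ∀ X ∈ G, ∀ Y ∈ G, VF.lie X Y ∈
      Submodule.span C^∞⟮I, M; ℝ⟯ G) {X Y : VF I M} (hX : X ∈ Submodule.span C^∞⟮I, M; ℝ⟯ G)
    (hY : Y ∈ Submodule.span C^∞⟮I, M; ℝ⟯ G) :
    VF.lie X Y ∈ Submodule.span C^∞⟮I, M; ℝ⟯ G := by
  have hsm : ∀ X ∈ Submodule.span C^∞⟮I, M; ℝ⟯ G, IsSmooth X := fun X hX => by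
    induction hX using Submodule.span_induction with
    | mem X hX => exact hG X hX
    | zero => exact isSmooth_zero
    | add X Y _ _ h1 h2 => exact h1.add h2
    | smul f X _ h1 => exact h1.smul f
  induction hX using Submodule.span_induction with
  | zero =>
    have : VF.lie (0 : VF I M) Y = 0 :=
      VectorField.mlieBracket_zero_left
    rw [this]
    exact Submodule.zero_mem _
  | add X X' h1 h2 h3 h4 =>
    have : VF.lie (X + X') Y = VF.lie X Y + VF.lie X' Y :=
      funext fun x => VectorField.mlieBracket_add_left ((hsm X h1).mdifferentiableAt x)
        ((hsm X' h2).mdifferentiableAt x)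
    rw [this]
    exact Submodule.add_mem _ h3 h4
  | smul f X h1 h2 =>
    rw [VF.smul_lie (hsm X h1) (hsm Y hY)]
    exact Submodule.sub_mem _ (Submodule.smul_mem _ _ h2) (Submodule.smul_mem _ _ h1)
  | mem X hXG =>
    induction hY using Submodule.span_induction with
    | zero =>
      have : VF.lie X (0 : VF I M) = 0 :=
        VectorField.mlieBracket_zero_right
      rw [this]
      exact Submodule.zero_mem _
    | add Y Y' h1 h2 h3 h4 =>
      have : VF.lie X (Y + Y') = VF.lie X Y + VF.lie X Y' :=
        funext fun x => VectorField.mlieBracket_add_right ((hsm Y h1).mdifferentiableAt x)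
          ((hsm Y' h2).mdifferentiableAt x)
      rw [this]
      exact Submodule.add_mem _ h3 h4
    | smul f Y h1 h2 =>
      rw [VF.lie_smul (hG X hXG) (hsm Y h1)]
      exact Submodule.add_mem _ (Submodule.smul_mem _ _ h2) (Submodule.smul_mem _ _ h1)
    | mem Y hYG => exact h X hXG Y hYG

end Bracket

section Adiabatic

set_option linter.unusedSectionVars false

variable {E : Type*} [NormedAddCommGroup E] [NormedSpace ℝ E] [FiniteDimensional ℝ E]
  {M : Type*} [TopologicalSpace M] [ChartedSpace E M] [IsManifold 𝓘(ℝ, E) ∞ M]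
  {F : Submodule C^∞⟮𝓘(ℝ, E), M; ℝ⟯ (VF 𝓘(ℝ, E) M)}

/-- The second projection of `M × ℝ`. -/
noncomputable def sndMap (E M : Type*) [NormedAddCommGroup E] [NormedSpace ℝ E] [TopologicalSpace M]
    [ChartedSpace E M] : C^∞⟮𝓘(ℝ, E).prod 𝓘(ℝ), M × ℝ; ℝ⟯ := ⟨Prod.snd, contMDiff_snd⟩

/-- A function on `M`, as a function on `M × ℝ`. -/
noncomputable def fstMap (f : C^∞⟮𝓘(ℝ, E), M; ℝ⟯) : C^∞⟮𝓘(ℝ, E).prod 𝓘(ℝ), M × ℝ; ℝ⟯ :=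
  ⟨fun p => f p.1, f.contMDiff.comp contMDiff_fst⟩

theorem extend_add (X Y : VF 𝓘(ℝ, E) M) :
    extend (X + Y : VF 𝓘(ℝ, E) M) = (extend X + extend Y : VF (𝓘(ℝ, E).prod 𝓘(ℝ)) (M × ℝ)) :=
  funext fun _ => Prod.ext rfl (add_zero (0 : ℝ)).symm

theorem extend_zero : extend (0 : VF 𝓘(ℝ, E) M) = (0 : VF (𝓘(ℝ, E).prod 𝓘(ℝ)) (M × ℝ)) := rfl

theorem extend_smul (f : C^∞⟮𝓘(ℝ, E), M; ℝ⟯) (X : VF 𝓘(ℝ, E) M) :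
    extend (f • X : VF 𝓘(ℝ, E) M) =
      (fstMap f • extend X : VF (𝓘(ℝ, E).prod 𝓘(ℝ)) (M × ℝ)) :=
  funext fun p => Prod.ext rfl (smul_zero (f p.1)).symm

theorem smul_extend_mem_adiabatic (g : C^∞⟮𝓘(ℝ, E).prod 𝓘(ℝ), M × ℝ; ℝ⟯)
    (hg : HasCompactSupport g) {X : VF 𝓘(ℝ, E) M} (hX : X ∈ F) :
    ((sndMap E M * g) • extend X : VF (𝓘(ℝ, E).prod 𝓘(ℝ)) (M × ℝ)) ∈ adiabatic F :=
  Submodule.subset_span ⟨g, hg, X, hX, rfl⟩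

theorem adiabatic_induction
    {p : ∀ Z : VF (𝓘(ℝ, E).prod 𝓘(ℝ)) (M × ℝ), Z ∈ adiabatic F → Prop}
    (mem : ∀ (g : C^∞⟮𝓘(ℝ, E).prod 𝓘(ℝ), M × ℝ; ℝ⟯) (hg : HasCompactSupport g) (X) (hX : X ∈ F),
      p ((sndMap E M * g) • extend X) (smul_extend_mem_adiabatic g hg hX))
    (zero : p 0 (Submodule.zero_mem _))
    (add : ∀ Y Z hY hZ, p Y hY → p Z hZ → p (Y + Z) (Submodule.add_mem _ hY hZ))
    (smul : ∀ (f : C^∞⟮𝓘(ℝ, E).prod 𝓘(ℝ), M × ℝ; ℝ⟯) Y hY, p Y hY →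
      p (f • Y) (Submodule.smul_mem _ f hY))
    {Z : VF (𝓘(ℝ, E).prod 𝓘(ℝ)) (M × ℝ)} (hZ : Z ∈ adiabatic F) : p Z hZ := by
  refine Submodule.span_induction (p := p) ?_ zero (fun Y Z hY hZ => add Y Z hY hZ)
    (fun f Y hY => smul f Y hY) hZ
  rintro _ ⟨g, hg, X, hX, rfl⟩
  exact mem g hg X hX

theorem adiabatic_le (hF : F ≤ compactFields 𝓘(ℝ, E) M) :
    adiabatic F ≤ compactFields (𝓘(ℝ, E).prod 𝓘(ℝ)) (M × ℝ) := by
  intro Z hZ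
  induction hZ using adiabatic_induction with
  | zero => exact Submodule.zero_mem _
  | add Y Z _ _ h1 h2 => exact Submodule.add_mem _ h1 h2
  | smul f Y _ h1 => exact Submodule.smul_mem _ _ h1
  | mem g hg X hX =>
    refine ⟨(isSmooth_extend (hF hX).1).smul _, ?_⟩
    refine IsCompact.of_isClosed_subset hg isClosed_closure (closure_mono fun p hp => ?_)
    rw [Function.mem_support]
    intro h
    refine hp ?_
    change (p.2 * g p) • extend X p = 0
    rw [h, mul_zero]
    exact zero_smul ℝ _

theorem mlieBracket_mem_adiabatic (hF : IsFoliation F) {Y Z : VF (𝓘(ℝ, E).prod 𝓘(ℝ)) (M × ℝ)}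
    (hY : Y ∈ adiabatic F) (hZ : Z ∈ adiabatic F) :
    (VectorField.mlieBracket (𝓘(ℝ, E).prod 𝓘(ℝ)) Y Z : VF (𝓘(ℝ, E).prod 𝓘(ℝ)) (M × ℝ)) ∈
      adiabatic F := by
  refine mlieBracket_mem_span (fun X hX => ?_) ?_ hY hZ
  · exact (adiabatic_le hF.le (Submodule.subset_span hX)).1
  · rintro _ ⟨g, hg, X, hX, rfl⟩ _ ⟨g', hg', X', hX', rfl⟩
    have hs := isSmooth_extend (hF.le hX).1
    have hs' := isSmooth_extend (hF.le hX').1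
    change VF.lie ((sndMap E M * g) • extend X) ((sndMap E M * g') • extend X') ∈ adiabatic F
    have hb : VF.lie (extend X) (extend X') = extend (VF.lie X X') :=
      mlieBracket_extend (hF.le hX).1 (hF.le hX').1
    rw [VF.smul_lie hs (hs'.smul _), VF.lie_smul hs hs', hb, smul_add]
    have hd : (hs'.smul (sndMap E M * g')).derivation (sndMap E M * g) • extend X =
        hs'.derivation (sndMap E M * g) • ((sndMap E M * g') • extend X) := by
      rw [IsSmooth.derivation_smul hs', smul_smul, mul_comm]
    rw [hd]
    refine Submodule.sub_mem _ (Submodule.add_mem _ (Submodule.smul_mem _ _ ?_) ?_)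
      (Submodule.smul_mem _ _ (smul_extend_mem_adiabatic g' hg' hX))
    · exact smul_extend_mem_adiabatic g' hg' (hF.bracket X hX X' hX')
    · rw [smul_comm]
      exact Submodule.smul_mem _ _ (smul_extend_mem_adiabatic g hg hX')

theorem supp_smul_subset {f : C^∞⟮𝓘(ℝ, E), M; ℝ⟯} {X : VF 𝓘(ℝ, E) M} :
    supp (f • X : VF 𝓘(ℝ, E) M) ⊆ tsupport f := by
  refine closure_mono fun x hx => ?_
  rw [Function.mem_support]
  intro h
  refine hx ?_
  change f x • X x = 0
  rw [h]
  exact zero_smul ℝ _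

variable [T2Space M]

theorem isFoliation_adiabatic (hF : IsFoliation F) : IsFoliation (adiabatic F) where
  le := adiabatic_le hF.le
  bracket := fun _ hY _ hZ => mlieBracket_mem_adiabatic hF hY hZ
  locally_fg := by
    intro p
    obtain ⟨O, hO, hx, S, hS, hSF, hspan⟩ := hF.locally_fg p.1
    obtain ⟨ρ, -, hρ, hρ1⟩ := exists_bump 𝓘(ℝ, E) (hO.mem_nhds hx)
    obtain ⟨χ, hχ, -, hχ1⟩ := exists_bump (𝓘(ℝ, E).prod 𝓘(ℝ)) (x := p) univ_mem
    let G : VF 𝓘(ℝ, E) M → VF (𝓘(ℝ, E).prod 𝓘(ℝ)) (M × ℝ) := fun X =>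
      (sndMap E M * χ) • extend X
    have hev : ∀ᶠ z in 𝓝 p, ρ z.1 = 1 ∧ χ z = 1 :=
      (continuousAt_fst.eventually hρ1).and hχ1
    refine ⟨interior {z | ρ z.1 = 1 ∧ χ z = 1}, isOpen_interior,
      mem_interior_iff_mem_nhds.2 hev, G '' S, hS.image G, ?_, fun Z hZ hZO => ?_⟩
    · rintro _ ⟨X, hX, rfl⟩
      exact smul_extend_mem_adiabatic χ hχ (hSF hX)
    · have h1 : ∀ W ∈ Submodule.span C^∞⟮𝓘(ℝ, E), M; ℝ⟯ S, G W ∈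
          Submodule.span C^∞⟮𝓘(ℝ, E).prod 𝓘(ℝ), M × ℝ; ℝ⟯ (G '' S) := by
        intro W hW
        induction hW using Submodule.span_induction with
        | mem X hX => exact Submodule.subset_span ⟨X, hX, rfl⟩
        | zero => simp only [G, extend_zero, smul_zero]; exact Submodule.zero_mem _
        | add X Y _ _ h2 h3 =>
          simp only [G, extend_add, smul_add]
          exact Submodule.add_mem _ h2 h3
        | smul f X _ h2 =>
          simp only [G, extend_smul]
          rw [smul_comm]
          exact Submodule.smul_mem _ _ h2
      have h2 : (fstMap ρ * χ) • Z ∈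
          Submodule.span C^∞⟮𝓘(ℝ, E).prod 𝓘(ℝ), M × ℝ; ℝ⟯ (G '' S) := by
        clear hZO
        induction hZ using adiabatic_induction with
        | zero => rw [smul_zero]; exact Submodule.zero_mem _
        | add Y Z _ _ h3 h4 => rw [smul_add]; exact Submodule.add_mem _ h3 h4
        | smul f Y _ h3 => rw [smul_comm]; exact Submodule.smul_mem _ _ h3
        | mem g hg X hX =>
          have h3 := h1 _ (hspan (ρ • X : VF 𝓘(ℝ, E) M) (Submodule.smul_mem _ _ hX)
            (supp_smul_subset.trans hρ))
          have h4 : (fstMap ρ * χ) • ((sndMap E M * g) • extend X :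
              VF (𝓘(ℝ, E).prod 𝓘(ℝ)) (M × ℝ)) = g • G (ρ • X : VF 𝓘(ℝ, E) M) := by
            simp only [G, extend_smul, smul_smul]
            congr 1
            ring
          rw [h4]
          exact Submodule.smul_mem _ _ h3
      have h3 : (fstMap ρ * χ) • Z = Z := by
        funext z
        change (ρ z.1 * χ z) • Z z = Z z
        by_cases hz : Z z = 0
        · rw [hz]; exact smul_zero _
        · have h4 := interior_subset (hZO (subset_closure hz))
          have h5 : ρ z.1 = 1 ∧ χ z = 1 := h4
          rw [h5.1, h5.2, mul_one]
          exact one_smul ℝ _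
      rwa [h3] at h2

end Adiabatic

section BiSubmersion

set_option linter.unusedSectionVars false

variable {E : Type*} [NormedAddCommGroup E] [NormedSpace ℝ E] [FiniteDimensional ℝ E]
  {M : Type*} [TopologicalSpace M] [ChartedSpace E M] [IsManifold 𝓘(ℝ, E) ∞ M]
  {S : Span.{u} 𝓘(ℝ, E) M} {V : Submfd S.Model S.U}

namespace NormalChart

variable {ψ : OpenPartialHomeomorph M E} (c : NormalChart S V ψ ψ)

theorem symm_sec_mem {e : E} (he : c.sec e ∈ c.φ.target) : c.φ.symm (c.sec e) ∈ V.carrier := by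
  rw [c.slice _ (c.φ.map_target he), c.φ.right_inv he, c.ρ_sec]

theorem τ_sec (hV : S.IsIdentityBisection V) {e : E} (he : c.sec e ∈ c.φ.target) :
    c.τ (c.sec e) = e := by
  rw [AdaptedChart.τ, ← hV.eq _ (c.symm_sec_mem he), c.s_eq _ (c.φ.map_target he),
    c.φ.right_inv he, c.ρ_sec]

theorem eventually_sec_mem {e : E} (he : c.sec e ∈ c.φ.target) :
    ∀ᶠ e' in 𝓝 e, c.sec e' ∈ c.φ.target :=
  c.sec.continuous.continuousAt.eventually_mem (c.φ.open_target.mem_nhds he)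

theorem fderiv_τ_sec (hV : S.IsIdentityBisection V) {e : E} (he : c.sec e ∈ c.φ.target) (x : E) :
    fderiv ℝ c.τ (c.sec e) (c.sec x) = x := by
  have h1 : HasFDerivAt (fun e => c.τ (c.sec e)) ((fderiv ℝ c.τ (c.sec e)).comp c.sec) e :=
    ((c.contDiffAt_τ he).differentiableAt (by simp)).hasFDerivAt.comp e c.sec.hasFDerivAt
  have h2 : (fun e => c.τ (c.sec e)) =ᶠ[𝓝 e] id := by
    filter_upwards [c.eventually_sec_mem he] with e' he'
    exact c.τ_sec hV he'
  exact DFunLike.congr_fun (h1.unique ((hasFDerivAt_id e).congr_of_eventuallyEq h2)) x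

theorem mem_tangent {v : S.U} (hv : v ∈ c.φ.source) (hvV : v ∈ V.carrier) (ξ : S.Model) :
    ξ ∈ V.tangent v ↔ c.sec (c.ρ (chartD c.φ v ξ)) = chartD c.φ v ξ :=
  c.data.mem_tangent (mem_univ _) hv hvV ξ

theorem sec_apply_eq {v : S.U} (hv : v ∈ c.φ.source) (hvV : v ∈ V.carrier) :
    c.sec (ψ (S.s v)) = c.φ v := by
  rw [c.s_eq v hv, (c.slice v hv).1 hvV]

end NormalChart

theorem Span.IsIdentityBisection.dt_eq_ds (hV : S.IsIdentityBisection V) {v : S.U}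
    (hv : v ∈ V.carrier) {ξ : S.Model} (hξ : ξ ∈ V.tangent v) : S.dt v ξ = S.ds v ξ := by
  obtain ⟨c, hc⟩ := exists_normalChart hV (IsManifold.chart_mem_maximalAtlas (S.s v))
    (IsManifold.chart_mem_maximalAtlas (S.s v)) hv (mem_chart_source _ _)
    (by rw [← hV.eq v hv]; exact mem_chart_source _ _)
  have h1 := (c.mem_tangent hc hv ξ).1 hξ
  have h2 := c.sec_apply_eq hc hv
  have h3 : chartD (chartAt E (S.s v)) (S.t v) (S.dt v ξ) =
      chartD (chartAt E (S.s v)) (S.t v) (S.ds v ξ) := by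
    rw [c.chartD_dt hc, ← h1, ← h2, c.fderiv_τ_sec hV (by rw [h2]; exact c.φ.map_source hc),
      ← c.chartD_ds hc, hV.eq v hv]
  exact chartD_injective (IsManifold.chart_mem_maximalAtlas (S.s v)) (c.t_mem v hc) h3

theorem Span.IsIdentityBisection.inv (hV : S.IsIdentityBisection V) :
    S.inv.IsIdentityBisection V where
  eq := fun v hv => (hV.eq v hv).symm
  etale := fun v hv => by
    have h : (fun ξ : V.tangent v => S.dt v ξ) = fun ξ : V.tangent v => S.ds v ξ :=
      funext fun ξ => hV.dt_eq_ds hv ξ.2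
    change Function.Bijective fun ξ : V.tangent v => S.dt v ξ
    rw [h]
    exact hV.etale v hv

theorem surjective_deformD (hV : S.IsIdentityBisection V)
    (hS : ∀ u, Function.Surjective (S.ds u)) (y : DNC V) :
    Function.Surjective (deformD V S.s y) := by
  obtain ⟨D, hD⟩ := exists_deformChart hV hS y (IsManifold.chart_mem_maximalAtlas _)
    (IsManifold.chart_mem_maximalAtlas _) (mem_chart_source E (S.s (DNC.q y).1))
    (mem_chart_source E (S.t (DNC.q y).1))
  rintro ⟨a, b⟩
  obtain ⟨x, hx⟩ := chartD_surjective D.chart_mem hD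
    (D.sec (chartD (chartAt E (S.s (DNC.q y).1)) (S.s (DNC.q y).1) a), b)
  obtain ⟨h1, h2⟩ := D.chartD_ds hD x
  refine ⟨x, Prod.ext ?_ (h2.trans (congrArg Prod.snd hx))⟩
  refine chartD_injective D.memₛ (mem_chart_source E _) (h1.trans ?_)
  rw [hx, D.ρ_sec]

variable [T2Space M] [SecondCountableTopology M]
  {F : Submodule C^∞⟮𝓘(ℝ, E), M; ℝ⟯ (VF 𝓘(ℝ, E) M)}

theorem pullback_deformMap (hF : F ≤ compactFields 𝓘(ℝ, E) M) (hV : S.IsIdentityBisection V)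
    (hS : S.IsBiSubmersion F) :
    pullback 𝓘(ℝ, S.Model × ℝ) (adiabatic F) (deformMap V S.t) =
      verticalFields 𝓘(ℝ, S.Model × ℝ) (𝓘(ℝ, E).prod 𝓘(ℝ)) (deformMap V S.s) ⊔
      verticalFields 𝓘(ℝ, S.Model × ℝ) (𝓘(ℝ, E).prod 𝓘(ℝ)) (deformMap V S.t) := by
  have hD : ∀ y : DNC V, ∃ D : DeformChart S V (chartAt E (S.s (DNC.q y).1))
      (chartAt E (S.t (DNC.q y).1)), y ∈ D.d.chart.source := fun y =>
    exists_deformChart hV hS.submersion_s y (IsManifold.chart_mem_maximalAtlas _)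
      (IsManifold.chart_mem_maximalAtlas _) (mem_chart_source E (S.s (DNC.q y).1))
      (mem_chart_source E (S.t (DNC.q y).1))
  let pb : C^∞⟮𝓘(ℝ, E).prod 𝓘(ℝ), M × ℝ; ℝ⟯ → C^∞⟮𝓘(ℝ, S.Model × ℝ), DNC V; ℝ⟯ := fun f =>
    ⟨fun y => f (deformMap V S.t y), f.contMDiff.comp (contMDiff_deformMap S.smooth_t)⟩
  refine pullback_eq_sup (fun Y hY y₀ => ?_) fun X hX y₀ => ?_
  · change ∃ Z ∈ verticalFields 𝓘(ℝ, S.Model × ℝ) (𝓘(ℝ, E).prod 𝓘(ℝ)) (deformMap V S.s),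
      ∀ᶠ y in 𝓝 y₀, deformD V S.t y (Z y) = Y (deformMap V S.t y)
    induction hY using adiabatic_induction with
    | zero => exact ⟨0, Submodule.zero_mem _, Eventually.of_forall fun y => map_zero _⟩
    | add Y Y' _ _ h1 h2 =>
      obtain ⟨Z, hZ, hZY⟩ := h1
      obtain ⟨Z', hZ', hZY'⟩ := h2
      refine ⟨Z + Z', Submodule.add_mem _ hZ hZ', ?_⟩
      filter_upwards [hZY, hZY'] with y h3 h4
      exact (map_add (deformD V S.t y) (Z y) (Z' y)).trans (congrArg₂ (· + ·) h3 h4)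
    | smul f Y _ h1 =>
      obtain ⟨Z, hZ, hZY⟩ := h1
      refine ⟨pb f • Z, Submodule.smul_mem _ _ hZ, ?_⟩
      filter_upwards [hZY] with y h3
      exact (map_smul (deformD V S.t y) (pb f y) (Z y)).trans (congrArg (pb f y • ·) h3)
    | mem g hg X hX =>
      obtain ⟨D, hy₀⟩ := hD y₀
      obtain ⟨Z, hZ, hZX⟩ := D.exists_lift_deform hF hS hy₀ hX
      refine ⟨pb g • Z, Submodule.smul_mem _ _ hZ, ?_⟩
      filter_upwards [hZX] with y h3
      refine (map_smul (deformD V S.t y) (pb g y) (Z y)).trans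
        ((congrArg (pb g y • ·) h3).trans ?_)
      refine (smul_smul _ _ _).trans (congrArg (· • extend X (deformMap V S.t y)) ?_)
      exact mul_comm _ _
  · obtain ⟨D, hy₀⟩ := hD y₀
    exact D.exists_span_deform hS hy₀ hX

theorem Span.IsBiSubmersion.deform (hF : F ≤ compactFields 𝓘(ℝ, E) M)
    (hV : S.IsIdentityBisection V) (hS : S.IsBiSubmersion F) :
    (S.deform V).IsBiSubmersion (adiabatic F) := by
  have h1 := pullback_deformMap hF hV hS
  have h2 : pullback 𝓘(ℝ, S.Model × ℝ) (adiabatic F) (deformMap V S.s) =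
      verticalFields 𝓘(ℝ, S.Model × ℝ) (𝓘(ℝ, E).prod 𝓘(ℝ)) (deformMap V S.t) ⊔
      verticalFields 𝓘(ℝ, S.Model × ℝ) (𝓘(ℝ, E).prod 𝓘(ℝ)) (deformMap V S.s) :=
    pullback_deformMap (S := S.inv) (V := V) hF hV.inv hS.inv
  rw [sup_comm] at h2
  exact ⟨surjective_deformD hV hS.submersion_s,
    surjective_deformD (S := S.inv) (V := V) hV.inv hS.submersion_t, h2.trans h1.symm, h2⟩

end BiSubmersion

section Fiber

set_option linter.unusedSectionVars false

variable {E : Type*} [NormedAddCommGroup E] [NormedSpace ℝ E] [FiniteDimensional ℝ E]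
  {H : Type*} [TopologicalSpace H]
  {I : ModelWithCorners ℝ E H} {M : Type*} [TopologicalSpace M] [ChartedSpace H M]
  [IsManifold I ∞ M]
  {F : Submodule C^∞⟮I, M; ℝ⟯ (VF I M)}

theorem Fiber.mk_smul_eq_zero {x : M} {f : C^∞⟮I, M; ℝ⟯} (hf : f x = 0) (Y : F) :
    (Submodule.Quotient.mk (f • Y) : Fiber F x) = 0 :=
  (Submodule.Quotient.mk_eq_zero _).2 (Submodule.smul_mem_smul hf Submodule.mem_top)

theorem Fiber.mk_eq_zero_of_eventually [T2Space M] {x : M} {Y : F} (h : ∀ᶠ y in 𝓝 x, Y.1 y = 0) :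
    (Submodule.Quotient.mk Y : Fiber F x) = 0 := by
  obtain ⟨χ, -, h1, h2⟩ := exists_bump I h
  have h3 : (1 - χ) • Y = Y := by
    refine Subtype.ext (funext fun y => ?_)
    change (1 - χ y) • Y.1 y = Y.1 y
    by_cases hy : y ∈ tsupport χ
    · have h4 : Y.1 y = 0 := h1 hy
      rw [h4]
      exact smul_zero _
    · rw [image_eq_zero_of_notMem_tsupport hy, sub_zero]
      exact one_smul ℝ _
  rw [← h3]
  refine Fiber.mk_smul_eq_zero ?_ Y
  change 1 - χ x = 0
  rw [h2.self_of_nhds, sub_self]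

end Fiber

section Lift

set_option linter.unusedSectionVars false

variable {E : Type*} [NormedAddCommGroup E] [NormedSpace ℝ E] [FiniteDimensional ℝ E]
  {M : Type*} [TopologicalSpace M] [ChartedSpace E M] [IsManifold 𝓘(ℝ, E) ∞ M]
  {S : Span.{u} 𝓘(ℝ, E) M} {V : Submfd S.Model S.U}
  {ψ : OpenPartialHomeomorph M E}

/-- The vector field `Y` has a lift along `t` to a vector field in the kernel of `ds`, of value `n`
at `e₀`, in a chart. -/
def NormalChart.HasLift (c : NormalChart S V ψ ψ) (e₀ n : S.Model) (Y : VF 𝓘(ℝ, E) M) : Prop :=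
  ∃ b : S.Model → S.Model, b e₀ = n ∧ ∀ᶠ e in 𝓝 e₀, ContDiffAt ℝ ∞ b e ∧ c.ρ (b e) = 0 ∧
    fderiv ℝ c.τ e (b e) = fieldIn ψ Y (c.τ e)

theorem fieldIn_add (φ : OpenPartialHomeomorph M E) (X Y : VF 𝓘(ℝ, E) M) (e : E) :
    fieldIn φ (X + Y : VF 𝓘(ℝ, E) M) e = fieldIn φ X e + fieldIn φ Y e :=
  map_add (chartD φ (φ.symm e)) (X (φ.symm e)) (Y (φ.symm e))

theorem fieldIn_neg (φ : OpenPartialHomeomorph M E) (X : VF 𝓘(ℝ, E) M) (e : E) :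
    fieldIn φ (-X : VF 𝓘(ℝ, E) M) e = -fieldIn φ X e :=
  map_neg (chartD φ (φ.symm e)) (X (φ.symm e))

theorem fieldIn_smul (φ : OpenPartialHomeomorph M E) (f : C^∞⟮𝓘(ℝ, E), M; ℝ⟯)
    (X : VF 𝓘(ℝ, E) M) (e : E) :
    fieldIn φ (f • X : VF 𝓘(ℝ, E) M) e = f (φ.symm e) • fieldIn φ X e :=
  map_smul (chartD φ (φ.symm e)) (f (φ.symm e)) (X (φ.symm e))

theorem fieldIn_zero (φ : OpenPartialHomeomorph M E) (e : E) :
    fieldIn φ (0 : VF 𝓘(ℝ, E) M) e = 0 := map_zero (chartD φ (φ.symm e))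

theorem fieldIn_sum (φ : OpenPartialHomeomorph M E) {κ : Type*} (s : Finset κ)
    (X : κ → VF 𝓘(ℝ, E) M) (e : E) :
    fieldIn φ (∑ k ∈ s, X k : VF 𝓘(ℝ, E) M) e = ∑ k ∈ s, fieldIn φ (X k) e := by
  induction s using Finset.cons_induction with
  | empty => exact fieldIn_zero φ e
  | cons a s ha ih => rw [Finset.sum_cons, Finset.sum_cons, fieldIn_add, ih]

namespace NormalChart

variable (c : NormalChart S V ψ ψ)

theorem contMDiffAt_symm_τ {e : S.Model} (he : e ∈ c.φ.target) :
    ContMDiffAt 𝓘(ℝ, S.Model) 𝓘(ℝ, E) ∞ (fun e => ψ.symm (c.τ e)) e := by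
  refine ((S.smooth_t _).comp e (contMDiffAt_symm_of_mem_maximalAtlas c.mem he)
    ).congr_of_eventuallyEq ?_
  filter_upwards [c.φ.open_target.mem_nhds he] with e' he'
  exact c.symm_τ he'

variable {c} {e₀ n n' : S.Model} {Y Y' : VF 𝓘(ℝ, E) M}

theorem HasLift.add (h : c.HasLift e₀ n Y) (h' : c.HasLift e₀ n' Y') :
    c.HasLift e₀ (n + n') (Y + Y') := by
  obtain ⟨b, rfl, hb⟩ := h
  obtain ⟨b', rfl, hb'⟩ := h'
  refine ⟨fun e => b e + b' e, rfl, ?_⟩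
  filter_upwards [hb, hb'] with e h1 h2
  refine ⟨h1.1.add h2.1, by rw [map_add, h1.2.1, h2.2.1, add_zero], ?_⟩
  rw [map_add, h1.2.2, h2.2.2, fieldIn_add]

theorem HasLift.neg (h : c.HasLift e₀ n Y) : c.HasLift e₀ (-n) (-Y) := by
  obtain ⟨b, rfl, hb⟩ := h
  refine ⟨fun e => -b e, rfl, ?_⟩
  filter_upwards [hb] with e h1
  refine ⟨h1.1.neg, by rw [map_neg, h1.2.1, neg_zero], ?_⟩
  rw [map_neg, h1.2.2, fieldIn_neg]

theorem HasLift.sub (h : c.HasLift e₀ n Y) (h' : c.HasLift e₀ n' Y') :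
    c.HasLift e₀ (n - n') (Y - Y') := by
  rw [sub_eq_add_neg, sub_eq_add_neg]
  exact h.add h'.neg

theorem HasLift.smul (h : c.HasLift e₀ n Y) (he₀ : e₀ ∈ c.φ.target) (f : C^∞⟮𝓘(ℝ, E), M; ℝ⟯) :
    c.HasLift e₀ (f (ψ.symm (c.τ e₀)) • n) (f • Y) := by
  obtain ⟨b, rfl, hb⟩ := h
  refine ⟨fun e => f (ψ.symm (c.τ e)) • b e, rfl, ?_⟩
  filter_upwards [hb, c.φ.open_target.mem_nhds he₀] with e h1 h2
  refine ⟨ContDiffAt.smul ?_ h1.1, by rw [map_smul, h1.2.1, smul_zero], ?_⟩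
  · exact ((f.contMDiff _).comp e (c.contMDiffAt_symm_τ h2)).contDiffAt
  · rw [map_smul, h1.2.2, fieldIn_smul]

theorem HasLift.congr (h : c.HasLift e₀ n Y) (he₀ : e₀ ∈ c.φ.target)
    (hY : ∀ᶠ y in 𝓝 (ψ.symm (c.τ e₀)), Y y = Y' y) : c.HasLift e₀ n Y' := by
  obtain ⟨b, rfl, hb⟩ := h
  refine ⟨b, rfl, ?_⟩
  filter_upwards [hb, (c.contMDiffAt_symm_τ he₀).continuousAt.eventually hY] with e h1 h2
  refine ⟨h1.1, h1.2.1, h1.2.2.trans ?_⟩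
  exact congrArg (chartD ψ (ψ.symm (c.τ e))) h2

theorem HasLift.ρ_eq_zero (h : c.HasLift e₀ n Y) : c.ρ n = 0 := by
  obtain ⟨b, rfl, hb⟩ := h
  exact hb.self_of_nhds.2.1

variable [T2Space M] [SecondCountableTopology M]
  {F : Submodule C^∞⟮𝓘(ℝ, E), M; ℝ⟯ (VF 𝓘(ℝ, E) M)}

theorem exists_hasLift (hF : F ≤ compactFields 𝓘(ℝ, E) M) (hS : S.IsBiSubmersion F) {v : S.U}
    (hv : v ∈ c.φ.source) (hY : Y ∈ F) : ∃ n, c.HasLift (c.φ v) n Y := by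
  obtain ⟨b, hb⟩ := c.exists_lift hF hS hv hY
  exact ⟨_, b, rfl, hb⟩

theorem hasLift_zero_of_mk_eq_zero (hF : F ≤ compactFields 𝓘(ℝ, E) M) (hS : S.IsBiSubmersion F)
    {v : S.U} (hv : v ∈ c.φ.source) {x : M} (hx : S.t v = x) {Y : F}
    (hY : (Submodule.Quotient.mk Y : Fiber F x) = 0) :
    c.HasLift (c.φ v) 0 Y.1 := by
  rw [Submodule.Quotient.mk_eq_zero] at hY
  induction hY using Submodule.smul_induction_on' with
  | smul f hf Y _ =>
    obtain ⟨n, hn⟩ := exists_hasLift (c := c) hF hS hv Y.2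
    have h1 := hn.smul (c.φ.map_source hv) f
    have h2 : f (ψ.symm (c.τ (c.φ v))) = 0 := by
      rw [c.τ_apply hv, ψ.left_inv (c.t_mem v hv), hx]
      exact hf
    rw [h2, zero_smul] at h1
    exact h1
  | add Y _ Y' _ h1 h2 =>
    have := h1.add h2
    rw [add_zero] at this
    exact this

/-- A smooth family of vectors in the kernel of `ds` along `V` is mapped by `dt` to an element
of `F`. -/
theorem exists_hasLift_of_section (hF : F ≤ compactFields 𝓘(ℝ, E) M)
    (hV : S.IsIdentityBisection V) (hS : S.IsBiSubmersion F)
    {v : S.U} (hv : v ∈ c.φ.source) (hvV : v ∈ V.carrier) {ζ : E → S.Model}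
    (hζ : ∀ᶠ e in 𝓝 (ψ (S.s v)), ContDiffAt ℝ ∞ ζ e ∧ c.ρ (ζ e) = 0) :
    ∃ Y ∈ F, c.HasLift (c.φ v) (ζ (ψ (S.s v))) Y ∧
      (∀ᶠ e in 𝓝 (ψ (S.s v)), fieldIn ψ Y e = fderiv ℝ c.τ (c.sec e) (ζ e)) ∧
      (ζ (ψ (S.s v)) = 0 → ∀ hY : Y ∈ F,
        (Submodule.Quotient.mk (⟨Y, hY⟩ : F) : Fiber F (S.s v)) = 0) := by
  have hsv := c.s_mem v hv
  have he₀ : c.sec (ψ (S.s v)) = c.φ v := c.sec_apply_eq hv hvV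
  have ht : c.φ v ∈ c.φ.target := c.φ.map_source hv
  have hτ : c.τ (c.φ v) = ψ (S.s v) := by rw [c.τ_apply hv, hV.eq v hvV]
  obtain ⟨κ, _, Y, C, hY, hC⟩ := c.exists_span hS hv
  choose Z hZ using fun k => c.exists_lift hF hS hv (hY k)
  have hsec : Tendsto c.sec (𝓝 (ψ (S.s v))) (𝓝 (c.φ v)) := by
    rw [← he₀]; exact c.sec.continuous.continuousAt
  have hψc : Tendsto ψ (𝓝 (S.s v)) (𝓝 (ψ (S.s v))) := ψ.continuousAt hsv
  have hτc : Tendsto c.τ (𝓝 (c.φ v)) (𝓝 (ψ (S.s v))) := by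
    rw [← hτ]; exact (c.contDiffAt_τ ht).continuousAt
  let f : κ → E → ℝ := fun k e => C k (c.sec e) (ζ e)
  have hf : ∀ᶠ e in 𝓝 (ψ (S.s v)), ∀ k, ContDiffAt ℝ ∞ (f k) e := by
    filter_upwards [hsec.eventually hC, hζ] with e h1 h2 k
    exact ((h1.1 k).comp e c.sec.contDiff.contDiffAt).clm_apply h2.1
  choose g hg hgf using fun k => exists_smooth_extension (I := 𝓘(ℝ, E)) (x := S.s v)
    (f := fun y => f k (ψ y)) (by
      filter_upwards [hψc.eventually hf, ψ.open_source.mem_nhds hsv] with y h1 h2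
      exact (h1 k).contMDiffAt.comp y (contMDiffAt_of_mem_maximalAtlas c.memₛ h2))
  let Y' : VF 𝓘(ℝ, E) M := ∑ k, g k • Y k
  have hY' : Y' ∈ F := Submodule.sum_mem _ fun k _ => Submodule.smul_mem _ _ (hY k)
  have hsymm : Tendsto ψ.symm (𝓝 (ψ (S.s v))) (𝓝 (S.s v)) := by
    have := ψ.continuousAt_symm (ψ.map_source hsv)
    rwa [ContinuousAt, ψ.left_inv hsv] at this
  have hfield : ∀ᶠ e in 𝓝 (ψ (S.s v)), fieldIn ψ Y' e = ∑ k, f k e • fieldIn ψ (Y k) e := by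
    filter_upwards [hsymm.eventually (eventually_all.2 hgf),
      ψ.open_target.mem_nhds (ψ.map_source hsv)] with e h1 h2
    rw [fieldIn_sum]
    refine Finset.sum_congr rfl fun k _ => ?_
    rw [fieldIn_smul, h1 k, ψ.right_inv h2]
  refine ⟨Y', hY', ?_, ?_, ?_⟩
  · refine ⟨fun e => ζ (c.τ e) - ∑ k, (C k e (ζ (c.τ e)) - f k (c.τ e)) • Z k e, ?_, ?_⟩
    · have : ∀ k, C k (c.φ v) (ζ (ψ (S.s v))) - f k (ψ (S.s v)) = 0 := fun k => by
        simp only [f, he₀, sub_self]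
      simp only [hτ, this, zero_smul, Finset.sum_const_zero, sub_zero]
    · filter_upwards [hτc.eventually hζ, hτc.eventually hf, hC, eventually_all.2 hZ,
        c.φ.open_target.mem_nhds ht, hτc.eventually hfield] with e h1 h2 h3 h4 h5 h6
      have h7 := c.contDiffAt_τ h5
      have h8 : ContDiffAt ℝ ∞ (fun e => ζ (c.τ e)) e := h1.1.comp e h7
      refine ⟨h8.sub (ContDiffAt.sum fun k _ => ((((h3.1 k).clm_apply h8)).sub
        ((h2 k).comp e h7)).smul (h4 k).1), ?_, ?_⟩
      · simp only [map_sub, map_sum, map_smul, (h4 _).2.1, smul_zero, h1.2, Finset.sum_const_zero,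
          sub_zero]
      · simp only [map_sub, map_sum, map_smul, (h4 _).2.2]
        rw [h3.2 _ h1.2, h6, ← Finset.sum_sub_distrib]
        refine Finset.sum_congr rfl fun k _ => ?_
        rw [sub_smul, sub_sub_cancel]
  · filter_upwards [hfield, hsec.eventually hC, hζ,
      hsec.eventually (c.φ.open_target.mem_nhds ht)] with e h1 h2 h3 h4
    rw [h1, h2.2 _ h3.2, c.τ_sec hV h4]
  · intro h0 hY'
    have h1 : ∀ k, g k (S.s v) = 0 := fun k => by
      rw [(hgf k).self_of_nhds]
      simp only [f, h0, map_zero]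
    have h2 : (⟨Y', hY'⟩ : F) = ∑ k, g k • (⟨Y k, hY k⟩ : F) := by
      refine Subtype.ext ?_
      rw [AddSubmonoidClass.coe_finsetSum]
      rfl
    rw [h2]
    have h3 : ∀ s : Finset κ, (Submodule.Quotient.mk (∑ k ∈ s, g k • (⟨Y k, hY k⟩ : F)) :
        Fiber F (S.s v)) = 0 := fun s => by
      induction s using Finset.cons_induction with
      | empty => rw [Finset.sum_empty, Submodule.Quotient.mk_zero]
      | cons k s hk ih =>
        rw [Finset.sum_cons, Submodule.Quotient.mk_add, ih, Fiber.mk_smul_eq_zero (h1 k), add_zero]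
    exact h3 _

theorem eventually_eq_of_fieldIn {x : M} (hx : x ∈ ψ.source)
    (hψ : ψ ∈ IsManifold.maximalAtlas 𝓘(ℝ, E) ∞ M)
    (h : ∀ᶠ e in 𝓝 (ψ x), fieldIn ψ Y e = fieldIn ψ Y' e) : ∀ᶠ y in 𝓝 x, Y y = Y' y := by
  filter_upwards [(ψ.continuousAt hx).eventually h, ψ.open_source.mem_nhds hx] with y h1 h2
  rw [fieldIn_apply _ h2, fieldIn_apply _ h2] at h1
  exact chartD_injective hψ h2 h1

theorem mk_eq_zero_of_hasLift (hF : F ≤ compactFields 𝓘(ℝ, E) M)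
    (hV : S.IsIdentityBisection V) (hS : S.IsBiSubmersion F)
    {v : S.U} (hv : v ∈ c.φ.source) (hvV : v ∈ V.carrier) {Y : F}
    (h : c.HasLift (c.φ v) 0 Y.1) : (Submodule.Quotient.mk Y : Fiber F (S.s v)) = 0 := by
  obtain ⟨b, hb0, hb⟩ := h
  have he₀ : c.sec (ψ (S.s v)) = c.φ v := c.sec_apply_eq hv hvV
  have hsec : Tendsto c.sec (𝓝 (ψ (S.s v))) (𝓝 (c.φ v)) := by
    rw [← he₀]; exact c.sec.continuous.continuousAt
  obtain ⟨Y', hY', -, h1, h2⟩ := exists_hasLift_of_section (c := c) (ζ := fun e => b (c.sec e))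
    hF hV hS hv hvV (by
      filter_upwards [hsec.eventually hb] with e h1
      exact ⟨h1.1.comp e c.sec.contDiff.contDiffAt, h1.2.1⟩)
  have h3 : ∀ᶠ y in 𝓝 (S.s v), Y.1 y = Y' y := by
    refine eventually_eq_of_fieldIn (c.s_mem v hv) c.memₛ ?_
    filter_upwards [h1, hsec.eventually hb,
      hsec.eventually (c.φ.open_target.mem_nhds (c.φ.map_source hv))] with e h4 h5 h6
    rw [h4, h5.2.2, c.τ_sec hV h6]
  have h4 : (Submodule.Quotient.mk (Y - ⟨Y', hY'⟩) : Fiber F (S.s v)) = 0 := by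
    refine Fiber.mk_eq_zero_of_eventually ?_
    filter_upwards [h3] with y hy
    exact sub_eq_zero.2 hy
  rw [Submodule.Quotient.mk_sub, h2 (by rw [he₀, hb0]) hY', sub_zero] at h4
  exact h4

theorem HasLift.mk_eq_iff (hF : F ≤ compactFields 𝓘(ℝ, E) M)
    (hV : S.IsIdentityBisection V) (hS : S.IsBiSubmersion F)
    {v : S.U} (hv : v ∈ c.φ.source) (hvV : v ∈ V.carrier) {Y Y' : F}
    (h : c.HasLift (c.φ v) n Y.1) :
    (Submodule.Quotient.mk Y : Fiber F (S.s v)) = Submodule.Quotient.mk Y' ↔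
      c.HasLift (c.φ v) n Y'.1 := by
  constructor
  · intro h1
    have h2 : (Submodule.Quotient.mk (Y' - Y) : Fiber F (S.s v)) = 0 := by
      rw [Submodule.Quotient.mk_sub, h1, sub_self]
    have h3 := h.add (hasLift_zero_of_mk_eq_zero (c := c) hF hS hv (hV.eq v hvV).symm h2)
    have h4 : Y.1 + (Y' - Y).1 = Y'.1 := add_sub_cancel Y.1 Y'.1
    rwa [add_zero, h4] at h3
  · intro h1
    have h2 := h.sub h1
    rw [sub_self] at h2
    have h3 := mk_eq_zero_of_hasLift (Y := Y - Y') hF hV hS hv hvV h2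
    rwa [Submodule.Quotient.mk_sub, sub_eq_zero] at h3

/-- For a vector field `ξ` on `U`, a vector field `Y` of `F` whose restriction to `V` is
`dt(ξ) - ds(ξ)`. -/
theorem exists_hasLift_of_field (hF : F ≤ compactFields 𝓘(ℝ, E) M)
    (hV : S.IsIdentityBisection V) (hS : S.IsBiSubmersion F)
    {v : S.U} (hv : v ∈ c.φ.source) (hvV : v ∈ V.carrier) {ξ : VF 𝓘(ℝ, S.Model) S.U}
    (hξ : IsSmooth ξ) :
    ∃ Y ∈ F, (∀ᶠ w in 𝓝 v, w ∈ V.carrier → Y (S.s w) = S.dt w (ξ w) - S.ds w (ξ w)) ∧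
      c.HasLift (c.φ v) (chartD c.φ v (ξ v) - c.sec (c.ρ (chartD c.φ v (ξ v)))) Y := by
  have he₀ : c.sec (ψ (S.s v)) = c.φ v := c.sec_apply_eq hv hvV
  have hsec : Tendsto c.sec (𝓝 (ψ (S.s v))) (𝓝 (c.φ v)) := by
    rw [← he₀]; exact c.sec.continuous.continuousAt
  have ht := c.φ.map_source hv
  let ζ : E → S.Model := fun e =>
    fieldIn c.φ ξ (c.sec e) - c.sec (c.ρ (fieldIn c.φ ξ (c.sec e)))
  obtain ⟨Y, hY, h1, h2, -⟩ := exists_hasLift_of_section (c := c) (ζ := ζ) hF hV hS hv hvV (by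
    filter_upwards [hsec.eventually (c.φ.open_target.mem_nhds ht)] with e h1
    have h2 : ContDiffAt ℝ ∞ (fun e => fieldIn c.φ ξ (c.sec e)) e :=
      (contDiffAt_fieldIn c.mem hξ h1).comp e c.sec.contDiff.contDiffAt
    refine ⟨h2.sub ((c.sec.comp c.ρ).contDiff.contDiffAt.comp e h2), ?_⟩
    simp only [ζ, map_sub, c.ρ_sec, sub_self])
  refine ⟨Y, hY, ?_, ?_⟩
  · have hc : Tendsto (fun w => ψ (S.s w)) (𝓝 v) (𝓝 (ψ (S.s v))) :=
      (ψ.continuousAt (c.s_mem v hv)).tendsto.comp S.smooth_s.continuous.continuousAt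
    filter_upwards [hc.eventually h2, c.φ.open_source.mem_nhds hv] with w h3 h4 h5
    have h6 := c.sec_apply_eq h4 h5
    have h7 : c.ρ (c.φ w) = ψ (S.s w) := (c.s_eq w h4).symm
    have h10 : S.s w = S.t w := hV.eq w h5
    rw [fieldIn_apply _ (c.s_mem w h4)] at h3
    simp only [ζ] at h3
    rw [h6, fieldIn_apply _ h4, map_sub, ← h6, c.fderiv_τ_sec hV (by
      rw [h6]; exact c.φ.map_source h4), h6] at h3
    have h11 : chartD ψ (S.t w) = chartD ψ (S.s w) := by rw [h10]
    have h12 := c.chartD_dt h4 (ξ w)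
    rw [h11] at h12
    refine chartD_injective c.memₛ (c.s_mem w h4) (h3.trans ?_)
    refine (congrArg₂ (· - ·) h12.symm (c.chartD_ds h4 (ξ w)).symm).trans ?_
    exact (map_sub (chartD ψ (S.s w)) _ _).symm
  · have h8 : ζ (ψ (S.s v)) = chartD c.φ v (ξ v) - c.sec (c.ρ (chartD c.φ v (ξ v))) := by
      simp only [ζ]
      rw [he₀, fieldIn_apply _ hv]
    rw [h8] at h1
    exact h1

end NormalChart

end Lift

section Flow

set_option linter.unusedSectionVars false

variable {E : Type*} [NormedAddCommGroup E] [NormedSpace ℝ E] [FiniteDimensional ℝ E]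
  {M : Type*} [TopologicalSpace M] [ChartedSpace E M] [IsManifold 𝓘(ℝ, E) ∞ M]
  {S : Span.{u} 𝓘(ℝ, E) M} {V : Submfd S.Model S.U}
  {ψ : OpenPartialHomeomorph M E}

/-- `Γ (e, β)` is, in a chart, the integral curve of `β Y` starting at `e`. -/
structure IsExp (ψ : OpenPartialHomeomorph M E) (Y : VF 𝓘(ℝ, E) M) (e₀ : E)
    (Γ : E × ℝ → ℝ → E) : Prop where
  base : ∀ r ∈ Icc (0 : ℝ) 1, Γ (e₀, 0) r = e₀
  zero : ∀ p, Γ p 0 = p.1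
  smooth : ∀ᶠ p in 𝓝 (e₀, (0 : ℝ)), ContDiffAt ℝ ∞ (fun p => Γ p 1) p
  deriv : ∀ᶠ p in 𝓝 (e₀, (0 : ℝ)), ∀ r ∈ Icc (0 : ℝ) 1,
    HasDerivAt (Γ p) (p.2 • fieldIn ψ Y (Γ p r)) r
  cont : ∀ r ∈ Icc (0 : ℝ) 1, ContinuousAt (Function.uncurry Γ) ((e₀, 0), r)

theorem exists_isExp (hψ : ψ ∈ IsManifold.maximalAtlas 𝓘(ℝ, E) ∞ M) {Y : VF 𝓘(ℝ, E) M}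
    (hY : IsSmooth Y) {e₀ : E} (he₀ : e₀ ∈ ψ.target) : ∃ Γ, IsExp ψ Y e₀ Γ := by
  obtain ⟨Γ, h1, h2, h3, h4, h5⟩ := exists_local_flow (P := E × ℝ) (X := E)
    (fun q => q.1.2 • fieldIn ψ Y q.2.2) (e₀, (0 : ℝ)) (fun _ => e₀) (by
      intro r _
      have hc : Tendsto (fun q : (E × ℝ) × ℝ × E => q.2.2) (𝓝 ((e₀, (0 : ℝ)), r, e₀)) (𝓝 e₀) :=
        (by fun_prop : Continuous fun q : (E × ℝ) × ℝ × E => q.2.2).continuousAt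
      filter_upwards [hc.eventually (ψ.open_target.mem_nhds he₀)] with q hq
      exact (by fun_prop : ContDiffAt ℝ ∞ (fun q : (E × ℝ) × ℝ × E => q.1.2) q).smul
        ((contDiffAt_fieldIn hψ hY hq).comp q (f := fun q : (E × ℝ) × ℝ × E => q.2.2)
          (by fun_prop))) (by
      intro r _
      simp only [zero_smul]
      exact hasDerivAt_const _ _) Prod.fst (Eventually.of_forall fun _ => contDiffAt_fst) rfl
  exact ⟨Γ, h2, h3, h1, h4, h5⟩

variable {Y : VF 𝓘(ℝ, E) M} {e₀ : E} {Γ Γ' : E × ℝ → ℝ → E}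

theorem IsExp.tendsto (h : IsExp ψ Y e₀ Γ) :
    Tendsto (fun p : E × ℝ => (Γ p 1, p.2)) (𝓝 (e₀, 0)) (𝓝 (e₀, 0)) := by
  have h1 := h.smooth.self_of_nhds.continuousAt.prodMk
    (continuousAt_snd (p := (e₀, (0 : ℝ))))
  rw [ContinuousAt] at h1
  simp only [h.base 1 ⟨zero_le_one, le_rfl⟩] at h1
  exact h1

theorem hasFDerivAt_dil (π : S.Model →L[ℝ] S.Model) (β : ℝ) (x : S.Model) :
    HasFDerivAt (dil π β) (π + β • (ContinuousLinearMap.id ℝ S.Model - π)) x :=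
  π.hasFDerivAt.add (((hasFDerivAt_id x).sub π.hasFDerivAt).const_smul β)

namespace NormalChart

variable {c : NormalChart S V ψ ψ} {n : S.Model}

theorem HasLift.exists_flow {v : S.U} (h : c.HasLift (c.φ v) n Y) (hY : IsSmooth Y)
    (hv : v ∈ c.φ.source) (hvV : v ∈ V.carrier) (hV : S.IsIdentityBisection V)
    (he₀ : ψ (S.s v) = e₀) (hΓ : IsExp ψ Y e₀ Γ) {f : E × ℝ → E}
    (hf : Tendsto (fun p : E × ℝ => (f p, p.2)) (𝓝 (e₀, 0)) (𝓝 (e₀, 0)))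
    {m : S.Model} (hm : c.ρ m = 0) {g₀ : E × ℝ → S.Model} (hg₀m : g₀ (e₀, 0) = c.φ v + m)
    (hg₀ : ∀ᶠ p in 𝓝 (e₀, (0 : ℝ)), ContDiffAt ℝ ∞ g₀ p ∧ c.ρ (g₀ p) = p.1 ∧
      c.τ (dil c.data.π p.2 (g₀ p)) = f p) :
    ∃ g : E × ℝ → S.Model, g (e₀, 0) = c.φ v + (m + n) ∧
      ∀ᶠ p in 𝓝 (e₀, (0 : ℝ)), ContDiffAt ℝ ∞ g p ∧ c.ρ (g p) = p.1 ∧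
        c.τ (dil c.data.π p.2 (g p)) = Γ (f p, p.2) 1 := by
  have hn := h.ρ_eq_zero
  obtain ⟨b, hbn, hb⟩ := h
  have ht : c.φ v ∈ c.φ.target := c.φ.map_source hv
  have hτ : c.τ (c.φ v) = e₀ := by rw [c.τ_apply hv, ← hV.eq v hvV, he₀]
  have hπ : ∀ x, c.data.π x = c.sec (c.ρ x) := fun _ => rfl
  have hπv : c.data.π (c.φ v) = c.φ v := (c.slice v hv).1 hvV
  have het : e₀ ∈ ψ.target := he₀ ▸ ψ.map_source (c.s_mem v hv)
  let γ₀ : ℝ → S.Model := fun r => c.φ v + m + r • n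
  have hdil : ∀ r, dil c.data.π 0 (γ₀ r) = c.φ v := fun r => by
    rw [DNC.dil_zero, map_add, map_add, map_smul, hπv, hπ m, hm, hπ n, hn]
    simp
  have hdc : Continuous fun q : (E × ℝ) × S.Model => dil c.data.π q.1.2 q.2 :=
    (contDiff_dil c.data.π).continuous.comp
      (by fun_prop : Continuous fun q : (E × ℝ) × S.Model => (q.2, q.1.2))
  have hdt : ∀ r, Tendsto (fun q : (E × ℝ) × S.Model => dil c.data.π q.1.2 q.2)
      (𝓝 ((e₀, (0 : ℝ)), γ₀ r)) (𝓝 (c.φ v)) := fun r => by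
    have := hdc.continuousAt (x := ((e₀, (0 : ℝ)), γ₀ r))
    rw [ContinuousAt] at this
    simp only [hdil] at this
    exact this
  have hds : ContDiff ℝ ∞ fun q : (E × ℝ) × S.Model => dil c.data.π q.1.2 q.2 :=
    (contDiff_dil c.data.π).comp
      (by fun_prop : ContDiff ℝ ∞ fun q : (E × ℝ) × S.Model => (q.2, q.1.2))
  have hf₀ : f (e₀, 0) = e₀ := by
    have h1 := hg₀.self_of_nhds.2.2
    have h2 : dil c.data.π 0 (g₀ (e₀, 0)) = c.φ v := by
      have := hdil 0
      simp only [γ₀, zero_smul, add_zero] at this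
      rw [hg₀m, this]
    rw [h2, hτ] at h1
    exact h1.symm
  have hfr : ∀ r : ℝ, Tendsto (fun q : (E × ℝ) × ℝ => ((f q.1, q.1.2), q.2)) (𝓝 ((e₀, 0), r))
      (𝓝 ((e₀, 0), r)) := fun r => by
    have h1 : Tendsto (fun q : (E × ℝ) × ℝ => (f q.1, q.1.2)) (𝓝 ((e₀, 0), r)) (𝓝 (e₀, 0)) :=
      hf.comp (continuousAt_fst (p := ((e₀, (0 : ℝ)), r)))
    exact h1.prodMk_nhds (continuousAt_snd (p := ((e₀, (0 : ℝ)), r)))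
  have main : ∃ g : E × ℝ → S.Model, (∀ᶠ p in 𝓝 (e₀, (0 : ℝ)), ContDiffAt ℝ ∞ g p) ∧
      g (e₀, 0) = γ₀ 1 ∧ ∀ᶠ p in 𝓝 (e₀, (0 : ℝ)), c.τ (dil c.data.π p.2 (g p)) =
        Γ (f p, p.2) 1 ∧ c.ρ (g p) = c.ρ (g₀ p) := by
    refine exists_path_lift (κ := Unit) (p₀ := (e₀, (0 : ℝ))) (e₀ := e₀) (γ₀ := γ₀)
      (Y := fun _ => fieldIn ψ Y) (C := fun _ _ => 1)
      (b := fun _ q => b (dil c.data.π q.1.2 q.2))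
      (τ := fun q => c.τ (dil c.data.π q.1.2 q.2)) (μ := fun p => p.2)
      (β := fun p r => Γ (f p, p.2) r) (g₀ := g₀) c.ρ ?_ ?_ ?_ ?_ ?_ ?_ ?_ ?_ ?_ ?_ ?_ ?_ ?_ ?_
    · exact fun _ => (contDiffAt_fieldIn c.memₛ hY het).of_le (by simp)
    · exact fun _ _ _ => Eventually.of_forall fun _ => contDiffAt_const
    · intro _ r _
      filter_upwards [(hdt r).eventually hb] with q hq
      exact hq.1.comp q hds.contDiffAt
    · intro r _
      filter_upwards [(hdt r).eventually hb, (hdt r).eventually (c.φ.open_target.mem_nhds ht)]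
        with q h1 h2
      have h3 := ((c.contDiffAt_τ h2).differentiableAt (by simp)).hasFDerivAt.comp q.2
        (hasFDerivAt_dil c.data.π q.1.2 q.2)
      refine ⟨h3.differentiableAt, fun _ => ?_⟩
      have h4 : (c.data.π + q.1.2 • (ContinuousLinearMap.id ℝ S.Model - c.data.π))
          (b (dil c.data.π q.1.2 q.2)) = q.1.2 • b (dil c.data.π q.1.2 q.2) := by
        simp [hπ, h1.2.1]
      rw [show fderiv ℝ (fun x => c.τ (dil c.data.π q.1.2 x)) q.2 = _ from h3.fderiv,
        ContinuousLinearMap.comp_apply, h4, map_smul, h1.2.2]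
    · intro r _
      refine ContinuousAt.comp (g := c.τ) (f := fun q : (E × ℝ) × S.Model =>
        dil c.data.π q.1.2 q.2) (x := ((e₀, (0 : ℝ)), γ₀ r)) ?_ hdc.continuousAt
      simp only [hdil]
      exact (c.contDiffAt_τ ht).continuousAt
    · intro r _
      simp only [hdil, hτ]
    · intro _ r _
      filter_upwards [(hdt r).eventually hb] with q hq
      exact hq.2.1
    · intro r hr
      have h1 := (hΓ.cont r hr).tendsto.comp (hfr r)
      rw [ContinuousAt]
      simp only [Function.uncurry_apply_pair] at h1 ⊢
      rw [hf₀]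
      exact h1
    · intro r hr
      simp only [hf₀]
      exact hΓ.base r hr
    · filter_upwards [hf.eventually hΓ.deriv] with p hp r hr
      simp only [Finset.univ_unique, Finset.sum_const, Finset.card_singleton, one_smul]
      exact hp r hr
    · intro r _
      simp only [Finset.univ_unique, Finset.sum_const, Finset.card_singleton, one_smul, hdil, hbn]
      have := ((hasDerivAt_id r).smul_const n).const_add (c.φ v + m)
      rw [one_smul] at this
      exact this
    · exact hg₀.mono fun p hp => hp.1
    · simp only [γ₀, zero_smul, add_zero, hg₀m]
    · filter_upwards [hg₀] with p hp
      rw [hp.2.2, hΓ.zero]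
  obtain ⟨g, h1, h2, h3⟩ := main
  refine ⟨g, by rw [h2]; simp only [γ₀, one_smul, add_assoc], ?_⟩
  filter_upwards [h1, h3, hg₀] with p h4 h5 h6
  exact ⟨h4, h5.2.trans h6.2.1, h5.1⟩

end NormalChart

end Flow

section CarriesDeform

set_option linter.unusedSectionVars false

variable {E : Type*} [NormedAddCommGroup E] [NormedSpace ℝ E] [FiniteDimensional ℝ E]
  {M : Type*} [TopologicalSpace M] [ChartedSpace E M] [IsManifold 𝓘(ℝ, E) ∞ M]
  {S : Span.{u} 𝓘(ℝ, E) M} {V : Submfd S.Model S.U}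
  {ψ : OpenPartialHomeomorph M E} {c : NormalChart S V ψ ψ} {e₀ : E}

/-- A map of `E × ℝ`, over the identity of `ℝ`, as a map of `M × ℝ`. -/
def chartMap (ψ : OpenPartialHomeomorph M E) (f : E × ℝ → E) (p : M × ℝ) : M × ℝ :=
  (ψ.symm (f (ψ p.1, p.2)), p.2)

namespace NormalChart

/-- The component transverse to `V` of the normal vector `n`, in the chart. -/
noncomputable def normalPart (c : NormalChart S V ψ ψ) (v : V.carrier) (n : V.Normal (v : S.U)) :
    S.Model := (c.data.chart (DNC.on v n)).1 - c.φ v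

theorem chart_on (v : V.carrier) (n : V.Normal (v : S.U)) :
    c.data.chart (DNC.on v n) = (c.φ v + c.normalPart v n, 0) :=
  Prod.ext (add_sub_cancel _ _).symm rfl

theorem normalPart_mk (v : V.carrier) (ξ : S.Model) (hv : (v : S.U) ∈ c.φ.source) :
    c.normalPart v (Submodule.Quotient.mk ξ) =
      chartD c.φ v ξ - c.sec (c.ρ (chartD c.φ v ξ)) := by
  have h1 : (DNC.rep (Submodule.Quotient.mk ξ : V.Normal (v : S.U)) - ξ : S.Model) ∈
    V.tangent (v : S.U) := DNC.rep_mk_sub ξ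
  rw [c.mem_tangent hv v.2, map_sub, map_sub, map_sub] at h1
  refine (add_sub_cancel_left (c.φ v) _).trans ?_
  exact sub_eq_sub_iff_sub_eq_sub.2 h1.symm

theorem tendsto_chart {x : M} (hx : x ∈ ψ.source) (he₀ : ψ x = e₀) :
    Tendsto (fun p : M × ℝ => (ψ p.1, p.2)) (𝓝 (x, 0)) (𝓝 (e₀, 0)) := by
  have h1 : ContinuousAt (fun p : M × ℝ => ψ p.1) (x, 0) :=
    ContinuousAt.comp (x := (x, (0 : ℝ))) (g := ψ) (ψ.continuousAt hx) continuousAt_fst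
  have h2 := h1.prodMk (continuousAt_snd (p := (x, (0 : ℝ))))
  rw [ContinuousAt] at h2
  simp only [he₀] at h2
  exact h2

theorem tendsto_chart_symm {x : M} (hx : x ∈ ψ.source) (he₀ : ψ x = e₀) :
    Tendsto (fun p : E × ℝ => (ψ.symm p.1, p.2)) (𝓝 (e₀, 0)) (𝓝 (x, 0)) := by
  have h0 : ContinuousAt ψ.symm e₀ := ψ.continuousAt_symm (he₀ ▸ ψ.map_source hx)
  have h1 : ContinuousAt (fun p : E × ℝ => ψ.symm p.1) (e₀, 0) :=
    ContinuousAt.comp (x := (e₀, (0 : ℝ))) (g := ψ.symm) h0 continuousAt_fst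
  have h2 := h1.prodMk (continuousAt_snd (p := (e₀, (0 : ℝ))))
  rw [ContinuousAt] at h2
  simp only [← he₀, ψ.left_inv hx] at h2
  rw [← he₀]
  exact h2

variable [T2Space M] [SecondCountableTopology M]

theorem carries_of_chart (v : V.carrier) (n : V.Normal (v : S.U)) (hv : (v : S.U) ∈ c.φ.source)
    (he₀ : ψ (S.s v) = e₀) {g : E × ℝ → S.Model} {f : E × ℝ → E}
    (hg₀ : g (e₀, 0) = c.φ v + c.normalPart v n)
    (hg : ∀ᶠ p in 𝓝 (e₀, (0 : ℝ)), ContDiffAt ℝ ∞ g p ∧ c.ρ (g p) = p.1 ∧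
      c.τ (dil c.data.π p.2 (g p)) = f p) :
    (S.deform V).Carries (DNC.on v n) (chartMap ψ f) := by
  let y : DNC V := DNC.on v n
  have hy : y ∈ c.data.chart.source := c.deform.mem_source_iff.2 ⟨hv, mem_univ _⟩
  have hsv := c.s_mem v hv
  let A : M × ℝ → S.Model × ℝ := fun p => (g (ψ p.1, p.2), p.2)
  have hA₀ : A (S.s v, 0) = c.data.chart y := by
    rw [c.chart_on v n, ← hg₀]
    simp only [A, he₀]
  have hψc := tendsto_chart hsv he₀
  have hA : ∀ᶠ p in 𝓝 (S.s v, (0 : ℝ)),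
      ContMDiffAt (𝓘(ℝ, E).prod 𝓘(ℝ)) 𝓘(ℝ, S.Model × ℝ) ∞ A p := by
    filter_upwards [hψc.eventually hg, Eventually.prod_inl_nhds (ψ.open_source.mem_nhds hsv) 0]
      with p h1 h2
    have h3 : ContMDiffAt (𝓘(ℝ, E).prod 𝓘(ℝ)) 𝓘(ℝ, E × ℝ) ∞
        (fun p : M × ℝ => (ψ p.1, p.2)) p :=
      ((contMDiffAt_of_mem_maximalAtlas c.memₛ h2).comp p contMDiffAt_fst).prodMk_space
        contMDiffAt_snd
    exact (ContMDiffAt.comp p (g := g) h1.1.contMDiffAt h3).prodMk_space contMDiffAt_snd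
  have htar : ∀ᶠ p in 𝓝 (S.s v, (0 : ℝ)), A p ∈ c.data.chart.target := by
    refine hA.self_of_nhds.continuousAt.eventually_mem (c.data.chart.open_target.mem_nhds ?_)
    rw [hA₀]
    exact c.data.chart.map_source hy
  have main : ∃ σ : M × ℝ → DNC V, σ (S.s v, 0) = y ∧ ∀ᶠ p in 𝓝 (S.s v, (0 : ℝ)),
      ContMDiffAt (𝓘(ℝ, E).prod 𝓘(ℝ)) 𝓘(ℝ, S.Model × ℝ) ∞ σ p ∧ deformMap V S.s (σ p) = p ∧
        deformMap V S.t (σ p) = chartMap ψ f p := by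
    refine ⟨fun p => c.data.chart.symm (A p), ?_, ?_⟩
    · change c.data.chart.symm (A (S.s v, 0)) = y
      rw [hA₀, c.data.chart.left_inv hy]
    · filter_upwards [hA, htar, hψc.eventually hg,
        Eventually.prod_inl_nhds (ψ.open_source.mem_nhds hsv) 0] with p h1 h2 h3 h4
      have h5 := c.deform.q_symm h2
      have h6 : dil c.data.π p.2 (g (ψ p.1, p.2)) ∈ c.φ.target :=
        (c.deform.mem_target_iff.1 h2).1
      have h7 : DNC.q (c.data.chart.symm (A p)) =
        (c.φ.symm (dil c.data.π p.2 (g (ψ p.1, p.2))), p.2) := h5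
      have h8 : (DNC.q (c.data.chart.symm (A p))).2 = p.2 := congrArg Prod.snd h7
      refine ⟨(contMDiffAt_symm_of_mem_maximalAtlas c.deform.chart_mem h2).comp p h1,
        Prod.ext ?_ h8, Prod.ext ?_ h8⟩
      · change S.s (DNC.q (c.data.chart.symm (A p))).1 = p.1
        rw [h7]
        refine c.s_eq_of (c.φ.map_target h6) h4 ?_
        rw [c.φ.right_inv h6]
        exact (c.deform.ρ_dil _ _).trans h3.2.1
      · change S.t (DNC.q (c.data.chart.symm (A p))).1 = ψ.symm (f (ψ p.1, p.2))
        rw [h7, ← h3.2.2, c.symm_τ h6]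
  exact main

theorem exists_chart_of_carries (v : V.carrier) (n : V.Normal (v : S.U)) (hv : (v : S.U) ∈ c.φ.source)
    (he₀ : ψ (S.s v) = e₀) {Φ : M × ℝ → M × ℝ}
    (h : (S.deform V).Carries (DNC.on v n) Φ) :
    ∃ g : E × ℝ → S.Model,
      g (e₀, 0) = c.φ v + c.normalPart v n ∧
      ∀ᶠ p in 𝓝 (e₀, (0 : ℝ)), ContDiffAt ℝ ∞ g p ∧ c.ρ (g p) = p.1 ∧
        c.τ (dil c.data.π p.2 (g p)) = ψ (Φ (ψ.symm p.1, p.2)).1 := by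
  let y : DNC V := DNC.on v n
  have hy : y ∈ c.data.chart.source := c.deform.mem_source_iff.2 ⟨hv, mem_univ _⟩
  have hsv := c.s_mem v hv
  have h' : ∃ σ : M × ℝ → DNC V, σ (S.s v, 0) = y ∧ ∀ᶠ p in 𝓝 (S.s v, (0 : ℝ)),
      ContMDiffAt (𝓘(ℝ, E).prod 𝓘(ℝ)) 𝓘(ℝ, S.Model × ℝ) ∞ σ p ∧ deformMap V S.s (σ p) = p ∧
        deformMap V S.t (σ p) = Φ p := h
  obtain ⟨σ, hσ₀, hσ⟩ := h'
  have hsymm := tendsto_chart_symm hsv he₀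
  have hsrc : ∀ᶠ p in 𝓝 (S.s v, (0 : ℝ)), σ p ∈ c.data.chart.source :=
    hσ.self_of_nhds.1.continuousAt.eventually_mem (c.data.chart.open_source.mem_nhds (by
      rw [hσ₀]; exact hy))
  have het : e₀ ∈ ψ.target := he₀ ▸ ψ.map_source hsv
  refine ⟨fun p => (c.data.chart (σ (ψ.symm p.1, p.2))).1, ?_, ?_⟩
  · have h1 : ψ.symm e₀ = S.s v := by rw [← he₀, ψ.left_inv hsv]
    simp only [h1, hσ₀]
    exact congrArg Prod.fst (c.chart_on v n)
  · filter_upwards [hsymm.eventually hσ, hsymm.eventually hsrc,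
      Eventually.prod_inl_nhds (ψ.open_target.mem_nhds het) 0] with p h1 h2 h3
    have h4 : (DNC.q (σ (ψ.symm p.1, p.2))).2 = p.2 := congrArg Prod.snd h1.2.1
    have h5 : S.s (DNC.q (σ (ψ.symm p.1, p.2))).1 = ψ.symm p.1 := congrArg Prod.fst h1.2.1
    have h6 : S.t (DNC.q (σ (ψ.symm p.1, p.2))).1 = (Φ (ψ.symm p.1, p.2)).1 :=
      congrArg Prod.fst h1.2.2
    have h7 := (c.deform.mem_source_iff.1 h2).1
    have h8 := c.deform.φ_q h2
    have h9 : (c.data.chart (σ (ψ.symm p.1, p.2))).2 = p.2 := by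
      exact (congrArg Prod.snd (c.deform.q_eq h2)).symm.trans h4
    refine ⟨?_, ?_, ?_⟩
    · have h10 : ContMDiffAt 𝓘(ℝ, E × ℝ) (𝓘(ℝ, E).prod 𝓘(ℝ)) ∞
          (fun p : E × ℝ => (ψ.symm p.1, p.2)) p :=
        ((contMDiffAt_symm_of_mem_maximalAtlas c.memₛ h3).comp p
          contDiffAt_fst.contMDiffAt).prodMk contDiffAt_snd.contMDiffAt
      have h11 : ContMDiffAt 𝓘(ℝ, E × ℝ) 𝓘(ℝ, S.Model × ℝ) ∞
          (fun p : E × ℝ => c.data.chart (σ (ψ.symm p.1, p.2))) p :=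
        (contMDiffAt_of_mem_maximalAtlas c.deform.chart_mem h2).comp p
          (ContMDiffAt.comp p (g := σ) h1.1 h10)
      exact contDiffAt_fst.comp p h11.contDiffAt
    · refine (c.deform.ρ_dil (c.data.chart (σ (ψ.symm p.1, p.2))).2 _).symm.trans ?_
      refine (congrArg c.ρ h8).symm.trans ((c.s_eq _ h7).symm.trans ?_)
      rw [h5, ψ.right_inv h3]
    · rw [← h6]
      refine Eq.trans ?_ (c.τ_apply h7)
      refine congrArg c.τ (Eq.trans ?_ h8.symm)
      change _ = dil c.data.π (c.data.chart (σ (ψ.symm p.1, p.2))).2 _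
      rw [h9]
      rfl

variable
  {F : Submodule C^∞⟮𝓘(ℝ, E), M; ℝ⟯ (VF 𝓘(ℝ, E) M)}

/-- Two families of points of `U` with the same dilations differ, to first order, by a vector
whose class vanishes. -/
theorem hasLift_sub_zero (hF : F ≤ compactFields 𝓘(ℝ, E) M)
    (hV : S.IsIdentityBisection V) (hS : S.IsBiSubmersion F) {v : S.U}
    (hv : v ∈ c.φ.source) (hvV : v ∈ V.carrier) (he₀ : ψ (S.s v) = e₀) {g g' : E × ℝ → S.Model}
    {f : E × ℝ → E}
    (hg : ∀ᶠ p in 𝓝 (e₀, (0 : ℝ)), ContDiffAt ℝ ∞ g p ∧ c.ρ (g p) = p.1 ∧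
      c.τ (dil c.data.π p.2 (g p)) = f p)
    (hg' : ∀ᶠ p in 𝓝 (e₀, (0 : ℝ)), ContDiffAt ℝ ∞ g' p ∧ c.ρ (g' p) = p.1 ∧
      c.τ (dil c.data.π p.2 (g' p)) = f p) :
    c.HasLift (c.φ v) (g (e₀, 0) - g' (e₀, 0)) 0 := by
  subst he₀
  have hsec₀ : c.sec (ψ (S.s v)) = c.φ v := c.sec_apply_eq hv hvV
  have hsec : Tendsto c.sec (𝓝 (ψ (S.s v))) (𝓝 (c.φ v)) := by
    rw [← hsec₀]; exact c.sec.continuous.continuousAt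
  have hd : ∀ {g : E × ℝ → S.Model}, (∀ᶠ p in 𝓝 (ψ (S.s v), (0 : ℝ)), ContDiffAt ℝ ∞ g p ∧
      c.ρ (g p) = p.1 ∧ c.τ (dil c.data.π p.2 (g p)) = f p) → ∀ᶠ e in 𝓝 (ψ (S.s v)),
      HasDerivAt (fun β : ℝ => f (e, β)) (fderiv ℝ c.τ (c.sec e) (g (e, 0) - c.sec e)) 0 := by
    intro g hg
    have hi : Tendsto (fun e : E => (e, (0 : ℝ))) (𝓝 (ψ (S.s v))) (𝓝 (ψ (S.s v), 0)) :=
      (by fun_prop : Continuous fun e : E => (e, (0 : ℝ))).continuousAt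
    filter_upwards [hi.eventually hg.eventually_nhds,
      hsec.eventually (c.φ.open_target.mem_nhds (c.φ.map_source hv))] with e h1 h2
    have hj : Tendsto (fun β : ℝ => (e, β)) (𝓝 0) (𝓝 (e, 0)) :=
      (by fun_prop : Continuous fun β : ℝ => (e, β)).continuousAt
    have h3 : HasDerivAt (fun β : ℝ => c.sec e + β • (g (e, β) - c.sec e))
        (g (e, 0) - c.sec e) 0 := by
      have h4 : DifferentiableAt ℝ (fun β : ℝ => g (e, β) - c.sec e) 0 := by
        refine DifferentiableAt.sub_const ?_ _
        exact DifferentiableAt.comp (0 : ℝ) (g := g) (f := fun β : ℝ => (e, β))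
          (h1.self_of_nhds.1.differentiableAt (by simp)) (by fun_prop)
      have h5 := ((hasDerivAt_id (0 : ℝ)).smul h4.hasDerivAt).const_add (c.sec e)
      simpa using h5
    have h6 : HasFDerivAt c.τ (fderiv ℝ c.τ (c.sec e))
        (c.sec e + (0 : ℝ) • (g (e, 0) - c.sec e)) := by
      rw [zero_smul, add_zero]
      exact ((c.contDiffAt_τ h2).differentiableAt (by simp)).hasFDerivAt
    refine (h6.comp_hasDerivAt (0 : ℝ) h3).congr_of_eventuallyEq ?_
    filter_upwards [hj.eventually h1] with β h7
    rw [← h7.2.2]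
    have h8 : c.data.π (g (e, β)) = c.sec e := congrArg c.sec h7.2.1
    simp only [Function.comp_apply, dil, h8]
  have hi : Tendsto (fun e : E => (e, (0 : ℝ))) (𝓝 (ψ (S.s v))) (𝓝 (ψ (S.s v), 0)) :=
    (by fun_prop : Continuous fun e : E => (e, (0 : ℝ))).continuousAt
  obtain ⟨Y, hY, h1, h2, -⟩ := exists_hasLift_of_section (c := c)
    (ζ := fun e => g (e, 0) - g' (e, 0)) hF hV hS hv hvV (by
      filter_upwards [hi.eventually hg, hi.eventually hg'] with e h1 h2
      have h3 : ContDiffAt ℝ ∞ (fun e : E => (e, (0 : ℝ))) e := by fun_prop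
      refine ⟨(ContDiffAt.comp e (g := g) h1.1 h3).sub (ContDiffAt.comp e (g := g') h2.1 h3), ?_⟩
      rw [map_sub, h1.2.1, h2.2.1, sub_self])
  refine h1.congr (c.φ.map_source hv) ?_
  rw [c.τ_apply hv, ψ.left_inv (c.t_mem v hv), ← hV.eq v hvV]
  refine eventually_eq_of_fieldIn (c.s_mem v hv) c.memₛ ?_
  filter_upwards [h2, hd hg, hd hg'] with e h3 h4 h5
  have h6 := h4.unique h5
  rw [h3, fieldIn_zero, ← sub_sub_sub_cancel_right _ _ (c.sec e), map_sub, h6, sub_self]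

end NormalChart

end CarriesDeform

section NormalClass

set_option linter.unusedSectionVars false

theorem Span.Carries.congr {E : Type*} [NormedAddCommGroup E] [NormedSpace ℝ E] {H : Type*}
    [TopologicalSpace H] {I : ModelWithCorners ℝ E H} {M : Type*} [TopologicalSpace M]
    [ChartedSpace H M] {S : Span.{u} I M} {u : S.U} {h h' : M → M} (hu : S.Carries u h)
    (hh : ∀ᶠ x in 𝓝 (S.s u), h x = h' x) : S.Carries u h' := by
  obtain ⟨σ, h1, h2⟩ := hu
  refine ⟨σ, h1, ?_⟩
  filter_upwards [h2, hh] with x h3 h4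
  exact ⟨h3.1, h3.2.1, h3.2.2.trans h4⟩

variable {E : Type*} [NormedAddCommGroup E] [NormedSpace ℝ E] [FiniteDimensional ℝ E]
  {M : Type*} [TopologicalSpace M] [ChartedSpace E M] [IsManifold 𝓘(ℝ, E) ∞ M]
  [T2Space M] [SecondCountableTopology M]
  {S : Span.{u} 𝓘(ℝ, E) M} {V : Submfd S.Model S.U}
  {ψ : OpenPartialHomeomorph M E} {Y Y' : VF 𝓘(ℝ, E) M} {Γ Γ' : E × ℝ → ℝ → E}
  {F : Submodule C^∞⟮𝓘(ℝ, E), M; ℝ⟯ (VF 𝓘(ℝ, E) M)}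

theorem chartMap_comp {x : M} (hx : x ∈ ψ.source) {e₀ : E} (he₀ : ψ x = e₀)
    (h' : IsExp ψ Y' e₀ Γ') : ∀ᶠ p in 𝓝 (x, (0 : ℝ)),
      chartMap ψ (fun p => Γ (Γ' p 1, p.2) 1) p =
        (chartMap ψ (fun p => Γ p 1) ∘ chartMap ψ (fun p => Γ' p 1)) p := by
  have h1 : Tendsto (fun p : M × ℝ => Γ' (ψ p.1, p.2) 1) (𝓝 (x, 0)) (𝓝 e₀) :=
    (continuous_fst.tendsto _).comp (h'.tendsto.comp (NormalChart.tendsto_chart hx he₀))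
  filter_upwards [h1.eventually (ψ.open_target.mem_nhds (he₀ ▸ ψ.map_source hx))] with p hp
  simp only [chartMap, Function.comp_apply, ψ.right_inv hp]

namespace NormalChart

variable {c : NormalChart S V ψ ψ} {v : V.carrier} {n n' : V.Normal (v : S.U)} {e₀ : E}

theorem HasLift.exists_exp (hV : S.IsIdentityBisection V) (hv : (v : S.U) ∈ c.φ.source)
    {m : S.Model} (h : c.HasLift (c.φ v) m Y) (hY : IsSmooth Y) (he₀ : ψ (S.s v) = e₀)
    (hΓ : IsExp ψ Y e₀ Γ) : ∃ g : E × ℝ → S.Model, g (e₀, 0) = c.φ v + m ∧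
      ∀ᶠ p in 𝓝 (e₀, (0 : ℝ)), ContDiffAt ℝ ∞ g p ∧ c.ρ (g p) = p.1 ∧
        c.τ (dil c.data.π p.2 (g p)) = Γ p 1 := by
  have h1 : c.sec (ψ (S.s v)) = c.φ v := c.sec_apply_eq hv v.2
  have h2 := c.eventually_sec_mem (h1 ▸ c.φ.map_source hv)
  have h3 : ∀ᶠ p in 𝓝 (e₀, (0 : ℝ)), ContDiffAt ℝ ∞ (fun p : E × ℝ => c.sec p.1) p ∧
      c.ρ (c.sec p.1) = p.1 ∧ c.τ (dil c.data.π p.2 (c.sec p.1)) = p.1 := by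
    rw [he₀] at h2
    filter_upwards [Eventually.prod_inl_nhds h2 0] with p hp
    refine ⟨c.sec.contDiff.contDiffAt.comp p contDiffAt_fst, c.ρ_sec _, ?_⟩
    have h6 : c.data.π (c.sec p.1) = c.sec p.1 := congrArg c.sec (c.ρ_sec _)
    rw [dil, h6, sub_self, smul_zero, add_zero, c.τ_sec hV hp]
  obtain ⟨g, h4, h5⟩ := h.exists_flow hY hv v.2 hV he₀ hΓ (f := Prod.fst) tendsto_id
    (map_zero c.ρ) (g₀ := fun p => c.sec p.1) (by
      change c.sec e₀ = _
      rw [add_zero, ← he₀, h1]) h3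
  exact ⟨g, by rw [h4, zero_add], h5⟩

theorem HasLift.carries (hV : S.IsIdentityBisection V) (hv : (v : S.U) ∈ c.φ.source)
    (h : c.HasLift (c.φ v) (c.normalPart v n) Y) (hY : IsSmooth Y) (he₀ : ψ (S.s v) = e₀)
    (hΓ : IsExp ψ Y e₀ Γ) : (S.deform V).Carries (DNC.on v n) (chartMap ψ fun p => Γ p 1) := by
  obtain ⟨g, h1, h2⟩ := h.exists_exp hV hv hY he₀ hΓ
  exact carries_of_chart v n hv he₀ h1 h2

theorem HasLift.carries_comp (hF : F ≤ compactFields 𝓘(ℝ, E) M) (hS : S.IsBiSubmersion F)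
    (hV : S.IsIdentityBisection V) (hv : (v : S.U) ∈ c.φ.source) (hY : Y ∈ F) (hY' : Y' ∈ F)
    (h : c.HasLift (c.φ v) (c.normalPart v n) (Y + Y')) (he₀ : ψ (S.s v) = e₀)
    (hΓ : IsExp ψ Y e₀ Γ) (hΓ' : IsExp ψ Y' e₀ Γ') : (S.deform V).Carries (DNC.on v n)
      (chartMap ψ (fun p => Γ p 1) ∘ chartMap ψ (fun p => Γ' p 1)) := by
  obtain ⟨m, hm⟩ := exists_hasLift (c := c) hF hS hv hY'
  have hmn : c.HasLift (c.φ v) (c.normalPart v n - m) Y := by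
    have := h.sub hm
    rwa [add_sub_cancel_right] at this
  obtain ⟨g, h1, h2⟩ := hm.exists_exp hV hv (hF hY').1 he₀ hΓ'
  obtain ⟨g', h1', h2'⟩ := hmn.exists_flow (hF hY).1 hv v.2 hV he₀ hΓ hΓ'.tendsto
    hm.ρ_eq_zero (g₀ := g) h1 h2
  refine (carries_of_chart v n hv he₀ (by rw [h1', add_sub_cancel]) h2').congr ?_
  exact chartMap_comp (c.s_mem _ hv) he₀ hΓ'

theorem hasLift_sub_zero_of_carries (hF : F ≤ compactFields 𝓘(ℝ, E) M)
    (hV : S.IsIdentityBisection V) (hS : S.IsBiSubmersion F) (hv : (v : S.U) ∈ c.φ.source)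
    {Φ : M × ℝ → M × ℝ} (h : (S.deform V).Carries (DNC.on v n) Φ)
    (h' : (S.deform V).Carries (DNC.on v n') Φ) :
    c.HasLift (c.φ v) (c.normalPart v n - c.normalPart v n') 0 := by
  obtain ⟨g, h1, h2⟩ := exists_chart_of_carries v n hv rfl h
  obtain ⟨g', h1', h2'⟩ := exists_chart_of_carries v n' hv rfl h'
  have := hasLift_sub_zero hF hV hS hv v.2 rfl h2 h2'
  rwa [h1, h1', add_sub_add_left_eq_sub] at this

theorem exists_hasLift_normalPart (hF : F ≤ compactFields 𝓘(ℝ, E) M)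
    (hV : S.IsIdentityBisection V) (hS : S.IsBiSubmersion F) (hv : (v : S.U) ∈ c.φ.source)
    (n : V.Normal (v : S.U)) : ∃ Y ∈ F, c.HasLift (c.φ v) (c.normalPart v n) Y := by
  obtain ⟨ξ, rfl⟩ := Submodule.Quotient.mk_surjective _ n
  obtain ⟨X, hX, h1⟩ := exists_compactField c.mem hv (a := fun _ => chartD c.φ v ξ)
    (Eventually.of_forall fun _ => contDiffAt_const)
  obtain ⟨Y, hY, -, h2⟩ := exists_hasLift_of_field (c := c) hF hV hS hv v.2 hX.1
  refine ⟨Y, hY, ?_⟩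
  rw [c.normalPart_mk v ξ hv]
  have h3 : chartD c.φ v (X v) = chartD c.φ v ξ := h1.self_of_nhds
  rw [h3] at h2
  exact h2

theorem HasLift.exists_normalPart_eq {m : S.Model} (h : c.HasLift (c.φ v) m Y)
    (hv : (v : S.U) ∈ c.φ.source) : ∃ n, c.normalPart v n = m := by
  obtain ⟨ξ, hξ⟩ := chartD_surjective c.mem hv m
  exact ⟨Submodule.Quotient.mk ξ, by
    rw [c.normalPart_mk v ξ hv, hξ, h.ρ_eq_zero, map_zero, sub_zero]⟩

end NormalChart

namespace Span

/-- The class of the normal vector `n` at `v` is that of the vector field `Y`: the germ of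
bisections of `D(U, V)` through `n` is that of the flow `exp (β Y)`. -/
def HasClass (S : Span.{u} 𝓘(ℝ, E) M) (V : Submfd S.Model S.U) (x : M) (v : V.carrier)
    (n : V.Normal (v : S.U)) (Y : VF 𝓘(ℝ, E) M) : Prop :=
  S.s v = x ∧ ∃ Γ, IsExp (chartAt E x) Y (chartAt E x x) Γ ∧
    (S.deform V).Carries (DNC.on v n) (chartMap (chartAt E x) fun p => Γ p 1)

theorem IsIdentityBisection.exists_chart (hV : S.IsIdentityBisection V) (v : V.carrier) :
    ∃ c : NormalChart S V (chartAt E (S.s v)) (chartAt E (S.s v)), (v : S.U) ∈ c.φ.source :=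
  exists_normalChart hV (IsManifold.chart_mem_maximalAtlas (I := 𝓘(ℝ, E)) _)
    (IsManifold.chart_mem_maximalAtlas (I := 𝓘(ℝ, E)) _) v.2 (mem_chart_source _ _)
    (by rw [← hV.eq v v.2]; exact mem_chart_source _ _)

theorem exists_isExp_chartAt (x : M) (hY : IsSmooth Y) :
    ∃ Γ, IsExp (chartAt E x) Y (chartAt E x x) Γ :=
  exists_isExp (IsManifold.chart_mem_maximalAtlas (I := 𝓘(ℝ, E)) _) hY (mem_chart_target _ _)

variable {v : V.carrier} {n : V.Normal (v : S.U)} {x : M}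

theorem hasClass_iff (hF : F ≤ compactFields 𝓘(ℝ, E) M) (hV : S.IsIdentityBisection V)
    (hS : S.IsBiSubmersion F) {c : NormalChart S V (chartAt E (S.s v)) (chartAt E (S.s v))}
    (hv : (v : S.U) ∈ c.φ.source) (hY : Y ∈ F) :
    S.HasClass V (S.s v) v n Y ↔ c.HasLift (c.φ v) (c.normalPart v n) Y := by
  constructor
  · rintro ⟨-, Γ, hΓ, h⟩
    obtain ⟨m, hm⟩ := NormalChart.exists_hasLift (c := c) hF hS hv hY
    obtain ⟨n', rfl⟩ := hm.exists_normalPart_eq hv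
    have h1 := (NormalChart.hasLift_sub_zero_of_carries hF hV hS hv h
      (hm.carries hV hv (hF hY).1 rfl hΓ)).add hm
    rwa [sub_add_cancel, zero_add] at h1
  · intro h
    obtain ⟨Γ, hΓ⟩ := exists_isExp_chartAt (S.s v) (hF hY).1
    exact ⟨rfl, Γ, hΓ, h.carries hV hv (hF hY).1 rfl hΓ⟩

theorem exists_hasClass (hF : F ≤ compactFields 𝓘(ℝ, E) M) (hV : S.IsIdentityBisection V)
    (hS : S.IsBiSubmersion F) (hx : S.s v = x) (n : V.Normal (v : S.U)) :
    ∃ Y : F, S.HasClass V x v n Y.1 := by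
  subst hx
  obtain ⟨c, hc⟩ := hV.exists_chart v
  obtain ⟨Y, hY, h⟩ := NormalChart.exists_hasLift_normalPart hF hV hS hc n
  exact ⟨⟨Y, hY⟩, (hasClass_iff hF hV hS hc hY).2 h⟩

theorem exists_hasClass_of_mem (hF : F ≤ compactFields 𝓘(ℝ, E) M) (hV : S.IsIdentityBisection V)
    (hS : S.IsBiSubmersion F) (hx : S.s v = x) (hY : Y ∈ F) :
    ∃ n : V.Normal (v : S.U), S.HasClass V x v n Y := by
  subst hx
  obtain ⟨c, hc⟩ := hV.exists_chart v
  obtain ⟨m, hm⟩ := NormalChart.exists_hasLift (c := c) hF hS hc hY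
  obtain ⟨n, rfl⟩ := hm.exists_normalPart_eq hc
  exact ⟨n, (hasClass_iff hF hV hS hc hY).2 hm⟩

theorem HasClass.mk_eq_iff (hF : F ≤ compactFields 𝓘(ℝ, E) M) (hV : S.IsIdentityBisection V)
    (hS : S.IsBiSubmersion F) {Y Y' : F} (h : S.HasClass V x v n Y.1) :
    (Submodule.Quotient.mk Y : Fiber F x) = Submodule.Quotient.mk Y' ↔
      S.HasClass V x v n Y'.1 := by
  obtain rfl := h.1
  obtain ⟨c, hc⟩ := hV.exists_chart v
  rw [hasClass_iff hF hV hS hc Y'.2]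
  exact ((hasClass_iff hF hV hS hc Y.2).1 h).mk_eq_iff hF hV hS hc v.2

theorem HasClass.carries (hF : F ≤ compactFields 𝓘(ℝ, E) M) (hV : S.IsIdentityBisection V)
    (hS : S.IsBiSubmersion F) (hY : Y ∈ F) (h : S.HasClass V x v n Y)
    (hΓ : IsExp (chartAt E x) Y (chartAt E x x) Γ) :
    (S.deform V).Carries (DNC.on v n) (chartMap (chartAt E x) fun p => Γ p 1) := by
  obtain rfl := h.1
  obtain ⟨c, hc⟩ := hV.exists_chart v
  exact ((hasClass_iff hF hV hS hc hY).1 h).carries hV hc (hF hY).1 rfl hΓ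

theorem hasClass_add_iff (hF : F ≤ compactFields 𝓘(ℝ, E) M) (hV : S.IsIdentityBisection V)
    (hS : S.IsBiSubmersion F) (hx : S.s v = x) (hY : Y ∈ F) (hY' : Y' ∈ F)
    (hΓ : IsExp (chartAt E x) Y (chartAt E x x) Γ)
    (hΓ' : IsExp (chartAt E x) Y' (chartAt E x x) Γ') :
    S.HasClass V x v n (Y + Y') ↔ (S.deform V).Carries (DNC.on v n)
      (chartMap (chartAt E x) (fun p => Γ p 1) ∘ chartMap (chartAt E x) (fun p => Γ' p 1)) := by
  subst hx
  obtain ⟨c, hc⟩ := hV.exists_chart v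
  rw [hasClass_iff hF hV hS hc (F.add_mem hY hY')]
  refine ⟨fun h => h.carries_comp hF hS hV hc hY hY' rfl hΓ hΓ', fun h => ?_⟩
  obtain ⟨m, hm⟩ := NormalChart.exists_hasLift (c := c) hF hS hc (F.add_mem hY hY')
  obtain ⟨n', rfl⟩ := hm.exists_normalPart_eq hc
  have h1 := (NormalChart.hasLift_sub_zero_of_carries hF hV hS hc h
    (hm.carries_comp hF hS hV hc hY hY' rfl hΓ hΓ')).add hm
  rwa [sub_add_cancel, zero_add] at h1

theorem exists_hasClass_of_field (hF : F ≤ compactFields 𝓘(ℝ, E) M)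
    (hV : S.IsIdentityBisection V) (hS : S.IsBiSubmersion F) (v : V.carrier)
    {ξ : VF 𝓘(ℝ, S.Model) S.U} (hξ : IsSmooth ξ) : ∃ Y : F,
      (∀ᶠ w in 𝓝 (v : S.U), w ∈ V.carrier → Y.1 (S.s w) = S.dt w (ξ w) - S.ds w (ξ w)) ∧
      S.HasClass V (S.s v) v (Submodule.Quotient.mk (ξ v)) Y.1 := by
  obtain ⟨c, hc⟩ := hV.exists_chart v
  obtain ⟨Y, hY, h1, h2⟩ := NormalChart.exists_hasLift_of_field (c := c) hF hV hS hc v.2 hξ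
  refine ⟨⟨Y, hY⟩, h1, (hasClass_iff hF hV hS hc hY).2 ?_⟩
  have h3 := c.normalPart_mk v (ξ v) hc
  exact h3 ▸ h2

end Span

end NormalClass

section Morphisms

set_option linter.unusedSectionVars false

variable {E : Type*} [NormedAddCommGroup E] [NormedSpace ℝ E] [FiniteDimensional ℝ E]
  {M : Type*} [TopologicalSpace M] [ChartedSpace E M] [IsManifold 𝓘(ℝ, E) ∞ M]
  [T2Space M] [SecondCountableTopology M]
  {F : Submodule C^∞⟮𝓘(ℝ, E), M; ℝ⟯ (VF 𝓘(ℝ, E) M)}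
  {S S' T : Span.{u} 𝓘(ℝ, E) M} {V : Submfd S.Model S.U} {V' : Submfd S'.Model S'.U}
  {W : Submfd T.Model T.U}

theorem Span.hasMorphism_deform_of_carries (hF : F ≤ compactFields 𝓘(ℝ, E) M)
    (hV : S.IsIdentityBisection V) (hS : S.IsBiSubmersion F)
    (hW : T.IsIdentityBisection W) (hT : T.IsBiSubmersion F) {u : (S.deform V).U}
    {w : (T.deform W).U} {h : M × ℝ → M × ℝ} (hu : (S.deform V).Carries u h)
    (hw : (T.deform W).Carries w h) (hs : (S.deform V).s u = (T.deform W).s w) :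
    (S.deform V).HasMorphism (T.deform W) u w := by
  letI : ChartedSpace (E × ℝ) (M × ℝ) := prodChartedSpace E M ℝ ℝ
  haveI : @IsManifold ℝ _ (E × ℝ) _ _ (E × ℝ) _ (𝓘(ℝ, E).prod 𝓘(ℝ, ℝ)) ∞ (M × ℝ) _
    (prodChartedSpace E M ℝ ℝ) := IsManifold.prod M ℝ
  exact Span.hasMorphism_of_carries_of_eq modelWithCornersSelf_prod.symm
    (adiabatic_le hF) (hS.deform hF hV) (hT.deform hF hW) hu hw hs

theorem Span.hasCompMorphism_deform_of_carries (hF : F ≤ compactFields 𝓘(ℝ, E) M)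
    (hV : S.IsIdentityBisection V) (hS : S.IsBiSubmersion F)
    (hV' : S'.IsIdentityBisection V') (hS' : S'.IsBiSubmersion F)
    (hW : T.IsIdentityBisection W) (hT : T.IsBiSubmersion F) {u : (S.deform V).U}
    {v : (S'.deform V').U} {w : (T.deform W).U} {h h' : M × ℝ → M × ℝ}
    (hu : (S.deform V).Carries u h) (hv : (S'.deform V').Carries v h')
    (hw : (T.deform W).Carries w (h ∘ h')) (huv : (S.deform V).s u = (S'.deform V').t v)
    (hs : (T.deform W).s w = (S'.deform V').s v) :
    (S.deform V).HasCompMorphism (S'.deform V') (T.deform W) u v w := by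
  letI : ChartedSpace (E × ℝ) (M × ℝ) := prodChartedSpace E M ℝ ℝ
  haveI : @IsManifold ℝ _ (E × ℝ) _ _ (E × ℝ) _ (𝓘(ℝ, E).prod 𝓘(ℝ, ℝ)) ∞ (M × ℝ) _
    (prodChartedSpace E M ℝ ℝ) := IsManifold.prod M ℝ
  exact Span.hasCompMorphism_of_carries_of_eq modelWithCornersSelf_prod.symm
    (adiabatic_le hF) (hS.deform hF hV) (hS'.deform hF hV') (hT.deform hF hW) hu hv hw huv hs

theorem Span.HasClass.hasMorphism_iff (hF : F ≤ compactFields 𝓘(ℝ, E) M)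
    (hV : S.IsIdentityBisection V) (hS : S.IsBiSubmersion F)
    (hW : T.IsIdentityBisection W) (hT : T.IsBiSubmersion F) {v : V.carrier}
    {n : V.Normal (v : S.U)} {w : W.carrier} {m : W.Normal (w : T.U)} {x : M}
    {Y : VF 𝓘(ℝ, E) M} (hY : Y ∈ F) (h : S.HasClass V x v n Y) :
    (S.deform V).HasMorphism (T.deform W) (DNC.on v n) (DNC.on w m) ↔ T.HasClass W x w m Y := by
  obtain ⟨hx, Γ, hΓ, h1⟩ := h
  constructor
  · intro h2
    have h3 : (S.s v, (0 : ℝ)) = (T.s w, (0 : ℝ)) := h2.s_eq.symm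
    exact ⟨(congrArg Prod.fst h3).symm.trans hx, Γ, hΓ, h2.carries h1⟩
  · intro h2
    refine hasMorphism_deform_of_carries hF hV hS hW hT h1 (h2.carries hF hW hT hY hΓ) ?_
    exact Prod.ext (hx.trans h2.1.symm) rfl

theorem Span.HasClass.hasCompMorphism_iff (hF : F ≤ compactFields 𝓘(ℝ, E) M)
    (hV : S.IsIdentityBisection V) (hS : S.IsBiSubmersion F)
    (hV' : S'.IsIdentityBisection V') (hS' : S'.IsBiSubmersion F)
    (hW : T.IsIdentityBisection W) (hT : T.IsBiSubmersion F) {v : V.carrier}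
    {n : V.Normal (v : S.U)} {v' : V'.carrier} {n' : V'.Normal (v' : S'.U)} {w : W.carrier}
    {m : W.Normal (w : T.U)} {x : M} {Y Y' : VF 𝓘(ℝ, E) M} (hY : Y ∈ F) (hY' : Y' ∈ F)
    (h : S.HasClass V x v n Y) (h' : S'.HasClass V' x v' n' Y') :
    (S.deform V).HasCompMorphism (S'.deform V') (T.deform W) (DNC.on v n) (DNC.on v' n')
      (DNC.on w m) ↔ T.HasClass W x w m (Y + Y') := by
  obtain ⟨hx, Γ, hΓ, h1⟩ := h
  obtain ⟨hx', Γ', hΓ', h1'⟩ := h'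
  constructor
  · intro h2
    have h3 : (T.s w, (0 : ℝ)) = (S'.s v', (0 : ℝ)) := h2.eq.2.1
    exact (hasClass_add_iff hF hW hT ((congrArg Prod.fst h3).trans hx') hY hY' hΓ hΓ').2
      (h2.carries h1 h1')
  · intro h2
    refine hasCompMorphism_deform_of_carries hF hV hS hV' hS' hW hT h1 h1'
      ((hasClass_add_iff hF hW hT h2.1 hY hY' hΓ hΓ').1 h2) ?_ ?_
    · exact Prod.ext (hx.trans (hx'.symm.trans (hV'.eq v' v'.2))) rfl
    · exact Prod.ext (h2.1.trans hx'.symm) rfl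

end Morphisms

section OffZero

namespace DNC

variable {E : Type u} [NormedAddCommGroup E] [NormedSpace ℝ E] [FiniteDimensional ℝ E]
  {U : Type u} [TopologicalSpace U] [ChartedSpace E U] [IsManifold 𝓘(ℝ, E) ∞ U]
  {V : Submfd E U}

open Classical in
/-- The point `(u, β)` of `D(U, V)` if `β ≠ 0`, and the junk value `z` otherwise. -/
noncomputable def offMap (z : DNC V) (p : U × ℝ) : DNC V :=
  if h : p.2 = 0 then z else off p.1 p.2 h

theorem offMap_ne (z : DNC V) (u : U) {β : ℝ} (hβ : β ≠ 0) : offMap z (u, β) = off u β hβ :=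
  dif_neg hβ

theorem contMDiffAt_offMap (z : DNC V) {p : U × ℝ} (hp : p.2 ≠ 0) :
    ContMDiffAt (𝓘(ℝ, E).prod 𝓘(ℝ)) 𝓘(ℝ, E × ℝ) ∞ (offMap z) p := by
  let c := offData V p.1
  have hu : p.1 ∈ c.φ.source := mem_chart_source E p.1
  have hdil : ∀ (β : ℝ) (e : E), dil c.π β e = e := fun β e => by
    change e + β • (e - e) = e
    rw [sub_self, smul_zero, add_zero]
  have h1 : ContMDiffAt (𝓘(ℝ, E).prod 𝓘(ℝ)) 𝓘(ℝ, E × ℝ) ∞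
      (fun p : U × ℝ => (c.φ p.1, p.2)) p :=
    ((c.contMDiffAt hu).comp p contMDiffAt_fst).prodMk_space contMDiffAt_snd
  have h2 : (c.φ p.1, p.2) ∈ c.chart.target := by
    refine ⟨?_, hp⟩
    change dil c.π p.2 (c.φ p.1) ∈ c.φ.target
    rw [hdil]
    exact c.φ.map_source hu
  have h3 : ContMDiffAt 𝓘(ℝ, E × ℝ) 𝓘(ℝ, E × ℝ) ∞ c.chart.symm (c.φ p.1, p.2) :=
    contMDiffAt_symm_of_mem_maximalAtlas (IsManifold.subset_maximalAtlas c.chart_mem_atlas) h2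
  refine (ContMDiffAt.comp p (g := c.chart.symm) h3 h1).congr_of_eventuallyEq ?_
  filter_upwards [Eventually.prod_inl_nhds (c.φ.open_source.mem_nhds hu) p.2,
    Eventually.prod_inr_nhds (isOpen_compl_singleton.mem_nhds hp) p.1] with r hr hr'
  refine (offMap_ne z r.1 hr').trans ?_
  have h4 : c.chart.symm (c.φ r.1, r.2) = off (c.φ.symm (dil c.π r.2 (c.φ r.1))) r.2 hr' :=
    c.bwd_ne _ hr'
  refine Eq.trans ?_ h4.symm
  rw [hdil, c.φ.left_inv hr]

end DNC

set_option linter.unusedSectionVars false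

variable {E : Type*} [NormedAddCommGroup E] [NormedSpace ℝ E] [FiniteDimensional ℝ E]
  {M : Type*} [TopologicalSpace M] [ChartedSpace E M] [IsManifold 𝓘(ℝ, E) ∞ M]
  {S S' T : Span.{u} 𝓘(ℝ, E) M} {V : Submfd S.Model S.U} {V' : Submfd S'.Model S'.U}
  {W : Submfd T.Model T.U}

namespace Span

theorem carries_off_iff {u : S.U} {β : ℝ} (hβ : β ≠ 0) {φ : M → M} :
    (S.deform V).Carries (DNC.off u β hβ) (Prod.map φ id) ↔ S.Carries u φ := by
  constructor
  · intro h
    have h' : ∃ σ : M × ℝ → DNC V, σ (S.s u, β) = DNC.off u β hβ ∧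
        ∀ᶠ p in 𝓝 (S.s u, β), ContMDiffAt (𝓘(ℝ, E).prod 𝓘(ℝ)) 𝓘(ℝ, S.Model × ℝ) ∞ σ p ∧
          deformMap V S.s (σ p) = p ∧ deformMap V S.t (σ p) = Prod.map φ id p := h
    obtain ⟨σ, h1, h2⟩ := h'
    have hc : ContMDiff 𝓘(ℝ, E) (𝓘(ℝ, E).prod 𝓘(ℝ)) ∞ fun x : M => (x, β) :=
      contMDiff_id.prodMk contMDiff_const
    refine ⟨fun x => (DNC.q (σ (x, β))).1, by simp only [h1]; rfl, ?_⟩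
    have h3 : Tendsto (fun x : M => (x, β)) (𝓝 (S.s u)) (𝓝 (S.s u, β)) :=
      hc.continuous.continuousAt
    filter_upwards [h3.eventually h2] with x hx
    refine ⟨?_, congrArg Prod.fst hx.2.1, congrArg Prod.fst hx.2.2⟩
    have h4 : ContMDiffAt 𝓘(ℝ, E) 𝓘(ℝ, S.Model × ℝ) ∞ (fun x => σ (x, β)) x :=
      ContMDiffAt.comp x (g := σ) hx.1 (hc x)
    exact ContMDiffAt.comp x (g := fun y : DNC V => (DNC.q y).1)
      ((contMDiff_fst.comp DNC.contMDiff_q) _) h4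
  · rintro ⟨σ, h1, h2⟩
    have main : ∃ σ : M × ℝ → DNC V, σ (S.s u, β) = DNC.off u β hβ ∧
        ∀ᶠ p in 𝓝 (S.s u, β), ContMDiffAt (𝓘(ℝ, E).prod 𝓘(ℝ)) 𝓘(ℝ, S.Model × ℝ) ∞ σ p ∧
          deformMap V S.s (σ p) = p ∧ deformMap V S.t (σ p) = Prod.map φ id p := by
      refine ⟨fun p => DNC.offMap (DNC.off u β hβ) (σ p.1, p.2), ?_, ?_⟩
      · simp only [h1]
        exact DNC.offMap_ne _ u hβ
      · filter_upwards [Eventually.prod_inl_nhds h2 β,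
          Eventually.prod_inr_nhds (isOpen_compl_singleton.mem_nhds hβ) (S.s u)] with p hp hp'
        have h3 : DNC.offMap (DNC.off u β hβ : DNC V) (σ p.1, p.2) = DNC.off (σ p.1) p.2 hp' :=
          DNC.offMap_ne _ _ hp'
        refine ⟨?_, ?_, ?_⟩
        · have h4 : ContMDiffAt (𝓘(ℝ, E).prod 𝓘(ℝ)) (𝓘(ℝ, S.Model).prod 𝓘(ℝ)) ∞
              (fun p : M × ℝ => (σ p.1, p.2)) p :=
            (ContMDiffAt.comp p (g := σ) hp.1 contMDiffAt_fst).prodMk contMDiffAt_snd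
          exact ContMDiffAt.comp p (g := DNC.offMap _) (DNC.contMDiffAt_offMap _ hp') h4
        · rw [h3]
          exact Prod.ext hp.2.1 rfl
        · rw [h3]
          exact Prod.ext hp.2.2 rfl
    exact main

variable [T2Space M] [SecondCountableTopology M]
  {F : Submodule C^∞⟮𝓘(ℝ, E), M; ℝ⟯ (VF 𝓘(ℝ, E) M)}

theorem hasMorphism_off_iff (hF : F ≤ compactFields 𝓘(ℝ, E) M)
    (hV : S.IsIdentityBisection V) (hS : S.IsBiSubmersion F)
    (hW : T.IsIdentityBisection W) (hT : T.IsBiSubmersion F) {u : S.U} {w : T.U} {β : ℝ}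
    (hβ : β ≠ 0) :
    (S.deform V).HasMorphism (T.deform W) (DNC.off u β hβ) (DNC.off w β hβ) ↔
      S.HasMorphism T u w := by
  obtain ⟨φ, hφ⟩ := hS.exists_carries u
  have h1 := (carries_off_iff (V := V) hβ).2 hφ
  constructor
  · intro h
    have h2 : (T.s w, β) = (S.s u, β) := h.s_eq
    exact hasMorphism_of_carries hF hS hT hφ ((carries_off_iff hβ).1 (h.carries h1))
      (congrArg Prod.fst h2).symm
  · intro h
    exact hasMorphism_deform_of_carries hF hV hS hW hT h1
      ((carries_off_iff hβ).2 (h.carries hφ)) (Prod.ext h.s_eq.symm rfl)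

theorem hasCompMorphism_off_iff (hF : F ≤ compactFields 𝓘(ℝ, E) M)
    (hV : S.IsIdentityBisection V) (hS : S.IsBiSubmersion F)
    (hV' : S'.IsIdentityBisection V') (hS' : S'.IsBiSubmersion F)
    (hW : T.IsIdentityBisection W) (hT : T.IsBiSubmersion F) {u : S.U} {v : S'.U} {w : T.U}
    {β : ℝ} (hβ : β ≠ 0) :
    (S.deform V).HasCompMorphism (S'.deform V') (T.deform W) (DNC.off u β hβ) (DNC.off v β hβ)
      (DNC.off w β hβ) ↔ S.HasCompMorphism S' T u v w := by
  obtain ⟨φ, hφ⟩ := hS.exists_carries u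
  obtain ⟨φ', hφ'⟩ := hS'.exists_carries v
  have h1 := (carries_off_iff (V := V) hβ).2 hφ
  have h1' := (carries_off_iff (V := V') hβ).2 hφ'
  constructor
  · intro h
    have h2 : (S.s u, β) = (S'.t v, β) := h.eq.1
    have h3 : (T.s w, β) = (S'.s v, β) := h.eq.2.1
    exact hasCompMorphism_of_carries hF hS hS' hT hφ hφ'
      ((carries_off_iff (φ := φ ∘ φ') hβ).1 (h.carries h1 h1'))
      (congrArg Prod.fst h2) (congrArg Prod.fst h3)
  · intro h
    exact hasCompMorphism_deform_of_carries hF hV hS hV' hS' hW hT h1 h1'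
      ((carries_off_iff (φ := φ ∘ φ') hβ).2 (h.carries hφ hφ')) (Prod.ext h.eq.1 rfl)
      (Prod.ext h.eq.2.1 rfl)

end Span

end OffZero

section AdiabaticGroupoid

set_option linter.unusedSectionVars false

variable {E : Type*} [NormedAddCommGroup E] [NormedSpace ℝ E] [FiniteDimensional ℝ E]
  {M : Type*} [TopologicalSpace M] [ChartedSpace E M] [IsManifold 𝓘(ℝ, E) ∞ M]
  [T2Space M] [SecondCountableTopology M]
  {F : Submodule C^∞⟮𝓘(ℝ, E), M; ℝ⟯ (VF 𝓘(ℝ, E) M)}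
  {ι : Type*} {𝒰 : ι → Span.{u} 𝓘(ℝ, E) M} {V : ∀ i, Submfd (𝒰 i).Model (𝒰 i).U}

theorem isAtlas_adiabaticAtlas (hF : F ≤ compactFields 𝓘(ℝ, E) M) (h𝒰 : IsAtlas F 𝒰)
    (hV : ∀ i, (𝒰 i).IsIdentityBisection (V i))
    (hcover : ∀ x : M, ∃ i, ∃ v ∈ (V i).carrier, (𝒰 i).s v = x) :
    IsAtlas (adiabatic F) (adiabaticAtlas 𝒰 V) where
  biSubmersion i := (h𝒰.biSubmersion i).deform hF (hV i)
  cover := by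
    rintro ⟨x, β⟩
    by_cases hβ : β = 0
    · obtain ⟨i, v, hv, hx⟩ := hcover x
      exact ⟨i, DNC.on ⟨v, hv⟩ 0, Prod.ext hx hβ.symm⟩
    · obtain ⟨i, u, hx⟩ := h𝒰.cover x
      exact ⟨i, DNC.off u β hβ, Prod.ext hx rfl⟩
  inv_adapted := by
    rintro i (⟨u, β, hβ⟩ | ⟨v, n⟩)
    · obtain ⟨j, w, h⟩ := h𝒰.inv_adapted i u
      exact ⟨j, DNC.off w β hβ, (Span.hasMorphism_off_iff (S := (𝒰 i).inv) (V := V i) hF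
        (hV i).inv (h𝒰.biSubmersion i).inv (hV j) (h𝒰.biSubmersion j) hβ).2 h⟩
    · obtain ⟨Y, hY⟩ := Span.exists_hasClass (S := (𝒰 i).inv) (V := V i) (v := v) hF
        (hV i).inv (h𝒰.biSubmersion i).inv rfl n
      obtain ⟨m, hm⟩ := Span.exists_hasClass_of_mem (V := V i) (v := v) hF (hV i)
        (h𝒰.biSubmersion i) ((hV i).eq v v.2) Y.2
      exact ⟨i, DNC.on v m, (hY.hasMorphism_iff (S := (𝒰 i).inv) (V := V i) hF (hV i).inv
        (h𝒰.biSubmersion i).inv (hV i) (h𝒰.biSubmersion i) Y.2).2 hm⟩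
  comp_adapted := by
    rintro i j (⟨u, β, hβ⟩ | ⟨v, n⟩) (⟨u', β', hβ'⟩ | ⟨v', n'⟩) h
    · obtain rfl : β = β' := congrArg Prod.snd h
      obtain ⟨k, w, hw⟩ := h𝒰.comp_adapted i j u u' (congrArg Prod.fst h)
      exact ⟨k, DNC.off w β hβ, (Span.hasCompMorphism_off_iff hF (hV i) (h𝒰.biSubmersion i) (hV j)
        (h𝒰.biSubmersion j) (hV k) (h𝒰.biSubmersion k) hβ).2 hw⟩
    · exact absurd (congrArg Prod.snd h : β = 0) hβ
    · exact absurd (congrArg Prod.snd h : 0 = β').symm hβ'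
    · have hs : (𝒰 i).s v = (𝒰 j).s v' :=
        (congrArg Prod.fst h : (𝒰 i).s v = (𝒰 j).t v').trans ((hV j).eq v' v'.2).symm
      obtain ⟨Y, hY⟩ := Span.exists_hasClass (v := v) hF (hV i) (h𝒰.biSubmersion i) hs n
      obtain ⟨Y', hY'⟩ := Span.exists_hasClass (v := v') hF (hV j) (h𝒰.biSubmersion j) rfl n'
      obtain ⟨m, hm⟩ := Span.exists_hasClass_of_mem (v := v') hF (hV j) (h𝒰.biSubmersion j) rfl
        (F.add_mem Y.2 Y'.2)
      exact ⟨j, DNC.on v' m, (hY.hasCompMorphism_iff hF (hV i) (h𝒰.biSubmersion i) (hV j)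
        (h𝒰.biSubmersion j) (hV j) (h𝒰.biSubmersion j) Y.2 Y'.2 hY').2 hm⟩

theorem equivalence_rel_adiabaticAtlas (hF : F ≤ compactFields 𝓘(ℝ, E) M)
    (h : IsAtlas (adiabatic F) (adiabaticAtlas 𝒰 V)) : Equivalence (Rel (adiabaticAtlas 𝒰 V)) := by
  letI : ChartedSpace (E × ℝ) (M × ℝ) := prodChartedSpace E M ℝ ℝ
  haveI : @IsManifold ℝ _ (E × ℝ) _ _ (E × ℝ) _ (𝓘(ℝ, E).prod 𝓘(ℝ, ℝ)) ∞ (M × ℝ) _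
    (prodChartedSpace E M ℝ ℝ) := IsManifold.prod M ℝ
  exact h.equivalence_of_eq modelWithCornersSelf_prod.symm (adiabatic_le hF)

theorem isGroupoid_adiabaticAtlas (hF : F ≤ compactFields 𝓘(ℝ, E) M)
    (h : IsAtlas (adiabatic F) (adiabaticAtlas 𝒰 V)) :
    IsGroupoid (Arrow.src (𝒰 := adiabaticAtlas 𝒰 V)) Arrow.tgt Arrow.IsComp := by
  letI : ChartedSpace (E × ℝ) (M × ℝ) := prodChartedSpace E M ℝ ℝ
  haveI : @IsManifold ℝ _ (E × ℝ) _ _ (E × ℝ) _ (𝓘(ℝ, E).prod 𝓘(ℝ, ℝ)) ∞ (M × ℝ) _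
    (prodChartedSpace E M ℝ ℝ) := IsManifold.prod M ℝ
  exact h.isGroupoid_of_eq modelWithCornersSelf_prod.symm (adiabatic_le hF)

theorem isComp_mk_adiabaticAtlas_iff (hF : F ≤ compactFields 𝓘(ℝ, E) M)
    (h : IsAtlas (adiabatic F) (adiabaticAtlas 𝒰 V)) {i j l : ι} {a : (adiabaticAtlas 𝒰 V i).U}
    {b : (adiabaticAtlas 𝒰 V j).U} {c : (adiabaticAtlas 𝒰 V l).U} :
    Arrow.IsComp (Arrow.mk i a) (Arrow.mk j b) (Arrow.mk l c) ↔
      (adiabaticAtlas 𝒰 V i).HasCompMorphism (adiabaticAtlas 𝒰 V j) (adiabaticAtlas 𝒰 V l)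
        a b c := by
  letI : ChartedSpace (E × ℝ) (M × ℝ) := prodChartedSpace E M ℝ ℝ
  haveI : @IsManifold ℝ _ (E × ℝ) _ _ (E × ℝ) _ (𝓘(ℝ, E).prod 𝓘(ℝ, ℝ)) ∞ (M × ℝ) _
    (prodChartedSpace E M ℝ ℝ) := IsManifold.prod M ℝ
  exact h.isComp_mk_iff_of_eq modelWithCornersSelf_prod.symm (adiabatic_le hF)

theorem TangentGroupoid.zero_mk_eq {x x' : M} {Y Y' : F}
    (h : (zero x (Submodule.Quotient.mk Y) : TangentGroupoid F 𝒰) =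
      zero x' (Submodule.Quotient.mk Y')) :
    x = x' ∧ (Submodule.Quotient.mk Y : Fiber F x) = Submodule.Quotient.mk Y' := by
  injection h with h1 h2
  subst h1
  exact ⟨rfl, eq_of_heq h2⟩

theorem TangentGroupoid.zero_ne_ne {x : M} {ξ : Fiber F x} {g : Arrow 𝒰} {β : ℝ} {hβ : β ≠ 0} :
    (zero x ξ : TangentGroupoid F 𝒰) ≠ ne g β hβ := by
  rintro ⟨⟩

theorem TangentGroupoid.IsComp.cases_mk {a b c : TangentGroupoid F 𝒰} (h : IsComp a b c) :
    (∃ (x : M) (Y Y' : F), a = .zero x (Submodule.Quotient.mk Y) ∧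
      b = .zero x (Submodule.Quotient.mk Y') ∧ c = .zero x (Submodule.Quotient.mk (Y + Y'))) ∨
    ∃ (g h k : Arrow 𝒰) (β : ℝ) (hβ : β ≠ 0), a = .ne g β hβ ∧ b = .ne h β hβ ∧ c = .ne k β hβ ∧
      Arrow.IsComp g h k := by
  cases h with
  | zero x ξ η =>
    obtain ⟨Y, rfl⟩ := Submodule.Quotient.mk_surjective _ ξ
    obtain ⟨Y', rfl⟩ := Submodule.Quotient.mk_surjective _ η
    exact Or.inl ⟨x, Y, Y', rfl, rfl, rfl⟩
  | ne g h k β hβ hk => exact Or.inr ⟨g, h, k, β, hβ, rfl, rfl, rfl, hk⟩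

/-- The arrow of the tangent groupoid defined by a point of `D(Uᵢ, Vᵢ)`. -/
noncomputable def tangentClass (hF : F ≤ compactFields 𝓘(ℝ, E) M)
    (hS : ∀ i, (𝒰 i).IsBiSubmersion F) (hV : ∀ i, (𝒰 i).IsIdentityBisection (V i)) (i : ι) :
    DNC (V i) → TangentGroupoid F 𝒰
  | .off u β hβ => .ne (Arrow.mk i u) β hβ
  | .on v n => .zero ((𝒰 i).s v)
      (Submodule.Quotient.mk (Span.exists_hasClass hF (hV i) (hS i) rfl n).choose)

section TangentClass

variable {hF : F ≤ compactFields 𝓘(ℝ, E) M} {hS : ∀ i, (𝒰 i).IsBiSubmersion F}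
  {hV : ∀ i, (𝒰 i).IsIdentityBisection (V i)}

theorem tangentClass_on_eq_iff {i : ι} {v : (V i).carrier} {n : (V i).Normal (v : (𝒰 i).U)} {x : M}
    {Y : F} : tangentClass hF hS hV i (.on v n) =
      .zero x (Submodule.Quotient.mk Y) ↔ (𝒰 i).HasClass (V i) x v n Y.1 := by
  have h1 := (Span.exists_hasClass (v := v) hF (hV i) (hS i) rfl n).choose_spec
  constructor
  · intro h
    obtain ⟨rfl, h2⟩ := TangentGroupoid.zero_mk_eq h
    exact (h1.mk_eq_iff hF (hV i) (hS i)).1 h2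
  · intro h
    obtain rfl := h.1
    exact congrArg (TangentGroupoid.zero _) ((h1.mk_eq_iff hF (hV i) (hS i)).2 h)

theorem exists_tangentClass_on_eq {i : ι} {v : (V i).carrier} (n : (V i).Normal (v : (𝒰 i).U)) :
    ∃ Y : F, tangentClass hF hS hV i (.on v n) =
      .zero ((𝒰 i).s v) (Submodule.Quotient.mk Y) := ⟨_, rfl⟩

theorem tangentClass_eq_iff (h𝒰 : IsAtlas F 𝒰) {i j : ι} (a : DNC (V i)) (b : DNC (V j)) :
    ((𝒰 i).deform (V i)).HasMorphism ((𝒰 j).deform (V j)) a b ↔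
      tangentClass hF h𝒰.biSubmersion hV i a = tangentClass hF h𝒰.biSubmersion hV j b := by
  rcases a with ⟨u, β, hβ⟩ | ⟨v, n⟩ <;> rcases b with ⟨u', β', hβ'⟩ | ⟨v', n'⟩
  · constructor
    · intro h
      obtain rfl : β' = β := congrArg Prod.snd h.s_eq
      exact congrArg (TangentGroupoid.ne · β' hβ) ((h𝒰.mk_eq_iff hF).2
        ((Span.hasMorphism_off_iff hF (hV i) (h𝒰.biSubmersion i) (hV j)
          (h𝒰.biSubmersion j) hβ).1 h))
    · intro h
      have h' : TangentGroupoid.ne (F := F) (Arrow.mk i u) β hβ =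
        TangentGroupoid.ne (Arrow.mk j u') β' hβ' := h
      injection h' with h1 h2
      subst h2
      exact (Span.hasMorphism_off_iff hF (hV i) (h𝒰.biSubmersion i) (hV j)
        (h𝒰.biSubmersion j) hβ).2 ((h𝒰.mk_eq_iff hF).1 h1)
  · exact ⟨fun h => absurd (congrArg Prod.snd h.s_eq : 0 = β).symm hβ,
      fun h => (TangentGroupoid.zero_ne_ne h.symm).elim⟩
  · exact ⟨fun h => absurd (congrArg Prod.snd h.s_eq : β' = 0) hβ',
      fun h => (TangentGroupoid.zero_ne_ne h).elim⟩
  · obtain ⟨Y, hY⟩ := exists_tangentClass_on_eq (hF := hF) (hS := h𝒰.biSubmersion) (hV := hV) n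
    have h1 := tangentClass_on_eq_iff.1 hY
    rw [hY, eq_comm, tangentClass_on_eq_iff]
    exact h1.hasMorphism_iff hF (hV i) (h𝒰.biSubmersion i) (hV j) (h𝒰.biSubmersion j) Y.2

theorem isComp_tangentClass_iff (h𝒰 : IsAtlas F 𝒰) {i j k : ι} (a : DNC (V i)) (b : DNC (V j)) (c : DNC (V k)) :
    ((𝒰 i).deform (V i)).HasCompMorphism ((𝒰 j).deform (V j)) ((𝒰 k).deform (V k)) a b c ↔
      TangentGroupoid.IsComp (tangentClass hF h𝒰.biSubmersion hV i a)
        (tangentClass hF h𝒰.biSubmersion hV j b) (tangentClass hF h𝒰.biSubmersion hV k c) := by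
  constructor
  · intro h
    have hab : (DNC.q a).2 = (DNC.q b).2 := congrArg Prod.snd h.eq.1
    have hcb : (DNC.q c).2 = (DNC.q b).2 := congrArg Prod.snd h.eq.2.1
    rcases a with ⟨u, β, hβ⟩ | ⟨v, n⟩ <;> rcases b with ⟨u', β', hβ'⟩ | ⟨v', n'⟩ <;>
      rcases c with ⟨w, γ, hγ⟩ | ⟨w, m⟩
    · obtain rfl : β = β' := hab
      obtain rfl : γ = β := hcb
      exact .ne _ _ _ _ _ ((h𝒰.isComp_mk_iff hF).2 ((Span.hasCompMorphism_off_iff hF (hV i)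
        (h𝒰.biSubmersion i) (hV j) (h𝒰.biSubmersion j) (hV k) (h𝒰.biSubmersion k) hβ).1 h))
    · exact absurd hcb.symm hβ'
    · exact absurd hab hβ
    · exact absurd hab hβ
    · exact absurd hab.symm hβ'
    · exact absurd hab.symm hβ'
    · exact absurd hcb hγ
    · obtain ⟨Y, hY⟩ := exists_tangentClass_on_eq (hF := hF) (hS := h𝒰.biSubmersion) (hV := hV) n
      obtain ⟨Y', hY'⟩ := exists_tangentClass_on_eq (hF := hF) (hS := h𝒰.biSubmersion) (hV := hV) n'
      have hs : (𝒰 i).s v = (𝒰 j).s v' :=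
        (congrArg Prod.fst h.eq.1 : (𝒰 i).s v = (𝒰 j).t v').trans ((hV j).eq v' v'.2).symm
      rw [hY, hY', ← hs]
      rw [← hs] at hY'
      have h1 := tangentClass_on_eq_iff.1 hY
      have h2 := tangentClass_on_eq_iff.1 hY'
      have h3 := (h1.hasCompMorphism_iff hF (hV i) (h𝒰.biSubmersion i) (hV j) (h𝒰.biSubmersion j)
        (hV k) (h𝒰.biSubmersion k) Y.2 Y'.2 h2).1 h
      rw [tangentClass_on_eq_iff (Y := Y + Y') |>.2 h3]
      exact .zero _ _ _
  · intro h
    rcases h.cases_mk with ⟨x, Y, Y', h1, h2, h3⟩ | ⟨g, g', l, γ, hγ, h1, h2, h3, h4⟩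
    · rcases a with ⟨u, β, hβ⟩ | ⟨v, n⟩
      · exact (TangentGroupoid.zero_ne_ne h1.symm).elim
      rcases b with ⟨u, β, hβ⟩ | ⟨v', n'⟩
      · exact (TangentGroupoid.zero_ne_ne h2.symm).elim
      rcases c with ⟨u, β, hβ⟩ | ⟨w, m⟩
      · exact (TangentGroupoid.zero_ne_ne h3.symm).elim
      exact ((tangentClass_on_eq_iff.1 h1).hasCompMorphism_iff hF (hV i) (h𝒰.biSubmersion i) (hV j)
        (h𝒰.biSubmersion j) (hV k) (h𝒰.biSubmersion k) Y.2 Y'.2 (tangentClass_on_eq_iff.1 h2)).2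
        (tangentClass_on_eq_iff.1 h3)
    · rcases a with ⟨u, β, hβ⟩ | ⟨v, n⟩
      swap
      · exact (TangentGroupoid.zero_ne_ne h1).elim
      rcases b with ⟨u', β', hβ'⟩ | ⟨v', n'⟩
      swap
      · exact (TangentGroupoid.zero_ne_ne h2).elim
      rcases c with ⟨w, γ', hγ'⟩ | ⟨w, m⟩
      swap
      · exact (TangentGroupoid.zero_ne_ne h3).elim
      have h1' : TangentGroupoid.ne (F := F) (Arrow.mk i u) β hβ = .ne g γ hγ := h1
      have h2' : TangentGroupoid.ne (F := F) (Arrow.mk j u') β' hβ' = .ne g' γ hγ := h2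
      have h3' : TangentGroupoid.ne (F := F) (Arrow.mk k w) γ' hγ' = .ne l γ hγ := h3
      injection h1' with e1 e1'
      injection h2' with e2 e2'
      injection h3' with e3 e3'
      subst e1 e1' e2 e2' e3 e3'
      exact (Span.hasCompMorphism_off_iff hF (hV i) (h𝒰.biSubmersion i) (hV j)
        (h𝒰.biSubmersion j) (hV k) (h𝒰.biSubmersion k) hβ).2 ((h𝒰.isComp_mk_iff hF).1 h4)

theorem surjective_tangentClass (hcover : ∀ x : M, ∃ i, ∃ v ∈ (V i).carrier, (𝒰 i).s v = x)
    (z : TangentGroupoid F 𝒰) : ∃ i a, tangentClass hF hS hV i a = z := by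
  rcases z with ⟨x, ξ⟩ | ⟨⟨i, u⟩, β, hβ⟩
  · obtain ⟨Y, rfl⟩ := Submodule.Quotient.mk_surjective _ ξ
    obtain ⟨i, v, hv, hx⟩ := hcover x
    obtain ⟨n, hn⟩ := Span.exists_hasClass_of_mem (v := ⟨v, hv⟩) hF (hV i) (hS i)
      hx Y.2
    exact ⟨i, .on ⟨v, hv⟩ n, tangentClass_on_eq_iff.2 hn⟩
  · exact ⟨i, .off u β hβ, rfl⟩

end TangentClass

end AdiabaticGroupoid

end SingularFoliation

theorem mainTheorem3
    {E : Type*} [NormedAddCommGroup E] [NormedSpace ℝ E] [FiniteDimensional ℝ E]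
    {M : Type*} [TopologicalSpace M] [ChartedSpace E M] [IsManifold 𝓘(ℝ, E) ∞ M]
    [T2Space M] [SecondCountableTopology M]
    (F : Submodule C^∞⟮𝓘(ℝ, E), M; ℝ⟯ (VF 𝓘(ℝ, E) M)) (hF : IsFoliation F)
    {ι : Type*} (𝒰 : ι → Span 𝓘(ℝ, E) M) (h𝒰 : IsAtlas F 𝒰)
    (V : ∀ i, Submfd (𝒰 i).Model (𝒰 i).U)
    (hV : ∀ i, (𝒰 i).IsIdentityBisection (V i))
    (hcover : ∀ x : M, ∃ i, ∃ v ∈ (V i).carrier, (𝒰 i).s v = x) :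
    IsFoliation (adiabatic F) ∧
    IsAtlas (adiabatic F) (adiabaticAtlas 𝒰 V) ∧
    Equivalence (Rel (adiabaticAtlas 𝒰 V)) ∧
    IsGroupoid (Arrow.src (𝒰 := adiabaticAtlas 𝒰 V)) Arrow.tgt Arrow.IsComp ∧
    ∃ Θ : Arrow (adiabaticAtlas 𝒰 V) ≃ TangentGroupoid F 𝒰,
      (∀ γ, (Θ γ).src = γ.src ∧ (Θ γ).tgt = γ.tgt) ∧
      (∀ a b c, Arrow.IsComp a b c ↔ TangentGroupoid.IsComp (Θ a) (Θ b) (Θ c)) ∧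
      (∀ (i : ι) (u : (𝒰 i).U) (β : ℝ) (hβ : β ≠ 0),
        Θ (Arrow.mk i (DNC.off u β hβ)) = .ne (Arrow.mk i u) β hβ) ∧
      ∀ (i : ι) (v : (V i).carrier) (ξ : VF 𝓘(ℝ, (𝒰 i).Model) (𝒰 i).U), IsSmooth ξ →
        ∃ Y : F,
          (∀ᶠ w in 𝓝 (v : (𝒰 i).U), w ∈ (V i).carrier →
            Y.1 ((𝒰 i).s w) = (𝒰 i).dt w (ξ w) - (𝒰 i).ds w (ξ w)) ∧
          Θ (Arrow.mk i (DNC.on v (Submodule.Quotient.mk (ξ v)))) =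
            .zero ((𝒰 i).s v) (Submodule.Quotient.mk Y) := by
  have hA := isAtlas_adiabaticAtlas hF.le h𝒰 hV hcover
  have hiff : ∀ a b : Σ i, (adiabaticAtlas 𝒰 V i).U, Rel (adiabaticAtlas 𝒰 V) a b ↔
      tangentClass hF.le h𝒰.biSubmersion hV a.1 a.2 =
        tangentClass hF.le h𝒰.biSubmersion hV b.1 b.2 :=
    fun a b => tangentClass_eq_iff h𝒰 (i := a.1) (j := b.1) a.2 b.2
  let Θ₀ : Arrow (adiabaticAtlas 𝒰 V) → TangentGroupoid F 𝒰 :=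
    Quot.lift (fun a => tangentClass hF.le h𝒰.biSubmersion hV a.1 a.2) fun a b => (hiff a b).1
  have hΘ : Function.Bijective Θ₀ := by
    constructor
    · rintro ⟨a⟩ ⟨b⟩ h
      exact Quot.sound ((hiff a b).2 h)
    · intro z
      obtain ⟨i, a, rfl⟩ := surjective_tangentClass (hF := hF.le) (hS := h𝒰.biSubmersion) (hV := hV) hcover z
      exact ⟨Arrow.mk i a, rfl⟩
  refine ⟨isFoliation_adiabatic hF, hA, equivalence_rel_adiabaticAtlas hF.le hA,
    isGroupoid_adiabaticAtlas hF.le hA, Equiv.ofBijective Θ₀ hΘ, ?_, ?_, fun _ _ _ _ => rfl, ?_⟩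
  · rintro ⟨i, u | v⟩
    · exact ⟨rfl, rfl⟩
    · exact ⟨rfl, Prod.ext ((hV i).eq _ (Subtype.prop _)) rfl⟩
  · rintro ⟨i, a⟩ ⟨j, b⟩ ⟨k, c⟩
    exact (isComp_mk_adiabaticAtlas_iff hF.le hA).trans 
      (isComp_tangentClass_iff (hF := hF.le) (hV := hV) h𝒰 a b c)
  · intro i v ξ hξ
    obtain ⟨Y, h1, h2⟩ :=
      Span.exists_hasClass_of_field hF.le (hV i) (h𝒰.biSubmersion i) v hξ
    exact ⟨Y, h1,
      (tangentClass_on_eq_iff (hF := hF.le) (hS := h𝒰.biSubmersion) (hV := hV)).2 h2⟩
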